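/- **Setting.** Let $e,Z,M>0$, $\psi_0=\sqrt Z$, and let $\sigma:\mathbb R^3\to\mathbb R$ be an ion density with $\sigma\in L^1$, $\int\sigma\,dx=eZ$, $\langle x\rangle^4\sigma\in L^2(\mathbb R^3)$ and $(\Delta-1)\sigma\in L^1(\mathbb R^3)$ (distributionally). Put $\tilde f(\xi)=\int e^{i\xi x}f(x)\,dx$, $\Gamma^*=2\pi\mathbb Z^3$, $\Pi^*=[0,2\pi]^3$, $T^3=\mathbb R^3/\mathbb Z^3$, and $$\Sigma(\theta)=\sum_{m\in\mathbb Z^3}\Big[\frac{\xi\otimes\xi}{|\xi|^2}|\tilde\sigma(\xi)|^2\Big]_{\xi=2\pi m+\theta},\qquad \Pi^*_+=\{\theta\in\Pi^*\setminus\Gamma^*:\ \Sigma(\theta)>0\}.$$ Assume the Jellium condition $\tilde\sigma(2\pi m)=0$ for $m\in\mathbb Z^3\setminus0$, and the Wiener condition $\Sigma(\theta)>0$ for a.e. $\theta\in\Pi^*$. In $\mathcal X^0=L^2(\mathbb R^3)^2\oplus(\ell^2(\mathbb Z^3)\otimes\mathbb C^3)^2$ consider, for $Y=(\Psi_1,\Psi_2,q,p)$,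 the equation $\dot Y=AY$, $A=JB$, where $$B=\begin{pmatrix}2H^0+4e^2\psi_0G\psi_0&0&2S&0\\0&2H^0&0&0\\2S^*&0&T&0\\0&0&0&M^{-1}\end{pmatrix},\qquad J=\begin{pmatrix}0&\frac12&0&0\\-\frac12&0&0&0\\0&0&0&1\\0&0&-1&0\end{pmatrix},$$ $H^0=-\frac12\Delta$, $G=(-\Delta)^{-1}$, $S(x,n)=e\psi_0G\nabla\sigma(x-n)$, $T(n,n')=-\langle G\nabla\otimes\nabla\sigma(x-n'),\sigma(x-n)\rangle$. Let $\mathcal F Y=\tilde Y$ be the Bloch transform: $\tilde\Psi_j(\theta,y)=e^{i\theta y}\sum_ne^{in\theta}\Psi_j(n+y)$, and $\hat q(\theta)=\sum_ne^{in\theta}q(n)$, similarly $\hat p$; its values lie in $\tilde{\mathcal X}^0(T^3)=L^2(T^3)^2\oplus\mathbb C^3\oplus\mathbb C^3$. For $\theta\in\Pi^*\setminus\Gamma^*$ let $\tilde B(\theta)$, with domain $H^2(T^3)^2\oplus\mathbb C^3\oplus\mathbb C^3$, be the Bloch operator of $B$: replace $H^0,G,S,T$ by $\tilde H^0(\theta)=-\frac12(\nabla-i\theta)^2$,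 $\tilde G(\theta)=(i\nabla+\theta)^{-2}$, $\tilde S(\theta)=e\psi_0\tilde G(\theta)(\nabla-i\theta)\tilde\sigma(\theta,\cdot)$ with $\tilde\sigma(\theta,y)=e^{i\theta y}\sum_ne^{in\theta}\sigma(n+y)$, and $\Sigma(\theta)$. Put $\tilde\Lambda(\theta)=\tilde B(\theta)^{1/2}$ and $\tilde K(\theta)=\tilde\Lambda(\theta)\,iJ\,\tilde\Lambda(\theta)$. The energy space $\mathcal W$ is the completion of $\mathcal D_0=\{Y\in\mathcal X^0:\ \Psi_1,\Psi_2\in H^1(\mathbb R^3),\ \tilde Y=0\text{ near }\Gamma^*\}$ in the norm $\|Y\|_{\mathcal W}=\|\tilde\Lambda\tilde Y\|_{L^2(\Pi^*_+,\tilde{\mathcal X}^0(T^3))}$; through $\mathcal F$ it is identified with $\{\tilde Y\in L^2_{\rm loc}(\Pi^*_+,\tilde{\mathcal X}^0(T^3)):\ \tilde\Lambda\tilde Y\in L^2(\Pi^*_+,\tilde{\mathcal X}^0(T^3))\}$. A function $Y\in C(\mathbb R,\mathcal W)$ is a *weak solution* of $\dot Y=AY$ if $$\langle Y(t)-Y(0),V\rangle=\int_0^t\langle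 Y(s),A^*V\rangle\,ds,\qquad t\in\mathbb R,$$ for all $V=(\Psi_1,\Psi_2,q,p)$ with $\Psi_1,\Psi_2$ Schwartz functions, $q,p$ rapidly decreasing sequences, and $\operatorname{supp}\tilde V$ a compact subset of $\Pi^*_+$. Here $A^*=-BJ$ is the formal adjoint of $A$ and $\langle Y,V\rangle=|\Pi^*|^{-1}\int_{\Pi^*_+}\langle\tilde Y(\theta),\tilde V(\theta)\rangle\,d\theta$, which extends the scalar product of $\mathcal X^0$. **Statement.** For every $\theta\in\Pi^*_+$ the operator $\tilde\Lambda(\theta)$ exists as the nonnegative selfadjoint square root of $\tilde B(\theta)$ and is invertible, and $\tilde K(\theta)$ is selfadjoint with compact resolvent. For every $Y_0\in\mathcal W$ there is a unique weak solution $Y\in C_b(\mathbb R,\mathcal W)$ of $\dot Y=AY$ with $Y(0)=Y_0$. Its energy norm is conserved, $\|Y(t)\|_{\mathcal W}=\|Y_0\|_{\mathcal W}$ for all $t\in\mathbb R$, and $$Y(t)=\mathcal F^{-1}\,\tilde\Lambda(\theta)^{-1}e^{-i\tilde K(\theta)t}\,\tilde\Lambda(\theta)\,\tilde Y_0(\theta),\qquad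 t\in\mathbb R.$$ -/

import Mathlib

open MeasureTheory Filter Topology Set
open scoped FourierTransform ENNReal BoundedContinuousFunction SchwartzMap

noncomputable section

/-! ## Unbounded operators on a Hilbert space -/

/-- The value of a partially defined operator, extended by `0` off its domain. -/
def LinearPMap.ap {E F : Type} [AddCommGroup E] [Module ℂ E] [AddCommGroup F] [Module ℂ F]
    (T : E →ₗ.[ℂ] F) (x : E) : F :=
  open Classical in if h : x ∈ T.domain then T ⟨x, h⟩ else 0

theorem LinearPMap.ap_of_mem {E F : Type} [AddCommGroup E] [Module ℂ E] [AddCommGroup F]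
    [Module ℂ F] (T : E →ₗ.[ℂ] F) {x : E} (h : x ∈ T.domain) : T.ap x = T ⟨x, h⟩ := by
  simp [LinearPMap.ap, h]

/-- Composition of unbounded operators: `x ∈ D(ST)` iff `x ∈ D(T)` and `T x ∈ D(S)`. -/
def LinearPMap.pcomp {E F G : Type} [AddCommGroup E] [Module ℂ E] [AddCommGroup F] [Module ℂ F]
    [AddCommGroup G] [Module ℂ G] (S : F →ₗ.[ℂ] G) (T : E →ₗ.[ℂ] F) : E →ₗ.[ℂ] G where
  domain :=
    { carrier := {x | ∃ h : x ∈ T.domain, T ⟨x, h⟩ ∈ S.domain}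
      zero_mem' := ⟨T.domain.zero_mem, by
        have : T ⟨0, T.domain.zero_mem⟩ = 0 := T.map_zero
        rw [this]; exact S.domain.zero_mem⟩
      add_mem' := by
        rintro x y ⟨hx, hx'⟩ ⟨hy, hy'⟩
        refine ⟨T.domain.add_mem hx hy, ?_⟩
        have : T ⟨x + y, T.domain.add_mem hx hy⟩ = T ⟨x, hx⟩ + T ⟨y, hy⟩ :=
          T.map_add ⟨x, hx⟩ ⟨y, hy⟩
        rw [this]; exact S.domain.add_mem hx' hy'
      smul_mem' := by
        rintro c x ⟨hx, hx'⟩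
        refine ⟨T.domain.smul_mem c hx, ?_⟩
        have : T ⟨c • x, T.domain.smul_mem c hx⟩ = c • T ⟨x, hx⟩ := T.map_smul c ⟨x, hx⟩
        rw [this]; exact S.domain.smul_mem c hx' }
  toFun :=
    { toFun := fun x => S ⟨T ⟨x.1, x.2.1⟩, x.2.2⟩
      map_add' := by
        rintro ⟨x, hx, hx'⟩ ⟨y, hy, hy'⟩
        rw [← S.map_add]
        congr 1
        exact Subtype.ext (T.map_add ⟨x, hx⟩ ⟨y, hy⟩)
      map_smul' := by
        rintro c ⟨x, hx, hx'⟩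
        rw [RingHom.id_apply, ← S.map_smul]
        congr 1
        exact Subtype.ext (T.map_smul c ⟨x, hx⟩) }

section Operators

variable {H : Type} [NormedAddCommGroup H] [InnerProductSpace ℂ H] [CompleteSpace H]

/-- `L` is the nonnegative selfadjoint square root of `B`. -/
structure IsPosSqrt (B L : H →ₗ.[ℂ] H) : Prop where
  selfAdjoint : IsSelfAdjoint L
  nonneg : ∀ x : L.domain, 0 ≤ (inner ℂ (x : H) (L x)).re
  sq : L.pcomp L = B

/-- `B ^ (1/2)`, the nonnegative selfadjoint square root of `B` (and `0` if there is none). -/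
def posSqrt (B : H →ₗ.[ℂ] H) : H →ₗ.[ℂ] H :=
  open Classical in if h : ∃ L, IsPosSqrt B L then h.choose else 0

/-- `U` is the strongly continuous unitary group `U t = exp (-i K t)`, i.e. the one whose
infinitesimal generator is `-i K`. -/
structure IsUnitaryGroup (K : H →ₗ.[ℂ] H) (U : ℝ → H →L[ℂ] H) : Prop where
  map_zero : U 0 = 1
  map_add : ∀ s t, U (s + t) = U s * U t
  isometry : ∀ t x, ‖U t x‖ = ‖x‖
  continuous : ∀ x, Continuous fun t => U t x
  generator : ∀ x y, (x, y) ∈ K.graph ↔ HasDerivAt (fun t => U t x) (-(Complex.I • y)) 0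

/-- `exp (-i K t)` (and `0` if `-i K` generates no unitary group). -/
def expGroup (K : H →ₗ.[ℂ] H) : ℝ → H →L[ℂ] H :=
  open Classical in if h : ∃ U, IsUnitaryGroup K U then h.choose else fun _ => 0

/-- For some complex `z` the operator `K - z` has an everywhere defined, bounded, compact
inverse `R`. -/
def HasCompactResolvent (K : H →ₗ.[ℂ] H) : Prop :=
  ∃ (z : ℂ) (R : H →L[ℂ] H), IsCompactOperator R ∧
    ∀ x y, (x, y + z • x) ∈ K.graph ↔ x = R y

end Operators

/-! ## Spaces -/

/-- `H ⊕ H ⊕ Q ⊕ Q` with the Hilbert space norm. -/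
abbrev Quad (H Q : Type) : Type := WithLp 2 (WithLp 2 (H × H) × WithLp 2 (Q × Q))

namespace Quad

variable {H Q : Type}

abbrev mk (a b : H) (c d : Q) : Quad H Q :=
  WithLp.toLp 2 (WithLp.toLp 2 (a, b), WithLp.toLp 2 (c, d))
abbrev psi1 (Y : Quad H Q) : H := Y.fst.fst
abbrev psi2 (Y : Quad H Q) : H := Y.fst.snd
abbrev q (Y : Quad H Q) : Q := Y.snd.fst
abbrev p (Y : Quad H Q) : Q := Y.snd.snd

theorem mk_add [AddCommGroup H] [AddCommGroup Q] (a b a' b' : H) (c d c' d' : Q) :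
    mk (a + a') (b + b') (c + c') (d + d') = mk a b c d + mk a' b' c' d' := rfl

/-- The symplectic matrix `J`. -/
def J [AddCommGroup H] [Module ℂ H] [AddCommGroup Q] [Module ℂ Q] :
    Quad H Q →ₗ[ℂ] Quad H Q where
  toFun Y := mk ((1 / 2 : ℂ) • Y.psi2) (-((1 / 2 : ℂ) • Y.psi1)) Y.p (-Y.q)
  map_add' X Y := by
    have h1 : (X + Y).psi1 = X.psi1 + Y.psi1 := rfl
    have h2 : (X + Y).psi2 = X.psi2 + Y.psi2 := rfl
    have h3 : (X + Y).q = X.q + Y.q := rfl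
    have h4 : (X + Y).p = X.p + Y.p := rfl
    rw [h1, h2, h3, h4, smul_add, smul_add, neg_add, neg_add]
    rfl
  map_smul' c Y := by
    have h1 : (c • Y).psi1 = c • Y.psi1 := rfl
    have h2 : (c • Y).psi2 = c • Y.psi2 := rfl
    have h3 : (c • Y).q = c • Y.q := rfl
    have h4 : (c • Y).p = c • Y.p := rfl
    rw [h1, h2, h3, h4, smul_comm _ c Y.psi1, smul_comm _ c Y.psi2, ← smul_neg c, ← smul_neg c]
    rfl

end Quad

/-- `ℝ³` -/
abbrev E3 : Type := EuclideanSpace ℝ (Fin 3)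
/-- `ℂ³` -/
abbrev C3 : Type := EuclideanSpace ℂ (Fin 3)
/-- `ℤ³` -/
abbrev Z3 : Type := Fin 3 → ℤ
/-- `L²(ℝ³)` -/
abbrev L2R : Type := Lp ℂ 2 (volume : Measure E3)
/-- `ℓ²(ℤ³) ⊗ ℂ³` -/
abbrev SeqL2 : Type := lp (fun _ : Z3 => C3) 2
/-- The normalised Haar measure of `T³ = ℝ³/ℤ³`. -/
abbrev haarT : Measure (UnitAddTorus (Fin 3)) := Measure.pi fun _ => AddCircle.haarAddCircle
/-- `L²(T³)` -/
abbrev L2T : Type := Lp ℂ 2 haarT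
/-- `X⁰ = L²(ℝ³) ⊕ L²(ℝ³) ⊕ ℓ² ⊕ ℓ²` -/
abbrev X0 : Type := Quad L2R SeqL2
/-- `X⁰(T³) = L²(T³) ⊕ L²(T³) ⊕ ℂ³ ⊕ ℂ³` -/
abbrev X0T : Type := Quad L2T C3

/-- An element of `ℤ³` as a vector of `ℝ³`. -/
def latticePt (n : Z3) : E3 := WithLp.toLp 2 fun j => (n j : ℝ)

/-- `Γ* = 2πℤ³` -/
def dualLattice : Set E3 := range fun m : Z3 => (2 * Real.pi) • latticePt m

/-- `Π* = [0, 2π]³` -/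
def brillouin : Set E3 := {θ | ∀ j, θ j ∈ Icc 0 (2 * Real.pi)}

/-- Lebesgue measure on `Π*`. -/
abbrev muBrillouin : Measure E3 := volume.restrict brillouin

/-- The Fourier transform `∫ exp(i ξ·x) f(x) dx`. -/
def ft (f : E3 → ℂ) (ξ : E3) : ℂ := ∫ x, Complex.exp (Complex.I * (inner ℝ ξ x : ℝ)) * f x

/-- The class of `f` in `L²(ℝ³)` (`0` if `f` is not square integrable). -/
def toL2R (f : E3 → ℂ) : L2R :=
  open Classical in if h : MemLp f 2 volume then h.toLp f else 0

/-- The class of `f` in `L²(T³)` (`0` if `f` is not square integrable). -/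
def toL2T (f : UnitAddTorus (Fin 3) → ℂ) : L2T :=
  open Classical in if h : MemLp f 2 haarT then h.toLp f else 0

/-- The sequence `q` as an element of `ℓ²` (`0` if `q` is not square summable). -/
def toSeqL2 (q : Z3 → C3) : SeqL2 := open Classical in if h : Memℓp q 2 then ⟨q, h⟩ else 0

/-! ## Fourier multipliers on `ℝ³` and on `T³` -/

/-- The functions `f ∈ L²(ℝ³)` with `b f ∈ L²(ℝ³)`. -/
def mulL2RDomain (b : E3 → ℂ) : Submodule ℂ L2R where
  carrier := {f | MemLp (fun w => b w * f w) 2 volume}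
  zero_mem' := by
    refine MemLp.ae_eq (f := fun _ => (0 : ℂ)) ?_ MemLp.zero'
    filter_upwards [Lp.coeFn_zero ℂ 2 (volume : Measure E3)] with w hw
    rw [hw, Pi.zero_apply, mul_zero]
  add_mem' := by
    intro f g hf hg
    refine MemLp.ae_eq ?_ (MemLp.add hf hg)
    filter_upwards [Lp.coeFn_add f g] with w hw
    rw [hw, Pi.add_apply, Pi.add_apply, mul_add]
  smul_mem' := by
    intro c f hf
    refine MemLp.ae_eq ?_ (MemLp.const_smul hf c)
    filter_upwards [Lp.coeFn_smul c f] with w hw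
    rw [hw, Pi.smul_apply, Pi.smul_apply, smul_eq_mul, smul_eq_mul, mul_left_comm]

theorem mulL2R_toLp_smul (b : E3 → ℂ) (c : ℂ) (f : L2R)
    (hf : MemLp (fun w => b w * f w) 2 volume)
    (hcf : MemLp (fun w => b w * (c • f : L2R) w) 2 volume) :
    hcf.toLp = c • hf.toLp := by
  apply Lp.ext
  filter_upwards [Lp.coeFn_smul c f, Lp.coeFn_smul c hf.toLp, hf.coeFn_toLp,
    hcf.coeFn_toLp] with w h1 h2 h3 h4
  rw [h4, h2, Pi.smul_apply, h3, h1, Pi.smul_apply, smul_eq_mul, smul_eq_mul, mul_left_comm]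

theorem mulL2R_toLp_add (b : E3 → ℂ) (f g : L2R)
    (hf : MemLp (fun w => b w * f w) 2 volume) (hg : MemLp (fun w => b w * g w) 2 volume)
    (hfg : MemLp (fun w => b w * (f + g : L2R) w) 2 volume) :
    hfg.toLp = hf.toLp + hg.toLp := by
  apply Lp.ext
  filter_upwards [Lp.coeFn_add f g, Lp.coeFn_add hf.toLp hg.toLp, hf.coeFn_toLp, hg.coeFn_toLp,
    hfg.coeFn_toLp] with w h1 h2 h3 h4 h5
  rw [h5, h2, Pi.add_apply, h3, h4, h1, Pi.add_apply, mul_add]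

/-- Multiplication by `b` in `L²(ℝ³)`, with its maximal domain. -/
def mulL2R (b : E3 → ℂ) : L2R →ₗ.[ℂ] L2R where
  domain := mulL2RDomain b
  toFun :=
    { toFun := fun f => MemLp.toLp (fun w => b w * (f : L2R) w) f.2
      map_add' := fun f g => mulL2R_toLp_add b f g f.2 g.2 (f + g).2
      map_smul' := fun c f => mulL2R_toLp_smul b c f f.2 (c • f).2 }

/-- Multiplication by `b` in `ℓ²(ℤ³)`, with its maximal domain. -/
def mulSeq (b : Z3 → ℂ) : lp (fun _ : Z3 => ℂ) 2 →ₗ.[ℂ] lp (fun _ : Z3 => ℂ) 2 where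
  domain :=
    { carrier := {f | Memℓp (fun k => b k * f k) 2}
      zero_mem' := by
        have h : (fun k => b k * (0 : lp (fun _ : Z3 => ℂ) 2) k) = 0 := by funext k; simp
        change Memℓp (fun k => b k * (0 : lp (fun _ : Z3 => ℂ) 2) k) 2
        rw [h]; exact zero_memℓp
      add_mem' := by
        intro f g hf hg
        have h : (fun k => b k * (f + g) k) = (fun k => b k * f k) + fun k => b k * g k := by
          funext k; simp [mul_add]
        change Memℓp (fun k => b k * (f + g) k) 2
        rw [h]; exact Memℓp.add hf hg
      smul_mem' := by
        intro c f hf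
        have h : (fun k => b k * (c • f) k) = c • fun k => b k * f k := by
          funext k; simp [mul_left_comm]
        change Memℓp (fun k => b k * (c • f) k) 2
        rw [h]; exact Memℓp.const_smul hf c }
  toFun :=
    { toFun := fun f => ⟨fun k => b k * f.1 k, f.2⟩
      map_add' := by
        rintro ⟨f, hf⟩ ⟨g, hg⟩
        ext k
        change b k * (f k + g k) = b k * f k + b k * g k
        rw [mul_add]
      map_smul' := by
        rintro c ⟨f, hf⟩
        ext k
        change b k * (c * f k) = c * (b k * f k)
        rw [mul_left_comm] }

/-- The operator on `L²(ℝ³)` that multiplies the Fourier transform `∫ exp(i ξ·x) f(x) dx` by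
`a ξ`, with its maximal domain. (The transform `𝓕` of Mathlib at `w` is the one above at
`ξ = -2πw`.) -/
def multR (a : E3 → ℂ) : L2R →ₗ.[ℂ] L2R :=
  let 𝓕L : L2R ≃ₗ[ℂ] L2R := (Lp.fourierTransformₗᵢ E3 ℂ).toLinearEquiv
  𝓕L.symm.toLinearMap.compPMap
    ((mulL2R fun w => a (-(2 * Real.pi) • w)).pcomp (𝓕L.toLinearMap.toPMap ⊤))

/-- The operator `a(i∇ + θ)` on `L²(T³)`, with its maximal domain:
since `(i∇ + θ) exp(2πi k·y) = (θ - 2πk) exp(2πi k·y)`, it multiplies the `k`-th Fourier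
coefficient `∫ exp(-2πi k·y) f(y) dy` by `a (θ - 2πk)`. -/
def multT (a : E3 → ℂ) (θ : E3) : L2T →ₗ.[ℂ] L2T :=
  let c : L2T ≃ₗ[ℂ] lp (fun _ : Z3 => ℂ) 2 :=
    (UnitAddTorus.mFourierBasis (d := Fin 3)).repr.toLinearEquiv
  c.symm.toLinearMap.compPMap
    ((mulSeq fun k => a (θ - (2 * Real.pi) • latticePt k)).pcomp (c.toLinearMap.toPMap ⊤))

/-- Symbol of `H⁰ = -Δ/2`, resp. of `H̃⁰(θ) = -(∇ - iθ)²/2 = (i∇ + θ)²/2`. -/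
def symH (ξ : E3) : ℂ := ((‖ξ‖ ^ 2 / 2 : ℝ) : ℂ)
/-- Symbol of `G = (-Δ)⁻¹`, resp. of `G̃(θ) = (i∇ + θ)⁻²`. -/
def symG (ξ : E3) : ℂ := (((‖ξ‖ ^ 2)⁻¹ : ℝ) : ℂ)
/-- Symbol of `G ∂ⱼ`, resp. of `G̃(θ) (∇ - iθ)ⱼ`; note `∂ⱼ ↔ -i ξⱼ`. -/
def symGD (j : Fin 3) (ξ : E3) : ℂ := -Complex.I * ((ξ j / ‖ξ‖ ^ 2 : ℝ) : ℂ)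
/-- Symbol of `G ∂ᵢ ∂ⱼ`. -/
def symGDD (i j : Fin 3) (ξ : E3) : ℂ := ((-(ξ i * ξ j / ‖ξ‖ ^ 2) : ℝ) : ℂ)

/-! ## The Bloch transform -/

/-- The representative in `[0, 1)³` of a point of `T³`. -/
def cellRep (x : UnitAddTorus (Fin 3)) : E3 :=
  WithLp.toLp 2 fun j => (AddCircle.equivIco (1 : ℝ) 0 (x j) : ℝ)

/-- `{n ∈ ℤ³ : |nⱼ| ≤ N}` -/
def box (N : ℕ) : Finset Z3 := Fintype.piFinset fun _ => Finset.Icc (-(N : ℤ)) N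

/-- `exp(i n·θ)` -/
def phase (θ : E3) (n : Z3) : ℂ := Complex.exp (Complex.I * (inner ℝ θ (latticePt n) : ℝ))

/-- The partial sum over `box N` of the series `exp(iθ·y) ∑ₙ exp(i n·θ) Ψ(n + y)`, in `L²(T³)`. -/
def blochPartialFun (N : ℕ) (Ψ : E3 → ℂ) (θ : E3) : L2T :=
  toL2T fun x => Complex.exp (Complex.I * (inner ℝ θ (cellRep x) : ℝ)) *
    ∑ n ∈ box N, phase θ n * Ψ (cellRep x + latticePt n)

/-- The partial sum over `box N` of the series `M(θ) ∑ₙ exp(i n·θ) Y(n)`. -/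
def blochPartial (N : ℕ) (Y : X0) (θ : E3) : X0T :=
  Quad.mk (blochPartialFun N Y.psi1 θ) (blochPartialFun N Y.psi2 θ)
    (∑ n ∈ box N, phase θ n • Y.q n) (∑ n ∈ box N, phase θ n • Y.p n)

/-- `F` is the Bloch transform of `Y`: the sum of the series `M(θ) ∑ₙ exp(i n·θ) Y(n)`, which
converges in `L²(Π*, X⁰(T³))`. -/
def IsBloch (Y : X0) (F : E3 → X0T) : Prop :=
  AEStronglyMeasurable F muBrillouin ∧
    Tendsto (fun N => eLpNorm (fun θ => F θ - blochPartial N Y θ) 2 muBrillouin) atTop (𝓝 0)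

/-- The Bloch transform `𝓕 Y`, determined up to a null set of `θ ∈ Π*`. -/
def bloch (Y : X0) : E3 → X0T :=
  open Classical in if h : ∃ F, IsBloch Y F then h.choose else fun _ => 0

/-! ## The crystal -/

/-- The parameters of the model: elementary charge `e`, charge number `Z`, ion mass `M`, and
ion charge density `σ`. -/
structure Crystal where
  e : ℝ
  Z : ℝ
  M : ℝ
  σ : E3 → ℝ

namespace Crystal

variable (C : Crystal)

/-- The regularity conditions: `σ ∈ L¹`, `⟨x⟩⁴ σ ∈ L²` and `(Δ - 1)σ ∈ L¹` (in the sense of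
distributions). -/
structure Regular : Prop where
  integrable : Integrable C.σ
  decay : MemLp (fun x => (1 + ‖x‖ ^ 2) ^ 2 * C.σ x) 2 volume
  smooth : ∃ g : E3 → ℝ, Integrable g ∧ ∀ φ : E3 → ℝ, ContDiff ℝ (⊤ : ℕ∞) φ →
    HasCompactSupport φ → ∫ x, C.σ x * (Laplacian.laplacian φ x - φ x) = ∫ x, g x * φ x

/-- The Fourier transform `σ̃` of the ion density. -/
def ftσ (ξ : E3) : ℂ := ft (fun x => (C.σ x : ℂ)) ξ

/-- The Jellium condition. -/
def Jellium : Prop := ∀ m : Z3, m ≠ 0 → C.ftσ ((2 * Real.pi) • latticePt m) = 0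

/-- The matrix `Σ(θ) = ∑ₘ [ξ ⊗ ξ / |ξ|² |σ̃(ξ)|²]` at `ξ = 2πm + θ`. -/
def Sig (θ : E3) : Matrix (Fin 3) (Fin 3) ℝ := Matrix.of fun i j =>
  ∑' m : Z3, let ξ := (2 * Real.pi) • latticePt m + θ
    ξ i * ξ j / ‖ξ‖ ^ 2 * ‖C.ftσ ξ‖ ^ 2

/-- The Wiener condition. -/
def Wiener : Prop := ∀ᵐ θ ∂muBrillouin, (C.Sig θ).PosDef

/-- `Π*₊ = {θ ∈ Π* \ Γ* : Σ(θ) > 0}` -/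
def PiPlus : Set E3 := {θ | θ ∈ brillouin ∧ θ ∉ dualLattice ∧ (C.Sig θ).PosDef}

/-- Lebesgue measure on `Π*₊`. -/
abbrev muPlus : Measure E3 := volume.restrict C.PiPlus

/-- The ground state `ψ₀ = √Z`. -/
def ψ₀ : ℝ := Real.sqrt C.Z

/-! ### The linearised equation on `ℝ³` -/

/-- The translate `σ(x - n)` in `L²(ℝ³)`. -/
def σAt (n : Z3) : L2R := toL2R fun x => (C.σ (x - latticePt n) : ℂ)

/-- The `j`-th component of `S(x,n) = e ψ₀ G ∇σ(x - n)`. -/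
def Sker (n : Z3) (j : Fin 3) : L2R := ((C.e * C.ψ₀ : ℝ) : ℂ) • (multR (symGD j)).ap (C.σAt n)

/-- `(S q)(x) = ∑ₙ S(x,n)·q(n)` -/
def opS (q : SeqL2) : L2R := ∑' n, ∑ j, q n j • C.Sker n j

/-- `(S* Ψ)(n) = ⟨Ψ, S(·,n)⟩` -/
def opSstar (Ψ : L2R) : SeqL2 :=
  toSeqL2 fun n => WithLp.toLp 2 fun j => inner ℂ (C.Sker n j) Ψ

/-- `T(n,n') = -⟨G ∇ ⊗ ∇ σ(x - n'), σ(x - n)⟩` -/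
def Tker (n n' : Z3) (i j : Fin 3) : ℂ :=
  -inner ℂ (C.σAt n) ((multR (symGDD i j)).ap (C.σAt n'))

/-- `(T q)(n) = ∑ₙ' T(n,n') q(n')` -/
def opT (q : SeqL2) : SeqL2 :=
  toSeqL2 fun n => ∑' n', WithLp.toLp 2 fun i => ∑ j, C.Tker n n' i j * q n' j

/-- The energy operator `B`. -/
def opB (Y : X0) : X0 := Quad.mk
  ((2 : ℂ) • (multR symH).ap Y.psi1
    + ((4 * C.e ^ 2 * C.ψ₀ ^ 2 : ℝ) : ℂ) • (multR symG).ap Y.psi1 + (2 : ℂ) • C.opS Y.q)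
  ((2 : ℂ) • (multR symH).ap Y.psi2)
  ((2 : ℂ) • C.opSstar Y.psi1 + C.opT Y.q)
  (((C.M⁻¹ : ℝ) : ℂ) • Y.p)

/-- The generator `A = J B`. -/
def opA (Y : X0) : X0 := Quad.J (C.opB Y)

/-- The formal adjoint `A* = -B J`. -/
def opAstar (V : X0) : X0 := -C.opB (Quad.J V)

/-- The Fourier transform of `f` vanishes in a neighbourhood of positive radius of `Γ*`. -/
def InSPlus (f : 𝓢(E3, ℂ)) : Prop :=
  ∃ ε > 0, ∀ ξ, ∀ γ ∈ dualLattice, dist ξ γ < ε → ft f ξ = 0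

/-- The space `𝒟`: `Ψ₁, Ψ₂` are Schwartz functions whose Fourier transforms vanish near `Γ*`,
and `q, p` have finite support. -/
def CoreD : Set X0 := {Y |
  (∃ f : 𝓢(E3, ℂ), InSPlus f ∧ f.toLp 2 = Y.psi1) ∧
  (∃ f : 𝓢(E3, ℂ), InSPlus f ∧ f.toLp 2 = Y.psi2) ∧
  (Function.support fun n => Y.q n).Finite ∧ (Function.support fun n => Y.p n).Finite}

/-- The sequence decreases faster than any power of `|n|`. -/
def RapidlyDecreasing (q : Z3 → C3) : Prop :=
  ∀ k : ℕ, ∃ c : ℝ, ∀ n, ‖n‖ ^ k * ‖q n‖ ≤ c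

/-- The test vectors: `Ψ₁, Ψ₂` are Schwartz functions, `q, p` are rapidly decreasing, and the
support of the Bloch transform is a compact subset of `Π*₊`. -/
def Test : Set X0 := {V |
  (∃ f : 𝓢(E3, ℂ), f.toLp 2 = V.psi1) ∧ (∃ f : 𝓢(E3, ℂ), f.toLp 2 = V.psi2) ∧
  RapidlyDecreasing V.q ∧ RapidlyDecreasing V.p ∧
  ∃ K ⊆ C.PiPlus, IsCompact K ∧ ∀ᵐ θ ∂muBrillouin, θ ∉ K → bloch V θ = 0}

/-! ### The Bloch generators -/

/-- The periodic function `σ̃(θ,y) = exp(iθ·y) ∑ₙ exp(i n·θ) σ(n + y)` in `L²(T³)`. -/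
def σT (θ : E3) : L2T := toL2T fun x => Complex.exp (Complex.I * (inner ℝ θ (cellRep x) : ℝ)) *
  ∑' n, phase θ n * C.σ (cellRep x + latticePt n)

/-- The `j`-th component of `e ψ₀ G̃(θ) (∇ - iθ) σ̃(θ,·)`. -/
def Stker (θ : E3) (j : Fin 3) : L2T := ((C.e * C.ψ₀ : ℝ) : ℂ) • (multT (symGD j) θ).ap (C.σT θ)

/-- `S̃(θ) : ℂ³ → L²(T³)` -/
def St (θ : E3) : C3 →ₗ[ℂ] L2T where
  toFun q := ∑ j, q j • C.Stker θ j
  map_add' a b := by simp [add_smul, Finset.sum_add_distrib]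
  map_smul' c a := by simp [Finset.smul_sum, smul_smul]

/-- The adjoint `S̃*(θ) : L²(T³) → ℂ³` -/
def Ststar (θ : E3) : L2T →ₗ[ℂ] C3 where
  toFun Ψ := WithLp.toLp 2 fun j => inner ℂ (C.Stker θ j) Ψ
  map_add' a b := by ext j; simp [inner_add_right]
  map_smul' c a := by ext j; simp [inner_smul_right]

/-- `T̂(θ) = Σ(θ)`, acting on `ℂ³` -/
def Tt (θ : E3) : C3 →ₗ[ℂ] C3 := Matrix.toEuclideanLin ((C.Sig θ).map Complex.ofReal)

/-- The Bloch energy operator `B̃(θ)`. For `θ ∉ Γ*` the operator `G̃(θ)` is defined everywhere and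
the domain of `H̃⁰(θ)` is `H²(T³)`, so that the domain of `B̃(θ)` is
`H²(T³) ⊕ H²(T³) ⊕ ℂ³ ⊕ ℂ³`. -/
def Bt (θ : E3) : X0T →ₗ.[ℂ] X0T where
  domain :=
    { carrier := {Y | (Y.psi1 ∈ (multT symH θ).domain ∧ Y.psi1 ∈ (multT symG θ).domain) ∧
        Y.psi2 ∈ (multT symH θ).domain}
      zero_mem' := ⟨⟨Submodule.zero_mem _, Submodule.zero_mem _⟩, Submodule.zero_mem _⟩
      add_mem' := fun hx hy => ⟨⟨Submodule.add_mem _ hx.1.1 hy.1.1,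
        Submodule.add_mem _ hx.1.2 hy.1.2⟩, Submodule.add_mem _ hx.2 hy.2⟩
      smul_mem' := fun c _ hx => ⟨⟨Submodule.smul_mem _ c hx.1.1,
        Submodule.smul_mem _ c hx.1.2⟩, Submodule.smul_mem _ c hx.2⟩ }
  toFun :=
    { toFun := fun Y => Quad.mk
        ((2 : ℂ) • multT symH θ ⟨Y.1.psi1, Y.2.1.1⟩
          + ((4 * C.e ^ 2 * C.ψ₀ ^ 2 : ℝ) : ℂ) • multT symG θ ⟨Y.1.psi1, Y.2.1.2⟩
          + (2 : ℂ) • C.St θ Y.1.q)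
        ((2 : ℂ) • multT symH θ ⟨Y.1.psi2, Y.2.2⟩)
        ((2 : ℂ) • C.Ststar θ Y.1.psi1 + C.Tt θ Y.1.q)
        (((C.M⁻¹ : ℝ) : ℂ) • Y.1.p)
      map_add' := by
        rintro ⟨X, hX⟩ ⟨Y, hY⟩
        have h1 := (multT symH θ).map_add ⟨X.psi1, hX.1.1⟩ ⟨Y.psi1, hY.1.1⟩
        have h2 := (multT symG θ).map_add ⟨X.psi1, hX.1.2⟩ ⟨Y.psi1, hY.1.2⟩
        have h3 := (multT symH θ).map_add ⟨X.psi2, hX.2⟩ ⟨Y.psi2, hY.2⟩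
        simp only [AddMemClass.mk_add_mk] at h1 h2 h3
        have e1 : (X + Y).psi1 = X.psi1 + Y.psi1 := rfl
        have e2 : (X + Y).psi2 = X.psi2 + Y.psi2 := rfl
        have e3 : (X + Y).q = X.q + Y.q := rfl
        have e4 : (X + Y).p = X.p + Y.p := rfl
        simp only [AddMemClass.mk_add_mk, e1, e2, e3, e4, h1, h2, h3, map_add, smul_add]
        rw [← Quad.mk_add]
        congr 1 <;> abel_nf
      map_smul' := by
        rintro c ⟨X, hX⟩
        have h1 := (multT symH θ).map_smul c ⟨X.psi1, hX.1.1⟩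
        have h2 := (multT symG θ).map_smul c ⟨X.psi1, hX.1.2⟩
        have h3 := (multT symH θ).map_smul c ⟨X.psi2, hX.2⟩
        simp only [SetLike.mk_smul_mk] at h1 h2 h3
        have e1 : (c • X).psi1 = c • X.psi1 := rfl
        have e2 : (c • X).psi2 = c • X.psi2 := rfl
        have e3 : (c • X).q = c • X.q := rfl
        have e4 : (c • X).p = c • X.p := rfl
        simp only [SetLike.mk_smul_mk, e1, e2, e3, e4, h1, h2, h3, map_smul, RingHom.id_apply,
          smul_comm _ c, ← smul_add]
        rfl }

/-- `Λ̃(θ) = B̃(θ)^{1/2}` -/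
def Lam (θ : E3) : X0T →ₗ.[ℂ] X0T := posSqrt (C.Bt θ)

/-- `K̃(θ) = Λ̃(θ) iJ Λ̃(θ)` -/
def Kt (θ : E3) : X0T →ₗ.[ℂ] X0T :=
  (C.Lam θ).pcomp ((Complex.I • (Quad.J : X0T →ₗ[ℂ] X0T)).compPMap (C.Lam θ))

/-! ### The energy space -/

/-- The (Bloch transforms of) states of finite energy: `w ∈ L²_loc(Π*₊, X⁰(T³))` with
`Λ̃ w ∈ L²(Π*₊, X⁰(T³))`. -/
def WSub : Submodule ℂ (E3 →ₘ[C.muPlus] X0T) where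
  carrier := {w | (∀ᵐ θ ∂C.muPlus, w θ ∈ (C.Lam θ).domain) ∧
    MemLp (fun θ => (C.Lam θ).ap (w θ)) 2 C.muPlus ∧
    ∀ K ⊆ C.PiPlus, IsCompact K → MemLp w 2 (volume.restrict K)}
  zero_mem' := by
    have h0 := AEEqFun.coeFn_zero (α := E3) (β := X0T) (μ := C.muPlus)
    refine ⟨?_, ?_, fun K hK _ => ?_⟩
    · filter_upwards [h0] with θ h
      rw [h]; exact (C.Lam θ).domain.zero_mem
    · refine MemLp.ae_eq (f := fun _ => (0 : X0T)) ?_ MemLp.zero'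
      filter_upwards [h0] with θ h
      rw [h, Pi.zero_apply, LinearPMap.ap_of_mem _ (C.Lam θ).domain.zero_mem]
      exact (C.Lam θ).map_zero.symm
    · refine MemLp.ae_eq (f := fun _ => (0 : X0T)) ?_ MemLp.zero'
      filter_upwards [ae_mono (Measure.restrict_mono hK le_rfl) h0] with θ h
      rw [h, Pi.zero_apply]
  add_mem' := by
    rintro v w ⟨hv1, hv2, hv3⟩ ⟨hw1, hw2, hw3⟩
    have h0 := AEEqFun.coeFn_add v w
    refine ⟨?_, ?_, fun K hK hc => ?_⟩
    · filter_upwards [h0, hv1, hw1] with θ h h1 h2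
      rw [h]; exact (C.Lam θ).domain.add_mem h1 h2
    · refine MemLp.ae_eq ?_ (hv2.add hw2)
      filter_upwards [h0, hv1, hw1] with θ h h1 h2
      rw [h, Pi.add_apply, Pi.add_apply, LinearPMap.ap_of_mem _ h1, LinearPMap.ap_of_mem _ h2,
        LinearPMap.ap_of_mem _ ((C.Lam θ).domain.add_mem h1 h2)]
      exact ((C.Lam θ).map_add ⟨_, h1⟩ ⟨_, h2⟩).symm
    · refine MemLp.ae_eq ?_ ((hv3 K hK hc).add (hw3 K hK hc))
      exact Filter.EventuallyEq.symm (ae_mono (Measure.restrict_mono hK le_rfl) h0)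
  smul_mem' := by
    rintro c v ⟨hv1, hv2, hv3⟩
    have h0 := AEEqFun.coeFn_smul c v
    refine ⟨?_, ?_, fun K hK hc => ?_⟩
    · filter_upwards [h0, hv1] with θ h h1
      rw [h]; exact (C.Lam θ).domain.smul_mem c h1
    · refine MemLp.ae_eq ?_ (hv2.const_smul c)
      filter_upwards [h0, hv1] with θ h h1
      rw [h, Pi.smul_apply, Pi.smul_apply, LinearPMap.ap_of_mem _ h1,
        LinearPMap.ap_of_mem _ ((C.Lam θ).domain.smul_mem c h1)]
      exact ((C.Lam θ).map_smul c ⟨_, h1⟩).symm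
    · refine MemLp.ae_eq ?_ ((hv3 K hK hc).const_smul c)
      exact Filter.EventuallyEq.symm (ae_mono (Measure.restrict_mono hK le_rfl) h0)

/-- The energy space `𝒲`, realised through the Bloch transform. -/
abbrev W : Type := C.WSub

/-- The Bloch transform `w̃(θ)` of an element `w` of `𝒲`, as a class of functions on `Π*₊`. -/
abbrev field (w : C.W) : E3 →ₘ[C.muPlus] X0T := w.1

/-- The map `w ↦ Λ̃ w̃` from `𝒲` to `L²(Π*₊, X⁰(T³))`. -/
def lamField : C.W →ₗ[ℂ] Lp X0T 2 C.muPlus where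
  toFun w := MemLp.toLp (fun θ => (C.Lam θ).ap (C.field w θ)) w.2.2.1
  map_add' v w := by
    rw [← MemLp.toLp_add]
    refine MemLp.toLp_congr _ _ ?_
    filter_upwards [AEEqFun.coeFn_add (C.field v) (C.field w), v.2.1, w.2.1] with θ h h1 h2
    have h' : C.field (v + w) θ = C.field v θ + C.field w θ := h
    rw [h', Pi.add_apply]
    rw [LinearPMap.ap_of_mem (C.Lam θ) (x := C.field v θ) h1,
      LinearPMap.ap_of_mem (C.Lam θ) (x := C.field w θ) h2,
      LinearPMap.ap_of_mem _ ((C.Lam θ).domain.add_mem h1 h2)]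
    exact (C.Lam θ).map_add ⟨_, h1⟩ ⟨_, h2⟩
  map_smul' c v := by
    rw [RingHom.id_apply, ← MemLp.toLp_const_smul]
    refine MemLp.toLp_congr _ _ ?_
    filter_upwards [AEEqFun.coeFn_smul c (C.field v), v.2.1] with θ h h1
    have h' : C.field (c • v) θ = c • C.field v θ := h
    rw [h', Pi.smul_apply]
    rw [LinearPMap.ap_of_mem (C.Lam θ) (x := C.field v θ) h1,
      LinearPMap.ap_of_mem _ ((C.Lam θ).domain.smul_mem c h1)]
    exact (C.Lam θ).map_smul c ⟨_, h1⟩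

/-- The energy norm `‖w‖ = ‖Λ̃ w̃‖` in `L²(Π*₊, X⁰(T³))`. -/
instance : SeminormedAddCommGroup C.W :=
  SeminormedAddCommGroup.induced C.W (Lp X0T 2 C.muPlus) C.lamField

/-- The space `𝒟₀` of `Y ∈ X¹` whose Bloch transforms vanish in a neighbourhood of `Γ*`. -/
def CoreD0 : Set X0 := {Y |
  TemperedDistribution.MemSobolev 1 2 (Lp.toTemperedDistribution Y.psi1) ∧
  TemperedDistribution.MemSobolev 1 2 (Lp.toTemperedDistribution Y.psi2) ∧
  ∃ U, IsOpen U ∧ dualLattice ⊆ U ∧ ∀ᵐ θ ∂muBrillouin, θ ∈ U → bloch Y θ = 0}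

/-- `w ∈ 𝒲` is the element given by the state `Y`. -/
def Represents (w : C.W) (Y : X0) : Prop := C.field w =ᵐ[C.muPlus] bloch Y

/-- The pairing `⟨w, V⟩ = |Π*|⁻¹ ∫ ⟨w̃(θ), Ṽ(θ)⟩ dθ` of `w ∈ 𝒲` with a vector `V`. -/
def pairing (w : C.W) (V : X0) : ℂ :=
  (((2 * Real.pi) ^ 3 : ℝ) : ℂ)⁻¹ * ∫ θ, inner ℂ (bloch V θ) (C.field w θ) ∂C.muPlus

/-- `Y` is a weak solution of `Ẏ = A Y`. -/
def IsWeakSolution (Y : ℝ → C.W) : Prop := ∀ V ∈ C.Test, ∀ t : ℝ,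
  C.pairing (Y t - Y 0) V = ∫ s in (0 : ℝ)..t, C.pairing (Y s) (C.opAstar V)

end Crystal

end

/-! Fix `θ` off the dual lattice with `Σ(θ) > 0`. Put `κ = 2eψ₀` and `D(θ)q =
|i∇+θ|⁻¹(∇-iθ)σ̃(θ,·)·q`. By Parseval `D*D = Σ(θ)`, so the Coulomb terms complete to a square: the
quadratic form of `B̃(θ)` is `‖|i∇+θ|Ψ₁‖² + ‖|i∇+θ|Ψ₂‖² + M⁻¹|p|² + ‖κ|i∇+θ|⁻¹Ψ₁ + Dq‖²`. Let `A(θ)`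
be `|i∇+θ|⁻¹` on the two wave components and the identity on `q, p`. Then `B̃ = A⁻¹NA⁻¹` with a
bounded nonnegative `N` (`mem_Bt_graph_iff_exists`), and `N` is coercive because `Σ(θ) > 0` makes
`D` injective on `ℂ³` (`isUnit_innerT`). Hence `B̃(θ)` has the bounded, nonnegative, compact inverse
`R = AN⁻¹A`.

All domain questions are then settled through inverses: an unbounded operator is described by its
everywhere defined bounded inverse (`HasInverse`). The square root `Λ̃` has inverse `R^{1/2}`, and
`K̃ = Λ̃ iJ Λ̃` has inverse `R^{1/2}(iJ)⁻¹R^{1/2}`, which is compact, selfadjoint and injective. Its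
eigenvectors span a dense subspace, so bounded operators can be compared on eigenvectors only. The
group `exp(-iK̃t)` is the strong limit of exponentials of regularised inverses of `K̃⁻¹`
(`exists_isUnitaryGroup`). Since `R(θ)` is norm-continuous on the open set where `Σ > 0`, these
approximants are norm-continuous in `θ`, and the strong limits are measurable fields of operators.

The map `w ↦ Λ̃w̃` is an isometric bijection from `𝒲` onto `L²(Π*₊)`. Transporting the fibrewise
unitary group through it gives the formula for the solution, its continuity and the conservation of
energy. For a test vector `V` the pairing with `w` is, up to a constant, the scalar product of
`Λ̃⁻¹Ṽ` with `Λ̃w̃`. The Bloch transform turns `B` into `B̃(θ)` (`blochMk_opB_mem_graph`), which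
gives `Λ̃⁻¹Ṽ = -iK̃⁻¹Λ̃⁻¹(A*V)~`; thus test vectors lie in the domain of `K̃` fibrewise, and the
evolution is a weak solution.

For uniqueness, let `z(t)` be `Λ̃` applied to the difference of two solutions and `u(t) = ∫₀ᵗ z`.
There are enough test vectors, namely smooth cutoffs in `θ` times basis vectors of the fibre
(`exists_test`), and these basis vectors determine the graph of `B̃(θ)` (`mem_Bt_graph_of_weak`).
Therefore the weak equation forces `u = iK̃⁻¹z` (`eq_KtInv_of_weak`). As `K̃⁻¹` is selfadjoint, `⟨u,
u'⟩` is imaginary, so `‖u‖` is constant, hence zero (`eq_zero_of_weak`). The same test vectors give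
the density of `𝒟₀` in `𝒲`. -/

noncomputable section

set_option linter.unusedSectionVars false

set_option linter.unusedSectionVars false

/-! ### Unbounded operators described by bounded inverses -/

section InverseOperators

variable {H : Type} [NormedAddCommGroup H] [InnerProductSpace ℂ H] [CompleteSpace H]

/-- `B` is the inverse of the everywhere defined bounded operator `R`. -/
def LinearPMap.HasInverse (B : H →ₗ.[ℂ] H) (R : H →L[ℂ] H) : Prop :=
  ∀ x y, (x, y) ∈ B.graph ↔ x = R y

namespace LinearPMap.HasInverse

variable {B : H →ₗ.[ℂ] H} {R : H →L[ℂ] H}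

theorem injective (h : B.HasInverse R) : Function.Injective R := by
  intro y y' hy
  exact B.mem_graph_snd_inj ((h (R y) y).2 rfl) ((h (R y') y').2 rfl) hy

theorem mem_domain (h : B.HasInverse R) (y : H) : R y ∈ B.domain :=
  LinearPMap.mem_domain_of_mem_graph ((h _ y).2 rfl)

theorem apply (h : B.HasInverse R) (y : H) : B ⟨R y, h.mem_domain y⟩ = y :=
  (LinearPMap.image_iff (h.mem_domain y)).2 ((h _ y).2 rfl) |>.symm

theorem ap (h : B.HasInverse R) (y : H) : B.ap (R y) = y := by
  rw [LinearPMap.ap_of_mem _ (h.mem_domain y), h.apply]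

theorem apply_inverse (h : B.HasInverse R) (x : B.domain) : R (B x) = x :=
  ((h _ _).1 (B.mem_graph x)).symm

theorem ap_inverse (h : B.HasInverse R) {x : H} (hx : x ∈ B.domain) : R (B.ap x) = x := by
  rw [LinearPMap.ap_of_mem _ hx]; exact h.apply_inverse ⟨x, hx⟩

theorem ext {B' : H →ₗ.[ℂ] H} (h : B.HasInverse R) (h' : B'.HasInverse R) : B = B' := by
  apply LinearPMap.eq_of_eq_graph
  ext ⟨x, y⟩
  rw [h, h']

theorem bijective (h : B.HasInverse R) : Function.Bijective B := by
  refine ⟨fun x y hxy => ?_, fun y => ⟨_, h.apply y⟩⟩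
  apply Subtype.ext
  rw [← h.apply_inverse x, ← h.apply_inverse y, hxy]

theorem inverse_ap (h : B.HasInverse R) (y : H) : B.inverse.ap y = R y := by
  have hk : LinearMap.ker B.toFun = ⊥ := LinearMap.ker_eq_bot.2 h.bijective.1
  have hg := LinearPMap.mem_inverse_graph hk ⟨R y, h.mem_domain y⟩
  rw [h.apply] at hg
  have hd := LinearPMap.mem_domain_of_mem_graph hg
  rw [LinearPMap.ap_of_mem _ hd]
  exact ((LinearPMap.image_iff hd).2 hg).symm

end LinearPMap.HasInverse

/-- The orthogonal complement of the range is the kernel of the adjoint, which is `R` itself. -/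
theorem denseRange_of_isSelfAdjoint {R : H →L[ℂ] H} (hR : IsSelfAdjoint R)
    (hi : Function.Injective R) : DenseRange R := by
  have h1 : (R : H →ₗ[ℂ] H).rangeᗮ = ⊥ := by
    rw [ContinuousLinearMap.orthogonal_range, hR.adjoint_eq]
    exact LinearMap.ker_eq_bot.2 hi
  have := (Submodule.topologicalClosure_eq_top_iff).2 h1
  exact Submodule.dense_iff_topologicalClosure_eq_top.2 this

/-- The inverse of an injective bounded operator. -/
def ContinuousLinearMap.pinv (R : H →L[ℂ] H) : H →ₗ.[ℂ] H :=
  ((R : H →ₗ[ℂ] H).toPMap ⊤).inverse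

theorem ContinuousLinearMap.hasInverse_pinv {R : H →L[ℂ] H} (hi : Function.Injective R) :
    R.pinv.HasInverse R := by
  intro x y
  have hk : LinearMap.ker ((R : H →ₗ[ℂ] H).toPMap ⊤).toFun = ⊥ := by
    rw [LinearMap.ker_eq_bot]
    intro a b hab
    exact Subtype.ext (hi hab)
  rw [ContinuousLinearMap.pinv, LinearPMap.inverse_graph hk, Submodule.mem_map]
  constructor
  · rintro ⟨⟨a, b⟩, hab, h⟩
    obtain ⟨c, hc, hc'⟩ := (LinearPMap.mem_graph_iff _).1 hab
    simp only [LinearEquiv.coe_coe, LinearEquiv.prodComm_apply, Prod.swap_prod_mk,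
      Prod.mk.injEq] at h
    obtain ⟨rfl, rfl⟩ := h
    exact hc'.symm.trans (congrArg R hc)
  · rintro rfl
    exact ⟨(y, R y), (LinearPMap.mem_graph_iff _).2 ⟨⟨y, trivial⟩, rfl, rfl⟩, rfl⟩

namespace LinearPMap.HasInverse

variable {B : H →ₗ.[ℂ] H} {R : H →L[ℂ] H}

/-- Symmetry of `R` passes to `B`, so `B` is contained in its adjoint. Conversely, testing against
`B (R w) = w` shows that every `x` in the domain of the adjoint equals `R (B* x)`, hence lies in the
range of `R`, which is the domain of `B`. -/
theorem isSelfAdjoint (h : B.HasInverse R) (hR : IsSelfAdjoint R) : IsSelfAdjoint B := by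
  have hsymm : ∀ x y, inner ℂ (R x) y = inner ℂ x (R y) := fun x y => by
    rw [← ContinuousLinearMap.adjoint_inner_right, hR.adjoint_eq]
  have hdense : Dense (B.domain : Set H) := by
    refine (denseRange_of_isSelfAdjoint hR h.injective).mono ?_
    rintro _ ⟨y, rfl⟩
    exact h.mem_domain y
  have hle : B ≤ B.adjoint := by
    refine LinearPMap.IsFormalAdjoint.le_adjoint hdense ?_
    intro x y
    have := hsymm (B x) (B y)
    rw [h.apply_inverse, h.apply_inverse] at this
    exact this.symm
  rw [LinearPMap.isSelfAdjoint_def]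
  refine (LinearPMap.eq_of_le_of_domain_eq hle (le_antisymm hle.1 ?_)).symm
  intro x hx
  have hx' : x = R (B.adjoint ⟨x, hx⟩) := by
    refine ext_inner_right ℂ fun w => ?_
    have := LinearPMap.adjoint_isFormalAdjoint hdense ⟨x, hx⟩ ⟨R w, h.mem_domain w⟩
    rw [h.apply] at this
    rw [hsymm, this]
  rw [hx']
  exact h.mem_domain _

/-- The composition `L T L` with a bounded invertible operator `T` in the middle. -/
theorem pcomp_comp (h : B.HasInverse R) {T : H →ₗ[ℂ] H} {T' : H →L[ℂ] H}
    (h1 : ∀ x, T (T' x) = x) (h2 : ∀ x, T' (T x) = x) :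
    (B.pcomp (T.compPMap B)).HasInverse (R * T' * R) := by
  intro x y
  rw [LinearPMap.mem_graph_iff]
  constructor
  · rintro ⟨⟨a, ha, ha'⟩, rfl, rfl⟩
    change a = R (T' (R (B ⟨T (B ⟨a, ha⟩), ha'⟩)))
    rw [h.apply_inverse, h2, h.apply_inverse]
  · rintro rfl
    have e1 : T (B ⟨R (T' (R y)), h.mem_domain _⟩) = R y := by rw [h.apply, h1]
    refine ⟨⟨R (T' (R y)), h.mem_domain _, ?_⟩, rfl, ?_⟩
    · change T (B ⟨R (T' (R y)), h.mem_domain _⟩) ∈ B.domain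
      rw [e1]; exact h.mem_domain _
    · refine Eq.trans ?_ (h.apply y)
      exact congrArg B (Subtype.ext e1)

theorem pcomp_self (h : B.HasInverse R) : (B.pcomp B).HasInverse (R * R) := by
  have := h.pcomp_comp (T := LinearMap.id) (T' := 1) (fun _ => rfl) (fun _ => rfl)
  rw [mul_one] at this
  exact this

end LinearPMap.HasInverse

-- Existence of the square root: invert the bounded square root of `R`. It is injective because its
-- square is, so its inverse is selfadjoint, and its nonnegativity is that of `R^{1/2}`.
open ComplexOrder in
theorem isPosSqrt_pinv_sqrt {B : H →ₗ.[ℂ] H} {R : H →L[ℂ] H} (h : B.HasInverse R)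
    (hR : 0 ≤ R) : IsPosSqrt B (CFC.sqrt R).pinv := by
  have hS0 : 0 ≤ CFC.sqrt R := CFC.sqrt_nonneg R
  have hSa : IsSelfAdjoint (CFC.sqrt R) :=
    ((ContinuousLinearMap.nonneg_iff_isPositive _).1 hS0).isSelfAdjoint
  have hSS : CFC.sqrt R * CFC.sqrt R = R := CFC.sqrt_mul_sqrt_self R hR
  have hi : Function.Injective (CFC.sqrt R : H →L[ℂ] H) := by
    intro x y hxy
    apply h.injective
    rw [← hSS]
    exact congrArg (CFC.sqrt R : H →L[ℂ] H) hxy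
  have hinv := ContinuousLinearMap.hasInverse_pinv hi
  refine ⟨hinv.isSelfAdjoint hSa, fun x => ?_, ?_⟩
  · have h1 := ((ContinuousLinearMap.nonneg_iff_isPositive _).1 hS0).re_inner_nonneg_left
      ((CFC.sqrt R).pinv x)
    rw [hinv.apply_inverse] at h1
    exact h1
  · have := hinv.pcomp_self
    rw [hSS] at this
    exact this.ext h

/-- Uniqueness of the square root, needed because `posSqrt` is only a choice. The operator `L` is
bijective since `L ∘ L = B` is; its inverse is symmetric and everywhere defined, hence bounded
(Hellinger–Toeplitz). It is nonnegative with square `R`, so it is `R^{1/2}`. -/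
theorem IsPosSqrt.hasInverse {B L : H →ₗ.[ℂ] H} {R : H →L[ℂ] H} (hL : IsPosSqrt B L)
    (h : B.HasInverse R) : L.HasInverse (CFC.sqrt R) := by
  have hB := hL.sq
  have hmem : ∀ y, ∃ h1 : R y ∈ L.domain, ∃ h2 : L ⟨R y, h1⟩ ∈ L.domain, L ⟨_, h2⟩ = y := by
    intro y
    have h0 := h.mem_domain y
    have h3 := h.apply y
    subst hB
    exact ⟨h0.1, h0.2, h3⟩
  have hinj : Function.Injective L.toFun := by
    rw [← LinearMap.ker_eq_bot, LinearMap.ker_eq_bot']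
    intro x hx
    have h0 : L x = 0 := hx
    have h1 : L x ∈ L.domain := by rw [h0]; exact L.domain.zero_mem
    have h2 : ((x : H), (0 : H)) ∈ B.graph := by
      rw [← hB, LinearPMap.mem_graph_iff]
      refine ⟨⟨x, x.2, h1⟩, rfl, ?_⟩
      change L ⟨L x, h1⟩ = 0
      simp only [h0]
      exact L.map_zero
    have := (h _ _).1 h2
    rw [map_zero] at this
    exact Subtype.ext this
  have hsurj : Function.Surjective L.toFun := fun y => by
    obtain ⟨h1, h2, h3⟩ := hmem y
    exact ⟨_, h3⟩
  let e := LinearEquiv.ofBijective L.toFun ⟨hinj, hsurj⟩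
  let S : H →ₗ[ℂ] H := L.domain.subtype ∘ₗ e.symm.toLinearMap
  have hLe : ∀ y, L (e.symm y) = y := fun y => e.apply_symm_apply y
  have heL : ∀ x, e.symm (L x) = x := fun x => e.symm_apply_apply x
  have hsymm : S.IsSymmetric := by
    intro x y
    have h1 := LinearPMap.adjoint_isFormalAdjoint hL.selfAdjoint.dense_domain
    rw [(LinearPMap.isSelfAdjoint_def).1 hL.selfAdjoint] at h1
    have := h1 (e.symm x) (e.symm y)
    rw [hLe, hLe] at this
    exact this.symm
  let S' : H →L[ℂ] H := ⟨S, hsymm.continuous⟩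
  have hinv : L.HasInverse S' := by
    intro x y
    rw [LinearPMap.mem_graph_iff]
    constructor
    · rintro ⟨a, rfl, rfl⟩
      change (a : H) = (e.symm (L a) : L.domain)
      rw [heL]
    · rintro rfl
      exact ⟨e.symm y, rfl, hLe y⟩
  have hsq : S' * S' = R := by
    ext y
    obtain ⟨h1, h2, h3⟩ := hmem y
    have e1 : S' y = L ⟨R y, h1⟩ := by
      rw [← congrArg S' h3]; exact hinv.apply_inverse ⟨_, h2⟩
    change S' (S' y) = _
    rw [e1]; exact hinv.apply_inverse ⟨_, h1⟩
  have hpos : 0 ≤ S' := by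
    rw [ContinuousLinearMap.nonneg_iff_isPositive]
    refine ContinuousLinearMap.isPositive_def'.2
      ⟨(ContinuousLinearMap.isSelfAdjoint_iff_isSymmetric).2 hsymm, fun x => ?_⟩
    have := hL.nonneg (e.symm x)
    rw [hLe] at this
    exact this
  have : CFC.sqrt R = S' := CFC.sqrt_unique hsq hpos
  rw [this]
  exact hinv

/-- From `‖S x‖² = ⟨R x, x⟩ ≤ ‖R x‖ ‖x‖`, a finite net for the image of the unit ball under `R`
yields one for its image under `S = R^{1/2}`. -/
theorem isCompactOperator_sqrt {R : H →L[ℂ] H} (hR : 0 ≤ R) (hc : IsCompactOperator R) :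
    IsCompactOperator (CFC.sqrt R : H →L[ℂ] H) := by
  have hS0 : 0 ≤ CFC.sqrt R := CFC.sqrt_nonneg R
  have hSa : IsSelfAdjoint (CFC.sqrt R) :=
    ((ContinuousLinearMap.nonneg_iff_isPositive _).1 hS0).isSelfAdjoint
  have hSS : CFC.sqrt R * CFC.sqrt R = R := CFC.sqrt_mul_sqrt_self R hR
  set S := CFC.sqrt R
  have hn : ∀ x, ‖S x‖ ^ 2 ≤ ‖R x‖ * ‖x‖ := by
    intro x
    have : ‖S x‖ ^ 2 = RCLike.re (inner ℂ (R x) x) := by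
      rw [← hSS, ← inner_self_eq_norm_sq (𝕜 := ℂ)]
      change _ = RCLike.re (inner ℂ (S (S x)) x)
      conv_lhs => rw [← ContinuousLinearMap.adjoint_inner_left,
        hSa.adjoint_eq]
    rw [this]
    exact (RCLike.re_le_norm _).trans (norm_inner_le_norm _ _)
  have htb := hc.isCompact_closure_image_closedBall (f := (R : H →ₗ[ℂ] H)) 1
  refine (isCompactOperator_iff_isCompact_closure_image_closedBall (S : H →ₗ[ℂ] H)
    one_pos).2 ?_
  refine TotallyBounded.isCompact_of_isClosed (TotallyBounded.closure ?_) isClosed_closure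
  have htb' : TotallyBounded ((R : H →ₗ[ℂ] H) '' Metric.closedBall 0 1) :=
    htb.totallyBounded.subset subset_closure
  rw [Metric.totallyBounded_iff]
  intro ε hε
  -- Two points of the unit ball are at distance at most 2, so `‖R (x - z)‖ < ε²/4` gives `‖S (x -
  -- z)‖² < ε²`.
  obtain ⟨t, hts, htf, ht⟩ :=
    Metric.finite_approx_of_totallyBounded htb' (ε ^ 2 / 4) (by positivity)
  have hts' : ∀ y, ∃ z, y ∈ t → z ∈ Metric.closedBall (0 : H) 1 ∧ R z = y := fun y => by
    by_cases hy : y ∈ t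
    · obtain ⟨z, hz, hz'⟩ := hts hy
      exact ⟨z, fun _ => ⟨hz, hz'⟩⟩
    · exact ⟨0, fun h => absurd h hy⟩
  choose g hg using hts'
  refine ⟨(fun y => S (g y)) '' t, htf.image _, ?_⟩
  rintro _ ⟨x, hx, rfl⟩
  obtain ⟨y, hy, hxy⟩ := Set.mem_iUnion₂.1 (ht ⟨x, hx, rfl⟩)
  refine Set.mem_iUnion₂.2 ⟨S (g y), ⟨y, hy, rfl⟩, ?_⟩
  have h1 := hn (x - g y)
  have h2 : ‖R (x - g y)‖ < ε ^ 2 / 4 := by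
    have h3 : R (g y) = y := (hg y hy).2
    rw [map_sub, h3, ← dist_eq_norm]
    exact hxy
  have h4 : ‖x - g y‖ ≤ 2 := by
    have h5 := (hg y hy).1
    rw [mem_closedBall_zero_iff] at h5 hx
    linarith [norm_sub_le x (g y)]
  rw [Metric.mem_ball, dist_eq_norm]
  change ‖S x - S (g y)‖ < ε
  rw [← map_sub]
  refine lt_of_pow_lt_pow_left₀ 2 hε.le (h1.trans_lt ?_)
  nlinarith [norm_nonneg (R (x - g y)), norm_nonneg (x - g y), sq_nonneg ε, pow_pos hε 2]

end InverseOperators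

/-! ### Unitary groups whose generator has a compact inverse -/

section UnitaryGroups

variable {H : Type} [NormedAddCommGroup H] [InnerProductSpace ℂ H] [CompleteSpace H]

/-- The form of `C² + ε²` is bounded below by `ε²`, so the sum is invertible even where `C` is not.
-/
theorem isUnit_sq_add {C : H →L[ℂ] H} (hC : IsSelfAdjoint C) {ε : ℝ} (hε : ε ≠ 0) :
    IsUnit (C * C + ((ε ^ 2 : ℝ) : ℂ) • (1 : H →L[ℂ] H)) := by
  refine ContinuousLinearMap.isUnit_of_forall_le_norm_inner_map _ (c := Real.toNNReal (ε ^ 2))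
    (Real.toNNReal_pos.2 (by positivity)) fun x => ?_
  have h1 : inner ℂ ((C * C + ((ε ^ 2 : ℝ) : ℂ) • (1 : H →L[ℂ] H)) x) x
      = ((‖C x‖ ^ 2 + ε ^ 2 * ‖x‖ ^ 2 : ℝ) : ℂ) := by
    have : inner ℂ (C (C x)) x = inner ℂ (C x) (C x) := by
      rw [← ContinuousLinearMap.adjoint_inner_right, hC.adjoint_eq]
    change inner ℂ (C (C x) + ((ε ^ 2 : ℝ) : ℂ) • x) x = _
    rw [inner_add_left, this, inner_smul_left, inner_self_eq_norm_sq_to_K,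
      inner_self_eq_norm_sq_to_K, Complex.conj_ofReal]
    push_cast
    rfl
  rw [h1, Complex.norm_real, Real.norm_of_nonneg (by positivity)]
  rw [Real.coe_toNNReal _ (sq_nonneg ε)]
  nlinarith [sq_nonneg ‖C x‖]

/-- A bounded approximation of the inverse of `C`. -/
def invApprox (C : H →L[ℂ] H) (n : ℕ) : H →L[ℂ] H :=
  C * Ring.inverse (C * C + ((((n : ℝ) + 1)⁻¹ ^ 2 : ℝ) : ℂ) • (1 : H →L[ℂ] H))

/-- The approximation of `exp (-i t C⁻¹)` obtained from that of `C⁻¹`. -/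
def unitApprox (C : H →L[ℂ] H) (n : ℕ) (t : ℝ) : H →L[ℂ] H :=
  NormedSpace.exp ((-(Complex.I * t)) • invApprox C n)

theorem ne_zero_inv_succ (n : ℕ) : ((n : ℝ) + 1)⁻¹ ≠ 0 := by positivity

theorem isSelfAdjoint_invApprox {C : H →L[ℂ] H} (hC : IsSelfAdjoint C) (n : ℕ) :
    IsSelfAdjoint (invApprox C n) := by
  have hs : IsSelfAdjoint (C * C + ((((n : ℝ) + 1)⁻¹ ^ 2 : ℝ) : ℂ) • (1 : H →L[ℂ] H)) := by
    rw [isSelfAdjoint_iff, star_add, star_mul, hC.star_eq, star_smul, star_one]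
    congr 2
    exact Complex.conj_ofReal _
  have hcomm : Commute C (C * C + ((((n : ℝ) + 1)⁻¹ ^ 2 : ℝ) : ℂ) • (1 : H →L[ℂ] H)) :=
    ((Commute.refl C).mul_right (Commute.refl C)).add_right ((Commute.one_right C).smul_right _)
  rw [invApprox, isSelfAdjoint_iff, star_mul, hs.ringInverse.star_eq, hC.star_eq]
  have hu := isUnit_sq_add hC (ne_zero_inv_succ n)
  set D := C * C + ((((n : ℝ) + 1)⁻¹ ^ 2 : ℝ) : ℂ) • (1 : H →L[ℂ] H)
  calc Ring.inverse D * C = Ring.inverse D * C * (D * Ring.inverse D) := by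
        rw [Ring.mul_inverse_cancel _ hu, mul_one]
    _ = Ring.inverse D * (C * D) * Ring.inverse D := by simp only [mul_assoc]
    _ = (Ring.inverse D * D) * C * Ring.inverse D := by rw [hcomm.eq]; simp only [mul_assoc]
    _ = C * Ring.inverse D := by rw [Ring.inverse_mul_cancel _ hu, one_mul]

theorem norm_unitApprox {C : H →L[ℂ] H} (hC : IsSelfAdjoint C) (n : ℕ) (t : ℝ) (x : H) :
    ‖unitApprox C n t x‖ = ‖x‖ := by
  refine ContinuousLinearMap.norm_map_of_mem_unitary ?_ x
  let _ : NormedAlgebra ℚ (H →L[ℂ] H) := NormedAlgebra.restrictScalars ℚ ℂ _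
  refine NormedSpace.exp_mem_unitary_of_mem_skewAdjoint ?_
  rw [skewAdjoint.mem_iff, star_smul, (isSelfAdjoint_invApprox hC n).star_eq, ← neg_smul]
  congr 1
  simp

theorem exp_apply_of_eigenvector {A : H →L[ℂ] H} {a : ℂ} {x : H} (h : A x = a • x) :
    NormedSpace.exp A x = Complex.exp a • x := by
  have hp : ∀ n : ℕ, (A ^ n) x = a ^ n • x := by
    intro n
    induction n with
    | zero => simp
    | succ n ih =>
      rw [pow_succ']
      change A ((A ^ n) x) = _
      rw [ih, map_smul, h, smul_smul, pow_succ]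
  have h1 := (NormedSpace.exp_series_hasSum_exp' (𝕂 := ℂ) A).mapL
    (ContinuousLinearMap.apply ℂ H x)
  have h2 := (NormedSpace.exp_series_hasSum_exp' (𝕂 := ℂ) a).smul_const x
  rw [← Complex.exp_eq_exp_ℂ] at h2
  refine h1.unique ?_
  convert h2 using 2 with n
  change (((n.factorial : ℂ))⁻¹ • (A ^ n)) x = _
  rw [smul_apply, hp, smul_smul, smul_eq_mul]

/-- On an eigenvector the construction is scalar: the regularisation replaces `1/μ` by `μ/(μ² + ε²)`
with `ε = 1/(n+1)`. -/
theorem invApprox_apply_of_eigenvector {C : H →L[ℂ] H} (hC : IsSelfAdjoint C) (n : ℕ) {μ : ℝ}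
    {x : H} (h : C x = (μ : ℂ) • x) :
    invApprox C n x = ((μ / (μ ^ 2 + ((n : ℝ) + 1)⁻¹ ^ 2) : ℝ) : ℂ) • x := by
  have hu := isUnit_sq_add hC (ne_zero_inv_succ n)
  rw [invApprox]
  set D := C * C + ((((n : ℝ) + 1)⁻¹ ^ 2 : ℝ) : ℂ) • (1 : H →L[ℂ] H)
  have hpos : (μ ^ 2 + ((n : ℝ) + 1)⁻¹ ^ 2) ≠ 0 := by positivity
  have hD : D x = ((μ ^ 2 + ((n : ℝ) + 1)⁻¹ ^ 2 : ℝ) : ℂ) • x := by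
    change C (C x) + ((((n : ℝ) + 1)⁻¹ ^ 2 : ℝ) : ℂ) • x = _
    rw [h, map_smul, h, smul_smul, ← add_smul]
    push_cast
    ring_nf
  have hI : Ring.inverse D x = (((μ ^ 2 + ((n : ℝ) + 1)⁻¹ ^ 2)⁻¹ : ℝ) : ℂ) • x := by
    have h1 : Ring.inverse D (D x) = x := by
      change (Ring.inverse D * D) x = x
      rw [Ring.inverse_mul_cancel _ hu]; rfl
    rw [hD, map_smul] at h1
    conv_rhs => rw [← h1]
    rw [smul_smul, ← Complex.ofReal_mul, inv_mul_cancel₀ hpos, Complex.ofReal_one, one_smul]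
  change C (Ring.inverse D x) = _
  rw [hI, map_smul, h, smul_smul, ← Complex.ofReal_mul]
  congr 2
  rw [div_eq_inv_mul]

theorem tendsto_unitApprox_of_eigenvector {C : H →L[ℂ] H} (hC : IsSelfAdjoint C) {μ : ℝ}
    (hμ : μ ≠ 0) {x : H} (h : C x = (μ : ℂ) • x) (t : ℝ) :
    Tendsto (fun n => unitApprox C n t x) atTop
      (𝓝 (Complex.exp (-(Complex.I * t) * ((μ⁻¹ : ℝ) : ℂ)) • x)) := by
  have h1 : ∀ n, unitApprox C n t x = Complex.exp (-(Complex.I * t) *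
      ((μ / (μ ^ 2 + ((n : ℝ) + 1)⁻¹ ^ 2) : ℝ) : ℂ)) • x := fun n => by
    refine exp_apply_of_eigenvector ?_
    rw [smul_apply, invApprox_apply_of_eigenvector hC n h, smul_smul]
  simp only [h1]
  refine Tendsto.smul_const ?_ x
  refine (Complex.continuous_exp.tendsto _).comp (Tendsto.const_mul _ ?_)
  refine (Complex.continuous_ofReal.tendsto _).comp ?_
  have h2 : Tendsto (fun n : ℕ => ((n : ℝ) + 1)⁻¹) atTop (𝓝 0) := by
    simpa using tendsto_one_div_add_atTop_nhds_zero_nat (𝕜 := ℝ)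
  have h3 := Tendsto.div (tendsto_const_nhds (x := μ)) (((h2.pow 2).const_add (μ ^ 2)))
    (by positivity)
  have h4 : μ⁻¹ = μ / (μ ^ 2 + 0 ^ 2) := by field_simp; simp
  rw [h4]
  exact h3

/-- A closed subspace that contains all eigenvectors of an injective compact selfadjoint operator
is the whole space. -/
theorem mem_of_eigenvectors {C : H →L[ℂ] H} (hC : IsSelfAdjoint C) (hc : IsCompactOperator C)
    (hi : Function.Injective C) (M : Submodule ℂ H) (hM : IsClosed (M : Set H))
    (h : ∀ (μ : ℝ) (x : H), μ ≠ 0 → C x = (μ : ℂ) • x → x ∈ M) (x : H) : x ∈ M := by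
  have hsymm := (ContinuousLinearMap.isSelfAdjoint_iff_isSymmetric).1 hC
  have h1 := ContinuousLinearMap.orthogonalComplement_iSup_eigenspaces_eq_bot hc hsymm
  have h2 : (⨆ μ, Module.End.eigenspace (C : Module.End ℂ H) μ) ≤ M := by
    refine iSup_le fun μ v hv => ?_
    have hv' : C v = μ • v := Module.End.mem_eigenspace_iff.1 hv
    by_cases hv0 : v = 0
    · rw [hv0]; exact M.zero_mem
    have hr : (starRingEnd ℂ) μ = μ := by
      have := hsymm v v
      change inner ℂ (C v) v = inner ℂ v (C v) at this
      rw [hv', inner_smul_left, inner_smul_right] at this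
      exact mul_right_cancel₀ (inner_self_ne_zero.2 hv0) this
    obtain ⟨r, rfl⟩ := Complex.conj_eq_iff_real.1 hr
    -- Injectivity rules out the eigenvalue 0, so the hypothesis on nonzero real eigenvalues covers
    -- every eigenspace.
    refine h r v (fun h0 => hv0 (hi ?_)) hv'
    rw [hv', h0, Complex.ofReal_zero, zero_smul, map_zero]
  have h3 := (Submodule.topologicalClosure_eq_top_iff).2 h1
  have h4 := Submodule.topologicalClosure_minimal _ h2 hM
  rw [h3] at h4
  exact h4 trivial

theorem eq_of_eigenvectors {C : H →L[ℂ] H} (hC : IsSelfAdjoint C) (hc : IsCompactOperator C)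
    (hi : Function.Injective C) {F G : H →L[ℂ] H}
    (h : ∀ (μ : ℝ) (x : H), μ ≠ 0 → C x = (μ : ℂ) • x → F x = G x) : F = G := by
  ext x
  refine mem_of_eigenvectors hC hc hi (LinearMap.eqLocus F.toLinearMap G.toLinearMap) ?_ h x
  exact isClosed_eq F.continuous G.continuous

/-- The approximants are isometries, so the vectors on which they converge form a closed subspace
(an `ε/3` argument). It contains all eigenvectors. -/
theorem exists_tendsto_unitApprox {C : H →L[ℂ] H} (hC : IsSelfAdjoint C)
    (hc : IsCompactOperator C) (hi : Function.Injective C) (t : ℝ) (x : H) :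
    ∃ y, Tendsto (fun n => unitApprox C n t x) atTop (𝓝 y) := by
  let M : Submodule ℂ H :=
    { carrier := {x | ∃ y, Tendsto (fun n => unitApprox C n t x) atTop (𝓝 y)}
      zero_mem' := ⟨0, by simp⟩
      add_mem' := by
        rintro x y ⟨a, ha⟩ ⟨b, hb⟩
        exact ⟨a + b, by simpa using ha.add hb⟩
      smul_mem' := by
        rintro c x ⟨a, ha⟩
        exact ⟨c • a, by simpa using ha.const_smul c⟩ }
  refine mem_of_eigenvectors hC hc hi M ?_
    (fun μ x hμ h => ⟨_, tendsto_unitApprox_of_eigenvector hC hμ h t⟩) x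
  refine isClosed_of_closure_subset fun x hx => ?_
  refine cauchySeq_tendsto_of_complete (Metric.cauchySeq_iff'.2 fun ε hε => ?_)
  obtain ⟨y, ⟨z, hz⟩, hxy⟩ := Metric.mem_closure_iff.1 hx (ε / 3) (by positivity)
  obtain ⟨N, hN⟩ := Metric.cauchySeq_iff'.1 hz.cauchySeq (ε / 3) (by positivity)
  refine ⟨N, fun n hn => ?_⟩
  have h1 : ∀ n, dist (unitApprox C n t x) (unitApprox C n t y) = dist x y := fun n => by
    rw [dist_eq_norm, ← map_sub, norm_unitApprox hC, dist_eq_norm]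
  calc dist (unitApprox C n t x) (unitApprox C N t x)
      ≤ dist (unitApprox C n t x) (unitApprox C n t y)
        + dist (unitApprox C n t y) (unitApprox C N t y)
        + dist (unitApprox C N t y) (unitApprox C N t x) := dist_triangle4 _ _ _ _
    _ < ε / 3 + ε / 3 + ε / 3 := by
        rw [dist_comm (unitApprox C N t y), h1, h1]
        exact add_lt_add (add_lt_add hxy (hN n hn)) hxy
    _ = ε := by ring

/-- The strong limit of the approximants multiplies an eigenvector of `C` for `μ` by `exp(-it/μ)`.
The group law is checked there and extends to bounded operators by density; isometry survives the
limit, and with it strong continuity extends from eigenvectors to all vectors. -/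
theorem exists_isUnitaryGroup {C : H →L[ℂ] H} (hC : IsSelfAdjoint C)
    (hc : IsCompactOperator C) {K : H →ₗ.[ℂ] H} (hK : K.HasInverse C) :
    ∃ U, IsUnitaryGroup K U := by
  have hi := hK.injective
  choose f hf using exists_tendsto_unitApprox hC hc hi
  let U : ℝ → H →L[ℂ] H := fun t =>
    continuousLinearMapOfTendsto (fun n => unitApprox C n t) (tendsto_pi_nhds.2 (hf t))
  have hU : ∀ t x, Tendsto (fun n => unitApprox C n t x) atTop (𝓝 (U t x)) := hf
  have hnorm : ∀ t x, ‖U t x‖ = ‖x‖ := fun t x => by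
    have h1 := (hU t x).norm
    simp only [norm_unitApprox hC] at h1
    exact (tendsto_nhds_unique h1 tendsto_const_nhds)
  have heig : ∀ t (μ : ℝ) (x : H), μ ≠ 0 → C x = (μ : ℂ) • x →
      U t x = Complex.exp (-(Complex.I * t) * ((μ⁻¹ : ℝ) : ℂ)) • x := fun t μ x hμ h =>
    tendsto_nhds_unique (hU t x) (tendsto_unitApprox_of_eigenvector hC hμ h t)
  have hzero : U 0 = 1 := by
    refine eq_of_eigenvectors hC hc hi fun μ x hμ h => ?_
    rw [heig 0 μ x hμ h]; simp
  have hadd : ∀ s t, U (s + t) = U s * U t := fun s t => by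
    refine eq_of_eigenvectors hC hc hi fun μ x hμ h => ?_
    change _ = U s (U t x)
    rw [heig _ μ x hμ h, heig t μ x hμ h, map_smul, heig s μ x hμ h, smul_smul, ← Complex.exp_add]
    congr 2
    push_cast
    ring
  have hcont : ∀ x, Continuous fun t => U t x := by
    let M : Submodule ℂ H :=
      { carrier := {x | Continuous fun t => U t x}
        zero_mem' := by simpa using continuous_const
        add_mem' := by
          intro x y hx hy
          simpa using Continuous.fun_add hx hy
        smul_mem' := by
          intro c x hx
          simpa using Continuous.fun_const_smul hx c }
    refine mem_of_eigenvectors hC hc hi M ?_ fun μ x hμ h => ?_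
    · refine isClosed_of_closure_subset fun x hx => ?_
      refine continuous_of_uniform_approx_of_continuous fun u hu => ?_
      obtain ⟨ε, hε, hu⟩ := Metric.mem_uniformity_dist.1 hu
      obtain ⟨y, hy, hxy⟩ := Metric.mem_closure_iff.1 hx ε hε
      refine ⟨fun t => U t y, hy, fun t => hu ?_⟩
      rwa [dist_eq_norm, ← map_sub, hnorm, ← dist_eq_norm]
    · change Continuous fun t => U t x
      simp only [heig _ μ x hμ h]
      fun_prop
  refine ⟨U, hzero, hadd, hnorm, hcont, fun x y => ?_⟩
  rw [hK]
  constructor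
  · rintro rfl
    -- An integrated form of the differential equation. Both sides are bounded operators applied to
    -- `y`, so it suffices to verify it on eigenvectors; its derivative at `t = 0` then gives the
    -- generator on the whole range of `C`.
    have hint : ∀ t, U t (C y) - C y = -(Complex.I • ∫ s in (0 : ℝ)..t, U s y) := by
      intro t
      let Jt : H →L[ℂ] H := LinearMap.mkContinuous
        { toFun := fun y => ∫ s in (0 : ℝ)..t, U s y
          map_add' := fun x y => by
            simp only [map_add]
            exact intervalIntegral.integral_add ((hcont x).intervalIntegrable _ _)
              ((hcont y).intervalIntegrable _ _)
          map_smul' := fun c x => by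
            simp only [map_smul]
            exact intervalIntegral.integral_smul c _ } |t| (fun x => by
            have := intervalIntegral.norm_integral_le_of_norm_le_const (a := (0 : ℝ)) (b := t)
              (f := fun s => U s x) (C := ‖x‖) (fun s _ => (hnorm s x).le)
            rw [sub_zero, mul_comm] at this
            exact this)
      have : U t * C - C = -(Complex.I • Jt) := by
        refine eq_of_eigenvectors hC hc hi fun μ x hμ h => ?_
        change U t (C x) - C x = -(Complex.I • ∫ s in (0 : ℝ)..t, U s x)
        have hd : ∀ s ∈ uIcc 0 t, HasDerivAt (fun s => U s (C x)) (-(Complex.I • U s x)) s := by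
          intro s _
          simp only [h, map_smul, heig _ μ x hμ h, smul_smul]
          have h1 : HasDerivAt (fun s : ℝ => -(Complex.I * s) * ((μ⁻¹ : ℝ) : ℂ))
              (-(Complex.I * (1 : ℝ)) * ((μ⁻¹ : ℝ) : ℂ)) s := by
            refine HasDerivAt.mul_const ?_ _
            refine HasDerivAt.neg ?_
            exact (HasDerivAt.ofReal_comp (hasDerivAt_id s)).const_mul _
          have h2 := (h1.cexp.const_mul (μ : ℂ)).smul_const x
          refine h2.congr_deriv ?_
          rw [← neg_smul]
          congr 1
          have : (μ : ℂ) ≠ 0 := by exact_mod_cast hμ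
          push_cast
          field_simp
        have h3 := intervalIntegral.integral_eq_sub_of_hasDerivAt hd
          (((hcont x).const_smul Complex.I).neg.intervalIntegrable _ _)
        rw [hzero] at h3
        rw [← intervalIntegral.integral_smul, ← intervalIntegral.integral_neg]
        exact h3.symm
      exact congrArg (fun F : H →L[ℂ] H => F y) this
    have h1 : HasDerivAt (fun t => ∫ s in (0 : ℝ)..t, U s y) (U 0 y) 0 :=
      intervalIntegral.integral_hasDerivAt_right ((hcont y).intervalIntegrable _ _)
        ((hcont y).stronglyMeasurableAtFilter _ _) (hcont y).continuousAt
    have h2 := (h1.const_smul Complex.I).neg.add_const (C y)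
    rw [hzero] at h2
    refine h2.congr_of_eventuallyEq (Eventually.of_forall fun t => ?_)
    have := hint t
    rw [sub_eq_iff_eq_add] at this
    exact this
  · intro h
    -- For an eigenvector `v` of `C` one has `⟨v, U t x⟩ = exp(-it/μ)⟨v, x⟩`. Differentiating at 0
    -- gives `⟨v, y⟩ = μ⁻¹⟨v, x⟩`, that is `⟨v, C y - x⟩ = 0`; the eigenvectors being total, `C y =
    -- x`.
    have key : ∀ v : H, inner ℂ v (C y - x) = 0 := by
      let M : Submodule ℂ H := (ℂ ∙ (C y - x))ᗮ
      have hMc : IsClosed (M : Set H) := Submodule.isClosed_orthogonal _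
      intro v
      refine Submodule.inner_left_of_mem_orthogonal (Submodule.mem_span_singleton_self _)
        (mem_of_eigenvectors hC hc hi M hMc (fun μ v hμ hv => ?_) v)
      rw [Submodule.mem_orthogonal_singleton_iff_inner_left, inner_sub_right]
      have h1 : inner ℂ v (C y) = (μ : ℂ) * inner ℂ v y := by
        rw [← ContinuousLinearMap.adjoint_inner_left, hC.adjoint_eq, hv, inner_smul_left,
          Complex.conj_ofReal]
      have hU1 : ∀ t, inner ℂ v (U t x)
          = Complex.exp (-(Complex.I * t) * ((μ⁻¹ : ℝ) : ℂ)) * inner ℂ v x := fun t => by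
        have e1 : inner ℂ (U t (U (-t) v)) (U t x) = inner ℂ (U (-t) v) x := by
          let L : H →ₗᵢ[ℂ] H := ⟨(U t).toLinearMap, hnorm t⟩
          exact L.inner_map_map _ _
        have e2 : U t (U (-t) v) = v := by
          change (U t * U (-t)) v = v
          rw [← hadd, add_neg_cancel, hzero]; rfl
        rw [e2, heig _ μ v hμ hv, inner_smul_left, ← Complex.exp_conj] at e1
        rw [e1]
        congr 2
        simp
      have h2 : HasDerivAt (fun t => inner ℂ v (U t x)) (inner ℂ v (-(Complex.I • y))) 0 :=
        (innerSL ℂ v).restrictScalars ℝ |>.hasFDerivAt.comp_hasDerivAt 0 h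
      have h3 : HasDerivAt (fun s : ℝ => -(Complex.I * s) * ((μ⁻¹ : ℝ) : ℂ))
              (-(Complex.I * (1 : ℝ)) * ((μ⁻¹ : ℝ) : ℂ)) 0 := by
        refine HasDerivAt.mul_const ?_ _
        refine HasDerivAt.neg ?_
        exact (HasDerivAt.ofReal_comp (hasDerivAt_id (0 : ℝ))).const_mul _
      have h4 := h3.cexp.mul_const (inner ℂ v x)
      simp only [hU1] at h2
      have h5 := h2.unique h4
      rw [inner_neg_right, inner_smul_right] at h5
      simp only [Complex.ofReal_zero, mul_zero, neg_zero, zero_mul, Complex.exp_zero,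
        Complex.ofReal_one, mul_one, one_mul, neg_mul, neg_inj, mul_assoc] at h5
      have h6 := mul_left_cancel₀ Complex.I_ne_zero h5
      rw [h1, h6]
      have : (μ : ℂ) ≠ 0 := by exact_mod_cast hμ
      push_cast
      field_simp
      ring
    have := ext_inner_left ℂ (x := C y - x) (y := 0) fun v => by rw [key, inner_zero_right]
    exact (sub_eq_zero.1 this).symm

theorem IsUnitaryGroup.hasDerivAt {K : H →ₗ.[ℂ] H} {U : ℝ → H →L[ℂ] H} (hU : IsUnitaryGroup K U)
    {x y : H} (h : (x, y) ∈ K.graph) (t : ℝ) :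
    HasDerivAt (fun t => U t x) (-(Complex.I • U t y)) t := by
  have h1 := (hU.generator x y).1 h
  have h2 := (((U t).restrictScalars ℝ).hasFDerivAt (x := U 0 x)).comp_hasDerivAt 0 h1
  have h3 : HasDerivAt (fun s => U (t + (s - t)) x) (-(Complex.I • U t y)) t := by
    have h4 : HasDerivAt (fun s : ℝ => s - t) 1 t := (hasDerivAt_id t).sub_const t
    have h5 : HasDerivAt ((U t).restrictScalars ℝ ∘ fun t => U t x)
      ((U t).restrictScalars ℝ (-(Complex.I • y))) (t - t) := by rw [sub_self]; exact h2
    have h6 := HasDerivAt.scomp (h := fun s => s - t) t h5 h4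
    rw [one_smul] at h6
    refine (h6.congr_deriv ?_).congr_of_eventuallyEq (Eventually.of_forall fun s => ?_)
    · change U t _ = _
      rw [map_neg, map_smul]
    · change U (t + (s - t)) x = U t (U (s - t) x)
      rw [hU.map_add]; rfl
  simpa using h3

/-- The derivative of `exp(it/μ) U t x` vanishes, so the generator alone determines the group on
eigenvectors. -/
theorem IsUnitaryGroup.apply_of_eigenvector {K : H →ₗ.[ℂ] H} {U : ℝ → H →L[ℂ] H}
    (hU : IsUnitaryGroup K U) {C : H →L[ℂ] H} (hK : K.HasInverse C) {μ : ℝ} (hμ : μ ≠ 0) {x : H}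
    (h : C x = (μ : ℂ) • x) (t : ℝ) :
    U t x = Complex.exp (-(Complex.I * t) * ((μ⁻¹ : ℝ) : ℂ)) • x := by
  have hμ' : (μ : ℂ) ≠ 0 := by exact_mod_cast hμ
  have hg : (x, ((μ⁻¹ : ℝ) : ℂ) • x) ∈ K.graph := by
    rw [hK, map_smul, h, smul_smul, Complex.ofReal_inv, inv_mul_cancel₀ hμ', one_smul]
  have hd : ∀ t, HasDerivAt (fun t : ℝ => Complex.exp ((Complex.I * t) * ((μ⁻¹ : ℝ) : ℂ)) • U t x)
      0 t := fun t => by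
    have h1 := hU.hasDerivAt hg t
    have h3 : HasDerivAt (fun s : ℝ => (Complex.I * s) * ((μ⁻¹ : ℝ) : ℂ))
              ((Complex.I * (1 : ℝ)) * ((μ⁻¹ : ℝ) : ℂ)) t := by
      refine HasDerivAt.mul_const ?_ _
      exact (HasDerivAt.ofReal_comp (hasDerivAt_id t)).const_mul _
    refine (h3.cexp.smul h1).congr_deriv ?_
    rw [map_smul, smul_neg, smul_smul, smul_smul, ← sub_eq_neg_add, ← sub_smul]
    simp
    left
    ring
  have hconst := is_const_of_deriv_eq_zero (fun t => (hd t).differentiableAt)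
    (fun t => (hd t).deriv) t 0
  simp only [Complex.ofReal_zero, mul_zero, zero_mul, Complex.exp_zero, hU.map_zero, one_smul]
    at hconst
  have h0 : (1 : H →L[ℂ] H) x = x := rfl
  rw [h0] at hconst
  rw [← hconst, smul_smul, ← Complex.exp_add, hconst]
  simp

/-- Any group with generator `-iK` agrees with the limit of the approximants on eigenvectors, hence
everywhere. This applies in particular to the one chosen by `expGroup`, and makes it measurable in
parameters. -/
theorem IsUnitaryGroup.tendsto_unitApprox {K : H →ₗ.[ℂ] H} {U : ℝ → H →L[ℂ] H}
    (hU : IsUnitaryGroup K U) {C : H →L[ℂ] H} (hC : IsSelfAdjoint C) (hc : IsCompactOperator C)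
    (hK : K.HasInverse C) (t : ℝ) (x : H) :
    Tendsto (fun n => unitApprox C n t x) atTop (𝓝 (U t x)) := by
  have hi := hK.injective
  choose f hf using exists_tendsto_unitApprox hC hc hi
  let V : H →L[ℂ] H :=
    continuousLinearMapOfTendsto (fun n => unitApprox C n t) (tendsto_pi_nhds.2 (hf t))
  have hV : U t = V := eq_of_eigenvectors hC hc hi fun μ x hμ h => by
    rw [hU.apply_of_eigenvector hK hμ h]
    exact tendsto_nhds_unique (tendsto_unitApprox_of_eigenvector hC hμ h t) (hf t x)
  rw [hV]
  exact hf t x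

/-- Inversion is norm-continuous at units, so each approximant inherits the norm continuity of the
family; its limit `n → ∞` is only a strong one. -/
theorem continuousOn_invApprox {X : Type} [TopologicalSpace X] {s : Set X} {C : X → H →L[ℂ] H}
    (hC : ∀ θ ∈ s, IsSelfAdjoint (C θ)) (h : ContinuousOn C s) (n : ℕ) :
    ContinuousOn (fun θ => invApprox (C θ) n) s := by
  refine h.mul fun θ hθ => ?_
  have h1 : ContinuousWithinAt (fun θ => C θ * C θ +
      ((((n : ℝ) + 1)⁻¹ ^ 2 : ℝ) : ℂ) • (1 : H →L[ℂ] H)) s θ :=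
    (((h θ hθ).mul (h θ hθ))).add continuousWithinAt_const
  have hu := isUnit_sq_add (hC θ hθ) (ne_zero_inv_succ n)
  have h2 := NormedRing.inverse_continuousAt hu.unit
  exact ContinuousAt.comp_continuousWithinAt (g := Ring.inverse) h2 h1

theorem continuousOn_unitApprox {X : Type} [TopologicalSpace X] {s : Set X} {C : X → H →L[ℂ] H}
    (hC : ∀ θ ∈ s, IsSelfAdjoint (C θ)) (h : ContinuousOn C s) (n : ℕ) (t : ℝ) :
    ContinuousOn (fun θ => unitApprox (C θ) n t) s := by
  let _ : NormedAlgebra ℚ (H →L[ℂ] H) := NormedAlgebra.restrictScalars ℚ ℂ _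
  exact NormedSpace.exp_continuous.comp_continuousOn
    (ContinuousOn.fun_const_smul (continuousOn_invApprox hC h n) _)

end UnitaryGroups

/-! ### Regularised inverses and form domains -/

section FormDomain

variable {H : Type} [NormedAddCommGroup H] [InnerProductSpace ℂ H] [CompleteSpace H]

/-- A uniform bound makes the set of vectors with convergence closed, so convergence on eigenvectors
suffices. -/
theorem tendsto_of_eigenvectors {C : H →L[ℂ] H} (hC : IsSelfAdjoint C)
    (hc : IsCompactOperator C) (hi : Function.Injective C) {F : ℕ → H →L[ℂ] H} {G : H →L[ℂ] H}
    {c : ℝ} (hF : ∀ n x, ‖F n x‖ ≤ c * ‖x‖)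
    (h : ∀ (μ : ℝ) (x : H), μ ≠ 0 → C x = (μ : ℂ) • x →
      Tendsto (fun n => F n x) atTop (𝓝 (G x))) (x : H) :
    Tendsto (fun n => F n x) atTop (𝓝 (G x)) := by
  let M : Submodule ℂ H :=
    { carrier := {x | Tendsto (fun n => F n x) atTop (𝓝 (G x))}
      zero_mem' := by simp
      add_mem' := by
        intro x y hx hy
        simpa using Tendsto.add hx hy
      smul_mem' := by
        intro c x hx
        simpa using Tendsto.const_smul hx c }
  refine mem_of_eigenvectors hC hc hi M (isClosed_of_closure_subset fun x hx => ?_) h x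
  change Tendsto (fun n => F n x) atTop (𝓝 (G x))
  rw [Metric.tendsto_atTop]
  intro ε hε
  have hc0 : 0 < |c| + ‖G‖ + 1 := by positivity
  obtain ⟨y, hy, hxy⟩ := Metric.mem_closure_iff.1 hx (ε / 2 / (|c| + ‖G‖ + 1)) (by positivity)
  obtain ⟨N, hN⟩ := Metric.tendsto_atTop.1 hy (ε / 2) (by positivity)
  refine ⟨N, fun n hn => ?_⟩
  rw [lt_div_iff₀ hc0] at hxy
  have h1 : dist (F n x) (F n y) ≤ |c| * dist x y := by
    rw [dist_eq_norm, ← map_sub, dist_eq_norm]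
    exact (hF n _).trans (mul_le_mul_of_nonneg_right (le_abs_self c) (norm_nonneg _))
  have h2 : dist (G y) (G x) ≤ ‖G‖ * dist x y := by
    rw [dist_comm, dist_eq_norm, ← map_sub, dist_eq_norm]
    exact G.le_opNorm _
  have h3 := dist_triangle4 (F n x) (F n y) (G y) (G x)
  have h4 := hN n hn
  nlinarith [dist_nonneg (x := x) (y := y)]

/-- With `D = S² + ε²` the operator is `1 - ε² D⁻¹`, and `‖ε² D⁻¹‖ ≤ 1` by coercivity; hence the
constant 2. -/
theorem norm_invApprox_apply_le {S : H →L[ℂ] H} (hS : IsSelfAdjoint S) (n : ℕ) (x : H) :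
    ‖(invApprox S n * S) x‖ ≤ 2 * ‖x‖ := by
  have hcomm : Commute S (S * S + ((((n : ℝ) + 1)⁻¹ ^ 2 : ℝ) : ℂ) • (1 : H →L[ℂ] H)) :=
    ((Commute.refl S).mul_right (Commute.refl S)).add_right ((Commute.one_right S).smul_right _)
  have hu := isUnit_sq_add hS (ne_zero_inv_succ n)
  have hsa := isSelfAdjoint_invApprox hS n
  have hinv : invApprox S n
      = Ring.inverse (S * S + ((((n : ℝ) + 1)⁻¹ ^ 2 : ℝ) : ℂ) • (1 : H →L[ℂ] H)) * S := by
    have hs : IsSelfAdjoint (S * S + ((((n : ℝ) + 1)⁻¹ ^ 2 : ℝ) : ℂ) • (1 : H →L[ℂ] H)) := by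
      rw [isSelfAdjoint_iff, star_add, star_mul, hS.star_eq, star_smul, star_one]
      congr 2
      exact Complex.conj_ofReal _
    rw [← hsa.star_eq, invApprox, star_mul, hs.ringInverse.star_eq, hS.star_eq]
  set D := S * S + ((((n : ℝ) + 1)⁻¹ ^ 2 : ℝ) : ℂ) • (1 : H →L[ℂ] H) with hDdef
  set ε := ((n : ℝ) + 1)⁻¹
  set u := Ring.inverse D x with hudef
  have hDu : S (S u) + ((ε ^ 2 : ℝ) : ℂ) • u = x := by
    change D u = x
    rw [hudef]
    change (D * Ring.inverse D) x = x
    rw [Ring.mul_inverse_cancel _ hu]; rfl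
  have h1 : (invApprox S n * S) x = x - ((ε ^ 2 : ℝ) : ℂ) • u := by
    rw [hinv, mul_assoc]
    have : S * S = D - ((ε ^ 2 : ℝ) : ℂ) • (1 : H →L[ℂ] H) := by rw [hDdef]; abel
    rw [this, mul_sub, Ring.inverse_mul_cancel _ hu, mul_smul_comm, mul_one]
    rfl
  have h2 : ε ^ 2 * ‖u‖ ≤ ‖x‖ := by
    by_cases hu0 : ‖u‖ = 0
    · rw [hu0, mul_zero]; exact norm_nonneg _
    have h3 : ε ^ 2 * ‖u‖ ^ 2 ≤ RCLike.re (inner ℂ x u) := by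
      rw [← hDu, inner_add_left, inner_smul_left, Complex.conj_ofReal]
      have : inner ℂ (S (S u)) u = inner ℂ (S u) (S u) := by
        rw [← ContinuousLinearMap.adjoint_inner_right, hS.adjoint_eq]
      rw [this, map_add, inner_self_eq_norm_sq, RCLike.re_to_complex, Complex.re_ofReal_mul,
        ← RCLike.re_to_complex, inner_self_eq_norm_sq]
      nlinarith [sq_nonneg ‖S u‖]
    have h4 := h3.trans ((RCLike.re_le_norm _).trans (norm_inner_le_norm x u))
    have h5 : 0 < ‖u‖ := lt_of_le_of_ne (norm_nonneg _) (Ne.symm hu0)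
    refine le_of_mul_le_mul_right ?_ h5
    nlinarith
  rw [h1]
  refine (norm_sub_le _ _).trans ?_
  rw [norm_smul, Complex.norm_real, Real.norm_of_nonneg (sq_nonneg _)]
  linarith

/-- Exhibits `S⁻¹` on the range of `S` as a pointwise limit of bounded operators. Applied to `S =
Λ̃(θ)⁻¹`, it gives the measurability of `θ ↦ Λ̃(θ)Ỹ(θ)`. -/
theorem tendsto_invApprox {S : H →L[ℂ] H} (hS : IsSelfAdjoint S) (hc : IsCompactOperator S)
    (hi : Function.Injective S) (z : H) :
    Tendsto (fun n => invApprox S n (S z)) atTop (𝓝 z) := by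
  refine tendsto_of_eigenvectors hS hc hi (F := fun n => invApprox S n * S) (G := 1)
    (norm_invApprox_apply_le hS) (fun μ x hμ h => ?_) z
  have h1 : ∀ n, (invApprox S n * S) x
      = ((μ * (μ / (μ ^ 2 + ((n : ℝ) + 1)⁻¹ ^ 2)) : ℝ) : ℂ) • x := fun n => by
    change invApprox S n (S x) = _
    rw [h, map_smul, invApprox_apply_of_eigenvector hS n h, smul_smul, ← Complex.ofReal_mul]
  simp only [h1]
  have h2 : Tendsto (fun n : ℕ => ((n : ℝ) + 1)⁻¹) atTop (𝓝 0) := by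
    simpa using tendsto_one_div_add_atTop_nhds_zero_nat (𝕜 := ℝ)
  have h3 := (Tendsto.div (tendsto_const_nhds (x := μ)) (((h2.pow 2).const_add (μ ^ 2)))
    (by positivity)).const_mul μ
  have h4 : μ * (μ / (μ ^ 2 + 0 ^ 2)) = 1 := by field_simp; simp
  rw [h4] at h3
  have h5 := ((Complex.continuous_ofReal.tendsto _).comp h3).smul_const x
  simpa using h5

/-- Taking `w = L y` turns the hypothesis into `|⟨x, L y⟩| ≤ c ‖y‖`, which places `x` in the domain
of the adjoint, and `L` is selfadjoint. The norm bound follows by testing `L x` on the dense range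
of `S`. -/
theorem LinearPMap.HasInverse.mem_domain_of_le {L : H →ₗ.[ℂ] H} {S : H →L[ℂ] H}
    (h : L.HasInverse S) (hS : IsSelfAdjoint S) {x : H} {c : ℝ} (hc : 0 ≤ c)
    (hx : ∀ w, ‖inner ℂ x w‖ ≤ c * ‖S w‖) : x ∈ L.domain ∧ ‖L.ap x‖ ≤ c := by
  have hL := h.isSelfAdjoint hS
  have hd : x ∈ L.domain := by
    rw [← (LinearPMap.isSelfAdjoint_def).1 hL, LinearPMap.mem_adjoint_domain_iff]
    refine AddMonoidHomClass.continuous_of_bound ((innerₛₗ ℂ x).comp L.toFun) c fun y => ?_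
    have := hx (L y)
    rw [h.apply_inverse] at this
    exact this
  refine ⟨hd, ?_⟩
  set z := L.ap x
  have hz : S z = x := h.ap_inverse hd
  have h1 : ∀ v, ‖inner ℂ z v‖ ≤ c * ‖v‖ := by
    intro v
    refine (denseRange_of_isSelfAdjoint hS h.injective).induction_on
      (p := fun v => ‖inner ℂ z v‖ ≤ c * ‖v‖) v ?_ ?_
    · exact isClosed_le (by fun_prop) (by fun_prop)
    · intro w
      have := hx w
      rwa [← hz, ← ContinuousLinearMap.adjoint_inner_right, hS.adjoint_eq] at this
  have h2 := h1 z
  by_cases h0 : ‖z‖ = 0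
  · rw [h0]; exact hc
  · have h5 : 0 < ‖z‖ := lt_of_le_of_ne (norm_nonneg _) (Ne.symm h0)
    refine le_of_mul_le_mul_right ?_ h5
    rw [← inner_self_eq_norm_mul_norm (𝕜 := ℂ)]
    exact (RCLike.re_le_norm _).trans h2

/-- Write `N = S²` with `S = N^{1/2}`: then `‖N x‖ ≤ ‖S‖ ‖S x‖`, where `‖S‖² = ‖N‖` and `‖S x‖² = ⟨N
x, x⟩`. -/
theorem norm_sq_le_of_nonneg {N : H →L[ℂ] H} (hN : 0 ≤ N) (x : H) :
    ‖N x‖ ^ 2 ≤ ‖N‖ * RCLike.re (inner ℂ (N x) x) := by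
  have hS0 : 0 ≤ CFC.sqrt N := CFC.sqrt_nonneg N
  have hSa : IsSelfAdjoint (CFC.sqrt N) :=
    ((ContinuousLinearMap.nonneg_iff_isPositive _).1 hS0).isSelfAdjoint
  have hSS : CFC.sqrt N * CFC.sqrt N = N := CFC.sqrt_mul_sqrt_self N hN
  set S := CFC.sqrt N
  have h1 : RCLike.re (inner ℂ (N x) x) = ‖S x‖ ^ 2 := by
    rw [← hSS, ← inner_self_eq_norm_sq (𝕜 := ℂ)]
    change RCLike.re (inner ℂ (S (S x)) x) = _
    conv_rhs => rw [← ContinuousLinearMap.adjoint_inner_left, hSa.adjoint_eq]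
  have h2 : ‖N‖ = ‖S‖ ^ 2 := by
    rw [← hSS, sq, ← CStarRing.norm_star_mul_self, hSa.star_eq]
  rw [h1, h2, ← mul_pow]
  refine pow_le_pow_left₀ (norm_nonneg _) ?_ 2
  conv_lhs => rw [← hSS]
  exact S.le_opNorm (S x)

section Sandwich

variable {A N : H →L[ℂ] H}

theorem isPositive_ringInverse (hN : 0 ≤ N) (hu : IsUnit N) : 0 ≤ Ring.inverse N := by
  rw [ContinuousLinearMap.nonneg_iff_isPositive] at hN ⊢
  refine ContinuousLinearMap.isPositive_def'.2 ⟨hN.isSelfAdjoint.ringInverse, fun x => ?_⟩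
  have h1 : N (Ring.inverse N x) = x := by
    change (N * Ring.inverse N) x = x
    rw [Ring.mul_inverse_cancel _ hu]; rfl
  have h2 := hN.re_inner_nonneg_right (Ring.inverse N x)
  rw [h1] at h2
  exact h2

theorem nonneg_sandwich (hA : IsSelfAdjoint A) (hN : 0 ≤ N) (hu : IsUnit N) :
    0 ≤ A * Ring.inverse N * A := by
  have h1 := isPositive_ringInverse hN hu
  rw [ContinuousLinearMap.nonneg_iff_isPositive] at h1 ⊢
  have h2 := h1.conj_adjoint A
  rw [hA.adjoint_eq] at h2
  exact h2

/-- The range of `A` lies in the form domain of the inverse of `A N⁻¹ A`. -/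
theorem mem_form_domain (hA : IsSelfAdjoint A) (hN : 0 ≤ N) (hu : IsUnit N) {L : H →ₗ.[ℂ] H}
    (hL : L.HasInverse (CFC.sqrt (A * Ring.inverse N * A))) (u : H) :
    A u ∈ L.domain ∧ ‖L.ap (A u)‖ ≤ Real.sqrt ‖N‖ * ‖u‖ := by
  have hR := nonneg_sandwich hA hN hu
  have hS0 : 0 ≤ CFC.sqrt (A * Ring.inverse N * A) := CFC.sqrt_nonneg _
  have hSa : IsSelfAdjoint (CFC.sqrt (A * Ring.inverse N * A)) :=
    ((ContinuousLinearMap.nonneg_iff_isPositive _).1 hS0).isSelfAdjoint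
  have hSS := CFC.sqrt_mul_sqrt_self (A * Ring.inverse N * A) hR
  set S := CFC.sqrt (A * Ring.inverse N * A)
  refine hL.mem_domain_of_le hSa (by positivity) fun w => ?_
  have h1 : inner ℂ (A u) w = inner ℂ u (A w) := by
    rw [← ContinuousLinearMap.adjoint_inner_right, hA.adjoint_eq]
  -- Put `g = N⁻¹Aw`. Then `‖N g‖² ≤ ‖N‖ ⟨N g, g⟩`, and `⟨N g, g⟩ = ⟨Aw, N⁻¹Aw⟩ = ⟨w, S² w⟩ = ‖S
  -- w‖²`.
  have h2 : ‖A w‖ ≤ Real.sqrt ‖N‖ * ‖S w‖ := by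
    refine le_of_sq_le_sq ?_ (by positivity)
    set g := Ring.inverse N (A w) with hg
    have h3 : N g = A w := by
      change (N * Ring.inverse N) (A w) = A w
      rw [Ring.mul_inverse_cancel _ hu]; rfl
    have h4 := norm_sq_le_of_nonneg hN g
    rw [h3] at h4
    have h5 : RCLike.re (inner ℂ (A w) g) = ‖S w‖ ^ 2 := by
      have e1 : inner ℂ (A w) g = inner ℂ w (S (S w)) := by
        have : S (S w) = A (Ring.inverse N (A w)) := by
          change (S * S) w = _
          rw [hSS]; rfl
        rw [this, ← ContinuousLinearMap.adjoint_inner_left A, hA.adjoint_eq]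
      rw [e1, ← ContinuousLinearMap.adjoint_inner_left S, hSa.adjoint_eq, inner_self_eq_norm_sq]
    rw [h5] at h4
    rw [mul_pow, Real.sq_sqrt (norm_nonneg _)]
    exact h4
  rw [h1]
  refine (norm_inner_le_norm _ _).trans ?_
  calc ‖u‖ * ‖A w‖ ≤ ‖u‖ * (Real.sqrt ‖N‖ * ‖S w‖) := by gcongr
    _ = _ := by ring

theorem isCompactOperator_sandwich (hA : IsCompactOperator A) :
    IsCompactOperator (A * Ring.inverse N * A : H →L[ℂ] H) :=
  IsCompactOperator.clm_comp (f := A) hA (A * Ring.inverse N)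

theorem ContinuousOn.sandwich {X : Type} [TopologicalSpace X] {s : Set X} {A N : X → H →L[ℂ] H}
    (hA : ContinuousOn A s) (hN : ContinuousOn N s) (hu : ∀ θ ∈ s, IsUnit (N θ)) :
    ContinuousOn (fun θ => A θ * Ring.inverse (N θ) * A θ) s := by
  refine (hA.mul fun θ hθ => ?_).mul hA
  have h2 := NormedRing.inverse_continuousAt (hu θ hθ).unit
  exact ContinuousAt.comp_continuousWithinAt (g := Ring.inverse) h2 (hN θ hθ)

end Sandwich

/-- Norm continuity over a second countable space makes the family itself strongly measurable into
the operators; the application map is bilinear and continuous. -/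
theorem ContinuousOn.aestronglyMeasurable_clm_apply {X : Type} [TopologicalSpace X]
    [MeasurableSpace X] [OpensMeasurableSpace X] [SecondCountableTopology X]
    [TopologicalSpace.PseudoMetrizableSpace X] {μ : Measure X} {s : Set X} {T : X → H →L[ℂ] H}
    (hT : ContinuousOn T s) (hs : MeasurableSet s) {f : X → H}
    (hf : AEStronglyMeasurable f (μ.restrict s)) :
    AEStronglyMeasurable (fun θ => T θ (f θ)) (μ.restrict s) :=
  (ContinuousLinearMap.id ℂ (H →L[ℂ] H)).aestronglyMeasurable_comp₂
    (hT.aestronglyMeasurable hs) hf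

end FormDomain

/-! ### Tiling of space by lattice cells -/

/-- The unit cell `[0, 1)³`. -/
def unitCell : Set E3 := {y | ∀ j, y j ∈ Ico (0 : ℝ) 1}

theorem measurableSet_unitCell : MeasurableSet unitCell := by
  have : unitCell = ⋂ j, (fun y : E3 => y j) ⁻¹' Ico (0 : ℝ) 1 := by
    ext y; simp [unitCell]
  rw [this]
  exact MeasurableSet.iInter fun j => (by fun_prop : Measurable fun y : E3 => y j) measurableSet_Ico

theorem haarAddCircle_eq_volume :
    (AddCircle.haarAddCircle : Measure UnitAddCircle) = volume := by
  rw [AddCircle.volume_eq_smul_haarAddCircle]; simp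

theorem measurePreserving_equivIco_coe :
    MeasurePreserving (fun x : UnitAddCircle => (AddCircle.equivIco (1 : ℝ) 0 x : ℝ))
      AddCircle.haarAddCircle (volume.restrict (Ico 0 1)) := by
  have hm : Measurable (fun x : UnitAddCircle => (AddCircle.equivIco (1 : ℝ) 0 x : ℝ)) :=
    measurable_subtype_coe.comp (AddCircle.measurableEquivIco 1 0).measurable
  have h1 := AddCircle.measurePreserving_mk (1 : ℝ) 0
  rw [zero_add, ← restrict_Ico_eq_restrict_Ioc] at h1
  refine ⟨hm, ?_⟩
  have h2 : (AddCircle.haarAddCircle : Measure UnitAddCircle) = volume := haarAddCircle_eq_volume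
  rw [h2, ← h1.map_eq, Measure.map_map hm h1.measurable]
  have h3 : ((fun x : UnitAddCircle => (AddCircle.equivIco (1 : ℝ) 0 x : ℝ)) ∘
      ((↑) : ℝ → UnitAddCircle)) =ᵐ[volume.restrict (Ico 0 1)] id := by
    filter_upwards [ae_restrict_mem measurableSet_Ico] with x hx
    have hx' : x ∈ Ico (0 : ℝ) (0 + 1) := by rwa [zero_add]
    change (AddCircle.equivIco (1 : ℝ) 0 (x : UnitAddCircle) : ℝ) = x
    rw [AddCircle.equivIco_coe_eq hx']
  rw [Measure.map_congr h3, Measure.map_id]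

theorem measurePreserving_cellRep :
    MeasurePreserving cellRep haarT (volume.restrict unitCell) := by
  have h1 := measurePreserving_pi (fun _ : Fin 3 => (AddCircle.haarAddCircle : Measure UnitAddCircle))
    (fun _ => volume.restrict (Ico (0 : ℝ) 1)) (fun _ => measurePreserving_equivIco_coe)
  rw [← Measure.restrict_pi_pi] at h1
  have h2 := (PiLp.volume_preserving_toLp (Fin 3)).restrict_preimage measurableSet_unitCell
  have h3 : (WithLp.toLp 2 : (Fin 3 → ℝ) → E3) ⁻¹' unitCell = univ.pi fun _ => Ico (0 : ℝ) 1 := by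
    ext y; simp [unitCell]
  rw [h3] at h2
  exact h2.comp h1

/-- The translate of the unit cell by a lattice vector. -/
def latticeCell (n : Z3) : Set E3 := {y | y - latticePt n ∈ unitCell}

theorem measurableSet_latticeCell (n : Z3) : MeasurableSet (latticeCell n) :=
  (measurable_id.sub_const (latticePt n)) measurableSet_unitCell

theorem mem_latticeCell {n : Z3} {y : E3} : y ∈ latticeCell n ↔ ∀ j, ⌊y j⌋ = n j := by
  simp only [latticeCell, unitCell, mem_ofPred_eq, latticePt, PiLp.sub_apply, mem_Ico,
    Int.floor_eq_iff]
  refine forall_congr' fun j => ?_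
  constructor <;> rintro ⟨h1, h2⟩ <;> constructor <;> linarith

theorem pairwise_disjoint_latticeCell : Pairwise (Function.onFun Disjoint latticeCell) := by
  intro m n hmn
  refine Set.disjoint_left.2 fun y hm hn => hmn ?_
  rw [mem_latticeCell] at hm hn
  funext j
  rw [← hm j, hn j]

theorem iUnion_latticeCell : ⋃ n, latticeCell n = univ :=
  eq_univ_of_forall fun y => mem_iUnion.2 ⟨fun j => ⌊y j⌋, mem_latticeCell.2 fun _ => rfl⟩

theorem measurePreserving_cellRep_add (n : Z3) :
    MeasurePreserving (fun x => cellRep x + latticePt n) haarT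
      (volume.restrict (latticeCell n)) := by
  have h1 := (measurePreserving_add_right (volume : Measure E3) (latticePt n)).restrict_preimage
    (measurableSet_latticeCell n)
  have h2 : (fun x : E3 => x + latticePt n) ⁻¹' latticeCell n = unitCell := by
    ext y; simp [latticeCell]
  rw [h2] at h1
  exact h1.comp measurePreserving_cellRep

section Cells
variable {F : Type} [NormedAddCommGroup F]

theorem eLpNorm_cell {f : E3 → F} (hf : AEStronglyMeasurable f volume) (p : ℝ≥0∞) (n : Z3) :
    eLpNorm (fun x => f (cellRep x + latticePt n)) p haarT
      = eLpNorm f p (volume.restrict (latticeCell n)) :=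
  eLpNorm_comp_measurePreserving hf.restrict (measurePreserving_cellRep_add n)

theorem MeasureTheory.MemLp.cell {f : E3 → F} {p : ℝ≥0∞} (hf : MemLp f p volume) (n : Z3) :
    MemLp (fun x => f (cellRep x + latticePt n)) p haarT :=
  (hf.restrict _).comp_measurePreserving (measurePreserving_cellRep_add n)

theorem integral_cell [NormedSpace ℝ F] {f : E3 → F} (hf : AEStronglyMeasurable f volume) (n : Z3) :
    ∫ x, f (cellRep x + latticePt n) ∂haarT = ∫ y in latticeCell n, f y := by
  have h := measurePreserving_cellRep_add n
  rw [← h.map_eq, integral_map h.aemeasurable]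
  rw [h.map_eq]; exact hf.restrict

theorem hasSum_integral_cell [NormedSpace ℝ F] {f : E3 → F} (hf : Integrable f) :
    HasSum (fun n => ∫ x, f (cellRep x + latticePt n) ∂haarT) (∫ y, f y) := by
  have h := hasSum_integral_iUnion measurableSet_latticeCell pairwise_disjoint_latticeCell
    (f := f) (μ := volume) hf.integrableOn
  rw [iUnion_latticeCell, setIntegral_univ] at h
  simpa only [integral_cell hf.1] using h

theorem ae_of_cells {p : E3 → Prop} (h : ∀ᵐ y, p y) (n : Z3) :
    ∀ᵐ x ∂haarT, p (cellRep x + latticePt n) :=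
  (measurePreserving_cellRep_add n).quasiMeasurePreserving.ae (ae_restrict_of_ae h)

end Cells

theorem norm_sq_E3 (y : E3) : ‖y‖ ^ 2 = y 0 ^ 2 + y 1 ^ 2 + y 2 ^ 2 := by
  rw [EuclideanSpace.norm_sq_eq, Fin.sum_univ_three]
  simp

theorem cellRep_mem (x : UnitAddTorus (Fin 3)) : cellRep x ∈ unitCell := fun j => by
  have := (AddCircle.equivIco (1 : ℝ) 0 (x j)).2
  simp only [zero_add] at this
  exact this

theorem norm_sq_le_of_mem_unitCell {y : E3} (hy : y ∈ unitCell) : ‖y‖ ^ 2 ≤ 3 := by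
  have h := fun j => hy j
  simp only [mem_Ico] at h
  rw [norm_sq_E3]
  nlinarith [h 0, h 1, h 2]

theorem norm_le_of_mem_unitCell {y : E3} (hy : y ∈ unitCell) : ‖y‖ ≤ 2 := by
  have := norm_sq_le_of_mem_unitCell hy
  nlinarith [norm_nonneg y]

/-- The weight `(1 + |x|²)²`. -/
def weight (x : E3) : ℝ := (1 + ‖x‖ ^ 2) ^ 2

theorem weight_pos (x : E3) : 0 < weight x := by unfold weight; positivity

/-- A shift within the unit cell changes the weight by a bounded factor. Here `‖z‖² ≤ 2‖y + z‖² + 6`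
gives `1 + ‖z‖² ≤ 7(1 + ‖y + z‖²)`, and `49 = 7²`. -/
theorem weight_le_weight_add {y : E3} (h1 : ‖y‖ ^ 2 ≤ 3) (z : E3) :
    weight z ≤ 49 * weight (y + z) := by
  have h2 : ‖z‖ ^ 2 ≤ 2 * ‖y + z‖ ^ 2 + 2 * ‖y‖ ^ 2 := by
    have : ‖z‖ ≤ ‖y + z‖ + ‖y‖ := by
      have := norm_sub_le (y + z) y
      simpa using this
    nlinarith [norm_nonneg z, sq_nonneg (‖y + z‖ - ‖y‖)]
  have h3 : 1 + ‖z‖ ^ 2 ≤ 7 * (1 + ‖y + z‖ ^ 2) := by nlinarith [sq_nonneg ‖y + z‖]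
  unfold weight
  calc (1 + ‖z‖ ^ 2) ^ 2 ≤ (7 * (1 + ‖y + z‖ ^ 2)) ^ 2 := by gcongr
    _ = _ := by ring

/-- Comparison of the sum with the integral of `(1 + |x|²)⁻²`, which converges since `4 > 3`. -/
theorem summable_inv_weight : Summable fun n : Z3 => (weight (latticePt n))⁻¹ := by
  have hint : Integrable fun x : E3 => (weight x)⁻¹ := by
    have h := integrable_rpow_neg_one_add_norm_sq (E := E3) (μ := volume) (r := 4)
      (by simp; norm_num)
    refine h.congr (Eventually.of_forall fun x => ?_)
    simp only [weight]
    rw [show (-(4 : ℝ) / 2) = -((2 : ℕ) : ℝ) by norm_num, Real.rpow_neg (by positivity),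
      Real.rpow_natCast]
  have h1 := (hasSum_integral_cell hint).summable
  refine Summable.of_nonneg_of_le (fun n => (inv_pos.2 (weight_pos _)).le) (fun n => ?_)
    (h1.mul_left 49)
  have h2 : ∀ x, 49⁻¹ * (weight (latticePt n))⁻¹ ≤ (weight (cellRep x + latticePt n))⁻¹ := by
    intro x
    rw [← mul_inv]
    have h3 := weight_le_weight_add (y := -cellRep x)
      (by rw [norm_neg]; exact norm_sq_le_of_mem_unitCell (cellRep_mem x))
      (cellRep x + latticePt n)
    rw [neg_add_cancel_left] at h3
    gcongr
    exact weight_pos _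
  have h4 : Integrable (fun x => (weight (cellRep x + latticePt n))⁻¹) haarT := by
    have := (memLp_one_iff_integrable.2 hint).cell n
    exact memLp_one_iff_integrable.1 this
  have h5 := integral_mono (integrable_const _) h4 h2
  rw [integral_const, probReal_univ, one_smul] at h5
  linarith

/-! ### Plane waves and modulations on the torus -/

/-- The Fourier coefficients of a function on the torus. -/
abbrev coefT : L2T ≃ₗᵢ[ℂ] lp (fun _ : Z3 => ℂ) 2 := (UnitAddTorus.mFourierBasis (d := Fin 3)).repr

/-- The shifted dual lattice vector `θ - 2πk`. -/
def xi (θ : E3) (k : Z3) : E3 := θ - (2 * Real.pi) • latticePt k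

/-- The plane wave `exp(i ξ·x)`. -/
def wave (ξ x : E3) : ℂ := Complex.exp (Complex.I * (inner ℝ ξ x : ℝ))

theorem norm_wave (ξ x : E3) : ‖wave ξ x‖ = 1 := by
  rw [wave, mul_comm, Complex.norm_exp_ofReal_mul_I]

theorem wave_add (ξ x y : E3) : wave ξ (x + y) = wave ξ x * wave ξ y := by
  rw [wave, wave, wave, ← Complex.exp_add, inner_add_right]; push_cast; ring_nf

theorem wave_add_left (ξ η x : E3) : wave (ξ + η) x = wave ξ x * wave η x := by
  rw [wave, wave, wave, ← Complex.exp_add, inner_add_left]; push_cast; ring_nf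

theorem conj_wave (ξ x : E3) : (starRingEnd ℂ) (wave ξ x) = wave (-ξ) x := by
  rw [wave, wave, ← Complex.exp_conj, map_mul, Complex.conj_I, Complex.conj_ofReal, inner_neg_left]
  push_cast; ring_nf

theorem continuous_wave_right (ξ : E3) : Continuous (wave ξ) := by unfold wave; fun_prop

theorem continuous_wave_left (x : E3) : Continuous fun ξ => wave ξ x := by unfold wave; fun_prop

theorem phase_eq_wave (θ : E3) (n : Z3) : phase θ n = wave θ (latticePt n) := rfl

theorem inner_E3 (x y : E3) : inner ℝ x y = x 0 * y 0 + x 1 * y 1 + x 2 * y 2 := by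
  rw [PiLp.inner_apply, Fin.sum_univ_three]
  simp [mul_comm]

theorem wave_dual_lattice (k n : Z3) : wave ((2 * Real.pi) • latticePt k) (latticePt n) = 1 := by
  rw [wave, Complex.exp_eq_one_iff]
  refine ⟨k 0 * n 0 + k 1 * n 1 + k 2 * n 2, ?_⟩
  rw [inner_E3]
  simp [latticePt]
  ring

/-- The two momenta differ by a dual lattice vector, and `exp(2πi k·n) = 1`. So one phase per cell
serves all Fourier coefficients at once. -/
theorem phase_xi (θ : E3) (k n : Z3) : phase (xi θ k) n = phase θ n := by
  have h : θ = xi θ k + (2 * Real.pi) • latticePt k := by rw [xi, sub_add_cancel]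
  conv_rhs => rw [phase_eq_wave, h, wave_add_left, wave_dual_lattice, mul_one]
  rfl

theorem norm_phase (θ : E3) (n : Z3) : ‖phase θ n‖ = 1 := norm_wave _ _

theorem continuous_phase (n : Z3) : Continuous fun θ => phase θ n := continuous_wave_left _

theorem coe_cellRep (x : UnitAddTorus (Fin 3)) (j : Fin 3) :
    ((cellRep x j : ℝ) : UnitAddCircle) = x j := by
  change ((AddCircle.equivIco (1 : ℝ) 0 (x j) : ℝ) : UnitAddCircle) = x j
  exact AddCircle.coe_equivIco

theorem mFourier_eq_wave (k : Z3) (x : UnitAddTorus (Fin 3)) :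
    UnitAddTorus.mFourier k x = wave ((2 * Real.pi) • latticePt k) (cellRep x) := by
  change ∏ i, fourier (k i) (x i) = _
  simp only [← coe_cellRep x, fourier_coe_apply, Fin.prod_univ_three, ← Complex.exp_add]
  rw [wave, inner_E3]
  congr 1
  simp [latticePt]
  ring

theorem coefT_apply (f : L2T) (k : Z3) :
    coefT f k = ∫ x, wave (-((2 * Real.pi) • latticePt k)) (cellRep x) * f x ∂haarT := by
  rw [UnitAddTorus.mFourierBasis_repr, UnitAddTorus.mFourierCoeff]
  refine integral_congr_ae (Eventually.of_forall fun x => ?_)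
  simp only [smul_eq_mul]
  rw [UnitAddTorus.mFourier_neg, mFourier_eq_wave, conj_wave]

theorem measurable_cellRep : Measurable cellRep := measurePreserving_cellRep.measurable

theorem memLp_wave_mul {p : ℝ≥0∞} (θ : E3) {f : UnitAddTorus (Fin 3) → ℂ} (hf : MemLp f p haarT) :
    MemLp (fun x => wave θ (cellRep x) * f x) p haarT := by
  refine hf.of_le ?_ (Eventually.of_forall fun x => by rw [norm_mul, norm_wave, one_mul])
  exact ((continuous_wave_right θ).measurable.comp measurable_cellRep).aestronglyMeasurable.mul hf.1

/-- Multiplication by `exp(iθ·y)`, with `y` in the unit cell, on `L²(T³)`. -/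
def modT (θ : E3) : L2T →ₗᵢ[ℂ] L2T where
  toFun f := (memLp_wave_mul θ (Lp.memLp f)).toLp
  map_add' f g := by
    apply Lp.ext
    filter_upwards [Lp.coeFn_add f g,
      Lp.coeFn_add (memLp_wave_mul θ (Lp.memLp f)).toLp (memLp_wave_mul θ (Lp.memLp g)).toLp,
      (memLp_wave_mul θ (Lp.memLp f)).coeFn_toLp, (memLp_wave_mul θ (Lp.memLp g)).coeFn_toLp,
      (memLp_wave_mul θ (Lp.memLp (f + g))).coeFn_toLp] with x h1 h2 h3 h4 h5
    rw [h5, h2, Pi.add_apply, h3, h4, h1, Pi.add_apply, mul_add]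
  map_smul' c f := by
    apply Lp.ext
    filter_upwards [Lp.coeFn_smul c f, Lp.coeFn_smul c (memLp_wave_mul θ (Lp.memLp f)).toLp,
      (memLp_wave_mul θ (Lp.memLp f)).coeFn_toLp,
      (memLp_wave_mul θ (Lp.memLp (c • f))).coeFn_toLp] with x h1 h2 h3 h4
    rw [h4, h1, RingHom.id_apply, h2, Pi.smul_apply, Pi.smul_apply, h3, smul_eq_mul, smul_eq_mul,
      mul_left_comm]
  norm_map' f := by
    refine le_antisymm ?_ ?_
    · refine Lp.norm_le_norm_of_ae_le ?_
      filter_upwards [(memLp_wave_mul θ (Lp.memLp f)).coeFn_toLp] with x h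
      refine (congrArg norm h).trans_le ?_
      rw [ norm_mul, norm_wave, one_mul]
    · refine Lp.norm_le_norm_of_ae_le ?_
      filter_upwards [(memLp_wave_mul θ (Lp.memLp f)).coeFn_toLp] with x h
      refine le_trans ?_ (congrArg norm h).ge
      rw [ norm_mul, norm_wave, one_mul]

theorem coeFn_modT (θ : E3) (f : L2T) :
    modT θ f =ᵐ[haarT] fun x => wave θ (cellRep x) * f x :=
  (memLp_wave_mul θ (Lp.memLp f)).coeFn_toLp

theorem norm_wave_sub_le (θ θ' x : E3) : ‖wave θ x - wave θ' x‖ ≤ ‖θ - θ'‖ * ‖x‖ := by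
  have h1 : wave θ x - wave θ' x = wave θ' x * (wave (θ - θ') x - 1) := by
    rw [mul_sub, ← wave_add_left, add_sub_cancel, mul_one]
  rw [h1, norm_mul, norm_wave, one_mul, wave]
  exact (Real.norm_exp_I_mul_ofReal_sub_one_le).trans (norm_inner_le_norm _ _)

/-- The modulation is norm-continuous because the cell is bounded: the Lipschitz constant 2 bounds
the norm of its points. -/
theorem continuous_modT : Continuous fun θ => (modT θ).toContinuousLinearMap := by
  refine LipschitzWith.continuous (K := 2) (LipschitzWith.of_dist_le_mul fun θ θ' => ?_)
  rw [dist_eq_norm, dist_eq_norm]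
  refine ContinuousLinearMap.opNorm_le_bound _ (by positivity) fun f => ?_
  change ‖modT θ f - modT θ' f‖ ≤ _
  refine Lp.norm_le_mul_norm_of_ae_le_mul ?_
  filter_upwards [Lp.coeFn_sub (modT θ f) (modT θ' f), coeFn_modT θ f, coeFn_modT θ' f]
    with x h1 h2 h3
  rw [h1, Pi.sub_apply, h2, h3, ← sub_mul, norm_mul]
  refine mul_le_mul_of_nonneg_right ?_ (norm_nonneg _)
  have h4 := norm_wave_sub_le θ θ' (cellRep x)
  have h5 := norm_le_of_mem_unitCell (cellRep_mem x)
  simp only [NNReal.coe_ofNat]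
  nlinarith [norm_nonneg (θ - θ')]

theorem coefT_modT (θ : E3) (f : L2T) (k : Z3) :
    coefT (modT θ f) k = ∫ x, wave (xi θ k) (cellRep x) * f x ∂haarT := by
  rw [coefT_apply]
  refine integral_congr_ae ?_
  filter_upwards [coeFn_modT θ f] with x h
  rw [h, ← mul_assoc, ← wave_add_left, neg_add_eq_sub, xi]

theorem toL2T_of_memLp {f : UnitAddTorus (Fin 3) → ℂ} (hf : MemLp f 2 haarT) :
    toL2T f = hf.toLp f := dif_pos hf

theorem coeFn_toL2T {f : UnitAddTorus (Fin 3) → ℂ} (hf : MemLp f 2 haarT) :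
    toL2T f =ᵐ[haarT] f := by rw [toL2T_of_memLp hf]; exact hf.coeFn_toLp

/-! ### Absolutely convergent Bloch series -/

/-- The restriction of `f` to a cell as an element of `L²(T³)`. -/
def cellLp (f : E3 → ℂ) (n : Z3) : L2T := toL2T fun x => f (cellRep x + latticePt n)

theorem coeFn_cellLp {f : E3 → ℂ} (hf : MemLp f 2 volume) (n : Z3) :
    cellLp f n =ᵐ[haarT] fun x => f (cellRep x + latticePt n) := coeFn_toL2T (hf.cell n)

theorem coefT_modT_cellLp {f : E3 → ℂ} (hf : MemLp f 2 volume) (θ : E3) (n k : Z3) :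
    coefT (modT θ (phase θ n • cellLp f n)) k
      = ∫ x, wave (xi θ k) (cellRep x + latticePt n) * f (cellRep x + latticePt n) ∂haarT := by
  rw [coefT_modT]
  refine integral_congr_ae ?_
  filter_upwards [Lp.coeFn_smul (phase θ n) (cellLp f n), coeFn_cellLp hf n] with x h1 h2
  rw [h1, Pi.smul_apply, h2, smul_eq_mul, wave_add, ← mul_assoc, ← phase_eq_wave, phase_xi]

theorem coeFn_sum_phase_cellLp {f : E3 → ℂ} (hf : MemLp f 2 volume) (θ : E3) (s : Finset Z3) :
    (↑(∑ n ∈ s, phase θ n • cellLp f n) : UnitAddTorus (Fin 3) → ℂ) =ᵐ[haarT]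
      fun x => ∑ n ∈ s, phase θ n * f (cellRep x + latticePt n) := by
  have h1 : ∀ᵐ x ∂haarT, ∀ n, cellLp f n x = f (cellRep x + latticePt n) :=
    ae_all_iff.2 fun n => coeFn_cellLp hf n
  have h2 : ∀ᵐ x ∂haarT, ∀ n, (phase θ n • cellLp f n : L2T) x = phase θ n * cellLp f n x :=
    ae_all_iff.2 fun n => Lp.coeFn_smul _ _
  filter_upwards [Lp.coeFn_fun_finsetSum s fun n => phase θ n • cellLp f n, h1, h2] with x h h1 h2
  rw [h]
  exact Finset.sum_congr rfl fun n _ => by rw [h2, h1]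

theorem blochPartialFun_eq {f : E3 → ℂ} (hf : MemLp f 2 volume) (θ : E3) (N : ℕ) :
    blochPartialFun N f θ = modT θ (∑ n ∈ box N, phase θ n • cellLp f n) := by
  have h1 : (fun x => Complex.exp (Complex.I * (inner ℝ θ (cellRep x) : ℝ)) *
      ∑ n ∈ box N, phase θ n * f (cellRep x + latticePt n)) =ᵐ[haarT]
      modT θ (∑ n ∈ box N, phase θ n • cellLp f n) := by
    filter_upwards [coeFn_modT θ (∑ n ∈ box N, phase θ n • cellLp f n),
      coeFn_sum_phase_cellLp hf θ (box N)] with x h2 h3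
    rw [h2, h3, wave]
  have h2 := (memLp_congr_ae h1).2 (Lp.memLp _)
  rw [blochPartialFun]
  exact Lp.ext ((coeFn_toL2T h2).trans h1)

theorem tendsto_box : Tendsto box atTop atTop := by
  refine tendsto_atTop_finset_of_monotone ?_ ?_
  · intro N M h n hn
    simp only [box, Fintype.mem_piFinset, Finset.mem_Icc] at hn ⊢
    intro j
    have := hn j
    have h' : (N : ℤ) ≤ M := by exact_mod_cast h
    constructor <;> linarith
  · intro n
    refine ⟨∑ j, (n j).natAbs, ?_⟩
    simp only [box, Fintype.mem_piFinset, Finset.mem_Icc]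
    intro j
    have h : (n j).natAbs ≤ ∑ j, (n j).natAbs :=
      Finset.single_le_sum (f := fun j => (n j).natAbs) (fun _ _ => Nat.zero_le _)
        (Finset.mem_univ j)
    constructor <;> omega

/-- A function with sufficient decay for its Bloch series to converge absolutely. -/
structure CellSummable (f : E3 → ℂ) : Prop where
  memLp : MemLp f 2 volume
  integrable : Integrable f
  summable : Summable fun n => ‖cellLp f n‖

/-- On the cell at `n` the function is at most `49 / weight(n)` times the weighted one, whose cell
norms are bounded, and the inverse weights are summable over the lattice. -/
theorem CellSummable.of_weight {f : E3 → ℂ} (hf : Integrable f)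
    (hg : MemLp (fun x => (weight x : ℂ) * f x) 2 volume) : CellSummable f := by
  have hm : MemLp f 2 volume := by
    refine hg.of_le hf.1 (Eventually.of_forall fun x => ?_)
    rw [norm_mul, Complex.norm_real, Real.norm_of_nonneg (weight_pos _).le]
    refine le_mul_of_one_le_left (norm_nonneg _) ?_
    unfold weight
    nlinarith [sq_nonneg ‖x‖, sq_nonneg (‖x‖ ^ 2)]
  refine ⟨hm, hf, ?_⟩
  set g : E3 → ℂ := fun x => (weight x : ℂ) * f x with hgdef
  refine Summable.of_nonneg_of_le (fun _ => norm_nonneg _) (fun n => ?_)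
    (summable_inv_weight.mul_left (49 * (eLpNorm g 2 volume).toReal))
  have h1 : ‖cellLp f n‖ ≤ (49 * (weight (latticePt n))⁻¹) * ‖cellLp g n‖ := by
    refine Lp.norm_le_mul_norm_of_ae_le_mul ?_
    filter_upwards [coeFn_cellLp hm n, coeFn_cellLp hg n] with x h1 h2
    rw [h1, h2, hgdef, norm_mul, Complex.norm_real, ← mul_assoc,
      Real.norm_of_nonneg (weight_pos _).le]
    refine le_mul_of_one_le_left (norm_nonneg _) ?_
    have h3 := weight_le_weight_add (norm_sq_le_of_mem_unitCell (cellRep_mem x)) (latticePt n)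
    have h4 := weight_pos (latticePt n)
    rw [mul_right_comm, ← div_eq_mul_inv, le_div_iff₀ h4, one_mul]
    exact h3
  have h2 : ‖cellLp g n‖ ≤ (eLpNorm g 2 volume).toReal := by
    rw [cellLp, toL2T_of_memLp (hg.cell n), Lp.norm_toLp]
    refine ENNReal.toReal_mono hg.2.ne ?_
    rw [eLpNorm_cell hg.1]
    exact eLpNorm_mono_measure _ Measure.restrict_le_self
  have h3 := weight_pos (latticePt n)
  calc _ ≤ _ := h1
    _ ≤ (49 * (weight (latticePt n))⁻¹) * (eLpNorm g 2 volume).toReal := by gcongr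
    _ = _ := by ring

/-- The Fourier coefficients of an absolutely convergent Bloch series. -/
theorem CellSummable.coefT_of_hasSum {f : E3 → ℂ} (hf : CellSummable f) {θ : E3} {G : L2T}
    (h : HasSum (fun n => modT θ (phase θ n • cellLp f n)) G) (k : Z3) :
    coefT G k = ft f (xi θ k) := by
  let L : L2T →L[ℂ] ℂ := innerSL ℂ (UnitAddTorus.mFourierBasis (d := Fin 3) k)
  have hL : ∀ f, L f = coefT f k := fun f =>
    ((UnitAddTorus.mFourierBasis (d := Fin 3)).repr_apply_apply f k).symm
  have h1 := h.mapL L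
  -- The `n`-th term becomes the integral of `exp(iξ·x) f(x)` over the `n`-th cell with `ξ = θ -
  -- 2πk`; the cells tile `ℝ³`, so the terms add up to the Fourier integral.
  simp only [hL, coefT_modT_cellLp hf.memLp] at h1
  have h2 : Integrable fun x => wave (xi θ k) x * f x :=
    hf.integrable.bdd_mul (continuous_wave_right _).aestronglyMeasurable
      (Eventually.of_forall fun x => (norm_wave _ _).le)
  exact h1.unique (hasSum_integral_cell h2)

namespace Crystal
variable {C : Crystal}

theorem Regular.cellSummable (hC : C.Regular) : CellSummable fun x => (C.σ x : ℂ) := by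
  refine CellSummable.of_weight hC.integrable.ofReal ?_
  refine (hC.decay.ofReal (K := ℂ)).ae_eq (Eventually.of_forall fun x => ?_)
  exact Complex.ofReal_mul _ _

theorem Regular.memLp_ofReal (hC : C.Regular) : MemLp (fun x => (C.σ x : ℂ)) 2 volume :=
  hC.cellSummable.memLp

theorem Regular.summable_norm_cellLp (hC : C.Regular) :
    Summable fun n => ‖cellLp (fun x => (C.σ x : ℂ)) n‖ := hC.cellSummable.summable

theorem Regular.summable_phase_cellLp (hC : C.Regular) (θ : E3) :
    Summable fun n => phase θ n • cellLp (fun x => (C.σ x : ℂ)) n := by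
  refine Summable.of_norm ?_
  simp only [norm_smul, norm_phase, one_mul]
  exact hC.summable_norm_cellLp

/-- The definition of `σT` sums the series pointwise. Absolute convergence in `L²(T³)` implies
almost everywhere convergence to the same limit, so the sum in `L²` may be used instead. -/
theorem Regular.σT_eq (hC : C.Regular) (θ : E3) :
    C.σT θ = modT θ (∑' n, phase θ n • cellLp (fun x => (C.σ x : ℂ)) n) := by
  set G := ∑' n, phase θ n • cellLp (fun x => (C.σ x : ℂ)) n with hG
  have hsum := Lp.hasSum_coeFn_tsum
    (f := fun n => phase θ n • cellLp (fun x => (C.σ x : ℂ)) n)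
    (tsum_enorm_ne_top_iff_summable_norm.2 (by
      simpa only [norm_smul, norm_phase, one_mul] using hC.summable_norm_cellLp))
  have hall : ∀ᵐ x ∂haarT, ∀ n, (phase θ n • cellLp (fun x => (C.σ x : ℂ)) n : L2T) x
      = phase θ n * C.σ (cellRep x + latticePt n) := ae_all_iff.2 fun n => by
    filter_upwards [Lp.coeFn_smul (phase θ n) (cellLp (fun x => (C.σ x : ℂ)) n),
      coeFn_cellLp hC.memLp_ofReal n] with x h1 h2
    rw [h1, Pi.smul_apply, h2, smul_eq_mul]
  have h1 : (fun x => Complex.exp (Complex.I * (inner ℝ θ (cellRep x) : ℝ)) *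
      ∑' n, phase θ n * C.σ (cellRep x + latticePt n)) =ᵐ[haarT] modT θ G := by
    filter_upwards [coeFn_modT θ G, hsum, hall] with x h2 h3 h4
    simp only [h4] at h3
    rw [h2, h3.tsum_eq, wave]
  have h2 := (memLp_congr_ae h1).2 (Lp.memLp _)
  rw [σT]
  exact Lp.ext ((coeFn_toL2T h2).trans h1)

theorem Regular.continuous_σT (hC : C.Regular) : Continuous C.σT := by
  have h1 : C.σT = fun θ => (modT θ).toContinuousLinearMap
      (∑' n, phase θ n • cellLp (fun x => (C.σ x : ℂ)) n) := funext fun θ => hC.σT_eq θ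
  rw [h1]
  refine continuous_modT.clm_apply ?_
  refine continuous_tsum (fun n => (continuous_phase n).smul continuous_const)
    hC.summable_norm_cellLp fun n θ => ?_
  rw [norm_smul, norm_phase, one_mul]

theorem Regular.hasSum_σT (hC : C.Regular) (θ : E3) :
    HasSum (fun n => modT θ (phase θ n • cellLp (fun x => (C.σ x : ℂ)) n)) (C.σT θ) := by
  rw [hC.σT_eq]
  exact (hC.summable_phase_cellLp θ).hasSum.mapL (modT θ).toContinuousLinearMap

theorem Regular.coefT_σT (hC : C.Regular) (θ : E3) (k : Z3) :
    coefT (C.σT θ) k = C.ftσ (xi θ k) := hC.cellSummable.coefT_of_hasSum (hC.hasSum_σT θ) k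

end Crystal

/-! ### Fourier multipliers on the torus -/

theorem ext_coefT {f g : L2T} (h : ∀ k, coefT f k = coefT g k) : f = g :=
  coefT.injective (lp.ext (funext h))

theorem memℓp_two_iff {ι : Type} {E : ι → Type} [∀ i, NormedAddCommGroup (E i)] {f : ∀ i, E i} :
    Memℓp f 2 ↔ Summable fun i => ‖f i‖ ^ 2 := by
  rw [memℓp_gen_iff (by norm_num)]
  simp

theorem hasSum_inner_coefT (f g : L2T) :
    HasSum (fun k => inner ℂ (coefT f k) (coefT g k)) (inner ℂ f g) := by
  rw [← coefT.inner_map_map f g]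
  exact lp.hasSum_inner _ _

/-- The bounded operator on `L²(T³)` that multiplies the Fourier coefficients by a bounded
sequence. -/
def diagT (b : Z3 → ℂ) : L2T →L[ℂ] L2T :=
  open Classical in
  if h : ∃ c : ℝ, ∀ k, ‖b k‖ ≤ c then
    LinearMap.mkContinuous
      { toFun := fun f => coefT.symm ⟨fun k => b k * coefT f k,
          ((lp.memℓp (coefT f)).const_smul (h.choose : ℂ)).mono' fun k => by
            rw [norm_mul, Pi.smul_apply, norm_smul, Complex.norm_real]
            exact mul_le_mul_of_nonneg_right ((h.choose_spec k).trans (le_abs_self _))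
              (norm_nonneg _)⟩
        map_add' := fun f g => by
          refine ext_coefT fun k => ?_
          simp [mul_add]
          rfl
        map_smul' := fun c f => by
          refine ext_coefT fun k => ?_
          simp [mul_left_comm] } |h.choose| (fun f => by
      change ‖coefT.symm _‖ ≤ _
      rw [LinearIsometryEquiv.norm_map, ← coefT.norm_map f]
      refine (lp.norm_mono (y := (h.choose : ℂ) • coefT f) (by norm_num) fun k => ?_).trans_eq ?_
      · change ‖b k * coefT f k‖ ≤ ‖(h.choose : ℂ) • coefT f k‖
        rw [norm_mul, norm_smul, Complex.norm_real]
        exact mul_le_mul_of_nonneg_right ((h.choose_spec k).trans (le_abs_self _)) (norm_nonneg _)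
      · rw [norm_smul, Complex.norm_real, Real.norm_eq_abs])
  else 0

theorem coefT_diagT {b : Z3 → ℂ} {c : ℝ} (hb : ∀ k, ‖b k‖ ≤ c) (f : L2T) (k : Z3) :
    coefT (diagT b f) k = b k * coefT f k := by
  rw [diagT, dif_pos ⟨c, hb⟩]
  change coefT (coefT.symm _) k = _
  rw [LinearIsometryEquiv.apply_symm_apply]

theorem norm_le_of_coefT_le {f g : L2T} {c : ℝ} (hc : 0 ≤ c)
    (h : ∀ k, ‖coefT f k‖ ≤ c * ‖coefT g k‖) : ‖f‖ ≤ c * ‖g‖ := by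
  rw [← coefT.norm_map f, ← coefT.norm_map g]
  have h1 : ‖coefT f‖ ≤ ‖(c : ℂ) • coefT g‖ := by
    refine lp.norm_mono (by norm_num) fun k => ?_
    change _ ≤ ‖(c : ℂ) • coefT g k‖
    rw [norm_smul, Complex.norm_real, Real.norm_of_nonneg hc]
    exact h k
  rwa [norm_smul, Complex.norm_real, Real.norm_of_nonneg hc] at h1

theorem norm_diagT_sub_le {b b' : Z3 → ℂ} {c c' d : ℝ} (hb : ∀ k, ‖b k‖ ≤ c)
    (hb' : ∀ k, ‖b' k‖ ≤ c') (h : ∀ k, ‖b k - b' k‖ ≤ d) : ‖diagT b - diagT b'‖ ≤ d := by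
  have hd : 0 ≤ d := (norm_nonneg _).trans (h 0)
  refine ContinuousLinearMap.opNorm_le_bound _ hd fun f => norm_le_of_coefT_le hd fun k => ?_
  rw [sub_apply, map_sub, lp.coeFn_sub, Pi.sub_apply, coefT_diagT hb,
    coefT_diagT hb', ← sub_mul, norm_mul]
  exact mul_le_mul_of_nonneg_right (h k) (norm_nonneg _)

theorem inner_diagT {b : Z3 → ℂ} {c : ℝ} (hb : ∀ k, ‖b k‖ ≤ c)
    (hr : ∀ k, (starRingEnd ℂ) (b k) = b k) (f g : L2T) :
    inner ℂ (diagT b f) g = inner ℂ f (diagT b g) := by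
  refine (hasSum_inner_coefT _ _).unique ?_
  convert hasSum_inner_coefT f (diagT b g) using 2 with k
  rw [coefT_diagT hb, coefT_diagT hb, RCLike.inner_apply, RCLike.inner_apply, map_mul, hr]
  ring

/-- The plane waves `exp(2πi k·y)` on the torus. -/
def waveT (k : Z3) : L2T := coefT.symm (lp.single 2 k (1 : ℂ))

theorem coefT_waveT (k l : Z3) : coefT (waveT k) l = if l = k then 1 else 0 := by
  rw [waveT, LinearIsometryEquiv.apply_symm_apply, lp.single_apply, Pi.single_apply]

theorem inner_waveT (k : Z3) (f : L2T) : inner ℂ (waveT k) f = coefT f k := by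
  refine (hasSum_inner_coefT _ _).unique ?_
  convert hasSum_single (f := fun l => inner ℂ (coefT (waveT k) l) (coefT f l)) k ?_ using 1
  · rw [coefT_waveT, if_pos rfl, RCLike.inner_apply]; simp
  · intro l hl
    rw [coefT_waveT, if_neg hl, inner_zero_left]

/-- Truncations to finitely many modes have finite rank and converge in norm, since the discarded
coefficients are uniformly small. -/
theorem isCompactOperator_diagT {b : Z3 → ℂ} (h : Tendsto b cofinite (𝓝 0)) :
    IsCompactOperator (diagT b) := by
  classical
  obtain ⟨c, hc⟩ : ∃ c : ℝ, ∀ k, ‖b k‖ ≤ c := by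
    have h1 : ∀ᶠ k in cofinite, ‖b k‖ < 1 := by
      have := (tendsto_norm_zero.comp h).eventually (gt_mem_nhds one_pos)
      exact this
    have h2 : Set.Finite {k | ¬ ‖b k‖ < 1} := h1
    refine ⟨1 + ∑ k ∈ h2.toFinset, ‖b k‖, fun k => ?_⟩
    by_cases hk : ‖b k‖ < 1
    · have : 0 ≤ ∑ k ∈ h2.toFinset, ‖b k‖ := Finset.sum_nonneg fun _ _ => norm_nonneg _
      linarith
    · have : ‖b k‖ ≤ ∑ k ∈ h2.toFinset, ‖b k‖ :=
        Finset.single_le_sum (f := fun k => ‖b k‖) (fun _ _ => norm_nonneg _)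
          (h2.mem_toFinset.2 hk)
      linarith
  have hc0 : 0 ≤ c := (norm_nonneg _).trans (hc 0)
  let bs : Finset Z3 → Z3 → ℂ := fun s k => if k ∈ s then b k else 0
  have hbs : ∀ s k, ‖bs s k‖ ≤ c := fun s k => by
    simp only [bs]; split_ifs
    · exact hc k
    · simpa using hc0
  have hcpt : ∀ s, IsCompactOperator (diagT (bs s)) := fun s => by
    have h1 : diagT (bs s) = ∑ k ∈ s, (b k) • ((innerSL ℂ (waveT k)).smulRight (waveT k)) := by
      ext1 f
      refine ext_coefT fun l => ?_
      rw [coefT_diagT (hbs s), sum_apply, map_sum, lp.coeFn_sum,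
        Finset.sum_apply]
      have h2 : ∀ k, coefT ((b k • (innerSL ℂ (waveT k)).smulRight (waveT k)) f) l
          = if l = k then b k * coefT f k else 0 := fun k => by
        rw [smul_apply, ContinuousLinearMap.smulRight_apply, innerSL_apply_apply, inner_waveT,
          map_smul, map_smul, lp.coeFn_smul, lp.coeFn_smul, Pi.smul_apply, Pi.smul_apply,
          coefT_waveT]
        split_ifs <;> simp
      simp only [h2, bs, Finset.sum_ite_eq]
      split_ifs <;> simp
    rw [h1]
    clear h1
    induction s using Finset.induction_on with
    | empty => simpa using isCompactOperator_zero
    | insert k s hk ih =>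
      rw [Finset.sum_insert hk]
      refine IsCompactOperator.add ?_ ih
      exact ((isCompactOperator_of_locallyCompactSpace_dom (innerSL ℂ (waveT k))).clm_comp
        (ContinuousLinearMap.toSpanSingleton ℂ (waveT k))).smul (b k)
  have hlim : Tendsto (fun s => diagT (bs s)) atTop (𝓝 (diagT b)) := by
    rw [Metric.tendsto_atTop]
    intro ε hε
    have h1 : ∀ᶠ k in cofinite, ‖b k‖ < ε / 2 := by
      have := (tendsto_norm_zero.comp h).eventually (gt_mem_nhds (half_pos hε))
      exact this
    have h2 : Set.Finite {k | ¬ ‖b k‖ < ε / 2} := h1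
    refine ⟨h2.toFinset, fun s hs => ?_⟩
    rw [dist_eq_norm]
    refine (norm_diagT_sub_le (hbs s) hc (d := ε / 2) fun k => ?_).trans_lt (half_lt_self hε)
    simp only [bs]
    split_ifs with hk
    · simpa using (half_pos hε).le
    · rw [zero_sub, norm_neg]
      by_contra hk'
      exact hk (hs (h2.mem_toFinset.2 fun h => hk' h.le))
  exact isCompactOperator_of_tendsto hlim (Eventually.of_forall hcpt)

/-- As the domain is maximal, the graph is described by Fourier coefficients alone: an element `g`
of `L²(T³)` with the right coefficients certifies that `f` is in the domain. -/
theorem mem_multT_graph {a : E3 → ℂ} {θ : E3} {f g : L2T} :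
    (f, g) ∈ (multT a θ).graph ↔ ∀ k, coefT g k = a (xi θ k) * coefT f k := by
  rw [LinearPMap.mem_graph_iff]
  constructor
  · rintro ⟨⟨f, hf⟩, rfl, rfl⟩ k
    obtain ⟨h1, h2⟩ := hf
    change coefT (coefT.symm _) k = _
    rw [LinearIsometryEquiv.apply_symm_apply]
    rfl
  · intro h
    have hm : Memℓp (fun k => a (xi θ k) * coefT f k) 2 := by
      have := lp.memℓp (coefT g)
      rwa [show ⇑(coefT g) = fun k => a (xi θ k) * coefT f k from funext h] at this
    have hf : f ∈ (multT a θ).domain := ⟨trivial, hm⟩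
    refine ⟨⟨f, hf⟩, rfl, ?_⟩
    refine ext_coefT fun k => ?_
    change coefT (coefT.symm _) k = _
    rw [LinearIsometryEquiv.apply_symm_apply, h]
    rfl

theorem mem_multT_domain {a : E3 → ℂ} {θ : E3} {f : L2T} :
    f ∈ (multT a θ).domain ↔ ∃ g, ∀ k, coefT g k = a (xi θ k) * coefT f k := by
  simp only [← mem_multT_graph]
  exact LinearPMap.mem_domain_iff

theorem multT_apply {a : E3 → ℂ} {θ : E3} {f g : L2T}
    (h : ∀ k, coefT g k = a (xi θ k) * coefT f k) (hf : f ∈ (multT a θ).domain) :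
    multT a θ ⟨f, hf⟩ = g :=
  ((LinearPMap.image_iff hf).2 (mem_multT_graph.2 h)).symm

theorem multT_ap {a : E3 → ℂ} {θ : E3} {f g : L2T}
    (h : ∀ k, coefT g k = a (xi θ k) * coefT f k) : (multT a θ).ap f = g := by
  have hf : f ∈ (multT a θ).domain := mem_multT_domain.2 ⟨g, h⟩
  rw [LinearPMap.ap_of_mem _ hf, multT_apply h]

/-! ### Operators on four-component vectors and the inverse of `iJ` -/

namespace Quad

variable {H Q : Type} [NormedAddCommGroup H] [InnerProductSpace ℂ H] [NormedAddCommGroup Q]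
  [InnerProductSpace ℂ Q]

theorem inner_eq (X Y : Quad H Q) : inner ℂ X Y =
    inner ℂ X.psi1 Y.psi1 + inner ℂ X.psi2 Y.psi2 + (inner ℂ X.q Y.q + inner ℂ X.p Y.p) := by
  rw [WithLp.prod_inner_apply, WithLp.prod_inner_apply, WithLp.prod_inner_apply]
  rfl

theorem norm_sq_eq (X : Quad H Q) :
    ‖X‖ ^ 2 = ‖X.psi1‖ ^ 2 + ‖X.psi2‖ ^ 2 + (‖X.q‖ ^ 2 + ‖X.p‖ ^ 2) := by
  rw [WithLp.prod_norm_sq_eq_of_L2, WithLp.prod_norm_sq_eq_of_L2, WithLp.prod_norm_sq_eq_of_L2]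

theorem ext' {X Y : Quad H Q} (h1 : X.psi1 = Y.psi1) (h2 : X.psi2 = Y.psi2) (h3 : X.q = Y.q)
    (h4 : X.p = Y.p) : X = Y := by
  change Quad.mk X.psi1 X.psi2 X.q X.p = Quad.mk Y.psi1 Y.psi2 Y.q Y.p
  rw [h1, h2, h3, h4]

def psi1L : Quad H Q →L[ℂ] H := WithLp.fstL 2 ℂ _ _ ∘L WithLp.fstL 2 ℂ _ _
def psi2L : Quad H Q →L[ℂ] H := WithLp.sndL 2 ℂ _ _ ∘L WithLp.fstL 2 ℂ _ _
def qL : Quad H Q →L[ℂ] Q := WithLp.fstL 2 ℂ _ _ ∘L WithLp.sndL 2 ℂ _ _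
def pL : Quad H Q →L[ℂ] Q := WithLp.sndL 2 ℂ _ _ ∘L WithLp.sndL 2 ℂ _ _

def inl : WithLp 2 (H × H) →L[ℂ] Quad H Q :=
  (WithLp.prodContinuousLinearEquiv 2 ℂ _ _).symm.toContinuousLinearMap ∘L
    ContinuousLinearMap.inl ℂ _ _
def inr : WithLp 2 (Q × Q) →L[ℂ] Quad H Q :=
  (WithLp.prodContinuousLinearEquiv 2 ℂ _ _).symm.toContinuousLinearMap ∘L
    ContinuousLinearMap.inr ℂ _ _
def in1 : H →L[ℂ] Quad H Q :=
  inl ∘L (WithLp.prodContinuousLinearEquiv 2 ℂ H H).symm.toContinuousLinearMap ∘L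
    ContinuousLinearMap.inl ℂ _ _
def in2 : H →L[ℂ] Quad H Q :=
  inl ∘L (WithLp.prodContinuousLinearEquiv 2 ℂ H H).symm.toContinuousLinearMap ∘L
    ContinuousLinearMap.inr ℂ _ _
def in3 : Q →L[ℂ] Quad H Q :=
  inr ∘L (WithLp.prodContinuousLinearEquiv 2 ℂ Q Q).symm.toContinuousLinearMap ∘L
    ContinuousLinearMap.inl ℂ _ _
def in4 : Q →L[ℂ] Quad H Q :=
  inr ∘L (WithLp.prodContinuousLinearEquiv 2 ℂ Q Q).symm.toContinuousLinearMap ∘L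
    ContinuousLinearMap.inr ℂ _ _

theorem mk_eq_sum (a b : H) (c d : Q) : Quad.mk a b c d = in1 a + in2 b + in3 c + in4 d := by
  apply ext'
  · change a = a + 0 + 0 + 0; simp
  · change b = 0 + b + 0 + 0; simp
  · change c = 0 + 0 + c + 0; simp
  · change d = 0 + 0 + 0 + d; simp

variable {X : Type} [NormedAddCommGroup X] [NormedSpace ℂ X]

/-- The operator with given components. -/
def mkL (a b : X →L[ℂ] H) (c d : X →L[ℂ] Q) : X →L[ℂ] Quad H Q :=
  (in1 : H →L[ℂ] Quad H Q) ∘L a + (in2 : H →L[ℂ] Quad H Q) ∘L b +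
    (in3 : Q →L[ℂ] Quad H Q) ∘L c + (in4 : Q →L[ℂ] Quad H Q) ∘L d

theorem mkL_apply (a b : X →L[ℂ] H) (c d : X →L[ℂ] Q) (x : X) :
    mkL a b c d x = Quad.mk (a x) (b x) (c x) (d x) := (mk_eq_sum _ _ _ _).symm

theorem continuousOn_mkL {Z : Type} [TopologicalSpace Z] {s : Set Z} {a b : Z → X →L[ℂ] H}
    {c d : Z → X →L[ℂ] Q} (ha : ContinuousOn a s) (hb : ContinuousOn b s) (hc : ContinuousOn c s)
    (hd : ContinuousOn d s) : ContinuousOn (fun z => mkL (a z) (b z) (c z) (d z)) s :=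
  (((continuousOn_const.clm_comp ha).add (continuousOn_const.clm_comp hb)).add
    (continuousOn_const.clm_comp hc)).add (continuousOn_const.clm_comp hd)

/-- The inverse of the operator `iJ`. -/
def iJinv : Quad H Q →L[ℂ] Quad H Q :=
  mkL ((2 * Complex.I) • psi2L) (-((2 * Complex.I) • psi1L)) (Complex.I • pL) (-(Complex.I • qL))

theorem iJinv_apply (Y : Quad H Q) : iJinv Y = Quad.mk ((2 * Complex.I) • Y.psi2)
    (-((2 * Complex.I) • Y.psi1)) (Complex.I • Y.p) (-(Complex.I • Y.q)) := mkL_apply _ _ _ _ _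

theorem iJ_iJinv (Y : Quad H Q) :
    (Complex.I • (Quad.J : Quad H Q →ₗ[ℂ] Quad H Q)) (iJinv Y) = Y := by
  have h1 : -(Complex.I * (1 / 2) * (2 * Complex.I)) = 1 := by
    linear_combination -Complex.I_mul_I
  have h2 : -(Complex.I * Complex.I) = 1 := by rw [Complex.I_mul_I, neg_neg]
  rw [iJinv_apply]
  apply ext'
  · change Complex.I • (1 / 2 : ℂ) • (-((2 * Complex.I) • Y.psi1)) = Y.psi1
    rw [smul_neg, smul_neg, smul_smul, smul_smul, ← neg_smul, h1, one_smul]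
  · change Complex.I • -((1 / 2 : ℂ) • ((2 * Complex.I) • Y.psi2)) = Y.psi2
    rw [smul_neg, smul_smul, smul_smul, ← neg_smul, h1, one_smul]
  · change Complex.I • -(Complex.I • Y.q) = Y.q
    rw [smul_neg, smul_smul, ← neg_smul, h2, one_smul]
  · change Complex.I • -(Complex.I • Y.p) = Y.p
    rw [smul_neg, smul_smul, ← neg_smul, h2, one_smul]

theorem iJinv_iJ (Y : Quad H Q) :
    iJinv ((Complex.I • (Quad.J : Quad H Q →ₗ[ℂ] Quad H Q)) Y) = Y := by
  have h1 : -(2 * Complex.I * (Complex.I * (1 / 2))) = 1 := by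
    linear_combination -Complex.I_mul_I
  have h2 : -(Complex.I * Complex.I) = 1 := by rw [Complex.I_mul_I, neg_neg]
  rw [iJinv_apply]
  apply ext'
  · change (2 * Complex.I) • Complex.I • -((1 / 2 : ℂ) • Y.psi1) = Y.psi1
    rw [smul_neg, smul_neg, smul_smul, smul_smul, ← neg_smul, mul_assoc, mul_assoc, ← mul_assoc,
      h1, one_smul]
  · change -((2 * Complex.I) • Complex.I • (1 / 2 : ℂ) • Y.psi2) = Y.psi2
    rw [smul_smul, smul_smul, ← neg_smul, mul_assoc, mul_assoc, ← mul_assoc, h1, one_smul]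
  · change Complex.I • Complex.I • -Y.q = Y.q
    rw [smul_neg, smul_neg, smul_smul, ← neg_smul, h2, one_smul]
  · change -(Complex.I • Complex.I • Y.p) = Y.p
    rw [smul_smul, ← neg_smul, h2, one_smul]

theorem isSelfAdjoint_iJinv [CompleteSpace H] [CompleteSpace Q] :
    IsSelfAdjoint (iJinv : Quad H Q →L[ℂ] Quad H Q) := by
  rw [ContinuousLinearMap.isSelfAdjoint_iff_isSymmetric]
  intro X Y
  change inner ℂ (iJinv X) Y = inner ℂ X (iJinv Y)
  rw [iJinv_apply, iJinv_apply, inner_eq, inner_eq]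
  change inner ℂ ((2 * Complex.I) • X.psi2) Y.psi1 + inner ℂ (-((2 * Complex.I) • X.psi1)) Y.psi2
    + (inner ℂ (Complex.I • X.p) Y.q + inner ℂ (-(Complex.I • X.q)) Y.p) =
    inner ℂ X.psi1 ((2 * Complex.I) • Y.psi2) + inner ℂ X.psi2 (-((2 * Complex.I) • Y.psi1))
    + (inner ℂ X.q (Complex.I • Y.p) + inner ℂ X.p (-(Complex.I • Y.q)))
  simp only [inner_neg_left, inner_neg_right, inner_smul_left, inner_smul_right, map_mul,
    Complex.conj_I, map_ofNat]
  ring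

end Quad

/-! ### Symbols away from the dual lattice -/

theorem isClosed_dualLattice : IsClosed dualLattice := by
  have h : dualLattice = ⋂ j : Fin 3, (fun θ : E3 => θ j / (2 * Real.pi)) ⁻¹'
      (range ((↑) : ℤ → ℝ)) := by
    have hp : 2 * Real.pi ≠ 0 := by positivity
    ext θ
    simp only [dualLattice, mem_range, mem_iInter, mem_preimage]
    constructor
    · rintro ⟨m, rfl⟩ j
      refine ⟨m j, ?_⟩
      simp [latticePt]
    · intro h
      choose m hm using h
      refine ⟨m, ?_⟩
      ext j
      simp only [latticePt, PiLp.smul_apply, smul_eq_mul, hm]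
      field_simp
  rw [h]
  exact isClosed_iInter fun j => Int.isClosedEmbedding_coe_real.isClosed_range.preimage
    (by fun_prop)

theorem xi_mem_sphere {θ : E3} {δ : ℝ} (h : Metric.ball θ δ ⊆ dualLatticeᶜ) (k : Z3) :
    δ ≤ ‖xi θ k‖ := by
  by_contra hk
  refine h (a := (2 * Real.pi) • latticePt k) ?_ ⟨k, rfl⟩
  rw [Metric.mem_ball, dist_comm, dist_eq_norm]
  exact not_le.1 hk

/-- Near a point off the dual lattice the vectors `θ - 2πk` are bounded away from `0`. -/
theorem exists_le_norm_xi {θ : E3} (hθ : θ ∉ dualLattice) :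
    ∃ δ > 0, ∀ θ' ∈ Metric.ball θ δ, ∀ k, δ ≤ ‖xi θ' k‖ := by
  obtain ⟨ε, hε, h⟩ := Metric.isOpen_iff.1 isClosed_dualLattice.isOpen_compl θ hθ
  refine ⟨ε / 2, half_pos hε, fun θ' hθ' => xi_mem_sphere ?_⟩
  refine subset_trans ?_ h
  intro x hx
  rw [Metric.mem_ball] at *
  linarith [dist_triangle x θ' θ]

theorem norm_xi_pos {θ : E3} (hθ : θ ∉ dualLattice) (k : Z3) : 0 < ‖xi θ k‖ := by
  obtain ⟨δ, hδ, h⟩ := exists_le_norm_xi hθ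
  exact hδ.trans_le (h θ (Metric.mem_ball_self hδ) k)

/-- The inverse weights are summable, so they tend to zero along the lattice. -/
theorem tendsto_norm_latticePt : Tendsto (fun n : Z3 => ‖latticePt n‖) cofinite atTop := by
  rw [tendsto_atTop]
  intro c
  have h1 := summable_inv_weight.tendsto_cofinite_zero
  have h2 : (0 : ℝ) < ((1 + c ^ 2) ^ 2)⁻¹ := by positivity
  filter_upwards [h1.eventually (gt_mem_nhds h2)] with n hn
  by_contra hc
  rw [not_le] at hc
  have h3 := norm_nonneg (latticePt n)
  have h4 : weight (latticePt n) ≤ (1 + c ^ 2) ^ 2 := by unfold weight; gcongr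
  exact absurd hn (not_lt.2 (inv_anti₀ (weight_pos _) h4))

theorem tendsto_norm_xi (θ : E3) : Tendsto (fun k : Z3 => ‖xi θ k‖) cofinite atTop := by
  refine tendsto_atTop_mono (f := fun k => ‖latticePt k‖ - ‖θ‖) (fun k => ?_)
    (tendsto_atTop_add_const_right _ _ tendsto_norm_latticePt)
  have h1 : ‖(2 * Real.pi) • latticePt k‖ - ‖θ‖ ≤ ‖xi θ k‖ := by
    rw [xi, norm_sub_rev]; exact norm_sub_norm_le _ _
  rw [norm_smul, Real.norm_of_nonneg (by positivity)] at h1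
  nlinarith [norm_nonneg (latticePt k), Real.pi_gt_three]

theorem xi_sub_xi (θ θ' : E3) (k : Z3) : xi θ k - xi θ' k = θ - θ' := by
  rw [xi, xi, sub_sub_sub_cancel_right]

/-- A symbol that is bounded and Lipschitz away from the origin. -/
def AdmissibleSymbol (a : E3 → ℂ) : Prop := ∀ δ > 0, ∃ c l : ℝ,
  (∀ ξ, δ ≤ ‖ξ‖ → ‖a ξ‖ ≤ c) ∧ ∀ ξ η, δ ≤ ‖ξ‖ → δ ≤ ‖η‖ → ‖a ξ - a η‖ ≤ l * ‖ξ - η‖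

/-- The bounded operator `a(i∇ + θ)` on `L²(T³)`. -/
def bddT (a : E3 → ℂ) (θ : E3) : L2T →L[ℂ] L2T := diagT fun k => a (xi θ k)

namespace AdmissibleSymbol

variable {a : E3 → ℂ} (ha : AdmissibleSymbol a) {θ : E3} (hθ : θ ∉ dualLattice)
include ha

/-- A change of `θ` moves all the momenta `θ - 2πk` by the same vector. The Lipschitz bound of the
symbol is therefore uniform in `k` and bounds the operator norm. -/
theorem continuousOn : ContinuousOn (bddT a) dualLatticeᶜ := by
  intro θ hθ
  obtain ⟨δ, hδ, h⟩ := exists_le_norm_xi hθ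
  obtain ⟨c, l, hc, hl⟩ := ha δ hδ
  refine ContinuousAt.continuousWithinAt ?_
  rw [ContinuousAt, tendsto_iff_norm_sub_tendsto_zero]
  refine squeeze_zero' (Eventually.of_forall fun _ => norm_nonneg _) ?_
    (g := fun θ' => l * ‖θ' - θ‖) ?_
  · filter_upwards [Metric.ball_mem_nhds θ hδ] with θ' hθ'
    refine norm_diagT_sub_le (fun k => hc _ (h θ' hθ' k))
      (fun k => hc _ (h θ (Metric.mem_ball_self hδ) k)) fun k => ?_
    rw [← xi_sub_xi θ' θ k]
    exact hl _ _ (h θ' hθ' k) (h θ (Metric.mem_ball_self hδ) k)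
  · have : ContinuousAt (fun θ' : E3 => l * ‖θ' - θ‖) θ := by fun_prop
    simpa [ContinuousAt] using this

include hθ

theorem exists_bound : ∃ c, ∀ k, ‖a (xi θ k)‖ ≤ c := by
  obtain ⟨δ, hδ, h⟩ := exists_le_norm_xi hθ
  obtain ⟨c, l, hc, hl⟩ := ha δ hδ
  exact ⟨c, fun k => hc _ (h θ (Metric.mem_ball_self hδ) k)⟩

theorem coefT (f : L2T) (k : Z3) : coefT (bddT a θ f) k = a (xi θ k) * coefT f k := by
  obtain ⟨c, hc⟩ := ha.exists_bound hθ
  exact coefT_diagT hc f k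

end AdmissibleSymbol

theorem inner_bddT {a : E3 → ℂ} (ha : AdmissibleSymbol a) {θ : E3} (hθ : θ ∉ dualLattice)
    (hr : ∀ ξ, (starRingEnd ℂ) (a ξ) = a ξ) (f g : L2T) :
    inner ℂ (bddT a θ f) g = inner ℂ f (bddT a θ g) := by
  obtain ⟨c, hc⟩ := ha.exists_bound hθ
  exact inner_diagT hc (fun k => hr _) f g

/-- Symbol of `|i∇|⁻¹`. -/
def symInv (ξ : E3) : ℂ := ((‖ξ‖⁻¹ : ℝ) : ℂ)
/-- Symbol of the Riesz transform `|i∇|⁻¹ ∂ⱼ`. -/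
def symRiesz (j : Fin 3) (ξ : E3) : ℂ := -Complex.I * ((ξ j / ‖ξ‖ : ℝ) : ℂ)

/-- Only one of the two inverse norms is estimated by `δ⁻¹`. The factor `‖η‖⁻¹` is kept so that it
can absorb the unbounded coordinate `η j` in the estimate for the Riesz symbol. -/
theorem abs_inv_norm_sub_le {δ : ℝ} (hδ : 0 < δ) {ξ η : E3} (hξ : δ ≤ ‖ξ‖) (hη : δ ≤ ‖η‖) :
    |‖ξ‖⁻¹ - ‖η‖⁻¹| ≤ ‖ξ - η‖ * (δ⁻¹ * ‖η‖⁻¹) := by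
  have h1 : 0 < ‖ξ‖ := hδ.trans_le hξ
  have h2 : 0 < ‖η‖ := hδ.trans_le hη
  have h3 : ‖ξ‖⁻¹ - ‖η‖⁻¹ = (‖η‖ - ‖ξ‖) * (‖ξ‖⁻¹ * ‖η‖⁻¹) := by field_simp
  rw [h3, abs_mul, abs_of_nonneg (by positivity : 0 ≤ ‖ξ‖⁻¹ * ‖η‖⁻¹)]
  have h4 : |‖η‖ - ‖ξ‖| ≤ ‖ξ - η‖ := by rw [norm_sub_rev]; exact abs_norm_sub_norm_le _ _
  gcongr

theorem admissible_symInv : AdmissibleSymbol symInv := by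
  intro δ hδ
  refine ⟨δ⁻¹, δ⁻¹ * δ⁻¹, fun ξ hξ => ?_, fun ξ η hξ hη => ?_⟩
  · rw [symInv, Complex.norm_real, Real.norm_of_nonneg (by positivity)]
    exact inv_anti₀ hδ hξ
  · rw [symInv, symInv, ← Complex.ofReal_sub, Complex.norm_real, Real.norm_eq_abs, mul_comm]
    refine (abs_inv_norm_sub_le hδ hξ hη).trans ?_
    gcongr

theorem admissible_symRiesz (j : Fin 3) : AdmissibleSymbol (symRiesz j) := by
  intro δ hδ
  refine ⟨1, 2 * δ⁻¹, fun ξ hξ => ?_, fun ξ η hξ hη => ?_⟩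
  · rw [symRiesz, norm_mul, norm_neg, Complex.norm_I, one_mul, Complex.norm_real, norm_div, norm_norm]
    exact div_le_one_of_le₀ (PiLp.norm_apply_le ξ j) (norm_nonneg _)
  · rw [symRiesz, symRiesz, ← mul_sub, norm_mul, norm_neg, Complex.norm_I, one_mul,
      ← Complex.ofReal_sub, Complex.norm_real, Real.norm_eq_abs]
    have h0 : 0 < ‖η‖ := hδ.trans_le hη
    have h1 : ξ j / ‖ξ‖ - η j / ‖η‖ = (ξ - η) j * ‖ξ‖⁻¹ + η j * (‖ξ‖⁻¹ - ‖η‖⁻¹) := by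
      rw [PiLp.sub_apply]; ring
    have h2 : |(ξ - η) j| ≤ ‖ξ - η‖ := PiLp.norm_apply_le (ξ - η) j
    have h3 : |η j| ≤ ‖η‖ := PiLp.norm_apply_le η j
    have h4 := abs_inv_norm_sub_le hδ hξ hη
    have h5 : ‖ξ‖⁻¹ ≤ δ⁻¹ := inv_anti₀ hδ hξ
    rw [h1]
    refine (abs_add_le _ _).trans ?_
    rw [abs_mul, abs_mul, abs_of_nonneg (by positivity : 0 ≤ ‖ξ‖⁻¹)]
    calc |(ξ - η) j| * ‖ξ‖⁻¹ + |η j| * |‖ξ‖⁻¹ - ‖η‖⁻¹|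
        ≤ ‖ξ - η‖ * δ⁻¹ + ‖η‖ * (‖ξ - η‖ * (δ⁻¹ * ‖η‖⁻¹)) := by gcongr
      _ = 2 * δ⁻¹ * ‖ξ - η‖ := by field_simp; ring

theorem symRiesz_mul_symInv (j : Fin 3) (ξ : E3) : symInv ξ * symRiesz j ξ = symGD j ξ := by
  rw [symInv, symRiesz, symGD]; push_cast; ring

theorem isCompactOperator_bddT_symInv (θ : E3) : IsCompactOperator (bddT symInv θ) := by
  refine isCompactOperator_diagT ?_
  have h := (tendsto_inv_atTop_zero.comp (tendsto_norm_xi θ))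
  have := (Complex.continuous_ofReal.tendsto 0).comp h
  simpa [symInv, Function.comp_def] using this

/-! ### The dipole operator and the Gram matrix `Σ(θ)` -/

namespace Crystal

variable (C : Crystal)

/-- The `j`-th component of `|i∇ + θ|⁻¹ (∇ - iθ) σ̃(θ,·)`. -/
def dipoleVec (θ : E3) (j : Fin 3) : L2T := bddT (symRiesz j) θ (C.σT θ)

/-- The operator `q ↦ |i∇ + θ|⁻¹ (∇ - iθ) σ̃(θ,·)·q`. -/
def dipole (θ : E3) : C3 →L[ℂ] L2T :=
  ∑ j, (EuclideanSpace.proj j : C3 →L[ℂ] ℂ).smulRight (C.dipoleVec θ j)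

theorem dipole_apply (θ : E3) (q : C3) : C.dipole θ q = ∑ j, q j • C.dipoleVec θ j := by
  rw [dipole, sum_apply]; rfl

theorem adjoint_dipole (θ : E3) (f : L2T) (j : Fin 3) :
    (C.dipole θ).adjoint f j = inner ℂ (C.dipoleVec θ j) f := by
  have h1 : C.dipole θ (EuclideanSpace.single j 1) = C.dipoleVec θ j := by
    rw [dipole_apply, Finset.sum_eq_single j]
    · simp
    · intro i _ hi; simp [hi]
    · simp
  rw [← h1, ← ContinuousLinearMap.adjoint_inner_right, EuclideanSpace.inner_single_left]
  simp

variable {C}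

theorem continuousOn_dipoleVec (hC : C.Regular) (j : Fin 3) :
    ContinuousOn (fun θ => C.dipoleVec θ j) dualLatticeᶜ :=
  (admissible_symRiesz j).continuousOn.clm_apply hC.continuous_σT.continuousOn

theorem continuousOn_dipole (hC : C.Regular) : ContinuousOn C.dipole dualLatticeᶜ := by
  unfold dipole
  refine continuousOn_finsetSum _ fun j _ => ?_
  exact ((ContinuousLinearMap.smulRightL ℂ C3 L2T
    (EuclideanSpace.proj j : C3 →L[ℂ] ℂ)).continuous.comp_continuousOn (continuousOn_dipoleVec hC j))

variable {θ : E3}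

theorem coefT_dipoleVec (hC : C.Regular) (hθ : θ ∉ dualLattice) (j : Fin 3) (k : Z3) :
    coefT (C.dipoleVec θ j) k = symRiesz j (xi θ k) * C.ftσ (xi θ k) := by
  rw [dipoleVec, (admissible_symRiesz j).coefT hθ, hC.coefT_σT]

/-- Parseval's identity. The sum defining `Σ` runs over `2πm + θ` while Fourier coefficients live at
`θ - 2πk`, hence the reindexing `m = -k`. -/
theorem inner_dipoleVec (hC : C.Regular) (hθ : θ ∉ dualLattice) (i j : Fin 3) :
    inner ℂ (C.dipoleVec θ i) (C.dipoleVec θ j) = (C.Sig θ i j : ℂ) := by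
  rw [← (hasSum_inner_coefT _ _).tsum_eq, Sig, Matrix.of_apply, Complex.ofReal_tsum,
    eq_comm, ← (Equiv.neg Z3).tsum_eq, eq_comm]
  refine tsum_congr fun k => ?_
  have h1 : (2 * Real.pi) • latticePt (Equiv.neg Z3 k) + θ = xi θ k := by
    have : latticePt (Equiv.neg Z3 k) = -latticePt k := by
      ext j; simp [latticePt]
    rw [this, smul_neg, xi, neg_add_eq_sub]
  rw [coefT_dipoleVec hC hθ, coefT_dipoleVec hC hθ, RCLike.inner_apply, h1]
  have h2 : ((‖C.ftσ (xi θ k)‖ ^ 2 : ℝ) : ℂ) = C.ftσ (xi θ k) * (starRingEnd ℂ) (C.ftσ (xi θ k)) := by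
    rw [Complex.mul_conj, Complex.normSq_eq_norm_sq]
  rw [Complex.ofReal_mul, h2, symRiesz, symRiesz]
  simp only [map_mul, map_neg, Complex.conj_I, Complex.conj_ofReal]
  push_cast
  linear_combination (-(((xi θ k) i : ℂ) * (xi θ k) j / ‖xi θ k‖ ^ 2 * (C.ftσ (xi θ k) *
    (starRingEnd ℂ) (C.ftσ (xi θ k))))) * Complex.I_mul_I

/-- This identity `D*D = Σ` is what completes the square in `B̃(θ)`. -/
theorem adjoint_dipole_dipole (hC : C.Regular) (hθ : θ ∉ dualLattice) (q : C3) :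
    (C.dipole θ).adjoint (C.dipole θ q) = C.Tt θ q := by
  ext i
  rw [adjoint_dipole, dipole_apply, inner_sum, Tt, Matrix.toLpLin_apply]
  simp only [inner_smul_right, inner_dipoleVec hC hθ]
  rw [Matrix.mulVec, dotProduct]
  exact Finset.sum_congr rfl fun j _ => mul_comm _ _

/-- As a Gram matrix of continuous vector fields `Σ` is continuous; its defining series need not be
estimated. -/
theorem continuousOn_Sig (hC : C.Regular) : ContinuousOn C.Sig dualLatticeᶜ := by
  refine continuousOn_pi.2 fun i => continuousOn_pi.2 fun j => ?_
  have h1 : ContinuousOn (fun θ => (inner ℂ (C.dipoleVec θ i) (C.dipoleVec θ j)).re) dualLatticeᶜ :=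
    Complex.continuous_re.comp_continuousOn
      ((continuousOn_dipoleVec hC i).inner (𝕜 := ℂ) (continuousOn_dipoleVec hC j))
  refine h1.congr fun θ hθ => ?_
  change _ = (inner ℂ (C.dipoleVec θ i) (C.dipoleVec θ j)).re
  rw [inner_dipoleVec hC hθ, Complex.ofReal_re]

theorem posSemidef_Sig (hC : C.Regular) (hθ : θ ∉ dualLattice) : (C.Sig θ).PosSemidef := by
  have hsymm : ∀ i j, C.Sig θ i j = C.Sig θ j i := fun i j => by
    simp only [Sig, Matrix.of_apply]
    exact tsum_congr fun m => by ring
  refine Matrix.PosSemidef.of_dotProduct_mulVec_nonneg ?_ fun x => ?_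
  · ext i j; simp [hsymm j i]
  · have h1 : ((x ⬝ᵥ (C.Sig θ).mulVec x : ℝ) : ℂ)
        = inner ℂ (∑ i, (x i : ℂ) • C.dipoleVec θ i) (∑ i, (x i : ℂ) • C.dipoleVec θ i) := by
      simp only [sum_inner, inner_sum, inner_smul_left, inner_smul_right, inner_dipoleVec hC hθ,
        dotProduct, Matrix.mulVec, Finset.mul_sum, Complex.conj_ofReal]
      push_cast
      rw [Finset.sum_comm]
      refine Finset.sum_congr rfl fun i _ => Finset.sum_congr rfl fun j _ => ?_
      rw [hsymm]; ring
    rw [inner_self_eq_norm_sq_to_K] at h1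
    have h2 : x ⬝ᵥ (C.Sig θ).mulVec x = ‖∑ i, (x i : ℂ) • C.dipoleVec θ i‖ ^ 2 := by
      apply Complex.ofReal_injective
      rw [h1]; push_cast; rfl
    simp only [star_trivial]
    rw [h2]; positivity

/-- The set of quasimomenta off the dual lattice at which `Σ` is positive. -/
def posSet (C : Crystal) : Set E3 := {θ | θ ∉ dualLattice ∧ (C.Sig θ).PosDef}

/-- `Σ(θ)` is positive semidefinite, so it is positive definite exactly where its continuous
determinant does not vanish. -/
theorem isOpen_posSet (hC : C.Regular) : IsOpen C.posSet := by
  have h1 : C.posSet = dualLatticeᶜ ∩ (fun θ => (C.Sig θ).det) ⁻¹' {0}ᶜ := by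
    ext θ
    simp only [posSet, mem_ofPred_eq, mem_inter_iff, mem_compl_iff, mem_preimage, mem_singleton_iff]
    exact and_congr_right fun hθ => (posSemidef_Sig hC hθ).posDef_iff_det_ne_zero
  rw [h1]
  refine ContinuousOn.isOpen_inter_preimage ?_ isClosed_dualLattice.isOpen_compl
    isOpen_compl_singleton
  exact (Continuous.matrix_det continuous_id).comp_continuousOn (continuousOn_Sig hC)

theorem isClosed_brillouin : IsClosed brillouin := by
  have h : brillouin = ⋂ j : Fin 3, (fun θ : E3 => θ j) ⁻¹' Icc 0 (2 * Real.pi) := by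
    ext θ; simp [brillouin]
  rw [h]
  exact isClosed_iInter fun j => isClosed_Icc.preimage (by fun_prop)

theorem measurableSet_PiPlus (hC : C.Regular) : MeasurableSet C.PiPlus :=
  isClosed_brillouin.measurableSet.inter (isOpen_posSet hC).measurableSet

/-- `D*D = Σ(θ)` is invertible, so `D` is injective; on the finite-dimensional space `ℂ³` this gives
a lower bound. -/
theorem exists_norm_le_dipole (hC : C.Regular) (hθ : θ ∈ C.posSet) :
    ∃ c : ℝ, 0 ≤ c ∧ ∀ q, ‖q‖ ≤ c * ‖C.dipole θ q‖ := by
  have hk : LinearMap.ker (C.dipole θ : C3 →ₗ[ℂ] L2T) = ⊥ := by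
    rw [LinearMap.ker_eq_bot']
    intro q hq
    have h1 := adjoint_dipole_dipole hC hθ.1 q
    rw [show C.dipole θ q = 0 from hq, map_zero] at h1
    rw [Tt, Matrix.toLpLin_apply, eq_comm] at h1
    have hd : ((C.Sig θ).map Complex.ofReal).det ≠ 0 := by
      have := Complex.ofRealHom.map_det (C.Sig θ)
      rw [RingHom.mapMatrix_apply] at this
      change ((C.Sig θ).map Complex.ofRealHom).det ≠ 0
      rw [← this]
      exact Complex.ofReal_ne_zero.2 hθ.2.det_pos.ne'
    have h2 := Matrix.eq_zero_of_mulVec_eq_zero hd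
      (v := q.ofLp) (by simpa using congrArg WithLp.ofLp h1)
    ext j
    exact congrFun h2 j
  obtain ⟨K, -, hK⟩ := LinearMap.exists_antilipschitzWith (C.dipole θ : C3 →ₗ[ℂ] L2T) hk
  refine ⟨K, K.2, fun q => ?_⟩
  have := hK.le_mul_dist q 0
  simpa using this

/-! ### The bounded factor `N(θ)` of the energy operator -/

variable (C)

/-- The coupling constant `2 e ψ₀`. -/
def coupling : ℝ := 2 * C.e * C.ψ₀

theorem coupling_sq : 4 * C.e ^ 2 * C.ψ₀ ^ 2 = C.coupling ^ 2 := by rw [coupling]; ring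

/-- `|i∇ + θ|⁻¹` on `L²(T³)`, extended by the identity. -/
def scaleT (θ : E3) : X0T →L[ℂ] X0T :=
  Quad.mkL (bddT symInv θ ∘L (Quad.psi1L : X0T →L[ℂ] L2T))
    (bddT symInv θ ∘L (Quad.psi2L : X0T →L[ℂ] L2T)) Quad.qL Quad.pL

/-- The electric field `|i∇ + θ|⁻¹ (κ Ψ₁ + (∇ - iθ) σ̃·q)` of the state whose first two components
are multiplied by `|i∇ + θ|`. -/
def fieldT (θ : E3) : X0T →L[ℂ] L2T :=
  (C.coupling : ℂ) • (bddT symInv θ ∘L bddT symInv θ ∘L (Quad.psi1L : X0T →L[ℂ] L2T)) +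
    C.dipole θ ∘L (Quad.qL : X0T →L[ℂ] C3)

/-- The bounded operator `N(θ)` with `B̃(θ) = A⁻¹ N(θ) A⁻¹`, where `A = scaleT θ`. -/
def innerT (θ : E3) : X0T →L[ℂ] X0T :=
  Quad.mkL Quad.psi1L Quad.psi2L 0 ((C.M⁻¹ : ℂ) • Quad.pL) + (C.fieldT θ).adjoint ∘L C.fieldT θ

/-- The bounded inverse of `B̃(θ)`. -/
def BtInv (θ : E3) : X0T →L[ℂ] X0T := scaleT θ * Ring.inverse (C.innerT θ) * scaleT θ

theorem scaleT_apply (θ : E3) (Y : X0T) : scaleT θ Y =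
    Quad.mk (bddT symInv θ Y.psi1) (bddT symInv θ Y.psi2) Y.q Y.p := Quad.mkL_apply _ _ _ _ _

theorem fieldT_apply (θ : E3) (Y : X0T) : C.fieldT θ Y =
    (C.coupling : ℂ) • bddT symInv θ (bddT symInv θ Y.psi1) + C.dipole θ Y.q := rfl

theorem conj_symInv (ξ : E3) : (starRingEnd ℂ) (symInv ξ) = symInv ξ := Complex.conj_ofReal _

variable {C}

theorem adjoint_fieldT_apply (hθ : θ ∉ dualLattice) (f : L2T) : (C.fieldT θ).adjoint f =
    Quad.mk ((C.coupling : ℂ) • bddT symInv θ (bddT symInv θ f)) 0 ((C.dipole θ).adjoint f) 0 := by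
  have h : C.fieldT θ = (Quad.mkL ((C.coupling : ℂ) • (bddT symInv θ ∘L bddT symInv θ)) 0
      (C.dipole θ).adjoint 0).adjoint := by
    rw [ContinuousLinearMap.eq_adjoint_iff]
    intro X f
    rw [Quad.mkL_apply, Quad.inner_eq, fieldT_apply, inner_add_left, inner_smul_left,
      Complex.conj_ofReal, inner_bddT admissible_symInv hθ conj_symInv,
      inner_bddT admissible_symInv hθ conj_symInv]
    change _ = inner ℂ X.psi1 ((C.coupling : ℂ) • (bddT symInv θ (bddT symInv θ f)))
      + inner ℂ X.psi2 0 + (inner ℂ X.q ((C.dipole θ).adjoint f) + inner ℂ X.p 0)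
    rw [inner_smul_right, inner_zero_right, inner_zero_right, add_zero, add_zero,
      ContinuousLinearMap.adjoint_inner_right]
  rw [h, ContinuousLinearMap.adjoint_adjoint, Quad.mkL_apply]
  rfl

theorem innerT_apply (hθ : θ ∉ dualLattice) (Y : X0T) : C.innerT θ Y =
    Quad.mk (Y.psi1 + (C.coupling : ℂ) • bddT symInv θ (bddT symInv θ (C.fieldT θ Y))) Y.psi2
      ((C.dipole θ).adjoint (C.fieldT θ Y)) ((C.M⁻¹ : ℂ) • Y.p) := by
  rw [innerT, add_apply, ContinuousLinearMap.comp_apply, adjoint_fieldT_apply hθ, Quad.mkL_apply,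
    ← Quad.mk_add, add_zero, add_zero]
  change Quad.mk (Y.psi1 + _) Y.psi2 (0 + _) _ = _
  rw [zero_add]
  rfl

theorem inner_innerT (X Y : X0T) : inner ℂ (C.innerT θ X) Y =
    inner ℂ X.psi1 Y.psi1 + inner ℂ X.psi2 Y.psi2 + (C.M⁻¹ : ℂ) * inner ℂ X.p Y.p
      + inner ℂ (C.fieldT θ X) (C.fieldT θ Y) := by
  rw [innerT, add_apply, inner_add_left, ContinuousLinearMap.comp_apply,
    ContinuousLinearMap.adjoint_inner_left, Quad.mkL_apply, Quad.inner_eq]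
  change inner ℂ X.psi1 Y.psi1 + inner ℂ X.psi2 Y.psi2 + (inner ℂ (0 : C3) Y.q +
    inner ℂ ((C.M⁻¹ : ℂ) • X.p) Y.p) + _ = _
  rw [inner_zero_left, zero_add, inner_smul_left, map_inv₀, Complex.conj_ofReal]

/-- The completed square: the cross terms between `Ψ₁` and `q` are all contained in the field
energy. -/
theorem re_inner_innerT (X : X0T) : (inner ℂ (C.innerT θ X) X).re =
    ‖X.psi1‖ ^ 2 + ‖X.psi2‖ ^ 2 + C.M⁻¹ * ‖X.p‖ ^ 2 + ‖C.fieldT θ X‖ ^ 2 := by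
  have h : inner ℂ (C.innerT θ X) X = ((‖X.psi1‖ ^ 2 + ‖X.psi2‖ ^ 2 + C.M⁻¹ * ‖X.p‖ ^ 2 +
      ‖C.fieldT θ X‖ ^ 2 : ℝ) : ℂ) := by
    rw [inner_innerT, inner_self_eq_norm_sq_to_K, inner_self_eq_norm_sq_to_K,
      inner_self_eq_norm_sq_to_K, inner_self_eq_norm_sq_to_K]
    push_cast; rfl
  rw [h, Complex.ofReal_re]

theorem nonneg_innerT (hM : 0 < C.M) : 0 ≤ C.innerT θ := by
  rw [ContinuousLinearMap.nonneg_iff_isPositive, ContinuousLinearMap.isPositive_def']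
  refine ⟨?_, fun X => ?_⟩
  · rw [ContinuousLinearMap.isSelfAdjoint_iff_isSymmetric]
    intro X Y
    change inner ℂ (C.innerT θ X) Y = inner ℂ X (C.innerT θ Y)
    rw [← inner_conj_symm X, inner_innerT, inner_innerT]
    simp only [map_add, map_mul, inner_conj_symm, map_inv₀, Complex.conj_ofReal]
  · change 0 ≤ (inner ℂ (C.innerT θ X) X).re
    rw [re_inner_innerT]
    positivity

/-- Coercivity. The only component not visibly controlled by the form is `q`; it is recovered from
the field and `Ψ₁` through the lower bound for the dipole operator. -/
theorem isUnit_innerT (hC : C.Regular) (hM : 0 < C.M) (hθ : θ ∈ C.posSet) :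
    IsUnit (C.innerT θ) := by
  obtain ⟨c, hc0, hc⟩ := exists_norm_le_dipole hC hθ
  set b := ‖(C.coupling : ℂ) • (bddT symInv θ ∘L bddT symInv θ)‖ with hb
  have hb0 : 0 ≤ b := norm_nonneg _
  -- The terms account for `Ψ₁, Ψ₂` (1), for `‖p‖² = M·M⁻¹‖p‖²`, and for `‖q‖² ≤ 2c²‖E‖² +
  -- 2c²b²‖Ψ₁‖²`, where `E` is the field.
  set d : ℝ := 1 + C.M + 2 * c ^ 2 + 2 * c ^ 2 * b ^ 2 with hd
  have hd0 : 0 < d := by positivity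
  refine ContinuousLinearMap.isUnit_of_forall_le_norm_inner_map (c := ⟨d⁻¹, by positivity⟩) _
    (by change (0 : ℝ) < d⁻¹; positivity) fun X => ?_
  change ‖X‖ ^ 2 * d⁻¹ ≤ _
  refine le_trans ?_ (RCLike.re_le_norm _)
  change _ ≤ (inner ℂ (C.innerT θ X) X).re
  rw [← div_eq_mul_inv, div_le_iff₀ hd0, re_inner_innerT, Quad.norm_sq_eq]
  have h1 : ‖X.q‖ ≤ c * (‖C.fieldT θ X‖ + b * ‖X.psi1‖) := by
    refine (hc X.q).trans (mul_le_mul_of_nonneg_left ?_ hc0)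
    have h2 : C.dipole θ X.q = C.fieldT θ X -
        ((C.coupling : ℂ) • (bddT symInv θ ∘L bddT symInv θ)) X.psi1 := by
      rw [fieldT_apply]
      exact (add_sub_cancel_left _ _).symm
    rw [h2]
    exact (norm_sub_le _ _).trans (add_le_add_right (ContinuousLinearMap.le_opNorm _ _) _)
  have h3 : ‖X.q‖ ^ 2 ≤ 2 * c ^ 2 * ‖C.fieldT θ X‖ ^ 2 + 2 * c ^ 2 * b ^ 2 * ‖X.psi1‖ ^ 2 := by
    refine (pow_le_pow_left₀ (norm_nonneg _) h1 2).trans ?_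
    nlinarith [sq_nonneg (c * (‖C.fieldT θ X‖ - b * ‖X.psi1‖))]
  have h4 : ‖X.p‖ ^ 2 = C.M * (C.M⁻¹ * ‖X.p‖ ^ 2) := by field_simp
  set P := C.M⁻¹ * ‖X.p‖ ^ 2
  have hP : 0 ≤ P := by positivity
  have e1 := sq_nonneg ‖X.psi1‖
  have e2 := sq_nonneg ‖X.psi2‖
  have e3 := sq_nonneg ‖C.fieldT θ X‖
  have e5 : 0 ≤ c ^ 2 := sq_nonneg c
  have e6 : 0 ≤ c ^ 2 * b ^ 2 := by positivity
  rw [h4]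
  nlinarith [mul_nonneg hM.le e1, mul_nonneg hM.le e2, mul_nonneg hM.le e3, mul_nonneg e5 e1,
    mul_nonneg e5 e2, mul_nonneg e5 e3, mul_nonneg e6 e1, mul_nonneg e6 e2, mul_nonneg e6 e3,
    mul_nonneg e5 hP, mul_nonneg e6 hP, mul_nonneg hM.le hP]

end Crystal

/-! ### Square roots of bounded nonnegative operators -/

section SquareRoot

variable {H : Type} [NormedAddCommGroup H] [InnerProductSpace ℂ H] [CompleteSpace H]

/-- The square root of a bounded nonnegative operator. -/
def opSqrt (R : H →L[ℂ] H) : H →L[ℂ] H := CFC.sqrt R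

theorem isSelfAdjoint_opSqrt (R : H →L[ℂ] H) : IsSelfAdjoint (opSqrt R) :=
  ((ContinuousLinearMap.nonneg_iff_isPositive _).1 (CFC.sqrt_nonneg R)).isSelfAdjoint

theorem opSqrt_mul_self {R : H →L[ℂ] H} (h : 0 ≤ R) : opSqrt R * opSqrt R = R :=
  CFC.sqrt_mul_sqrt_self R h

theorem opSqrt_opSqrt {R : H →L[ℂ] H} (h : 0 ≤ R) (x : H) : opSqrt R (opSqrt R x) = R x := by
  conv_rhs => rw [← opSqrt_mul_self h]
  rfl

theorem IsPosSqrt.hasInverse_opSqrt {B L : H →ₗ.[ℂ] H} {R : H →L[ℂ] H} (hL : IsPosSqrt B L)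
    (h : B.HasInverse R) : L.HasInverse (opSqrt R) := hL.hasInverse h

theorem isCompactOperator_opSqrt {R : H →L[ℂ] H} (hR : 0 ≤ R) (hc : IsCompactOperator R) :
    IsCompactOperator (opSqrt R) := isCompactOperator_sqrt hR hc

theorem ContinuousOn.opSqrt {X : Type} [TopologicalSpace X] {s : Set X} {R : X → H →L[ℂ] H}
    (h : ContinuousOn R s) (h0 : ∀ θ ∈ s, 0 ≤ R θ) : ContinuousOn (fun θ => opSqrt (R θ)) s :=
  CFC.continuousOn_sqrt.comp h h0

theorem IsSelfAdjoint.mul_mul_self {S T : H →L[ℂ] H} (hS : IsSelfAdjoint S)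
    (hT : IsSelfAdjoint T) : IsSelfAdjoint (S * T * S) := by
  have := hT.conjugate S
  rwa [hS.star_eq] at this

theorem IsCompactOperator.mul_right {S : H →L[ℂ] H} (hS : IsCompactOperator S)
    (T : H →L[ℂ] H) : IsCompactOperator (T * S : H →L[ℂ] H) :=
  IsCompactOperator.clm_comp (f := S) hS T

theorem ContinuousOn.mul_mul_self {X : Type} [TopologicalSpace X] {s : Set X}
    {S : X → H →L[ℂ] H} (h : ContinuousOn S s) (T : H →L[ℂ] H) :
    ContinuousOn (fun θ => S θ * T * S θ) s := (h.mul continuousOn_const).mul h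

end SquareRoot

/-! ### Factorisation and inversion of `B̃(θ)`; the operators `Λ̃(θ)` and `K̃(θ)` -/

namespace Crystal

variable (C : Crystal)

/-- The electric field `κ |i∇ + θ|⁻¹ Ψ₁ + |i∇ + θ|⁻¹ (∇ - iθ) σ̃·q`. -/
def electric (θ : E3) (Y : X0T) : L2T :=
  (C.coupling : ℂ) • bddT symInv θ Y.psi1 + C.dipole θ Y.q

variable {C} {θ : E3}

theorem fieldT_eq_electric (u : X0T) : C.fieldT θ u = C.electric θ (scaleT θ u) := by
  rw [scaleT_apply]; rfl

theorem coefT_bddT_symInv (hθ : θ ∉ dualLattice) (f : L2T) (k : Z3) :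
    coefT (bddT symInv θ f) k = ((‖xi θ k‖⁻¹ : ℝ) : ℂ) * coefT f k :=
  admissible_symInv.coefT hθ f k

theorem coefT_add (f g : L2T) (k : Z3) : coefT (f + g) k = coefT f k + coefT g k := by
  rw [map_add]; rfl

theorem coefT_smul (c : ℂ) (f : L2T) (k : Z3) : coefT (c • f) k = c * coefT f k := by
  rw [map_smul]; rfl

theorem coefT_symG (hθ : θ ∉ dualLattice) (f : L2T) (k : Z3) :
    coefT (bddT symInv θ (bddT symInv θ f)) k = symG (xi θ k) * coefT f k := by
  rw [coefT_bddT_symInv hθ, coefT_bddT_symInv hθ, ← mul_assoc, ← Complex.ofReal_mul, symG]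
  congr 2
  rw [sq, mul_inv]

theorem Stker_eq (hC : C.Regular) (hθ : θ ∉ dualLattice) (j : Fin 3) :
    C.Stker θ j = ((C.e * C.ψ₀ : ℝ) : ℂ) • bddT symInv θ (C.dipoleVec θ j) := by
  rw [Stker]
  congr 1
  refine multT_ap fun k => ?_
  rw [coefT_bddT_symInv hθ, coefT_dipoleVec hC hθ, hC.coefT_σT, ← mul_assoc]
  congr 1
  exact symRiesz_mul_symInv j _

theorem two_smul_St (hC : C.Regular) (hθ : θ ∉ dualLattice) (q : C3) :
    (2 : ℂ) • C.St θ q = (C.coupling : ℂ) • bddT symInv θ (C.dipole θ q) := by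
  change (2 : ℂ) • ∑ j, q j • C.Stker θ j = _
  rw [dipole_apply, map_sum, Finset.smul_sum, Finset.smul_sum]
  refine Finset.sum_congr rfl fun j _ => ?_
  rw [Stker_eq hC hθ, map_smul, smul_smul, smul_smul, smul_smul, coupling]
  congr 1; push_cast; ring

theorem two_smul_Ststar (hC : C.Regular) (hθ : θ ∉ dualLattice) (f : L2T) :
    (2 : ℂ) • C.Ststar θ f = (C.coupling : ℂ) • (C.dipole θ).adjoint (bddT symInv θ f) := by
  ext j
  change 2 * inner ℂ (C.Stker θ j) f = C.coupling * (C.dipole θ).adjoint (bddT symInv θ f) j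
  rw [adjoint_dipole, Stker_eq hC hθ, inner_smul_left, inner_bddT admissible_symInv hθ conj_symInv,
    Complex.conj_ofReal, coupling]
  push_cast; ring

/-- With `E` the electric field, the terms `4e²ψ₀²G̃ + 2S̃` collect to `κ|i∇+θ|⁻¹E`, and `2S̃* + Σ`
to `D*E`. -/
theorem Bt_apply (hC : C.Regular) (hθ : θ ∉ dualLattice) (Y : (C.Bt θ).domain) :
    C.Bt θ Y = Quad.mk ((2 : ℂ) • multT symH θ ⟨Y.1.psi1, Y.2.1.1⟩
        + (C.coupling : ℂ) • bddT symInv θ (C.electric θ Y.1))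
      ((2 : ℂ) • multT symH θ ⟨Y.1.psi2, Y.2.2⟩)
      ((C.dipole θ).adjoint (C.electric θ Y.1)) ((C.M⁻¹ : ℂ) • Y.1.p) := by
  have h1 : multT symG θ ⟨Y.1.psi1, Y.2.1.2⟩ = bddT symInv θ (bddT symInv θ Y.1.psi1) :=
    multT_apply (coefT_symG hθ _) _
  apply Quad.ext'
  · change (2 : ℂ) • multT symH θ ⟨Y.1.psi1, Y.2.1.1⟩ +
      ((4 * C.e ^ 2 * C.ψ₀ ^ 2 : ℝ) : ℂ) • multT symG θ ⟨Y.1.psi1, Y.2.1.2⟩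
      + (2 : ℂ) • C.St θ Y.1.q = (2 : ℂ) • multT symH θ ⟨Y.1.psi1, Y.2.1.1⟩
        + (C.coupling : ℂ) • bddT symInv θ (C.electric θ Y.1)
    rw [h1, two_smul_St hC hθ, add_assoc, electric, map_add, map_smul, smul_add, smul_smul,
      coupling_sq, sq, Complex.ofReal_mul]
  · rfl
  · change (2 : ℂ) • C.Ststar θ Y.1.psi1 + C.Tt θ Y.1.q = (C.dipole θ).adjoint (C.electric θ Y.1)
    rw [two_smul_Ststar hC hθ, ← adjoint_dipole_dipole hC hθ, electric, map_add, map_smul]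
  · change ((C.M⁻¹ : ℝ) : ℂ) • Y.1.p = (C.M⁻¹ : ℂ) • Y.1.p
    rw [Complex.ofReal_inv]

theorem two_mul_symH (ξ : E3) : 2 * symH ξ = ((‖ξ‖ ^ 2 : ℝ) : ℂ) := by
  rw [symH]; push_cast; ring

theorem mem_Bt_graph (hC : C.Regular) (hθ : θ ∉ dualLattice) {x y : X0T} :
    (x, y) ∈ (C.Bt θ).graph ↔
      (∀ k, coefT y.psi1 k = ((‖xi θ k‖ ^ 2 : ℝ) : ℂ) * coefT x.psi1 k +
        C.coupling * (((‖xi θ k‖⁻¹ : ℝ) : ℂ) * coefT (C.electric θ x) k)) ∧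
      (∀ k, coefT y.psi2 k = ((‖xi θ k‖ ^ 2 : ℝ) : ℂ) * coefT x.psi2 k) ∧
      y.q = (C.dipole θ).adjoint (C.electric θ x) ∧ y.p = (C.M⁻¹ : ℂ) • x.p := by
  rw [LinearPMap.mem_graph_iff]
  have hmul : ∀ (f : L2T) (hf : f ∈ (multT symH θ).domain) (k : Z3),
      coefT ((2 : ℂ) • multT symH θ ⟨f, hf⟩) k = ((‖xi θ k‖ ^ 2 : ℝ) : ℂ) * coefT f k := by
    intro f hf k
    rw [coefT_smul, mem_multT_graph.1 ((multT symH θ).mem_graph ⟨f, hf⟩), ← mul_assoc,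
      two_mul_symH]
  constructor
  · rintro ⟨Y, rfl, rfl⟩
    rw [Bt_apply hC hθ]
    refine ⟨fun k => ?_, fun k => hmul _ _ k, rfl, rfl⟩
    rw [← hmul _ Y.2.1.1, ← coefT_bddT_symInv hθ, ← coefT_smul, ← coefT_add]
    rfl
  · rintro ⟨h1, h2, h3, h4⟩
    -- The kinetic term is what remains of the first component of `y` after the bounded field term
    -- is removed, so the relation itself puts `Ψ₁` in the domain of `H̃⁰(θ)`.
    have d1 : x.psi1 ∈ (multT symH θ).domain := by
      refine mem_multT_domain.2
        ⟨(1 / 2 : ℂ) • (y.psi1 - (C.coupling : ℂ) • bddT symInv θ (C.electric θ x)), fun k => ?_⟩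
      rw [sub_eq_add_neg, ← neg_smul, coefT_smul, coefT_add, coefT_smul, h1, coefT_bddT_symInv hθ,
        ← two_mul_symH]
      ring
    have d2 : x.psi2 ∈ (multT symH θ).domain := by
      refine mem_multT_domain.2 ⟨(1 / 2 : ℂ) • y.psi2, fun k => ?_⟩
      rw [coefT_smul, h2, ← two_mul_symH]
      ring
    refine ⟨⟨x, ⟨d1, mem_multT_domain.2 ⟨_, coefT_symG hθ _⟩⟩, d2⟩, rfl, ?_⟩
    rw [Bt_apply hC hθ]
    refine Quad.ext' (ext_coefT fun k => ?_) (ext_coefT fun k => ?_) h3.symm h4.symm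
    · rw [h1, ← hmul _ d1, ← coefT_bddT_symInv hθ, ← coefT_smul, ← coefT_add]
      rfl
    · rw [h2, ← hmul _ d2]
      rfl

/-- The factorisation `B̃ = A⁻¹NA⁻¹` in a form without unbounded operators: `u` plays the role of
`A⁻¹x`. -/
theorem mem_Bt_graph_iff_exists (hC : C.Regular) (hθ : θ ∉ dualLattice) {x y : X0T} :
    (x, y) ∈ (C.Bt θ).graph ↔ ∃ u, scaleT θ u = x ∧ C.innerT θ u = scaleT θ y := by
  have hn : ∀ k, ((‖xi θ k‖ : ℝ) : ℂ) ≠ 0 := fun k => by exact_mod_cast (norm_xi_pos hθ k).ne'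
  rw [mem_Bt_graph hC hθ]
  constructor
  · rintro ⟨h1, h2, h3, h4⟩
    -- By the equation `|ξ|²x₁ = y₁ - κ|ξ|⁻¹E`, the vector `|ξ|x₁` equals `|ξ|⁻¹(y₁ - κ|ξ|⁻¹E)`; so
    -- it is square integrable, and similarly `|ξ|x₂ = |ξ|⁻¹y₂`.
    let u : X0T := Quad.mk (bddT symInv θ (y.psi1 - (C.coupling : ℂ) •
      bddT symInv θ (C.electric θ x))) (bddT symInv θ y.psi2) x.q x.p
    have hu : scaleT θ u = x := by
      rw [scaleT_apply]
      refine Quad.ext' (ext_coefT fun k => ?_) (ext_coefT fun k => ?_) rfl rfl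
      · change coefT (bddT symInv θ (bddT symInv θ (y.psi1 - (C.coupling : ℂ) •
          bddT symInv θ (C.electric θ x)))) k = _
        rw [sub_eq_add_neg, ← neg_smul, coefT_bddT_symInv hθ, coefT_bddT_symInv hθ, coefT_add,
          coefT_smul, h1, coefT_bddT_symInv hθ]
        push_cast
        have := hn k
        field_simp
        ring
      · change coefT (bddT symInv θ (bddT symInv θ y.psi2)) k = _
        rw [coefT_bddT_symInv hθ, coefT_bddT_symInv hθ, h2]
        push_cast
        have := hn k
        field_simp
    refine ⟨u, hu, ?_⟩
    rw [innerT_apply hθ, fieldT_eq_electric, hu, scaleT_apply, ← h3, ]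
    refine Quad.ext' ?_ rfl rfl h4.symm
    change bddT symInv θ (y.psi1 - (C.coupling : ℂ) • bddT symInv θ (C.electric θ x)) +
      (C.coupling : ℂ) • bddT symInv θ (bddT symInv θ (C.electric θ x)) = bddT symInv θ y.psi1
    rw [map_sub, map_smul, sub_add_cancel]
  · rintro ⟨u, rfl, hu⟩
    rw [innerT_apply hθ, fieldT_eq_electric, scaleT_apply θ y] at hu
    have e1 : u.psi1 + (C.coupling : ℂ) • bddT symInv θ (bddT symInv θ
      (C.electric θ (scaleT θ u))) = bddT symInv θ y.psi1 := congrArg Quad.psi1 hu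
    have e2 : u.psi2 = bddT symInv θ y.psi2 := congrArg Quad.psi2 hu
    have e3 : (C.dipole θ).adjoint (C.electric θ (scaleT θ u)) = y.q := congrArg Quad.q hu
    have e4 : (C.M⁻¹ : ℂ) • u.p = y.p := congrArg Quad.p hu
    rw [scaleT_apply] at e1 e3 ⊢
    refine ⟨fun k => ?_, fun k => ?_, e3.symm, e4.symm⟩
    · have := congrArg (fun f => coefT f k) e1
      simp only [coefT_add, coefT_smul, coefT_bddT_symInv hθ] at this
      set F := coefT (C.electric θ (Quad.mk (bddT symInv θ u.psi1) (bddT symInv θ u.psi2)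
        u.q u.p)) k
      change _ = _ * coefT (bddT symInv θ u.psi1) k + _
      rw [coefT_bddT_symInv hθ]
      have h := hn k
      push_cast at this ⊢
      field_simp at this ⊢
      linear_combination -this
    · have := congrArg (fun f => coefT f k) e2
      simp only [coefT_bddT_symInv hθ] at this
      change _ = _ * coefT (bddT symInv θ u.psi2) k
      rw [coefT_bddT_symInv hθ, this]
      have h := hn k
      push_cast
      field_simp

/-- The factorisation is solved by `u = N⁻¹Ay`, whence `x = AN⁻¹Ay`. -/
theorem hasInverse_Bt (hC : C.Regular) (hM : 0 < C.M) (hθ : θ ∈ C.posSet) :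
    (C.Bt θ).HasInverse (C.BtInv θ) := by
  intro x y
  have hu := isUnit_innerT hC hM hθ
  rw [mem_Bt_graph_iff_exists hC hθ.1]
  constructor
  · rintro ⟨u, rfl, h⟩
    change _ = scaleT θ (Ring.inverse (C.innerT θ) (scaleT θ y))
    rw [← h]
    change _ = scaleT θ ((Ring.inverse (C.innerT θ) * C.innerT θ) u)
    rw [Ring.inverse_mul_cancel _ hu]; rfl
  · rintro rfl
    refine ⟨Ring.inverse (C.innerT θ) (scaleT θ y), rfl, ?_⟩
    change (C.innerT θ * Ring.inverse (C.innerT θ)) _ = _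
    rw [Ring.mul_inverse_cancel _ hu]; rfl

theorem isSelfAdjoint_scaleT (hθ : θ ∉ dualLattice) : IsSelfAdjoint (scaleT θ) := by
  rw [ContinuousLinearMap.isSelfAdjoint_iff_isSymmetric]
  intro X Y
  change inner ℂ (scaleT θ X) Y = inner ℂ X (scaleT θ Y)
  rw [scaleT_apply, scaleT_apply, Quad.inner_eq, Quad.inner_eq]
  change inner ℂ (bddT symInv θ X.psi1) Y.psi1 + inner ℂ (bddT symInv θ X.psi2) Y.psi2 + _ =
    inner ℂ X.psi1 (bddT symInv θ Y.psi1) + inner ℂ X.psi2 (bddT symInv θ Y.psi2) + _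
  rw [inner_bddT admissible_symInv hθ conj_symInv, inner_bddT admissible_symInv hθ conj_symInv]
  rfl

/-- `|i∇+θ|⁻¹` is compact since the momenta `θ - 2πk` tend to infinity, and the remaining components
are finite-dimensional. -/
theorem isCompactOperator_scaleT (θ : E3) : IsCompactOperator (scaleT θ) := by
  have h := isCompactOperator_bddT_symInv θ
  refine IsCompactOperator.add (IsCompactOperator.add (IsCompactOperator.add ?_ ?_) ?_) ?_
  · exact (h.comp_clm (Quad.psi1L : X0T →L[ℂ] L2T)).clm_comp (Quad.in1 : L2T →L[ℂ] X0T)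
  · exact (h.comp_clm (Quad.psi2L : X0T →L[ℂ] L2T)).clm_comp (Quad.in2 : L2T →L[ℂ] X0T)
  · exact (isCompactOperator_of_locallyCompactSpace_dom (Quad.qL : X0T →L[ℂ] C3)).clm_comp
      (Quad.in3 : C3 →L[ℂ] X0T)
  · exact (isCompactOperator_of_locallyCompactSpace_dom (Quad.pL : X0T →L[ℂ] C3)).clm_comp
      (Quad.in4 : C3 →L[ℂ] X0T)

theorem continuousOn_scaleT : ContinuousOn scaleT dualLatticeᶜ :=
  Quad.continuousOn_mkL (admissible_symInv.continuousOn.clm_comp continuousOn_const)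
    (admissible_symInv.continuousOn.clm_comp continuousOn_const) continuousOn_const
    continuousOn_const

theorem continuousOn_innerT (hC : C.Regular) : ContinuousOn C.innerT dualLatticeᶜ := by
  have h1 : ContinuousOn C.fieldT dualLatticeᶜ :=
    ((admissible_symInv.continuousOn.clm_comp
      (admissible_symInv.continuousOn.clm_comp continuousOn_const)).const_smul (C.coupling : ℂ)).add
      ((continuousOn_dipole hC).clm_comp continuousOn_const)
  exact continuousOn_const.add
    ((ContinuousLinearMap.adjoint.continuous.comp_continuousOn h1).clm_comp h1)

theorem continuousOn_BtInv (hC : C.Regular) (hM : 0 < C.M) : ContinuousOn C.BtInv C.posSet :=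
  (continuousOn_scaleT.mono fun _ h => h.1).sandwich
    ((continuousOn_innerT hC).mono fun _ h => h.1) fun _ hθ => isUnit_innerT hC hM hθ

theorem nonneg_BtInv (hC : C.Regular) (hM : 0 < C.M) (hθ : θ ∈ C.posSet) : 0 ≤ C.BtInv θ :=
  nonneg_sandwich (isSelfAdjoint_scaleT hθ.1) (nonneg_innerT hM) (isUnit_innerT hC hM hθ)

variable (C) in
/-- The bounded inverse of `Λ̃(θ)`. -/
def LamInv (θ : E3) : X0T →L[ℂ] X0T := opSqrt (C.BtInv θ)

variable (C) in
/-- The bounded inverse of `K̃(θ)`. -/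
def KtInv (θ : E3) : X0T →L[ℂ] X0T := C.LamInv θ * Quad.iJinv * C.LamInv θ

section

variable (hC : C.Regular) (hM : 0 < C.M) (hθ : θ ∈ C.posSet)
include hC hM hθ

theorem isPosSqrt_Lam : IsPosSqrt (C.Bt θ) (C.Lam θ) := by
  have h : ∃ L, IsPosSqrt (C.Bt θ) L :=
    ⟨_, isPosSqrt_pinv_sqrt (hasInverse_Bt hC hM hθ) (nonneg_BtInv hC hM hθ)⟩
  rw [Lam, posSqrt, dif_pos h]
  exact h.choose_spec

theorem hasInverse_Lam : (C.Lam θ).HasInverse (C.LamInv θ) :=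
  (isPosSqrt_Lam hC hM hθ).hasInverse_opSqrt (hasInverse_Bt hC hM hθ)

omit hC hM hθ in
theorem isSelfAdjoint_LamInv : IsSelfAdjoint (C.LamInv θ) :=
  isSelfAdjoint_opSqrt _

theorem LamInv_LamInv (x : X0T) : C.LamInv θ (C.LamInv θ x) = C.BtInv θ x :=
  opSqrt_opSqrt (nonneg_BtInv hC hM hθ) x

theorem isCompactOperator_LamInv : IsCompactOperator (C.LamInv θ) :=
  isCompactOperator_opSqrt (nonneg_BtInv hC hM hθ)
    (isCompactOperator_sandwich (isCompactOperator_scaleT θ))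

theorem hasInverse_Kt : (C.Kt θ).HasInverse (C.KtInv θ) :=
  (hasInverse_Lam hC hM hθ).pcomp_comp Quad.iJ_iJinv Quad.iJinv_iJ

omit hC hM hθ in
theorem isSelfAdjoint_KtInv : IsSelfAdjoint (C.KtInv θ) :=
  isSelfAdjoint_LamInv.mul_mul_self Quad.isSelfAdjoint_iJinv

theorem isCompactOperator_KtInv : IsCompactOperator (C.KtInv θ) :=
  (isCompactOperator_LamInv hC hM hθ).mul_right _

theorem isSelfAdjoint_Kt : IsSelfAdjoint (C.Kt θ) :=
  (hasInverse_Kt hC hM hθ).isSelfAdjoint isSelfAdjoint_KtInv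

theorem hasCompactResolvent_Kt : HasCompactResolvent (C.Kt θ) := by
  refine ⟨0, C.KtInv θ, isCompactOperator_KtInv hC hM hθ, fun x y => ?_⟩
  rw [zero_smul, add_zero]
  exact hasInverse_Kt hC hM hθ x y

theorem isUnitaryGroup_expGroup : IsUnitaryGroup (C.Kt θ) (expGroup (C.Kt θ)) := by
  have h : ∃ U, IsUnitaryGroup (C.Kt θ) U :=
    exists_isUnitaryGroup isSelfAdjoint_KtInv (isCompactOperator_KtInv hC hM hθ)
      (hasInverse_Kt hC hM hθ)
  rw [expGroup, dif_pos h]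
  exact h.choose_spec

end

theorem continuousOn_LamInv (hC : C.Regular) (hM : 0 < C.M) : ContinuousOn C.LamInv C.posSet :=
  (continuousOn_BtInv hC hM).opSqrt fun _ hθ => nonneg_BtInv hC hM hθ

theorem continuousOn_KtInv (hC : C.Regular) (hM : 0 < C.M) : ContinuousOn C.KtInv C.posSet :=
  (continuousOn_LamInv hC hM).mul_mul_self _

end Crystal

/-! ### The Bloch transform as a multiple of an isometry -/

/-- The point `2π y` of the Brillouin zone, with `y` the representative of `x` in the unit cell. -/
def angle (x : UnitAddTorus (Fin 3)) : E3 := (2 * Real.pi) • cellRep x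

/-- The volume `(2π)³` of the Brillouin zone. -/
def brillouinVol : ℝ := (2 * Real.pi) ^ 3

theorem brillouinVol_pos : 0 < brillouinVol := by unfold brillouinVol; positivity

theorem restrict_brillouin : muBrillouin = volume.restrict {θ : E3 | ∀ j, θ j ∈ Ico 0 (2 * Real.pi)} := by
  have h1 : (univ.pi fun _ : Fin 3 => Ico (0 : ℝ) (2 * Real.pi)) =ᵐ[volume]
      Icc (fun _ => (0 : ℝ)) fun _ => 2 * Real.pi := Measure.univ_pi_Ico_ae_eq_Icc
  have h2 := (PiLp.volume_preserving_ofLp (Fin 3)).quasiMeasurePreserving.preimage_ae_eq h1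
  have e1 : brillouin = WithLp.ofLp ⁻¹' (Icc (fun _ : Fin 3 => (0 : ℝ)) fun _ => 2 * Real.pi) := by
    ext θ
    simp [brillouin, Pi.le_def, forall_and]
  have e2 : {θ : E3 | ∀ j, θ j ∈ Ico 0 (2 * Real.pi)} =
      WithLp.ofLp ⁻¹' (univ.pi fun _ : Fin 3 => Ico (0 : ℝ) (2 * Real.pi)) := by
    ext θ
    simp
  rw [muBrillouin, e1, e2]
  exact Measure.restrict_congr_set h2.symm

/-- Dilation by `2π` multiplies volumes by `(2π)³`, and the faces of the Brillouin zone are null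
sets. Fourier analysis on the zone thus reduces to the torus. -/
theorem measurePreserving_angle :
    MeasurePreserving angle haarT (ENNReal.ofReal brillouinVol⁻¹ • muBrillouin) := by
  have hp : (2 * Real.pi) ≠ 0 := by positivity
  have he : MeasurableEmbedding fun y : E3 => (2 * Real.pi) • y :=
    (Homeomorph.smulOfNeZero _ hp).measurableEmbedding
  have h1 : MeasurePreserving (fun y : E3 => (2 * Real.pi) • y) (volume.restrict unitCell)
      (ENNReal.ofReal brillouinVol⁻¹ • muBrillouin) := by
    refine ⟨he.measurable, ?_⟩
    have h2 := he.restrict_map volume {θ : E3 | ∀ j, θ j ∈ Ico 0 (2 * Real.pi)}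
    have h3 : (fun y : E3 => (2 * Real.pi) • y) ⁻¹' {θ : E3 | ∀ j, θ j ∈ Ico 0 (2 * Real.pi)}
        = unitCell := by
      ext y
      have hpos : 0 < 2 * Real.pi := by positivity
      simp only [unitCell, mem_preimage, mem_ofPred_eq, mem_Ico, PiLp.smul_apply, smul_eq_mul]
      refine forall_congr' fun j => and_congr ?_ ?_
      · exact mul_nonneg_iff_of_pos_left hpos
      · exact mul_lt_iff_lt_one_right hpos
    rw [h3] at h2
    rw [← h2, Measure.map_addHaar_smul _ hp, Measure.restrict_smul, ← restrict_brillouin,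
      finrank_euclideanSpace_fin, abs_of_pos (by positivity)]
    rfl
  exact h1.comp measurePreserving_cellRep

theorem phase_angle (x : UnitAddTorus (Fin 3)) (n : Z3) :
    phase (angle x) n = UnitAddTorus.mFourier n x := by
  rw [mFourier_eq_wave, phase, wave, angle, real_inner_smul_left, real_inner_smul_left,
    real_inner_comm]

theorem integral_angle {E : Type} [NormedAddCommGroup E] [NormedSpace ℝ E] {g : E3 → E}
    (hg : AEStronglyMeasurable g muBrillouin) :
    ∫ θ, g θ ∂muBrillouin = brillouinVol • ∫ x, g (angle x) ∂haarT := by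
  have h1 := measurePreserving_angle
  have hne : ENNReal.ofReal brillouinVol⁻¹ ≠ 0 := by
    simp [brillouinVol_pos]
  have h2 : ∫ x, g (angle x) ∂haarT = ∫ θ, g θ ∂(ENNReal.ofReal brillouinVol⁻¹ • muBrillouin) := by
    rw [← h1.map_eq, integral_map h1.measurable.aemeasurable]
    rw [h1.map_eq]; exact hg.smul_measure _
  rw [h2, integral_smul_measure, smul_smul, ENNReal.toReal_ofReal
    (inv_nonneg.2 brillouinVol_pos.le), mul_inv_cancel₀ brillouinVol_pos.ne', one_smul]

theorem phase_add_mul (θ : E3) (m n : Z3) : phase θ (m + n) = phase θ m * phase θ n := by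
  rw [phase_eq_wave, phase_eq_wave, phase_eq_wave, ← wave_add]
  congr 1; ext j; simp [latticePt]

theorem conj_phase (θ : E3) (n : Z3) : (starRingEnd ℂ) (phase θ n) = phase θ (-n) := by
  rw [phase_eq_wave, phase_eq_wave, conj_wave, wave, wave]
  congr 3
  rw [inner_neg_left, ← inner_neg_right]
  congr 1; ext j; simp [latticePt]

theorem integral_phase (n : Z3) :
    ∫ θ, phase θ n ∂muBrillouin = if n = 0 then (brillouinVol : ℂ) else 0 := by
  have h0 : ∫ x, UnitAddTorus.mFourier n x ∂haarT = if n = 0 then 1 else 0 := by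
    have h1 := (orthonormal_iff_ite.1 (UnitAddTorus.orthonormal_mFourier (d := Fin 3))) 0 n
    rw [L2.inner_def] at h1
    simp only [eq_comm (a := n)]
    rw [← h1]
    refine integral_congr_ae ?_
    filter_upwards [UnitAddTorus.coeFn_mFourierLp (d := Fin 3) 2 0,
      UnitAddTorus.coeFn_mFourierLp (d := Fin 3) 2 n] with x hx hx'
    rw [hx, hx', UnitAddTorus.mFourier_zero]
    simp
  rw [integral_angle (continuous_phase n).aestronglyMeasurable]
  simp only [phase_angle]
  rw [h0]
  split_ifs <;> simp

theorem isCompact_brillouin : IsCompact brillouin := by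
  have h : brillouin = WithLp.toLp 2 '' Icc (fun _ : Fin 3 => (0 : ℝ)) fun _ => 2 * Real.pi := by
    ext θ
    simp only [brillouin, mem_ofPred_eq, mem_image, mem_Icc, Pi.le_def]
    constructor
    · exact fun h => ⟨θ.ofLp, ⟨fun j => (h j).1, fun j => (h j).2⟩, rfl⟩
    · rintro ⟨x, ⟨h1, h2⟩, rfl⟩ j
      exact ⟨h1 j, h2 j⟩
  rw [h]
  exact isCompact_Icc.image (PiLp.continuous_toLp 2 _)

instance : IsFiniteMeasure muBrillouin := by
  exact ⟨by rw [Measure.restrict_apply_univ]; exact isCompact_brillouin.measure_lt_top⟩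

/-- The Fourier coefficients of a square integrable function on the Brillouin zone determine it. -/
theorem ae_eq_zero_of_integral_phase {g : E3 → ℂ} (hg : MemLp g 2 muBrillouin)
    (h : ∀ n, ∫ θ, (starRingEnd ℂ) (phase θ n) * g θ ∂muBrillouin = 0) : g =ᵐ[muBrillouin] 0 := by
  have hm := measurePreserving_angle
  have hc0 : ENNReal.ofReal brillouinVol⁻¹ ≠ 0 := by simp [brillouinVol_pos]
  have hg' : MemLp g 2 (ENNReal.ofReal brillouinVol⁻¹ • muBrillouin) :=
    hg.smul_measure ENNReal.ofReal_ne_top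
  have hT : MemLp (g ∘ angle) 2 haarT := hg'.comp_measurePreserving hm
  have h1 : hT.toLp = 0 := by
    refine ext_coefT fun n => ?_
    rw [coefT_apply, map_zero, lp.coeFn_zero, Pi.zero_apply]
    have h2 := h n
    rw [integral_angle (g := fun θ => (starRingEnd ℂ) (phase θ n) * g θ)
      (((continuous_phase n).star.aestronglyMeasurable).mul hg.1),
      smul_eq_zero_iff_right brillouinVol_pos.ne'] at h2
    rw [← h2]
    refine integral_congr_ae ?_
    filter_upwards [hT.coeFn_toLp] with x hx
    rw [hx, conj_phase, phase_angle, mFourier_eq_wave]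
    congr 2
    ext j; simp [latticePt]
  have h3 : eLpNorm (g ∘ angle) 2 haarT = 0 := by
    rw [eLpNorm_eq_zero_iff hT.1 (by norm_num)]
    exact hT.coeFn_toLp.symm.trans (by rw [h1]; exact Lp.coeFn_zero _ _ _)
  rw [eLpNorm_comp_measurePreserving hg'.1 hm, eLpNorm_eq_zero_iff hg'.1 (by norm_num)] at h3
  exact (Measure.ae_ennreal_smul_measure_iff hc0).1 h3

section Series

variable {H : Type} [NormedAddCommGroup H] [InnerProductSpace ℂ H] [CompleteSpace H]

/-- A strongly continuous family of isometries. -/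
structure StrongIsometry (H : Type) [NormedAddCommGroup H] [InnerProductSpace ℂ H] where
  toFun : E3 → H →ₗᵢ[ℂ] H
  continuous : ∀ y, Continuous fun θ => toFun θ y

namespace StrongIsometry

variable (M : StrongIsometry H)

theorem memLp (n : Z3) (y : H) : MemLp (fun θ => M.toFun θ (phase θ n • y)) 2 muBrillouin := by
  have h1 : Continuous fun θ => M.toFun θ (phase θ n • y) := by
    simp only [map_smul]
    exact (continuous_phase n).smul (M.continuous y)
  refine MemLp.of_bound h1.aestronglyMeasurable ‖y‖ (Eventually.of_forall fun θ => ?_)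
  rw [LinearIsometry.norm_map, norm_smul, norm_phase, one_mul]

/-- The term `M(θ) exp(i n·θ) y` of a Bloch series. -/
def term (n : Z3) (y : H) : Lp H 2 muBrillouin := (M.memLp n y).toLp

theorem coeFn_term (n : Z3) (y : H) :
    M.term n y =ᵐ[muBrillouin] fun θ => M.toFun θ (phase θ n • y) := (M.memLp n y).coeFn_toLp

/-- At each `θ` the isometry `M(θ)` drops out of the scalar product, leaving the orthogonality of
the phases. -/
theorem inner_term (m n : Z3) (x y : H) :
    inner ℂ (M.term m x) (M.term n y) = if m = n then (brillouinVol : ℂ) * inner ℂ x y else 0 := by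
  have h1 : inner ℂ (M.term m x) (M.term n y)
      = ∫ θ, phase θ (n - m) * inner ℂ x y ∂muBrillouin := by
    rw [L2.inner_def]
    refine integral_congr_ae ?_
    filter_upwards [M.coeFn_term m x, M.coeFn_term n y] with θ h1 h2
    rw [h1, h2, LinearIsometry.inner_map_map, inner_smul_left, inner_smul_right, conj_phase,
      ← mul_assoc, ← phase_add_mul, neg_add_eq_sub]
  rw [h1, integral_mul_const, integral_phase]
  simp only [sub_eq_zero, eq_comm (a := n)]
  split_ifs <;> simp

/-- The normalised term of a Bloch series as an isometry. -/
def termL (n : Z3) : H →ₗᵢ[ℂ] Lp H 2 muBrillouin :=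
  LinearMap.isometryOfInner
    { toFun := fun y => ((Real.sqrt brillouinVol)⁻¹ : ℂ) • M.term n y
      map_add' := fun x y => by
        rw [← smul_add]
        congr 1
        rw [term, term, term, ← MemLp.toLp_add]
        refine MemLp.toLp_congr _ _ (Eventually.of_forall fun θ => ?_)
        simp
      map_smul' := fun c y => by
        rw [RingHom.id_apply, smul_comm c]
        congr 1
        rw [term, term, ← MemLp.toLp_const_smul]
        refine MemLp.toLp_congr _ _ (Eventually.of_forall fun θ => ?_)
        simp [smul_comm c] }
    fun x y => by
      change inner ℂ (((Real.sqrt brillouinVol)⁻¹ : ℂ) • M.term n x)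
        (((Real.sqrt brillouinVol)⁻¹ : ℂ) • M.term n y) = inner ℂ x y
      rw [inner_smul_left, inner_smul_right, inner_term, if_pos rfl, map_inv₀,
        Complex.conj_ofReal, ← mul_assoc, ← mul_assoc, ← mul_inv, ← Complex.ofReal_mul,
        Real.mul_self_sqrt brillouinVol_pos.le, inv_mul_cancel₀, one_mul]
      exact_mod_cast brillouinVol_pos.ne'

theorem orthogonalFamily : OrthogonalFamily ℂ (fun _ : Z3 => H) M.termL := by
  intro m n hmn x y
  change inner ℂ (((Real.sqrt brillouinVol)⁻¹ : ℂ) • M.term m x)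
    (((Real.sqrt brillouinVol)⁻¹ : ℂ) • M.term n y) = 0
  rw [inner_smul_left, inner_smul_right, inner_term, if_neg hmn, mul_zero, mul_zero]

/-- The Bloch series `∑ₙ M(θ) exp(i n·θ) yₙ`. -/
def series : lp (fun _ : Z3 => H) 2 →L[ℂ] Lp H 2 muBrillouin :=
  (Real.sqrt brillouinVol : ℂ) • M.orthogonalFamily.linearIsometry.toContinuousLinearMap

theorem hasSum_series (y : lp (fun _ : Z3 => H) 2) :
    HasSum (fun n => M.term n (y n)) (M.series y) := by
  have h1 := (M.orthogonalFamily.hasSum_linearIsometry y).const_smul (Real.sqrt brillouinVol : ℂ)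
  refine h1.congr_fun fun n => ?_
  change _ = (Real.sqrt brillouinVol : ℂ) • ((Real.sqrt brillouinVol)⁻¹ : ℂ) • M.term n (y n)
  rw [smul_smul, mul_inv_cancel₀, one_smul]
  exact_mod_cast (Real.sqrt_pos.2 brillouinVol_pos).ne'

theorem inner_series (x y : lp (fun _ : Z3 => H) 2) :
    inner ℂ (M.series x) (M.series y) = brillouinVol * inner ℂ x y := by
  change inner ℂ ((Real.sqrt brillouinVol : ℂ) • M.orthogonalFamily.linearIsometry x)
    ((Real.sqrt brillouinVol : ℂ) • M.orthogonalFamily.linearIsometry y) = _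
  rw [inner_smul_left, inner_smul_right, LinearIsometry.inner_map_map, Complex.conj_ofReal,
    ← mul_assoc, ← Complex.ofReal_mul, Real.mul_self_sqrt brillouinVol_pos.le]

theorem ae_hasSum_series {y : lp (fun _ : Z3 => H) 2} (hy : Summable fun n => ‖y n‖) :
    ∀ᵐ θ ∂muBrillouin, HasSum (fun n => M.toFun θ (phase θ n • y n)) (M.series y θ) := by
  have hn : ∀ n, ‖M.term n (y n)‖ = Real.sqrt brillouinVol * ‖y n‖ := fun n => by
    have h1 : ‖M.term n (y n)‖ ^ 2 = (Real.sqrt brillouinVol * ‖y n‖) ^ 2 := by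
      apply Complex.ofReal_injective
      push_cast
      have := inner_self_eq_norm_sq_to_K (𝕜 := ℂ) (M.term n (y n))
      rw [inner_term, if_pos rfl, inner_self_eq_norm_sq_to_K] at this
      rw [mul_pow, ← Complex.ofReal_pow (Real.sqrt _), Real.sq_sqrt brillouinVol_pos.le]
      exact this.symm
    exact (sq_eq_sq₀ (norm_nonneg _) (by positivity)).1 h1
  have h1 := Lp.hasSum_coeFn_tsum (f := fun n => M.term n (y n))
    (tsum_enorm_ne_top_iff_summable_norm.2 (by simp only [hn]; exact hy.mul_left _))
  have h2 : ∀ᵐ θ ∂muBrillouin, ∀ n, M.term n (y n) θ = M.toFun θ (phase θ n • y n) :=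
    ae_all_iff.2 fun n => M.coeFn_term n (y n)
  filter_upwards [h1, h2] with θ h3 h4
  rw [(M.hasSum_series y).tsum_eq] at h3
  simpa only [h4] using h3

end StrongIsometry

end Series

theorem hasSum_inner_cellLp (f g : L2R) :
    HasSum (fun n => inner ℂ (cellLp f n) (cellLp g n)) (inner ℂ f g) := by
  have h := hasSum_integral_cell (L2.integrable_inner (𝕜 := ℂ) f g)
  rw [← L2.inner_def] at h
  refine h.congr_fun fun n => ?_
  rw [L2.inner_def]
  refine integral_congr_ae ?_
  filter_upwards [coeFn_cellLp (Lp.memLp f) n, coeFn_cellLp (Lp.memLp g) n] with x h1 h2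
  rw [h1, h2]

theorem memℓp_cellLp (f : L2R) : Memℓp (fun n => cellLp f n) 2 := by
  rw [memℓp_two_iff]
  have h := (hasSum_inner_cellLp f f).summable
  simp only [inner_self_eq_norm_sq_to_K] at h
  have h2 := Complex.reCLM.summable h
  refine h2.congr fun n => ?_
  change (((‖cellLp f n‖ : ℝ) : ℂ) ^ 2).re = _
  rw [← Complex.ofReal_pow, Complex.ofReal_re]

theorem cellLp_congr {f g : E3 → ℂ} (h : f =ᵐ[volume] g) (n : Z3) : cellLp f n = cellLp g n := by
  have h1 : (fun x => f (cellRep x + latticePt n)) =ᵐ[haarT] fun x => g (cellRep x + latticePt n) :=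
    ae_of_cells h n
  rw [cellLp, cellLp, toL2T, toL2T]
  by_cases hf : MemLp (fun x => f (cellRep x + latticePt n)) 2 haarT
  · rw [dif_pos hf, dif_pos ((memLp_congr_ae h1).1 hf)]
    exact MemLp.toLp_congr _ _ h1
  · rw [dif_neg hf, dif_neg fun h => hf ((memLp_congr_ae h1).2 h)]

/-- The restrictions of `f` to the cells of the lattice. -/
def cellSeq (f : L2R) : lp (fun _ : Z3 => L2T) 2 := ⟨fun n => cellLp f n, memℓp_cellLp f⟩

theorem inner_cellSeq (f g : L2R) : inner ℂ (cellSeq f) (cellSeq g) = inner ℂ f g :=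
  (lp.hasSum_inner (cellSeq f) (cellSeq g)).unique (hasSum_inner_cellLp f g)

/-- The map `cellSeq` as an isometry. -/
def cellsL : L2R →ₗᵢ[ℂ] lp (fun _ : Z3 => L2T) 2 :=
  LinearMap.isometryOfInner
    { toFun := cellSeq
      map_add' := fun f g => by
        ext1; funext n
        change cellLp (f + g : L2R) n = cellLp f n + cellLp g n
        apply Lp.ext
        filter_upwards [coeFn_cellLp (Lp.memLp f) n, coeFn_cellLp (Lp.memLp g) n,
          coeFn_cellLp (Lp.memLp (f + g)) n, Lp.coeFn_add (cellLp f n) (cellLp g n),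
          ae_of_cells (Lp.coeFn_add f g) n] with x h1 h2 h3 h4 h5
        rw [h3, h4, Pi.add_apply, h1, h2, h5, Pi.add_apply]
      map_smul' := fun c f => by
        ext1; funext n
        change cellLp (c • f : L2R) n = c • cellLp f n
        apply Lp.ext
        filter_upwards [coeFn_cellLp (Lp.memLp f) n, coeFn_cellLp (Lp.memLp (c • f)) n,
          Lp.coeFn_smul c (cellLp f n), ae_of_cells (Lp.coeFn_smul c f) n] with x h1 h2 h3 h4
        rw [h2, h3, Pi.smul_apply, h1, h4, Pi.smul_apply] }
    inner_cellSeq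

/-- The modulations `f ↦ exp(iθ·y) f` of `L²(T³)`. -/
def modulation : StrongIsometry L2T where
  toFun := modT
  continuous y := by
    have := continuous_modT.clm_apply (continuous_const (y := y))
    exact this

/-- The trivial family of isometries of `ℂ³`. -/
def noModulation : StrongIsometry C3 where
  toFun _ := LinearIsometry.id
  continuous _ := continuous_const

/-- The Bloch transform on `L²(ℝ³)`. -/
def blochFn : L2R →L[ℂ] Lp L2T 2 muBrillouin := modulation.series ∘L cellsL.toContinuousLinearMap

/-- The Fourier series on `ℓ²(ℤ³) ⊗ ℂ³`. -/
def blochSeq : SeqL2 →L[ℂ] Lp C3 2 muBrillouin := noModulation.series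

theorem inner_blochFn (f g : L2R) :
    inner ℂ (blochFn f) (blochFn g) = brillouinVol * inner ℂ f g := by
  change inner ℂ (modulation.series (cellsL f)) (modulation.series (cellsL g)) = _
  rw [StrongIsometry.inner_series, LinearIsometry.inner_map_map]

theorem inner_blochSeq (q r : SeqL2) :
    inner ℂ (blochSeq q) (blochSeq r) = brillouinVol * inner ℂ q r :=
  StrongIsometry.inner_series _ q r

section

variable {H : Type} [NormedAddCommGroup H] [InnerProductSpace ℂ H] [CompleteSpace H]

theorem StrongIsometry.aestronglyMeasurable_sum (M : StrongIsometry H) (y : Z3 → H)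
    (s : Finset Z3) :
    AEStronglyMeasurable (fun θ => ∑ n ∈ s, M.toFun θ (phase θ n • y n)) muBrillouin := by
  refine Continuous.aestronglyMeasurable (continuous_finsetSum _ fun n _ => ?_)
  simp only [map_smul]
  exact (continuous_phase n).smul (M.continuous (y n))

theorem StrongIsometry.tendsto_series (M : StrongIsometry H) (y : lp (fun _ : Z3 => H) 2) :
    Tendsto (fun N => eLpNorm (fun θ => M.series y θ -
      ∑ n ∈ box N, M.toFun θ (phase θ n • y n)) 2 muBrillouin) atTop (𝓝 0) := by
  have h1 : Tendsto (fun N => ∑ n ∈ box N, M.term n (y n)) atTop (𝓝 (M.series y)) :=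
    (M.hasSum_series y).comp tendsto_box
  have h2 := tendsto_iff_edist_tendsto_0.1 h1
  refine h2.congr fun N => ?_
  rw [edist_comm, Lp.edist_def]
  refine eLpNorm_congr_ae ?_
  have h3 : ∀ᵐ θ ∂muBrillouin, ∀ n, M.term n (y n) θ = M.toFun θ (phase θ n • y n) :=
    ae_all_iff.2 fun n => M.coeFn_term n (y n)
  filter_upwards [h3, Lp.coeFn_fun_finsetSum (box N) fun n => M.term n (y n)] with θ h4 h5
  rw [Pi.sub_apply, h5]
  simp only [h4]

end

theorem blochPartialFun_eq_sum (f : L2R) (N : ℕ) (θ : E3) : blochPartialFun N f θ =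
    ∑ n ∈ box N, modulation.toFun θ (phase θ n • cellsL f n) := by
  rw [blochPartialFun_eq (Lp.memLp f), map_sum]
  rfl

/-- The Bloch transform of `Y`, assembled from those of its components. -/
def blochMk (Y : X0) (θ : E3) : X0T :=
  Quad.mk (blochFn Y.psi1 θ) (blochFn Y.psi2 θ) (blochSeq Y.q θ) (blochSeq Y.p θ)

namespace Quad

variable {α H Q : Type} [NormedAddCommGroup H] [InnerProductSpace ℂ H] [NormedAddCommGroup Q]
  [InnerProductSpace ℂ Q] [MeasurableSpace α] {μ : Measure α}

theorem aestronglyMeasurable_mk {a b : α → H} {c d : α → Q} (ha : AEStronglyMeasurable a μ)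
    (hb : AEStronglyMeasurable b μ) (hc : AEStronglyMeasurable c μ)
    (hd : AEStronglyMeasurable d μ) :
    AEStronglyMeasurable (fun x => Quad.mk (a x) (b x) (c x) (d x)) μ := by
  simp only [mk_eq_sum]
  exact ((((in1 : H →L[ℂ] Quad H Q).continuous.comp_aestronglyMeasurable ha).add
    ((in2 : H →L[ℂ] Quad H Q).continuous.comp_aestronglyMeasurable hb)).add
    ((in3 : Q →L[ℂ] Quad H Q).continuous.comp_aestronglyMeasurable hc)).add
    ((in4 : Q →L[ℂ] Quad H Q).continuous.comp_aestronglyMeasurable hd)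

theorem norm_mk_le (a b : H) (c d : Q) : ‖Quad.mk a b c d‖ ≤ ‖a‖ + ‖b‖ + ‖c‖ + ‖d‖ := by
  refine le_of_sq_le_sq ?_ (by positivity)
  rw [norm_sq_eq]
  change ‖a‖ ^ 2 + ‖b‖ ^ 2 + (‖c‖ ^ 2 + ‖d‖ ^ 2) ≤ _
  have h1 := norm_nonneg a
  have h2 := norm_nonneg b
  have h3 := norm_nonneg c
  have h4 := norm_nonneg d
  nlinarith [mul_nonneg h1 h2, mul_nonneg h1 h3, mul_nonneg h1 h4, mul_nonneg h2 h3,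
    mul_nonneg h2 h4, mul_nonneg h3 h4]

theorem eLpNorm_mk_le {a b : α → H} {c d : α → Q} (ha : AEStronglyMeasurable a μ)
    (hb : AEStronglyMeasurable b μ) (hc : AEStronglyMeasurable c μ)
    (hd : AEStronglyMeasurable d μ) :
    eLpNorm (fun x => Quad.mk (a x) (b x) (c x) (d x)) 2 μ ≤
      eLpNorm a 2 μ + eLpNorm b 2 μ + eLpNorm c 2 μ + eLpNorm d 2 μ := by
  have h2 : (1 : ℝ≥0∞) ≤ 2 := by norm_num
  have e : ∀ {F : Type} [NormedAddCommGroup F] (f : α → F),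
      eLpNorm (fun x => ‖f x‖) 2 μ = eLpNorm f 2 μ := fun f => eLpNorm_norm f
  calc _ ≤ eLpNorm (((fun x => ‖a x‖) + fun x => ‖b x‖) + (fun x => ‖c x‖) + fun x => ‖d x‖) 2 μ :=
        eLpNorm_mono_real fun x => norm_mk_le _ _ _ _
    _ ≤ _ := by
      rw [← e a, ← e b, ← e c, ← e d]
      refine (eLpNorm_add_le ((ha.norm.add hb.norm).add hc.norm) hd.norm h2).trans ?_
      gcongr
      refine (eLpNorm_add_le (ha.norm.add hb.norm) hc.norm h2).trans ?_
      gcongr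
      exact eLpNorm_add_le ha.norm hb.norm h2

end Quad

theorem aestronglyMeasurable_blochMk (Y : X0) : AEStronglyMeasurable (blochMk Y) muBrillouin :=
  Quad.aestronglyMeasurable_mk (Lp.aestronglyMeasurable _) (Lp.aestronglyMeasurable _)
    (Lp.aestronglyMeasurable _) (Lp.aestronglyMeasurable _)

theorem blochPartial_eq (N : ℕ) (Y : X0) (θ : E3) : blochPartial N Y θ =
    Quad.mk (∑ n ∈ box N, modulation.toFun θ (phase θ n • cellsL Y.psi1 n))
      (∑ n ∈ box N, modulation.toFun θ (phase θ n • cellsL Y.psi2 n))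
      (∑ n ∈ box N, noModulation.toFun θ (phase θ n • Y.q n))
      (∑ n ∈ box N, noModulation.toFun θ (phase θ n • Y.p n)) := by
  rw [← blochPartialFun_eq_sum, ← blochPartialFun_eq_sum]
  rfl

theorem aestronglyMeasurable_blochPartial (N : ℕ) (Y : X0) :
    AEStronglyMeasurable (blochPartial N Y) muBrillouin := by
  rw [show blochPartial N Y = _ from funext fun θ => blochPartial_eq N Y θ]
  exact Quad.aestronglyMeasurable_mk (StrongIsometry.aestronglyMeasurable_sum _ _ _)
    (StrongIsometry.aestronglyMeasurable_sum _ _ _)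
    (StrongIsometry.aestronglyMeasurable_sum _ _ _) (StrongIsometry.aestronglyMeasurable_sum _ _ _)

theorem isBloch_blochMk (Y : X0) : IsBloch Y (blochMk Y) := by
  refine ⟨aestronglyMeasurable_blochMk Y, ?_⟩
  have h := (((modulation.tendsto_series (cellsL Y.psi1)).add
    (modulation.tendsto_series (cellsL Y.psi2))).add (noModulation.tendsto_series Y.q)).add
    (noModulation.tendsto_series Y.p)
  simp only [add_zero] at h
  refine tendsto_of_tendsto_of_tendsto_of_le_of_le tendsto_const_nhds h (fun _ => zero_le)
    fun N => ?_
  simp only [blochPartial_eq]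
  exact Quad.eLpNorm_mk_le
    ((Lp.aestronglyMeasurable _).sub (StrongIsometry.aestronglyMeasurable_sum _ _ _))
    ((Lp.aestronglyMeasurable _).sub (StrongIsometry.aestronglyMeasurable_sum _ _ _))
    ((Lp.aestronglyMeasurable _).sub (StrongIsometry.aestronglyMeasurable_sum _ _ _))
    ((Lp.aestronglyMeasurable _).sub (StrongIsometry.aestronglyMeasurable_sum _ _ _))

/-- Limits in `L²` are unique almost everywhere, so the choice made by `bloch` may be replaced by
the explicit `blochMk`. -/
theorem IsBloch.ae_eq {Y : X0} {F G : E3 → X0T} (hF : IsBloch Y F) (hG : IsBloch Y G) :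
    F =ᵐ[muBrillouin] G := by
  have h1 : ∀ N, eLpNorm (F - G) 2 muBrillouin ≤
      eLpNorm (fun θ => F θ - blochPartial N Y θ) 2 muBrillouin +
      eLpNorm (fun θ => G θ - blochPartial N Y θ) 2 muBrillouin := fun N => by
    have e : F - G = (fun θ => F θ - blochPartial N Y θ) - fun θ => G θ - blochPartial N Y θ := by
      funext θ; simp
    rw [e]
    have hP := aestronglyMeasurable_blochPartial N Y
    exact eLpNorm_sub_le (hF.1.sub hP) (hG.1.sub hP) (by norm_num)
  have h2 := ge_of_tendsto' (hF.2.add hG.2) h1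
  rw [add_zero] at h2
  have h3 := (eLpNorm_eq_zero_iff (hF.1.sub hG.1) (by norm_num)).1 (le_antisymm h2 zero_le)
  filter_upwards [h3] with θ h
  exact sub_eq_zero.1 h

theorem bloch_ae_eq (Y : X0) : bloch Y =ᵐ[muBrillouin] blochMk Y := by
  have h : ∃ F, IsBloch Y F := ⟨_, isBloch_blochMk Y⟩
  rw [bloch, dif_pos h]
  exact h.choose_spec.ae_eq (isBloch_blochMk Y)

theorem integral_inner_blochMk (V Y : X0) :
    ∫ θ, inner ℂ (blochMk V θ) (blochMk Y θ) ∂muBrillouin = brillouinVol * inner ℂ V Y := by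
  simp only [Quad.inner_eq]
  have i1 := L2.integrable_inner (𝕜 := ℂ) (blochFn V.psi1) (blochFn Y.psi1)
  have i2 := L2.integrable_inner (𝕜 := ℂ) (blochFn V.psi2) (blochFn Y.psi2)
  have i3 := L2.integrable_inner (𝕜 := ℂ) (blochSeq V.q) (blochSeq Y.q)
  have i4 := L2.integrable_inner (𝕜 := ℂ) (blochSeq V.p) (blochSeq Y.p)
  have e := integral_add (i1.add i2) (i3.add i4)
  refine e.trans ?_
  have e1 := integral_add i1 i2
  have e2 := integral_add i3 i4
  simp only [Pi.add_apply]
  rw [e1, e2, ← L2.inner_def, ← L2.inner_def, ← L2.inner_def, ← L2.inner_def, inner_blochFn,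
    inner_blochFn, inner_blochSeq, inner_blochSeq]
  ring

theorem memLp_blochMk (Y : X0) : MemLp (blochMk Y) 2 muBrillouin := by
  refine ⟨aestronglyMeasurable_blochMk Y, (Quad.eLpNorm_mk_le (Lp.aestronglyMeasurable _)
    (Lp.aestronglyMeasurable _) (Lp.aestronglyMeasurable _) (Lp.aestronglyMeasurable _)).trans_lt ?_⟩
  simp only [ENNReal.add_lt_top]
  exact ⟨⟨⟨Lp.eLpNorm_lt_top _, Lp.eLpNorm_lt_top _⟩, Lp.eLpNorm_lt_top _⟩, Lp.eLpNorm_lt_top _⟩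

/-- Parseval with the sequence supported at the single point `n` in the direction `j`, whose Bloch
series has one term. -/
theorem integral_phase_blochSeq (q : SeqL2) (n : Z3) (j : Fin 3) :
    ∫ θ, (starRingEnd ℂ) (phase θ n) * blochSeq q θ j ∂muBrillouin = brillouinVol * q n j := by
  let e : C3 := EuclideanSpace.single j 1
  have h1 := inner_blochSeq (lp.single 2 n e) q
  have h2 : blochSeq (lp.single 2 n e) = noModulation.term n e := by
    refine (noModulation.hasSum_series (lp.single 2 n e)).unique ?_
    have := hasSum_single (f := fun m => noModulation.term m (lp.single (E := fun _ => C3) 2 n e m)) n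
      fun m hm => by
        rw [lp.single_apply_ne _ _ _ hm]
        apply Lp.ext
        filter_upwards [noModulation.coeFn_term m (0 : C3), Lp.coeFn_zero C3 2 muBrillouin]
          with θ h1 h2
        rw [h1, h2, smul_zero, map_zero, Pi.zero_apply]
    simpa using this
  rw [h2, L2.inner_def, lp.inner_single_left, EuclideanSpace.inner_single_left, map_one,
    one_mul] at h1
  rw [← h1]
  refine integral_congr_ae ?_
  filter_upwards [noModulation.coeFn_term n e] with θ h
  rw [h]
  change _ = inner ℂ (phase θ n • e) (blochSeq q θ)
  rw [inner_smul_left, EuclideanSpace.inner_single_left, map_one, one_mul]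

/-- Every square integrable function on the Brillouin zone is a Fourier series. -/
theorem exists_blochSeq_eq (g : Lp C3 2 muBrillouin) : ∃ q, blochSeq q = g := by
  let V : Submodule ℂ (Lp C3 2 muBrillouin) :=
    LinearMap.range noModulation.orthogonalFamily.linearIsometry.toLinearMap
  have hc : IsClosed (V : Set (Lp C3 2 muBrillouin)) := by
    have := noModulation.orthogonalFamily.linearIsometry.isometry.isClosedEmbedding.isClosed_range
    exact this
  have hs : (Real.sqrt brillouinVol : ℂ) ≠ 0 := by
    exact_mod_cast (Real.sqrt_pos.2 brillouinVol_pos).ne'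
  have hV : ∀ q, blochSeq q ∈ V := fun q => V.smul_mem _ ⟨q, rfl⟩
  have : CompleteSpace V := hc.completeSpace_coe
  -- `V` is the closed range of an isometry. A function orthogonal to it has vanishing Fourier
  -- coefficients in each coordinate and is therefore zero.
  have htop : V = ⊤ := by
    rw [← Submodule.orthogonal_eq_bot_iff, Submodule.eq_bot_iff]
    intro g hg
    have h1 : ∀ j, (fun θ => g θ j) =ᵐ[muBrillouin] 0 := fun j => by
      have hm : MemLp (fun θ => g θ j) 2 muBrillouin :=
        (EuclideanSpace.proj j : C3 →L[ℂ] ℂ).comp_memLp' (Lp.memLp g)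
      refine ae_eq_zero_of_integral_phase hm fun n => ?_
      let e : C3 := EuclideanSpace.single j 1
      have h2 : noModulation.term n e ∈ V := by
        have h3 : (Real.sqrt brillouinVol : ℂ) • noModulation.termL n e ∈ V := by
          refine V.smul_mem _ ⟨lp.single 2 n e, ?_⟩
          exact noModulation.orthogonalFamily.linearIsometry_apply_single e
        convert h3
        change _ = (Real.sqrt brillouinVol : ℂ) • ((Real.sqrt brillouinVol)⁻¹ : ℂ) • noModulation.term n e
        rw [smul_smul, mul_inv_cancel₀ hs, one_smul]
      have h4 := (Submodule.mem_orthogonal _ _).1 hg _ h2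
      rw [← h4, L2.inner_def]
      refine integral_congr_ae ?_
      filter_upwards [noModulation.coeFn_term n e] with θ h
      rw [h]
      change _ = inner ℂ (phase θ n • e) (g θ)
      rw [inner_smul_left, EuclideanSpace.inner_single_left, map_one, one_mul]
    apply Lp.ext
    filter_upwards [ae_all_iff.2 h1, Lp.coeFn_zero C3 2 muBrillouin] with θ h2 h3
    rw [h3]
    ext j
    exact h2 j
  have hg : ((Real.sqrt brillouinVol : ℂ)⁻¹) • g ∈ V := by rw [htop]; trivial
  obtain ⟨q, hq⟩ := hg
  refine ⟨q, ?_⟩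
  change (Real.sqrt brillouinVol : ℂ) • noModulation.orthogonalFamily.linearIsometry.toLinearMap q = g
  rw [hq, smul_smul, mul_inv_cancel₀ hs, one_smul]

theorem ae_hasSum_blochSeq {q : SeqL2} (hq : Summable fun n => ‖q n‖) :
    ∀ᵐ θ ∂muBrillouin, HasSum (fun n => phase θ n • q n) (blochSeq q θ) :=
  noModulation.ae_hasSum_series hq

theorem CellSummable.coefT_blochFn {f : L2R} (hf : CellSummable f) :
    ∀ᵐ θ ∂muBrillouin, ∀ k, coefT (blochFn f θ) k = ft f (xi θ k) := by
  filter_upwards [modulation.ae_hasSum_series (y := cellsL f) hf.summable] with θ h k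
  exact hf.coefT_of_hasSum h k

/-! ### The Bloch transform and the Fourier transform on `ℝ³` -/

/-- The Fourier transform `∫ exp(iξ·x) f(x) dx` on `L²(ℝ³)`. -/
def ftL (f : L2R) (ξ : E3) : ℂ := (𝓕 f : L2R) (-(2 * Real.pi)⁻¹ • ξ)

theorem two_pi_inv_ne_zero : -(2 * Real.pi)⁻¹ ≠ 0 := by
  have := Real.pi_pos
  exact neg_ne_zero.2 (by positivity)

theorem quasiMeasurePreserving_ft :
    Measure.QuasiMeasurePreserving (fun ξ : E3 => -(2 * Real.pi)⁻¹ • ξ) volume volume :=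
  Measure.quasiMeasurePreserving_smul volume two_pi_inv_ne_zero

theorem quasiMeasurePreserving_ft_symm :
    Measure.QuasiMeasurePreserving (fun ξ : E3 => -(2 * Real.pi) • ξ) volume volume :=
  Measure.quasiMeasurePreserving_smul volume (by simp)

theorem ae_xi {P : E3 → Prop} (h : ∀ᵐ ξ, P ξ) : ∀ᵐ θ ∂muBrillouin, ∀ k, P (xi θ k) := by
  refine ae_restrict_of_ae (ae_all_iff.2 fun k => ?_)
  exact (measurePreserving_sub_right volume ((2 * Real.pi) • latticePt k)).quasiMeasurePreserving.ae h

theorem ft_eq_fourier (f : E3 → ℂ) (ξ : E3) : ft f ξ = 𝓕 f (-(2 * Real.pi)⁻¹ • ξ) := by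
  rw [Real.fourier_eq', ft]
  refine integral_congr_ae (Eventually.of_forall fun x => ?_)
  have hp := Real.pi_ne_zero
  simp only [smul_eq_mul]
  congr 2
  rw [real_inner_smul_right, real_inner_comm]
  push_cast
  field_simp

theorem ftL_toLp (f : 𝓢(E3, ℂ)) : ftL (f.toLp 2) =ᵐ[volume] ft f := by
  have h1 : (𝓕 (f.toLp 2 : L2R) : L2R) = (𝓕 f).toLp 2 := SchwartzMap.toLp_fourier_eq f
  have h2 := quasiMeasurePreserving_ft.ae ((𝓕 f).coeFn_toLp 2 volume)
  filter_upwards [h2] with ξ h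
  rw [ftL, h1, h, SchwartzMap.fourier_coe, ft_eq_fourier]

theorem hasTemperateGrowth_weight : Function.HasTemperateGrowth weight := by
  have h : Function.HasTemperateGrowth fun x : E3 => 1 + ‖x‖ ^ 2 :=
    (Function.HasTemperateGrowth.const 1).add (Function.hasTemperateGrowth_norm_sq E3)
  exact h.pow 2

theorem cellSummable_schwartz (f : 𝓢(E3, ℂ)) : CellSummable f := by
  refine CellSummable.of_weight f.integrable ?_
  have h := (SchwartzMap.smulLeftCLM ℂ weight f).memLp 2 volume
  rw [SchwartzMap.smulLeftCLM_apply hasTemperateGrowth_weight] at h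
  simpa only [Complex.real_smul] using h

theorem CellSummable.congr {f g : E3 → ℂ} (hf : CellSummable f) (h : f =ᵐ[volume] g) :
    CellSummable g := by
  refine ⟨(memLp_congr_ae h).1 hf.memLp, hf.integrable.congr h, ?_⟩
  simpa only [cellLp_congr h] using hf.summable

theorem ft_congr {f g : E3 → ℂ} (h : f =ᵐ[volume] g) : ft f = ft g := by
  funext ξ
  refine integral_congr_ae ?_
  filter_upwards [h] with x hx
  rw [hx]

theorem coefT_blochFn_toLp (f : 𝓢(E3, ℂ)) :
    ∀ᵐ θ ∂muBrillouin, ∀ k, coefT (blochFn (f.toLp 2) θ) k = ft f (xi θ k) := by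
  have h := f.coeFn_toLp 2 volume
  rw [← ft_congr h]
  exact CellSummable.coefT_blochFn ((cellSummable_schwartz f).congr h.symm)

/-- Known for Schwartz functions, which are dense. Convergence in `L²` of both sides gives almost
everywhere convergence along a subsequence, extracted first for the Fourier transform and then for
the Bloch transform. -/
theorem coefT_blochFn_eq_ftL (f : L2R) :
    ∀ᵐ θ ∂muBrillouin, ∀ k, coefT (blochFn f θ) k = ftL f (xi θ k) := by
  have hd : DenseRange fun g : 𝓢(E3, ℂ) => (g.toLp 2 : L2R) :=
    SchwartzMap.denseRange_toLpCLM (F := ℂ) (μ := (volume : Measure E3)) (p := 2)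
      ENNReal.ofNat_ne_top
  obtain ⟨u, hu1, hu2⟩ := mem_closure_iff_seq_limit.1 (hd f)
  choose g hg using hu1
  obtain rfl : (fun n => ((g n).toLp 2 : L2R)) = u := funext hg
  have h1 : Tendsto (fun n => (𝓕 ((g n).toLp 2 : L2R) : L2R)) atTop (𝓝 (𝓕 f)) :=
    ((Lp.fourierTransformₗᵢ E3 ℂ).continuous.tendsto f).comp hu2
  obtain ⟨a, ha1, ha2⟩ := (tendstoInMeasure_of_tendsto_Lp h1).exists_seq_tendsto_ae
  have h2 : Tendsto (fun n => blochFn ((g (a n)).toLp 2 : L2R)) atTop (𝓝 (blochFn f)) :=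
    ((blochFn.continuous.tendsto f).comp hu2).comp ha1.tendsto_atTop
  obtain ⟨b, hb1, hb2⟩ := (tendstoInMeasure_of_tendsto_Lp h2).exists_seq_tendsto_ae
  have h3 := ae_xi (quasiMeasurePreserving_ft.ae ha2)
  have h4 := ae_all_iff.2 fun n => coefT_blochFn_toLp (g n)
  have h5 := ae_xi (ae_all_iff.2 fun n => ftL_toLp (g n))
  filter_upwards [hb2, h3, h4, h5] with θ h6 h7 h8 h9 k
  have h10 : Tendsto (fun n => coefT (blochFn ((g (a (b n))).toLp 2 : L2R) θ) k) atTop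
      (𝓝 (coefT (blochFn f θ) k)) := by
    simp only [← inner_waveT]
    exact ((innerSL ℂ (waveT k)).continuous.tendsto _).comp h6
  refine tendsto_nhds_unique h10 ?_
  refine ((h7 k).comp hb1.tendsto_atTop).congr fun n => ?_
  rw [h8, ← h9]
  rfl

theorem mem_mulL2R_graph {b : E3 → ℂ} {f g : L2R} :
    (f, g) ∈ (mulL2R b).graph ↔ ∀ᵐ w, g w = b w * f w := by
  rw [LinearPMap.mem_graph_iff]
  constructor
  · rintro ⟨⟨f, hf⟩, rfl, rfl⟩
    exact MemLp.coeFn_toLp hf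
  · intro h
    have hm : MemLp (fun w => b w * f w) 2 volume := (memLp_congr_ae h).1 (Lp.memLp g)
    refine ⟨⟨f, hm⟩, rfl, Lp.ext ?_⟩
    exact (MemLp.coeFn_toLp hm).trans (EventuallyEq.symm h)

/-- Conjugation with the unitary Fourier transform and the substitution `ξ = -2πw`, which preserves
null sets in both directions. -/
theorem mem_multR_graph {a : E3 → ℂ} {f g : L2R} :
    (f, g) ∈ (multR a).graph ↔ ∀ᵐ ξ, ftL g ξ = a ξ * ftL f ξ := by
  have key : (f, g) ∈ (multR a).graph ↔
      ((𝓕 f : L2R), (𝓕 g : L2R)) ∈ (mulL2R fun w => a (-(2 * Real.pi) • w)).graph := by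
    constructor
    · intro h
      obtain ⟨⟨f, hf⟩, h1, h2⟩ := LinearPMap.mem_graph_iff _ |>.1 h
      obtain rfl : f = _ := h1
      obtain ⟨h3, h4⟩ := hf
      refine LinearPMap.mem_graph_iff _ |>.2 ⟨⟨_, h4⟩, rfl, ?_⟩
      rw [show g = _ from h2.symm]
      exact ((Lp.fourierTransformₗᵢ E3 ℂ).apply_symm_apply _).symm
    · intro h
      obtain ⟨⟨f', hf⟩, h1, h2⟩ := LinearPMap.mem_graph_iff _ |>.1 h
      obtain rfl : f' = _ := h1
      refine LinearPMap.mem_graph_iff _ |>.2 ⟨⟨f, ⟨trivial, hf⟩⟩, rfl, ?_⟩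
      apply (Lp.fourierTransformₗᵢ E3 ℂ).injective
      exact ((Lp.fourierTransformₗᵢ E3 ℂ).apply_symm_apply _).trans h2
  rw [key, mem_mulL2R_graph]
  have hp := Real.pi_ne_zero
  constructor
  · intro h
    filter_upwards [quasiMeasurePreserving_ft.ae h] with ξ h1
    rw [ftL, h1, smul_smul, ftL]
    rw [show -(2 * Real.pi) * -(2 * Real.pi)⁻¹ = 1 by field_simp, one_smul]
  · intro h
    filter_upwards [quasiMeasurePreserving_ft_symm.ae h] with w h1
    simp only [ftL, smul_smul] at h1
    rwa [show -(2 * Real.pi)⁻¹ * -(2 * Real.pi) = 1 by field_simp, one_smul] at h1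

theorem memLp_comp_ft {f : E3 → ℂ} :
    MemLp (fun w => f (-(2 * Real.pi) • w)) 2 volume ↔ MemLp f 2 volume := by
  have hr : -(2 * Real.pi) ≠ 0 := by have := Real.pi_pos; exact neg_ne_zero.2 (by positivity)
  have h := (MeasurableEquiv.smul (α := E3) (Units.mk0 _ hr)).measurableEmbedding
  have e : Measure.map (MeasurableEquiv.smul (α := E3) (Units.mk0 _ hr)) volume =
      ENNReal.ofReal |(-(2 * Real.pi)) ^ Module.finrank ℝ E3|⁻¹ • volume := by
    have := Measure.map_addHaar_smul (volume : Measure E3) hr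
    rw [abs_inv] at this
    exact this
  have h1 := h.memLp_map_measure_iff (μ := volume) (g := f) (p := 2)
  rw [e] at h1
  rw [show (fun w => f (-(2 * Real.pi) • w)) =
    f ∘ MeasurableEquiv.smul (α := E3) (Units.mk0 _ hr) from rfl, ← h1]
  refine ⟨fun h2 => ?_, fun h2 => h2.smul_measure ENNReal.ofReal_ne_top⟩
  exact h2.of_measure_le_smul (c := (ENNReal.ofReal |(-(2 * Real.pi)) ^ Module.finrank ℝ E3|⁻¹)⁻¹)
    (by simp) (by
      rw [smul_smul, ENNReal.inv_mul_cancel, one_smul]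
      · simp
      · exact ENNReal.ofReal_ne_top)

theorem memLp_ftL (f : L2R) : MemLp (ftL f) 2 volume := by
  rw [← memLp_comp_ft]
  have hp := Real.pi_ne_zero
  simp only [ftL, smul_smul]
  rw [show -(2 * Real.pi)⁻¹ * -(2 * Real.pi) = 1 by field_simp]
  simp only [one_smul]
  exact Lp.memLp _

/-- Every square integrable function is a Fourier transform. -/
theorem exists_ftL_eq {u : E3 → ℂ} (hu : MemLp u 2 volume) : ∃ f : L2R, ftL f =ᵐ[volume] u := by
  have h := memLp_comp_ft.2 hu
  have hp := Real.pi_ne_zero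
  refine ⟨(Lp.fourierTransformₗᵢ E3 ℂ).symm h.toLp, ?_⟩
  have h1 : (𝓕 ((Lp.fourierTransformₗᵢ E3 ℂ).symm h.toLp : L2R) : L2R) = h.toLp :=
    (Lp.fourierTransformₗᵢ E3 ℂ).apply_symm_apply _
  filter_upwards [quasiMeasurePreserving_ft.ae h.coeFn_toLp] with ξ h2
  rw [ftL, h1, h2, smul_smul, show -(2 * Real.pi) * -(2 * Real.pi)⁻¹ = 1 by field_simp, one_smul]

theorem mem_multR_domain {a : E3 → ℂ} {f : L2R} (h : MemLp (fun ξ => a ξ * ftL f ξ) 2 volume) :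
    f ∈ (multR a).domain := by
  obtain ⟨g, hg⟩ := exists_ftL_eq h
  exact LinearPMap.mem_domain_iff.2 ⟨g, mem_multR_graph.2 hg⟩

theorem ftL_multR_ap {a : E3 → ℂ} {f : L2R} (h : f ∈ (multR a).domain) :
    ∀ᵐ ξ, ftL ((multR a).ap f) ξ = a ξ * ftL f ξ := by
  rw [← mem_multR_graph, LinearPMap.ap_of_mem _ h]
  exact LinearPMap.mem_graph _ ⟨f, h⟩

theorem coefT_blochFn_multR {a : E3 → ℂ} {f : L2R} (h : f ∈ (multR a).domain) :
    ∀ᵐ θ ∂muBrillouin, ∀ k, coefT (blochFn ((multR a).ap f) θ) k =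
      a (xi θ k) * coefT (blochFn f θ) k := by
  filter_upwards [coefT_blochFn_eq_ftL f, coefT_blochFn_eq_ftL ((multR a).ap f), ae_xi (ftL_multR_ap h)]
    with θ h1 h2 h3 k
  rw [h1, h2, h3]

theorem volume_dualLattice : (volume : Measure E3) dualLattice = 0 :=
  (countable_range _).measure_zero _

theorem ae_notMem_dualLattice : ∀ᵐ θ ∂muBrillouin, θ ∉ dualLattice :=
  ae_restrict_of_ae (measure_eq_zero_iff_ae_notMem.1 volume_dualLattice)

theorem exists_xi_eq (ξ : E3) : ∃ θ ∈ brillouin, ∃ k, xi θ k = ξ := by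
  have hp : 0 < 2 * Real.pi := by positivity
  let k : Z3 := fun j => -⌊ξ j / (2 * Real.pi)⌋
  refine ⟨ξ + (2 * Real.pi) • latticePt k, fun j => ?_, k, by rw [xi, add_sub_cancel_right]⟩
  have e : (ξ + (2 * Real.pi) • latticePt k) j =
      ξ j - (2 * Real.pi) * ⌊ξ j / (2 * Real.pi)⌋ := by
    simp [latticePt, k]; ring
  rw [e]
  have h1 := Int.floor_le (ξ j / (2 * Real.pi))
  have h2 := Int.lt_floor_add_one (ξ j / (2 * Real.pi))
  rw [le_div_iff₀ hp] at h1
  rw [div_lt_iff₀ hp] at h2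
  constructor <;> nlinarith

/-- Every `ξ` is `θ - 2πk` with `θ` in the Brillouin zone. The exceptional set is covered by
countably many translates of a null set. -/
theorem ae_of_xi {P : E3 → Prop} (h : ∀ᵐ θ ∂muBrillouin, ∀ k, P (xi θ k)) : ∀ᵐ ξ, P ξ := by
  rw [ae_restrict_iff' Crystal.isClosed_brillouin.measurableSet] at h
  have h1 : ∀ᵐ ξ : E3, ∀ k : Z3, ξ + (2 * Real.pi) • latticePt k ∈ brillouin →
      ∀ l, P (xi (ξ + (2 * Real.pi) • latticePt k) l) := ae_all_iff.2 fun k =>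
    (measurePreserving_add_right volume ((2 * Real.pi) • latticePt k)).quasiMeasurePreserving.ae h
  filter_upwards [h1] with ξ h2
  obtain ⟨θ, hθ, k, rfl⟩ := exists_xi_eq ξ
  have e : xi θ k + (2 * Real.pi) • latticePt k = θ := sub_add_cancel _ _
  have := h2 k
  rw [e] at this
  exact this hθ k

/-- Both the `L²` transform and the Fourier integral give the Fourier coefficients of the same Bloch
transform, and these determine them at almost every momentum. -/
theorem CellSummable.ftL_eq {f : L2R} (hf : CellSummable f) : ftL f =ᵐ[volume] ft f := by
  refine ae_of_xi ?_
  filter_upwards [coefT_blochFn_eq_ftL f, hf.coefT_blochFn] with θ h1 h2 k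
  rw [← h1, h2]

theorem toL2R_of_memLp {f : E3 → ℂ} (hf : MemLp f 2 volume) : toL2R f = hf.toLp := by
  rw [toL2R, dif_pos hf]

theorem latticePt_sub (m n : Z3) : latticePt (m - n) = latticePt m - latticePt n := by
  ext j; simp [latticePt]

theorem CellSummable.translate {f : E3 → ℂ} (hf : CellSummable f) (n : Z3) :
    CellSummable fun x => f (x - latticePt n) := by
  have hp := measurePreserving_sub_right (volume : Measure E3) (latticePt n)
  refine ⟨hf.memLp.comp_measurePreserving hp, hf.integrable.comp_sub_right _, ?_⟩
  have e : ∀ m, cellLp (fun x => f (x - latticePt n)) m = cellLp f (m - n) := fun m => by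
    rw [cellLp, cellLp, latticePt_sub]
    simp only [add_sub_assoc]
  simp only [e]
  exact hf.summable.comp_injective (sub_left_injective)

theorem phase_zero (θ : E3) : phase θ 0 = 1 := by
  have h : latticePt 0 = 0 := by ext j; simp [latticePt]
  rw [phase, h, inner_zero_right, Complex.ofReal_zero, mul_zero, Complex.exp_zero]

theorem ft_translate (f : E3 → ℂ) (n : Z3) (ξ : E3) :
    ft (fun x => f (x - latticePt n)) ξ = phase ξ n * ft f ξ := by
  have h := integral_sub_right_eq_self (μ := volume) (fun x : E3 =>
    Complex.exp (Complex.I * (inner ℝ ξ (x + latticePt n) : ℝ)) * f x) (latticePt n)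
  rw [ft, ft, ← integral_const_mul]
  simp only [sub_add_cancel] at h
  rw [h]
  refine integral_congr_ae (Eventually.of_forall fun x => ?_)
  simp only [phase]
  rw [inner_add_right, ← mul_assoc, ← Complex.exp_add]
  push_cast
  ring_nf

theorem norm_ft_le (f : E3 → ℂ) (ξ : E3) : ‖ft f ξ‖ ≤ ∫ x, ‖f x‖ := by
  refine (norm_integral_le_integral_norm _).trans_eq ?_
  refine integral_congr_ae (Eventually.of_forall fun x => ?_)
  simp only [norm_mul]
  rw [mul_comm Complex.I, Complex.norm_exp_ofReal_mul_I, one_mul]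

theorem norm_le_of_norm_ftL_le {f g : L2R} (h : ∀ᵐ ξ, ‖ftL f ξ‖ ≤ ‖ftL g ξ‖) : ‖f‖ ≤ ‖g‖ := by
  have h1 : ‖(𝓕 f : L2R)‖ ≤ ‖(𝓕 g : L2R)‖ := by
    refine Lp.norm_le_norm_of_ae_le ?_
    filter_upwards [quasiMeasurePreserving_ft_symm.ae h] with w hw
    have hp := Real.pi_ne_zero
    simp only [ftL, smul_smul] at hw
    rwa [show -(2 * Real.pi)⁻¹ * -(2 * Real.pi) = 1 by field_simp, one_smul] at hw
  have e : ∀ f : L2R, ‖(𝓕 f : L2R)‖ = ‖f‖ := fun f => (Lp.fourierTransformₗᵢ E3 ℂ).norm_map f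
  rwa [e, e] at h1

/-! ### Multipliers applied to translated ion densities -/

namespace Crystal

variable {C : Crystal}

theorem σAt_eq (hC : C.Regular) (n : Z3) :
    C.σAt n = (hC.cellSummable.translate n).memLp.toLp := toL2R_of_memLp _

theorem ftL_σAt (hC : C.Regular) (n : Z3) :
    ∀ᵐ ξ, ftL (C.σAt n) ξ = phase ξ n * C.ftσ ξ := by
  have h1 := (hC.cellSummable.translate n)
  have h2 := h1.memLp.coeFn_toLp
  have h3 : CellSummable (C.σAt n) := by rw [σAt_eq hC]; exact h1.congr h2.symm
  filter_upwards [h3.ftL_eq] with ξ h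
  rw [h, σAt_eq hC, ft_congr h2, ft_translate (fun x => (C.σ x : ℂ)), ftσ]

/-- `a(i∇)` can be applied to the ion densities. -/
def Applicable (C : Crystal) (a : E3 → ℂ) : Prop := MemLp (fun ξ => a ξ * C.ftσ ξ) 2 volume

theorem memLp_ftσ (hC : C.Regular) : MemLp C.ftσ 2 volume := by
  refine (memLp_congr_ae ?_).1 (memLp_ftL (C.σAt 0))
  filter_upwards [ftL_σAt hC 0] with ξ h
  rw [h, phase_zero, one_mul]

theorem Applicable.mem_domain (hC : C.Regular) {a : E3 → ℂ} (ha : C.Applicable a) (n : Z3) :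
    C.σAt n ∈ (multR a).domain := by
  refine mem_multR_domain ?_
  have h1 : AEStronglyMeasurable (fun ξ => phase ξ n) (volume : Measure E3) :=
    (continuous_phase n).aestronglyMeasurable
  have h2 : MemLp (fun ξ => phase ξ n * (a ξ * C.ftσ ξ)) 2 volume := by
    refine ha.of_le (h1.mul ha.1) (Eventually.of_forall fun ξ => ?_)
    rw [norm_mul, norm_phase, one_mul]
  refine (memLp_congr_ae ?_).1 h2
  filter_upwards [ftL_σAt hC n] with ξ h
  rw [h]; ring

theorem Applicable.ftL_ap (hC : C.Regular) {a : E3 → ℂ} (ha : C.Applicable a) (n : Z3) :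
    ∀ᵐ ξ, ftL ((multR a).ap (C.σAt n)) ξ = phase ξ n * (a ξ * C.ftσ ξ) := by
  filter_upwards [ftL_multR_ap (ha.mem_domain hC n), ftL_σAt hC n] with ξ h1 h2
  rw [h1, h2]; ring

/-- A lattice translation changes the Fourier transform by a phase only, so all translates have
equal norms; absolutely summable coefficients then give convergent superpositions. -/
theorem Applicable.norm_le (hC : C.Regular) {a : E3 → ℂ} (ha : C.Applicable a) (n : Z3) :
    ‖(multR a).ap (C.σAt n)‖ ≤ ‖(multR a).ap (C.σAt 0)‖ := by
  refine norm_le_of_norm_ftL_le ?_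
  filter_upwards [ha.ftL_ap hC n, ha.ftL_ap hC 0] with ξ h1 h2
  rw [h1, h2, norm_mul, norm_mul (phase ξ 0), norm_phase, norm_phase]

theorem Applicable.coefT_blochFn_ap (hC : C.Regular) {a : E3 → ℂ} (ha : C.Applicable a) (n : Z3) :
    ∀ᵐ θ ∂muBrillouin, ∀ k, coefT (blochFn ((multR a).ap (C.σAt n)) θ) k =
      phase θ n * (a (xi θ k) * C.ftσ (xi θ k)) := by
  filter_upwards [coefT_blochFn_eq_ftL ((multR a).ap (C.σAt n)), ae_xi (ha.ftL_ap hC n)] with θ h1 h2 k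
  rw [h1, h2, phase_xi]

/-- The translation phase has the same value at `θ - 2πk` for all `k`, and so comes out of the fibre
as a scalar. -/
theorem Applicable.blochFn_ap (hC : C.Regular) {a : E3 → ℂ} (ha : C.Applicable a) :
    ∀ᵐ θ ∂muBrillouin, ∀ n, blochFn ((multR a).ap (C.σAt n)) θ =
      phase θ n • (multT a θ).ap (C.σT θ) := by
  rw [ae_all_iff]
  intro n
  filter_upwards [ha.coefT_blochFn_ap hC n, ha.coefT_blochFn_ap hC 0] with θ h1 h0
  have h0' : ∀ k, coefT (blochFn ((multR a).ap (C.σAt 0)) θ) k =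
      a (xi θ k) * coefT (C.σT θ) k := fun k => by
    rw [h0, hC.coefT_σT, phase_zero, one_mul]
  rw [multT_ap h0']
  refine ext_coefT fun k => ?_
  rw [h1, coefT_smul, h0', hC.coefT_σT]

/-- The Bloch transform of a superposition of translates. -/
theorem Applicable.superposition (hC : C.Regular) {a : E3 → ℂ} (ha : C.Applicable a) {c : Z3 → ℂ}
    (hc : Summable fun n => ‖c n‖) :
    (Summable fun n => c n • (multR a).ap (C.σAt n)) ∧
    ∀ᵐ θ ∂muBrillouin, blochFn (∑' n, c n • (multR a).ap (C.σAt n)) θ =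
      (∑' n, phase θ n * c n) • (multT a θ).ap (C.σT θ) := by
  have hn : Summable fun n => ‖c n • (multR a).ap (C.σAt n)‖ := by
    refine Summable.of_nonneg_of_le (fun _ => norm_nonneg _) (fun n => ?_)
      (hc.mul_right ‖(multR a).ap (C.σAt 0)‖)
    rw [norm_smul]
    exact mul_le_mul_of_nonneg_left (ha.norm_le hC n) (norm_nonneg _)
  refine ⟨hn.of_norm, ?_⟩
  have h1 := hn.of_norm.hasSum.mapL blochFn
  have h2 : Summable fun n => ‖blochFn (c n • (multR a).ap (C.σAt n))‖ := by
    refine Summable.of_nonneg_of_le (fun _ => norm_nonneg _) (fun n => ?_)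
      (hn.mul_left ‖blochFn‖)
    exact blochFn.le_opNorm _
  have h3 := Lp.hasSum_coeFn_tsum (f := fun n => blochFn (c n • (multR a).ap (C.σAt n)))
    (tsum_enorm_ne_top_iff_summable_norm.2 h2)
  rw [h1.tsum_eq] at h3
  have h4 : ∀ᵐ θ ∂muBrillouin, ∀ n, blochFn (c n • (multR a).ap (C.σAt n)) θ =
      c n • blochFn ((multR a).ap (C.σAt n)) θ := ae_all_iff.2 fun n => by
    rw [map_smul]
    exact Lp.coeFn_smul _ _
  filter_upwards [h3, h4, ha.blochFn_ap hC] with θ h5 h6 h7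
  simp only [h6, h7, smul_smul] at h5
  rw [← h5.tsum_eq]
  have hs : Summable fun n => phase θ n * c n := by
    refine Summable.of_norm ?_
    simpa only [norm_mul, norm_phase, one_mul] using hc
  simp only [mul_comm (c _)]
  exact hs.tsum_smul_const _

end Crystal

/-! ### States vanishing near the dual lattice -/

/-- The Fourier transform of `f` vanishes within distance `ε` of `Γ*`. -/
def VanishesNear (f : L2R) (ε : ℝ) : Prop :=
  ∀ᵐ ξ, ξ ∈ Metric.thickening ε dualLattice → ftL f ξ = 0

theorem xi_mem_thickening {θ : E3} {ε : ℝ} (k : Z3) :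
    xi θ k ∈ Metric.thickening ε dualLattice ↔ θ ∈ Metric.thickening ε dualLattice := by
  simp only [Metric.mem_thickening_iff, dualLattice, mem_range, exists_exists_eq_and]
  constructor
  · rintro ⟨m, hm⟩
    refine ⟨m + k, ?_⟩
    convert hm using 1
    rw [dist_eq_norm, dist_eq_norm, xi]
    congr 1
    ext j; simp [latticePt]; ring
  · rintro ⟨m, hm⟩
    refine ⟨m - k, ?_⟩
    convert hm using 1
    rw [dist_eq_norm, dist_eq_norm, xi, latticePt_sub]
    congr 1
    ext j; simp [latticePt]; ring

/-- The neighbourhood is invariant under dual lattice translations, so vanishing of all Fourier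
coefficients of the fibre at `θ` corresponds to vanishing of the transform at all points `θ - 2πk`.
-/
theorem vanishesNear_iff {f : L2R} {ε : ℝ} : VanishesNear f ε ↔
    ∀ᵐ θ ∂muBrillouin, θ ∈ Metric.thickening ε dualLattice → blochFn f θ = 0 := by
  constructor
  · intro h
    filter_upwards [ae_xi h, coefT_blochFn_eq_ftL f] with θ h1 h2 hθ
    refine ext_coefT fun k => ?_
    rw [h2, h1 k ((xi_mem_thickening k).2 hθ), map_zero]; rfl
  · intro h
    refine ae_of_xi ?_
    filter_upwards [h, coefT_blochFn_eq_ftL f] with θ h1 h2 k hθ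
    rw [← h2, h1 ((xi_mem_thickening k).1 hθ), map_zero]; rfl

theorem zero_mem_dualLattice : (0 : E3) ∈ dualLattice := ⟨0, by ext j; simp [latticePt]⟩

theorem VanishesNear.smul {f : L2R} {ε : ℝ} (h : VanishesNear f ε) (c : ℂ) :
    VanishesNear (c • f) ε := by
  rw [vanishesNear_iff] at h ⊢
  rw [map_smul]
  filter_upwards [h, Lp.coeFn_smul c (blochFn f)] with θ h1 h2 hθ
  rw [h2, Pi.smul_apply, h1 hθ, smul_zero]

theorem VanishesNear.mono {f : L2R} {ε δ : ℝ} (h : VanishesNear f ε) (hδ : δ ≤ ε) :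
    VanishesNear f δ := by
  filter_upwards [h] with ξ h1 h2
  exact h1 (Metric.thickening_mono hδ _ h2)

/-- The origin belongs to `Γ*`, so only momenta with `|ξ| ≥ ε` contribute, where the symbol of `G`
is at most `ε⁻²`. -/
theorem VanishesNear.mem_domain_symG {f : L2R} {ε : ℝ} (hε : 0 < ε) (h : VanishesNear f ε) :
    f ∈ (multR symG).domain := by
  refine mem_multR_domain ?_
  have hm : Measurable symG := by unfold symG; fun_prop
  refine ((memLp_ftL f).const_mul ((ε ^ 2)⁻¹ : ℂ)).of_le
    (hm.aestronglyMeasurable.mul (memLp_ftL f).1) ?_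
  filter_upwards [h] with ξ h1
  by_cases hξ : ‖ξ‖ < ε
  · rw [h1 (Metric.mem_thickening_iff.2 ⟨0, zero_mem_dualLattice, by simpa using hξ⟩)]
    simp
  · rw [norm_mul, norm_mul]
    refine mul_le_mul_of_nonneg_right ?_ (norm_nonneg _)
    rw [symG, Complex.norm_real, norm_inv, norm_inv, norm_pow, norm_pow, norm_norm,
      Complex.norm_real, Real.norm_of_nonneg hε.le]
    push Not at hξ
    gcongr

/-- Coefficients of a square integrable function on the Brillouin zone obtained by pairing two Bloch
transforms. -/
theorem blochSeq_toSeqL2 {h : Z3 → Fin 3 → L2R} {F : E3 → Fin 3 → L2T} {w : Fin 3 → L2R}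
    (hF : ∀ᵐ θ ∂muBrillouin, ∀ n j, blochFn (h n j) θ = phase θ n • F θ j) {c : ℝ}
    (hb : ∀ᵐ θ ∂muBrillouin, ∀ j,
      ‖(inner ℂ (F θ j) (blochFn (w j) θ) : ℂ)‖ ≤ c * ‖blochFn (w j) θ‖) :
    Memℓp (fun n => (WithLp.toLp 2 fun j => inner ℂ (h n j) (w j) : C3)) 2 ∧
    ∀ᵐ θ ∂muBrillouin,
      blochSeq (toSeqL2 fun n => WithLp.toLp 2 fun j => inner ℂ (h n j) (w j)) θ =
        WithLp.toLp 2 fun j => inner ℂ (F θ j) (blochFn (w j) θ) := by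
  have hF0 : ∀ᵐ θ ∂muBrillouin, ∀ j, F θ j = blochFn (h 0 j) θ := by
    filter_upwards [hF] with θ h1 j
    rw [h1, phase_zero, one_smul]
  have hm : ∀ j, MemLp (fun θ => (inner ℂ (F θ j) (blochFn (w j) θ) : ℂ)) 2 muBrillouin := by
    intro j
    have h1 : AEStronglyMeasurable (fun θ => (inner ℂ (F θ j) (blochFn (w j) θ) : ℂ))
        muBrillouin := by
      refine ((Lp.aestronglyMeasurable (blochFn (h 0 j))).inner (𝕜 := ℂ)
        (Lp.aestronglyMeasurable (blochFn (w j)))).congr ?_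
      filter_upwards [hF0] with θ h2
      rw [h2]
    refine ((Lp.memLp (blochFn (w j))).norm.const_mul c).of_le h1 ?_
    filter_upwards [hb] with θ h2
    exact (h2 j).trans (le_abs_self _)
  have hg : MemLp (fun θ => (WithLp.toLp 2 fun j => inner ℂ (F θ j) (blochFn (w j) θ) : C3)) 2
      muBrillouin := by
    have h1 : MemLp (fun θ => ∑ j, (inner ℂ (F θ j) (blochFn (w j) θ) : ℂ) •
        (EuclideanSpace.single j 1 : C3)) 2 muBrillouin := by
      refine memLp_finsetSum _ fun j _ => ?_
      exact ((ContinuousLinearMap.toSpanSingleton ℂ (EuclideanSpace.single j 1 : C3)).comp_memLp'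
        (hm j))
    refine h1.ae_eq (Eventually.of_forall fun θ => ?_)
    ext i
    simp [Finset.sum_apply, Pi.single_apply]
  -- Square summability is obtained backwards: take the sequence whose Fourier series is the given
  -- function, and identify it with the scalar products by comparing Fourier coefficients.
  obtain ⟨q, hq⟩ := exists_blochSeq_eq hg.toLp
  have hq' := hg.coeFn_toLp
  rw [← hq] at hq'
  have e : (fun n => (WithLp.toLp 2 fun j => inner ℂ (h n j) (w j) : C3)) = q := by
    funext n
    ext j
    have h1 := integral_phase_blochSeq q n j
    have h2 := inner_blochFn (h n j) (w j)
    have hv : (brillouinVol : ℂ) ≠ 0 := by exact_mod_cast brillouinVol_pos.ne'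
    refine mul_left_cancel₀ hv ?_
    rw [← h1]
    change (brillouinVol : ℂ) * inner ℂ (h n j) (w j) = _
    rw [← h2, L2.inner_def]
    refine integral_congr_ae ?_
    filter_upwards [hq', hF] with θ h3 h4
    rw [h3, h4, inner_smul_left]
  have hq2 : Memℓp (⇑q) 2 := lp.memℓp q
  have e2 : toSeqL2 (fun n => (WithLp.toLp 2 fun j => inner ℂ (h n j) (w j) : C3)) = q := by
    rw [e, toSeqL2, dif_pos hq2]
  refine ⟨by rw [e]; exact hq2, ?_⟩
  rw [e2]
  exact hq'

/-! ### Fibre decomposition of `S`, `S*`, `T` and `B` -/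

namespace Crystal

variable {C : Crystal}

theorem norm_ftσ_le (ξ : E3) : ‖C.ftσ ξ‖ ≤ ∫ x, ‖C.σ x‖ := by
  refine (norm_ft_le _ _).trans_eq ?_
  simp only [Complex.norm_real]

theorem norm_symGD_le (j : Fin 3) (ξ : E3) : ‖symGD j ξ‖ ≤ ‖ξ‖⁻¹ := by
  rw [symGD, norm_mul, norm_neg, Complex.norm_I, one_mul, Complex.norm_real, norm_div, norm_pow,
    norm_norm]
  rcases eq_or_ne ‖ξ‖ 0 with h | h
  · rw [h]; simp
  · rw [sq, div_mul_eq_div_div, ← one_div]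
    gcongr
    exact div_le_one_of_le₀ (PiLp.norm_apply_le ξ j) (norm_nonneg _)

theorem norm_symGDD_le (i j : Fin 3) (ξ : E3) : ‖symGDD i j ξ‖ ≤ 1 := by
  rw [symGDD, Complex.norm_real, norm_neg, norm_div, norm_mul, norm_pow, norm_norm, sq]
  exact div_le_one_of_le₀ (mul_le_mul (PiLp.norm_apply_le ξ i) (PiLp.norm_apply_le ξ j)
    (norm_nonneg _) (norm_nonneg _)) (by positivity)

theorem applicable_symGDD (hC : C.Regular) (i j : Fin 3) : C.Applicable (symGDD i j) := by
  have hm : Measurable (symGDD i j) := by unfold symGDD; fun_prop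
  refine (memLp_ftσ hC).of_le (hm.aestronglyMeasurable.mul (memLp_ftσ hC).1)
    (Eventually.of_forall fun ξ => ?_)
  rw [norm_mul]
  exact mul_le_of_le_one_left (norm_nonneg _) (norm_symGDD_le i j ξ)

/-- The symbol is at most `1/|ξ|`. Near the origin `σ̃` is bounded, as `σ ∈ L¹`, and `|ξ|⁻²` is
integrable in dimension three; outside the unit ball the symbol is at most 1 and `σ̃` is square
integrable. -/
theorem applicable_symGD (hC : C.Regular) (j : Fin 3) : C.Applicable (symGD j) := by
  have hm : Measurable (symGD j) := by unfold symGD; fun_prop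
  have hf := (memLp_ftσ hC)
  set c := ∫ x, ‖C.σ x‖
  have hball : MemLp ((Metric.ball (0 : E3) 1).indicator fun ξ => c * ‖ξ‖⁻¹) 2 volume := by
    have h1 : Measurable fun ξ : E3 => c * ‖ξ‖⁻¹ := by fun_prop
    rw [memLp_indicator_iff_restrict Metric.isOpen_ball.measurableSet,
      memLp_two_iff_integrable_sq h1.aestronglyMeasurable]
    refine integrableOn_ball_of_norm_le_rpow (C := c ^ 2) (α := 2) (by simp) ?_ ?_ ?_
    · simp; norm_num
    · refine Eventually.of_forall fun ξ => ?_
      rw [Real.norm_of_nonneg (by positivity), mul_pow, Real.rpow_neg (norm_nonneg _), inv_pow,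
        Real.rpow_two]
    · exact (h1.pow_const 2).aestronglyMeasurable
  refine (hf.norm.add hball).of_le (hm.aestronglyMeasurable.mul hf.1)
    (Eventually.of_forall fun ξ => ?_)
  have hi : 0 ≤ (Metric.ball (0 : E3) 1).indicator (fun ξ => c * ‖ξ‖⁻¹) ξ :=
    indicator_nonneg (fun ξ _ => mul_nonneg (integral_nonneg fun x => norm_nonneg _)
      (inv_nonneg.2 (norm_nonneg _))) _
  rw [norm_mul, Pi.add_apply, Real.norm_of_nonneg (add_nonneg (norm_nonneg _) hi)]
  by_cases hξ : ξ ∈ Metric.ball (0 : E3) 1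
  · rw [indicator_of_mem hξ, mul_comm c]
    refine le_add_of_nonneg_of_le (norm_nonneg _) ?_
    exact mul_le_mul (norm_symGD_le j ξ) (norm_ftσ_le ξ) (norm_nonneg _)
      (inv_nonneg.2 (norm_nonneg _))
  · refine le_add_of_le_of_nonneg (mul_le_of_le_one_left (norm_nonneg _) ?_) hi
    refine (norm_symGD_le j ξ).trans (inv_le_one_of_one_le₀ ?_)
    simpa using hξ

theorem blochFn_Sker (hC : C.Regular) :
    ∀ᵐ θ ∂muBrillouin, ∀ n j, blochFn (C.Sker n j) θ = phase θ n • C.Stker θ j := by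
  have h1 := ae_all_iff.2 fun j => (applicable_symGD hC j).blochFn_ap hC
  have h2 : ∀ᵐ θ ∂muBrillouin, ∀ n j, blochFn (C.Sker n j) θ =
      ((C.e * C.ψ₀ : ℝ) : ℂ) • blochFn ((multR (symGD j)).ap (C.σAt n)) θ := by
    rw [ae_all_iff]; intro n
    rw [ae_all_iff]; intro j
    rw [Sker, map_smul]
    exact Lp.coeFn_smul _ _
  filter_upwards [h1, h2] with θ h3 h4 n j
  rw [h4, h3, Stker, smul_comm]

theorem exists_norm_Stker_le (hC : C.Regular) {ε : ℝ} (hε : 0 < ε) : ∃ c : ℝ, 0 ≤ c ∧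
    ∀ θ ∈ brillouin, θ ∉ Metric.thickening ε dualLattice → ∀ j, ‖C.Stker θ j‖ ≤ c := by
  have hK : IsCompact (brillouin \ Metric.thickening ε dualLattice) :=
    isCompact_brillouin.diff Metric.isOpen_thickening
  have hsub : brillouin \ Metric.thickening ε dualLattice ⊆ dualLatticeᶜ := fun θ hθ h =>
    hθ.2 (Metric.self_subset_thickening hε _ h)
  have h1 : ∀ j, ∃ c, ∀ θ ∈ brillouin \ Metric.thickening ε dualLattice, ‖C.Stker θ j‖ ≤ c := by
    intro j
    refine hK.exists_bound_of_continuousOn ?_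
    have h2 : ContinuousOn ((fun _ => ((C.e * C.ψ₀ : ℝ) : ℂ)) • fun θ =>
        bddT symInv θ (C.dipoleVec θ j)) dualLatticeᶜ :=
      continuousOn_const.smul
        (admissible_symInv.continuousOn.clm_apply (continuousOn_dipoleVec hC j))
    exact (h2.congr fun θ hθ => Stker_eq hC hθ j).mono hsub
  choose c hc using h1
  refine ⟨∑ j, |c j|, Finset.sum_nonneg fun j _ => abs_nonneg _, fun θ h1 h2 j => ?_⟩
  refine (hc j θ ⟨h1, h2⟩).trans ((le_abs_self _).trans ?_)
  exact Finset.single_le_sum (f := fun j => |c j|) (fun j _ => abs_nonneg _) (Finset.mem_univ j)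

/-- The fibre kernel is bounded by compactness away from `Γ*`, and the Bloch transform of `Ψ`
vanishes on the rest of the Brillouin zone. -/
theorem blochSeq_opSstar (hC : C.Regular) {ε : ℝ} (hε : 0 < ε) {Ψ : L2R} (hΨ : VanishesNear Ψ ε) :
    ∀ᵐ θ ∂muBrillouin, blochSeq (C.opSstar Ψ) θ = C.Ststar θ (blochFn Ψ θ) := by
  obtain ⟨c, hc0, hc⟩ := exists_norm_Stker_le hC hε
  refine (blochSeq_toSeqL2 (F := fun θ j => C.Stker θ j) (w := fun _ => Ψ) (c := c)
    (blochFn_Sker hC) ?_).2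
  filter_upwards [vanishesNear_iff.1 hΨ, ae_restrict_mem isClosed_brillouin.measurableSet]
    with θ h1 h2 j
  by_cases h3 : θ ∈ Metric.thickening ε dualLattice
  · rw [h1 h3]; simp
  · exact (norm_inner_le_norm _ _).trans
      (mul_le_mul_of_nonneg_right (hc θ h2 h3 j) (norm_nonneg _))

theorem ae_blochSeq_tsum {q : SeqL2} (hq : Summable fun n => ‖q n‖) :
    ∀ᵐ θ ∂muBrillouin, ∀ j, ∑' n, phase θ n * q n j = blochSeq q θ j := by
  filter_upwards [ae_hasSum_blochSeq hq] with θ h j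
  exact (h.mapL (EuclideanSpace.proj j : C3 →L[ℂ] ℂ)).tsum_eq

theorem summable_norm_apply {q : SeqL2} (hq : Summable fun n => ‖q n‖) (j : Fin 3) :
    Summable fun n => ‖q n j‖ :=
  Summable.of_nonneg_of_le (fun _ => norm_nonneg _) (fun n => PiLp.norm_apply_le (q n) j) hq

/-- `S q` is an absolutely convergent superposition of translates of `G∂ⱼσ`, and the translation
phases sum to the Fourier series of `q`. -/
theorem blochFn_opS (hC : C.Regular) {q : SeqL2} (hq : Summable fun n => ‖q n‖) :
    ∀ᵐ θ ∂muBrillouin, blochFn (C.opS q) θ = C.St θ (blochSeq q θ) := by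
  have hs := fun j => (applicable_symGD hC j).superposition hC (summable_norm_apply hq j)
  have e : C.opS q = ((C.e * C.ψ₀ : ℝ) : ℂ) •
      ∑ j, ∑' n, q n j • (multR (symGD j)).ap (C.σAt n) := by
    have h1 := hasSum_sum (s := Finset.univ) fun j _ => (hs j).1.hasSum
    rw [opS, ← (h1.const_smul ((C.e * C.ψ₀ : ℝ) : ℂ)).tsum_eq]
    congr 1
    funext n
    rw [Finset.smul_sum]
    refine Finset.sum_congr rfl fun j _ => ?_
    rw [Sker, smul_comm]
  rw [e, map_smul, map_sum]
  filter_upwards [Lp.coeFn_smul ((C.e * C.ψ₀ : ℝ) : ℂ)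
      (∑ j, blochFn (∑' n, q n j • (multR (symGD j)).ap (C.σAt n))),
    Lp.coeFn_fun_finsetSum Finset.univ
      fun j => blochFn (∑' n, q n j • (multR (symGD j)).ap (C.σAt n)),
    ae_all_iff.2 fun j => (hs j).2, ae_blochSeq_tsum hq] with θ h1 h2 h3 h4
  rw [h1, Pi.smul_apply, h2, Finset.smul_sum]
  change _ = ∑ j, blochSeq q θ j • C.Stker θ j
  refine Finset.sum_congr rfl fun j _ => ?_
  rw [h3, h4, Stker, smul_comm]

theorem blochFn_σAt (hC : C.Regular) :
    ∀ᵐ θ ∂muBrillouin, ∀ n, blochFn (C.σAt n) θ = phase θ n • C.σT θ := by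
  rw [ae_all_iff]; intro n
  filter_upwards [coefT_blochFn_eq_ftL (C.σAt n), ae_xi (ftL_σAt hC n)] with θ h1 h2
  refine ext_coefT fun k => ?_
  rw [h1, h2, coefT_smul, hC.coefT_σT, phase_xi]

theorem symRiesz_mul_symRiesz (i j : Fin 3) (ξ : E3) :
    symRiesz i ξ * symRiesz j ξ = symGDD i j ξ := by
  have h := Complex.I_mul_I
  rw [symRiesz, symRiesz, symGDD, mul_mul_mul_comm, neg_mul_neg, h,
    ← Complex.ofReal_mul, neg_one_mul, ← Complex.ofReal_neg]
  congr 2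
  rw [div_mul_div_comm, sq]

theorem conj_symRiesz (i : Fin 3) (ξ : E3) : (starRingEnd ℂ) (symRiesz i ξ) = -symRiesz i ξ := by
  rw [symRiesz, map_mul, Complex.conj_ofReal, map_neg, Complex.conj_I, neg_mul, neg_mul]

/-- The symbol of `G∂ᵢ∂ⱼ` is a product of two Riesz symbols. These are imaginary, so moving one
factor to the left changes the sign and leaves the Gram matrix of the dipole vectors. -/
theorem inner_σT_symGDD (hC : C.Regular) {θ : E3} (hθ : θ ∉ dualLattice) (i j : Fin 3) :
    inner ℂ (C.σT θ) ((multT (symGDD i j) θ).ap (C.σT θ)) = -(C.Sig θ i j : ℂ) := by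
  have hc : ∀ k, coefT (bddT (symRiesz i) θ (C.dipoleVec θ j)) k =
      symGDD i j (xi θ k) * coefT (C.σT θ) k := fun k => by
    rw [(admissible_symRiesz i).coefT hθ, coefT_dipoleVec hC hθ, hC.coefT_σT, ← mul_assoc,
      symRiesz_mul_symRiesz]
  rw [multT_ap hc, ← inner_dipoleVec hC hθ]
  refine (hasSum_inner_coefT _ _).unique ?_
  refine (hasSum_inner_coefT (C.dipoleVec θ i) (C.dipoleVec θ j)).neg.congr_fun fun k => ?_
  rw [hc, coefT_dipoleVec hC hθ, coefT_dipoleVec hC hθ, hC.coefT_σT, RCLike.inner_apply',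
    RCLike.inner_apply', map_mul, conj_symRiesz, ← symRiesz_mul_symRiesz]
  ring

/-- `(T q)(n)` is the scalar product of `σ(· - n)` with one fixed function `wᵢ`, a superposition of
translates. The fibre of the translates is a phase times `σ̃`, which is bounded on the whole
Brillouin zone. -/
theorem blochSeq_opT (hC : C.Regular) {q : SeqL2} (hq : Summable fun n => ‖q n‖) :
    ∀ᵐ θ ∂muBrillouin, blochSeq (C.opT q) θ = C.Tt θ (blochSeq q θ) := by
  have hs := fun i j => (applicable_symGDD hC i j).superposition hC (summable_norm_apply hq j)
  let w : Fin 3 → L2R := fun i => -∑ j, ∑' n, q n j • (multR (symGDD i j)).ap (C.σAt n)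
  have hw : ∀ᵐ θ ∂muBrillouin, ∀ i, blochFn (w i) θ =
      -∑ j, blochSeq q θ j • (multT (symGDD i j) θ).ap (C.σT θ) := by
    rw [ae_all_iff]
    intro i
    simp only [w]
    rw [map_neg, map_sum]
    filter_upwards [Lp.coeFn_neg
        (∑ j, blochFn (∑' n, q n j • (multR (symGDD i j)).ap (C.σAt n))),
      Lp.coeFn_fun_finsetSum Finset.univ
        fun j => blochFn (∑' n, q n j • (multR (symGDD i j)).ap (C.σAt n)),
      ae_all_iff.2 fun j => (hs i j).2, ae_blochSeq_tsum hq] with θ h1 h2 h3 h4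
    rw [h1, Pi.neg_apply, h2]
    simp only [h3, h4]
  have e : C.opT q = toSeqL2 fun n => WithLp.toLp 2 fun i => inner ℂ (C.σAt n) (w i) := by
    rw [opT]
    congr 1
    funext n
    have h1 : ∀ i, HasSum (fun n' => ∑ j, C.Tker n n' i j * q n' j)
        (inner ℂ (C.σAt n) (w i)) := fun i => by
      have h2 := (hasSum_sum (s := Finset.univ) fun j _ => (hs i j).1.hasSum).neg.mapL
        (innerSL ℂ (C.σAt n))
      refine h2.congr_fun fun n' => ?_
      rw [innerSL_apply_apply, inner_neg_right, inner_sum, ← Finset.sum_neg_distrib]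
      refine Finset.sum_congr rfl fun j _ => ?_
      rw [inner_smul_right, Tker]
      ring
    exact ((Pi.hasSum.2 h1).mapL
      (PiLp.continuousLinearEquiv 2 ℂ (fun _ : Fin 3 => ℂ)).symm.toContinuousLinearMap).tsum_eq
  rw [e]
  obtain ⟨c, hc⟩ := isCompact_brillouin.exists_bound_of_continuousOn hC.continuous_σT.continuousOn
  filter_upwards [(blochSeq_toSeqL2 (h := fun n _ => C.σAt n) (F := fun θ _ => C.σT θ) (w := w)
    (c := c) (by filter_upwards [blochFn_σAt hC] with θ h n _; exact h n) (by
      filter_upwards [ae_restrict_mem isClosed_brillouin.measurableSet] with θ h j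
      exact (norm_inner_le_norm _ _).trans
        (mul_le_mul_of_nonneg_right (hc θ h) (norm_nonneg _)))).2, hw, ae_notMem_dualLattice]
    with θ h1 h2 h3
  rw [h1]
  ext i
  change inner ℂ (C.σT θ) (blochFn (w i) θ) = _
  rw [h2, inner_neg_right, inner_sum, ← Finset.sum_neg_distrib]
  simp only [inner_smul_right, inner_σT_symGDD hC h3]
  simp [Tt, Matrix.mulVec, dotProduct, mul_comm]

/-- States to which the energy operator applies fibrewise. -/
structure Nice (Y : X0) : Prop where
  mem1 : Y.psi1 ∈ (multR symH).domain
  mem2 : Y.psi2 ∈ (multR symH).domain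
  vanishes : ∃ ε > 0, VanishesNear Y.psi1 ε ∧ VanishesNear Y.psi2 ε
  summable_q : Summable fun n => ‖Y.q n‖
  summable_p : Summable fun n => ‖Y.p n‖

theorem Nice.J {Y : X0} (hY : Nice Y) : Nice (Quad.J Y) := by
  obtain ⟨ε, hε, h1, h2⟩ := hY.vanishes
  refine ⟨Submodule.smul_mem _ _ hY.mem2, Submodule.neg_mem _ (Submodule.smul_mem _ _ hY.mem1),
    ⟨ε, hε, h2.smul _, ?_⟩, hY.summable_p, ?_⟩
  · change VanishesNear (-((1 / 2 : ℂ) • Y.psi1)) ε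
    rw [← neg_smul]
    exact h1.smul _
  · refine hY.summable_q.congr fun n => ?_
    exact (norm_neg (Y.q n)).symm

/-- Stated with the graph, so that it contains both that the fibres of `Y` lie in the domain of
`B̃(θ)` and that the fibres of `B Y` are its values. -/
theorem blochMk_opB_mem_graph (hC : C.Regular) {Y : X0} (hY : Nice Y) :
    ∀ᵐ θ ∂muBrillouin, (blochMk Y θ, blochMk (C.opB Y) θ) ∈ (C.Bt θ).graph := by
  obtain ⟨ε, hε, hv1, hv2⟩ := hY.vanishes
  have h1 : ∀ᵐ θ ∂muBrillouin, blochFn (C.opB Y).psi1 θ =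
      (2 : ℂ) • blochFn ((multR symH).ap Y.psi1) θ +
      ((4 * C.e ^ 2 * C.ψ₀ ^ 2 : ℝ) : ℂ) • blochFn ((multR symG).ap Y.psi1) θ +
      (2 : ℂ) • blochFn (C.opS Y.q) θ := by
    change ∀ᵐ θ ∂muBrillouin, blochFn ((2 : ℂ) • (multR symH).ap Y.psi1
      + ((4 * C.e ^ 2 * C.ψ₀ ^ 2 : ℝ) : ℂ) • (multR symG).ap Y.psi1 + (2 : ℂ) • C.opS Y.q) θ = _
    rw [map_add, map_add, map_smul, map_smul, map_smul]
    filter_upwards [Lp.coeFn_add ((2 : ℂ) • blochFn ((multR symH).ap Y.psi1)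
        + ((4 * C.e ^ 2 * C.ψ₀ ^ 2 : ℝ) : ℂ) • blochFn ((multR symG).ap Y.psi1))
        ((2 : ℂ) • blochFn (C.opS Y.q)),
      Lp.coeFn_add ((2 : ℂ) • blochFn ((multR symH).ap Y.psi1))
        (((4 * C.e ^ 2 * C.ψ₀ ^ 2 : ℝ) : ℂ) • blochFn ((multR symG).ap Y.psi1)),
      Lp.coeFn_smul (2 : ℂ) (blochFn ((multR symH).ap Y.psi1)),
      Lp.coeFn_smul ((4 * C.e ^ 2 * C.ψ₀ ^ 2 : ℝ) : ℂ) (blochFn ((multR symG).ap Y.psi1)),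
      Lp.coeFn_smul (2 : ℂ) (blochFn (C.opS Y.q))] with θ a b c d e
    rw [a, Pi.add_apply, b, Pi.add_apply, c, d, e]
    rfl
  have h2 : ∀ᵐ θ ∂muBrillouin, blochFn (C.opB Y).psi2 θ =
      (2 : ℂ) • blochFn ((multR symH).ap Y.psi2) θ := by
    change ∀ᵐ θ ∂muBrillouin, blochFn ((2 : ℂ) • (multR symH).ap Y.psi2) θ = _
    rw [map_smul]
    exact Lp.coeFn_smul _ _
  have h3 : ∀ᵐ θ ∂muBrillouin, blochSeq (C.opB Y).q θ =
      (2 : ℂ) • blochSeq (C.opSstar Y.psi1) θ + blochSeq (C.opT Y.q) θ := by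
    change ∀ᵐ θ ∂muBrillouin, blochSeq ((2 : ℂ) • C.opSstar Y.psi1 + C.opT Y.q) θ = _
    rw [map_add, map_smul]
    filter_upwards [Lp.coeFn_add ((2 : ℂ) • blochSeq (C.opSstar Y.psi1)) (blochSeq (C.opT Y.q)),
      Lp.coeFn_smul (2 : ℂ) (blochSeq (C.opSstar Y.psi1))] with θ a b
    rw [a, Pi.add_apply, b]
    rfl
  have h4 : ∀ᵐ θ ∂muBrillouin, blochSeq (C.opB Y).p θ = ((C.M⁻¹ : ℝ) : ℂ) • blochSeq Y.p θ := by
    change ∀ᵐ θ ∂muBrillouin, blochSeq (((C.M⁻¹ : ℝ) : ℂ) • Y.p) θ = _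
    rw [map_smul]
    exact Lp.coeFn_smul _ _
  filter_upwards [h1, h2, h3, h4, coefT_blochFn_multR hY.mem1, coefT_blochFn_multR hY.mem2,
    coefT_blochFn_multR (hv1.mem_domain_symG hε), blochFn_opS hC hY.summable_q,
    blochSeq_opSstar hC hε hv1, blochSeq_opT hC hY.summable_q] with θ h1 h2 h3 h4 h5 h6 h7 h8 h9 h10
  have d1 : blochFn Y.psi1 θ ∈ (multT symH θ).domain := mem_multT_domain.2 ⟨_, h5⟩
  have d2 : blochFn Y.psi2 θ ∈ (multT symH θ).domain := mem_multT_domain.2 ⟨_, h6⟩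
  have d3 : blochFn Y.psi1 θ ∈ (multT symG θ).domain := mem_multT_domain.2 ⟨_, h7⟩
  refine LinearPMap.mem_graph_iff _ |>.2 ⟨⟨blochMk Y θ, ⟨d1, d3⟩, d2⟩, rfl, ?_⟩
  apply Quad.ext'
  · change (2 : ℂ) • multT symH θ ⟨_, d1⟩ + ((4 * C.e ^ 2 * C.ψ₀ ^ 2 : ℝ) : ℂ) •
      multT symG θ ⟨_, d3⟩ + (2 : ℂ) • C.St θ (blochSeq Y.q θ) = blochFn (C.opB Y).psi1 θ
    rw [h1, multT_apply h5, multT_apply h7, h8]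
  · change (2 : ℂ) • multT symH θ ⟨_, d2⟩ = blochFn (C.opB Y).psi2 θ
    rw [h2, multT_apply h6]
  · change (2 : ℂ) • C.Ststar θ (blochFn Y.psi1 θ) + C.Tt θ (blochSeq Y.q θ) =
      blochSeq (C.opB Y).q θ
    rw [h3, h9, h10]
  · exact h4.symm

end Crystal

theorem memLp_symH_ft (f : 𝓢(E3, ℂ)) : MemLp (fun ξ => symH ξ * ft f ξ) 2 volume := by
  rw [← memLp_comp_ft]
  have h := ((SchwartzMap.smulLeftCLM ℂ (fun x : E3 => ‖x‖ ^ 2) (𝓕 f)).memLp 2 volume).const_mul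
    (((2 * Real.pi) ^ 2 / 2 : ℝ) : ℂ)
  rw [SchwartzMap.smulLeftCLM_apply (Function.hasTemperateGrowth_norm_sq E3)] at h
  refine h.ae_eq (Eventually.of_forall fun w => ?_)
  have hp := Real.pi_ne_zero
  simp only [ft_eq_fourier, smul_smul]
  rw [show -(2 * Real.pi)⁻¹ * -(2 * Real.pi) = 1 by field_simp, one_smul, SchwartzMap.fourier_coe,
    symH, norm_smul, norm_neg, Real.norm_of_nonneg Real.two_pi_pos.le, Complex.real_smul]
  push_cast
  ring

theorem schwartz_mem_domain_symH (f : 𝓢(E3, ℂ)) : (f.toLp 2 : L2R) ∈ (multR symH).domain := by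
  refine mem_multR_domain ((memLp_congr_ae ?_).1 (memLp_symH_ft f))
  filter_upwards [ftL_toLp f] with ξ h
  rw [h]

theorem norm_latticePt_sq_le (n : Z3) : ‖latticePt n‖ ^ 2 ≤ 3 * ‖n‖ ^ 2 := by
  rw [EuclideanSpace.norm_sq_eq]
  calc ∑ j, ‖latticePt n j‖ ^ 2 ≤ ∑ _j : Fin 3, ‖n‖ ^ 2 := by
        refine Finset.sum_le_sum fun j _ => ?_
        have h := norm_le_pi_norm n j
        have e : ‖latticePt n j‖ = ‖n j‖ := by
          rw [← Int.norm_cast_real]; rfl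
        rw [e]
        gcongr
    _ = _ := by simp

theorem RapidlyDecreasing.summable {q : Z3 → C3} (hq : Crystal.RapidlyDecreasing q) :
    Summable fun n => ‖q n‖ := by
  obtain ⟨c0, h0⟩ := hq 0
  obtain ⟨c2, h2⟩ := hq 2
  obtain ⟨c4, h4⟩ := hq 4
  -- The coefficients come from `(1 + 3t²)² = 1 + 6t² + 9t⁴`, where `t` is the maximum norm of `n`.
  refine Summable.of_nonneg_of_le (fun _ => norm_nonneg _) (fun n => ?_)
    (summable_inv_weight.mul_left (c0 + 6 * c2 + 9 * c4))
  rw [← div_eq_mul_inv, le_div_iff₀ (weight_pos _)]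
  have hw : weight (latticePt n) ≤ 1 + 6 * ‖n‖ ^ 2 + 9 * ‖n‖ ^ 4 := by
    have h := norm_latticePt_sq_le n
    have h' : (1 + ‖latticePt n‖ ^ 2) ^ 2 ≤ (1 + 3 * ‖n‖ ^ 2) ^ 2 := by gcongr
    refine h'.trans_eq ?_
    ring
  have h0 := h0 n
  have h2 := h2 n
  have h4 := h4 n
  have := mul_le_mul_of_nonneg_left hw (norm_nonneg (q n))
  simp only [pow_zero, one_mul] at h0
  nlinarith

/-! ### Test vectors and the formal adjoint -/

namespace Crystal

variable {C : Crystal}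

theorem nice_of_mem_CoreD {Y : X0} (hY : Y ∈ CoreD) : Nice Y := by
  obtain ⟨⟨f, hf, h1⟩, ⟨g, hg, h2⟩, h3, h4⟩ := hY
  have hv : ∀ f : 𝓢(E3, ℂ), InSPlus f → ∃ ε > 0, VanishesNear (f.toLp 2) ε := by
    rintro f ⟨ε, hε, h⟩
    refine ⟨ε, hε, ?_⟩
    filter_upwards [ftL_toLp f] with ξ h1 h2
    obtain ⟨γ, hγ, hd⟩ := Metric.mem_thickening_iff.1 h2
    rw [h1, h ξ γ hγ hd]
  obtain ⟨ε, hε, h5⟩ := hv f hf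
  obtain ⟨δ, hδ, h6⟩ := hv g hg
  refine ⟨h1 ▸ schwartz_mem_domain_symH f, h2 ▸ schwartz_mem_domain_symH g,
    ⟨min ε δ, lt_min hε hδ, h1 ▸ h5.mono (min_le_left _ _), h2 ▸ h6.mono (min_le_right _ _)⟩,
    summable_of_hasFiniteSupport (h3.subset fun n hn h => ?_),
    summable_of_hasFiniteSupport (h4.subset fun n hn h => ?_)⟩
  · exact hn (norm_eq_zero.2 h)
  · exact hn (norm_eq_zero.2 h)

theorem exists_thickening_disjoint {K : Set E3} (hK : IsCompact K) (hsub : K ⊆ dualLatticeᶜ) :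
    ∃ ε > 0, Disjoint (Metric.thickening ε dualLattice) K := by
  obtain ⟨ε, hε, h⟩ := (disjoint_left.2 fun x hx => hsub hx : Disjoint K dualLattice).exists_thickenings
    hK isClosed_dualLattice
  exact ⟨ε, hε, (h.mono_left (Metric.self_subset_thickening hε K)).symm⟩

/-- A compact subset of `Π*₊` has positive distance from the closed set `Γ*`, so the Bloch transform
vanishes in a uniform neighbourhood of `Γ*`. -/
theorem nice_of_mem_Test {V : X0} (hV : V ∈ C.Test) : Nice V := by
  obtain ⟨⟨f, h1⟩, ⟨g, h2⟩, h3, h4, K, hKs, hK, h5⟩ := hV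
  obtain ⟨ε, hε, hd⟩ := exists_thickening_disjoint hK fun θ hθ => (hKs hθ).2.1
  have hz : ∀ᵐ θ ∂muBrillouin, θ ∈ Metric.thickening ε dualLattice → blochMk V θ = 0 := by
    filter_upwards [h5, bloch_ae_eq V] with θ h6 h7 h8
    rw [← h7]
    exact h6 fun h9 => disjoint_left.1 hd h8 h9
  refine ⟨h1 ▸ schwartz_mem_domain_symH f, h2 ▸ schwartz_mem_domain_symH g,
    ⟨ε, hε, vanishesNear_iff.2 ?_, vanishesNear_iff.2 ?_⟩, RapidlyDecreasing.summable h3,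
    RapidlyDecreasing.summable h4⟩
  · filter_upwards [hz] with θ h hθ
    exact congrArg Quad.psi1 (h hθ)
  · filter_upwards [hz] with θ h hθ
    exact congrArg Quad.psi2 (h hθ)

theorem ae_mem_posSet (hW : C.Wiener) : ∀ᵐ θ ∂muBrillouin, θ ∈ C.posSet := by
  filter_upwards [hW, ae_notMem_dualLattice] with θ h1 h2
  exact ⟨h2, h1⟩

theorem inner_Bt_graph (hC : C.Regular) (hM : 0 < C.M) {θ : E3} (hθ : θ ∈ C.posSet)
    {x y x' y' : X0T} (h : (x, y) ∈ (C.Bt θ).graph) (h' : (x', y') ∈ (C.Bt θ).graph) :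
    inner ℂ x y' = inner ℂ y x' := by
  have hi := hasInverse_Bt hC hM hθ
  rw [(hi x y).1 h, (hi x' y').1 h']
  have hs := (nonneg_BtInv hC hM hθ).isSelfAdjoint
  rw [← ContinuousLinearMap.adjoint_inner_right]
  congr 1
  rw [← ContinuousLinearMap.star_eq_adjoint, hs.star_eq]

end Crystal

theorem Quad.inner_mk_left {H Q : Type} [NormedAddCommGroup H] [InnerProductSpace ℂ H]
    [NormedAddCommGroup Q] [InnerProductSpace ℂ Q] (a b : H) (c d : Q) (Y : Quad H Q) :
    inner ℂ (Quad.mk a b c d) Y = inner ℂ a Y.psi1 + inner ℂ b Y.psi2 +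
      (inner ℂ c Y.q + inner ℂ d Y.p) := inner_eq _ _

theorem Quad.inner_J {H Q : Type} [NormedAddCommGroup H] [InnerProductSpace ℂ H]
    [NormedAddCommGroup Q] [InnerProductSpace ℂ Q] (X Y : Quad H Q) :
    inner ℂ X (Quad.J Y) = -inner ℂ (Quad.J X) Y := by
  rw [inner_eq, inner_eq]
  change inner ℂ X.psi1 ((1 / 2 : ℂ) • Y.psi2) + inner ℂ X.psi2 (-((1 / 2 : ℂ) • Y.psi1)) +
    (inner ℂ X.q Y.p + inner ℂ X.p (-Y.q)) = -(inner ℂ ((1 / 2 : ℂ) • X.psi2) Y.psi1 +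
      inner ℂ (-((1 / 2 : ℂ) • X.psi1)) Y.psi2 + (inner ℂ X.p Y.q + inner ℂ (-X.q) Y.p))
  simp only [inner_smul_right, inner_smul_left, inner_neg_left, inner_neg_right, map_div₀, map_one,
    map_ofNat]
  ring

namespace Crystal

variable {C : Crystal}

/-- Parseval reduces the claim to the fibres, where `B̃(θ)` is the inverse of a selfadjoint operator
for almost every `θ` by the Wiener condition. -/
theorem inner_opB (hC : C.Regular) (hM : 0 < C.M) (hW : C.Wiener) {X Y : X0} (hX : Nice X)
    (hY : Nice Y) : inner ℂ X (C.opB Y) = inner ℂ (C.opB X) Y := by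
  have hv : (brillouinVol : ℂ) ≠ 0 := by exact_mod_cast brillouinVol_pos.ne'
  refine mul_left_cancel₀ hv ?_
  rw [← integral_inner_blochMk, ← integral_inner_blochMk]
  refine integral_congr_ae ?_
  filter_upwards [blochMk_opB_mem_graph hC hX, blochMk_opB_mem_graph hC hY, ae_mem_posSet hW]
    with θ h1 h2 h3
  exact inner_Bt_graph hC hM h3 h1 h2

theorem inner_opA (hC : C.Regular) (hM : 0 < C.M) (hW : C.Wiener) {Y V : X0} (hY : Nice Y)
    (hV : Nice V) : inner ℂ V (C.opA Y) = inner ℂ (C.opAstar V) Y := by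
  rw [opA, opAstar, Quad.inner_J, inner_neg_left, inner_opB hC hM hW hV.J hY]

/-! ### Basis vectors of the fibre and the action of `B̃(θ)` on them -/

/-- Labels of the basis vectors of `X⁰(T³)`. -/
abbrev Mode : Type := (Z3 ⊕ Z3) ⊕ (Fin 3 ⊕ Fin 3)

/-- The basis vectors of `X⁰(T³)`. -/
def modeVec : Mode → X0T
  | .inl (.inl k) => Quad.mk (waveT k) 0 0 0
  | .inl (.inr k) => Quad.mk 0 (waveT k) 0 0
  | .inr (.inl j) => Quad.mk 0 0 (EuclideanSpace.single j 1) 0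
  | .inr (.inr j) => Quad.mk 0 0 0 (EuclideanSpace.single j 1)

/-- The image of a basis vector under `B̃(θ)`. -/
def BtMode (C : Crystal) (θ : E3) : Mode → X0T
  | .inl (.inl k) => Quad.mk (((‖xi θ k‖ ^ 2 + C.coupling ^ 2 * (‖xi θ k‖⁻¹) ^ 2 : ℝ) : ℂ) • waveT k)
      0 (((C.coupling * ‖xi θ k‖⁻¹ : ℝ) : ℂ) • (C.dipole θ).adjoint (waveT k)) 0
  | .inl (.inr k) => Quad.mk 0 (((‖xi θ k‖ ^ 2 : ℝ) : ℂ) • waveT k) 0 0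
  | .inr (.inl j) => Quad.mk ((C.coupling : ℂ) • bddT symInv θ (C.dipole θ (EuclideanSpace.single j 1)))
      0 ((C.dipole θ).adjoint (C.dipole θ (EuclideanSpace.single j 1))) 0
  | .inr (.inr j) => Quad.mk 0 0 0 ((C.M⁻¹ : ℂ) • EuclideanSpace.single j 1)

theorem electric_mk (θ : E3) (a b : L2T) (c d : C3) : C.electric θ (Quad.mk a b c d) =
    (C.coupling : ℂ) • bddT symInv θ a + C.dipole θ c := rfl

theorem coefT_zero (k : Z3) : coefT 0 k = 0 := by rw [map_zero]; rfl

theorem BtMode_mem_graph (hC : C.Regular) {θ : E3} (hθ : θ ∉ dualLattice) (m : Mode) :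
    (modeVec m, C.BtMode θ m) ∈ (C.Bt θ).graph := by
  rw [mem_Bt_graph hC hθ]
  rcases m with (k | k) | (j | j)
  · have he : bddT symInv θ (waveT k) = ((‖xi θ k‖⁻¹ : ℝ) : ℂ) • waveT k := by
      refine ext_coefT fun l => ?_
      rw [coefT_bddT_symInv hθ, coefT_smul, coefT_waveT]
      by_cases h : l = k
      · rw [h]
      · rw [if_neg h, mul_zero, mul_zero]
    simp only [modeVec, BtMode, electric_mk, map_zero (C.dipole θ), add_zero]
    refine ⟨fun l => ?_, fun l => ?_, ?_, ?_⟩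
    · change coefT (_ • waveT k) l = _ * coefT (waveT k) l + _
      rw [coefT_smul, coefT_smul, coefT_bddT_symInv hθ, coefT_waveT]
      by_cases h : l = k
      · rw [if_pos h, h]; push_cast; ring
      · rw [if_neg h]; ring
    · change coefT 0 l = _ * coefT 0 l
      rw [coefT_zero, mul_zero]
    · change _ • (C.dipole θ).adjoint (waveT k) = _
      rw [he, smul_smul, map_smul]
      push_cast; rfl
    · change (0 : C3) = _ • 0
      rw [smul_zero]
  · simp only [modeVec, BtMode, electric_mk, map_zero (bddT symInv θ),
      map_zero (C.dipole θ), add_zero, smul_zero, map_zero (C.dipole θ).adjoint]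
    refine ⟨fun l => ?_, fun l => ?_, rfl, (smul_zero _).symm⟩
    · change coefT 0 l = _ * coefT 0 l + _
      rw [coefT_zero]; ring
    · change coefT (_ • waveT k) l = _ * coefT (waveT k) l
      rw [coefT_smul, coefT_waveT]
      by_cases h : l = k
      · rw [h]
      · rw [if_neg h, mul_zero, mul_zero]
  · simp only [modeVec, BtMode, electric_mk, map_zero (bddT symInv θ),
      zero_add, smul_zero]
    refine ⟨fun l => ?_, fun l => ?_, rfl, (smul_zero _).symm⟩
    · change coefT (_ • _) l = _ * coefT 0 l + _
      rw [coefT_smul, coefT_bddT_symInv hθ, coefT_zero]; ring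
    · change coefT 0 l = _ * coefT 0 l
      rw [coefT_zero, mul_zero]
  · simp only [modeVec, BtMode, electric_mk, map_zero (bddT symInv θ),
      map_zero (C.dipole θ), add_zero, smul_zero, map_zero (C.dipole θ).adjoint]
    refine ⟨fun l => ?_, fun l => ?_, rfl, rfl⟩
    · change coefT 0 l = _ * coefT 0 l + _
      rw [coefT_zero]; ring
    · change coefT 0 l = _ * coefT 0 l
      rw [coefT_zero, mul_zero]

/-- The basis vectors form a core of `B̃(θ)`. -/
theorem mem_Bt_graph_of_modes (hC : C.Regular) {θ : E3} (hθ : θ ∉ dualLattice) {x y : X0T}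
    (h : ∀ m, inner ℂ (C.BtMode θ m) x = inner ℂ (modeVec m) y) : (x, y) ∈ (C.Bt θ).graph := by
  rw [mem_Bt_graph hC hθ]
  refine ⟨fun k => ?_, fun k => ?_, ?_, ?_⟩
  · have h1 := h (.inl (.inl k))
    simp only [modeVec, BtMode, Quad.inner_mk_left, inner_zero_left, add_zero] at h1
    rw [inner_smul_left, inner_smul_left, Complex.conj_ofReal, Complex.conj_ofReal,
      ContinuousLinearMap.adjoint_inner_left, inner_waveT, inner_waveT, inner_waveT] at h1
    rw [← h1, electric, coefT_add, coefT_smul, coefT_bddT_symInv hθ]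
    push_cast
    ring
  · have h1 := h (.inl (.inr k))
    simp only [modeVec, BtMode, Quad.inner_mk_left, inner_zero_left, add_zero, zero_add] at h1
    rw [inner_smul_left, Complex.conj_ofReal, inner_waveT, inner_waveT] at h1
    exact h1.symm
  · ext j
    have h1 := h (.inr (.inl j))
    simp only [modeVec, BtMode, Quad.inner_mk_left, inner_zero_left, add_zero, zero_add] at h1
    rw [inner_smul_left, Complex.conj_ofReal, inner_bddT admissible_symInv hθ conj_symInv,
      ContinuousLinearMap.adjoint_inner_left, ← inner_smul_right, ← inner_add_right,
      ← ContinuousLinearMap.adjoint_inner_right, EuclideanSpace.inner_single_left,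
      EuclideanSpace.inner_single_left, map_one, one_mul, one_mul] at h1
    exact h1.symm
  · ext j
    have h1 := h (.inr (.inr j))
    simp only [modeVec, BtMode, Quad.inner_mk_left, inner_zero_left, add_zero, zero_add] at h1
    rw [inner_smul_left, map_inv₀, Complex.conj_ofReal, EuclideanSpace.inner_single_left,
      EuclideanSpace.inner_single_left, map_one, one_mul, one_mul] at h1
    exact h1.symm

/-- The label of the basis vector that is proportional to `J` of a given one. -/
def Mode.conj : Mode → Mode
  | .inl (.inl k) => .inl (.inr k)
  | .inl (.inr k) => .inl (.inl k)
  | .inr (.inl j) => .inr (.inr j)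
  | .inr (.inr j) => .inr (.inl j)

/-- The weak equation involves `BJV`. Since `J` permutes the basis vectors up to nonzero scalars,
`JV` still ranges over all of them. -/
theorem exists_J_modeVec (m : Mode) :
    ∃ c : ℂ, c ≠ 0 ∧ Quad.J (modeVec m.conj) = c • modeVec m := by
  rcases m with (k | k) | (j | j)
  · refine ⟨1 / 2, by norm_num, Quad.ext' rfl ?_ ?_ ?_⟩
    · change -((1 / 2 : ℂ) • (0 : L2T)) = (1 / 2 : ℂ) • 0
      simp
    · change (0 : C3) = (1 / 2 : ℂ) • 0
      simp
    · change -(0 : C3) = (1 / 2 : ℂ) • 0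
      simp
  · refine ⟨-(1 / 2), by norm_num, Quad.ext' ?_ ?_ ?_ ?_⟩
    · change (1 / 2 : ℂ) • (0 : L2T) = -(1 / 2 : ℂ) • 0
      simp
    · change -((1 / 2 : ℂ) • waveT k) = -(1 / 2 : ℂ) • waveT k
      rw [neg_smul]
    · change (0 : C3) = -(1 / 2 : ℂ) • 0
      simp
    · change -(0 : C3) = -(1 / 2 : ℂ) • 0
      simp
  · refine ⟨1, by norm_num, Quad.ext' ?_ ?_ ?_ ?_⟩
    · change (1 / 2 : ℂ) • (0 : L2T) = (1 : ℂ) • 0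
      simp
    · change -((1 / 2 : ℂ) • (0 : L2T)) = (1 : ℂ) • 0
      simp
    · exact (one_smul ℂ _).symm
    · change -(0 : C3) = (1 : ℂ) • 0
      simp
  · refine ⟨-1, by norm_num, Quad.ext' ?_ ?_ ?_ ?_⟩
    · change (1 / 2 : ℂ) • (0 : L2T) = (-1 : ℂ) • 0
      simp
    · change -((1 / 2 : ℂ) • (0 : L2T)) = (-1 : ℂ) • 0
      simp
    · change (0 : C3) = (-1 : ℂ) • 0
      simp
    · change -(EuclideanSpace.single j (1 : ℂ)) = (-1 : ℂ) • (EuclideanSpace.single j (1 : ℂ))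
      rw [neg_one_smul]

end Crystal

/-! ### Test vectors with prescribed Bloch transform -/

/-- The interior `(0, 2π)³` of the Brillouin zone. -/
def openCell : Set E3 := {θ | ∀ j, θ j ∈ Ioo 0 (2 * Real.pi)}

theorem isOpen_openCell : IsOpen openCell := by
  simp only [openCell, ofPred_forall]
  refine isOpen_iInter_of_finite fun j => ?_
  exact isOpen_Ioo.preimage (by fun_prop : Continuous fun θ : E3 => θ j)

theorem openCell_subset : openCell ⊆ brillouin := fun _ h j => Ioo_subset_Icc_self (h j)

theorem ae_mem_openCell : ∀ᵐ θ ∂muBrillouin, θ ∈ openCell := by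
  have h1 : (univ.pi fun _ : Fin 3 => Ioo (0 : ℝ) (2 * Real.pi)) =ᵐ[volume]
      Icc (fun _ => (0 : ℝ)) fun _ => 2 * Real.pi := Measure.univ_pi_Ioo_ae_eq_Icc
  have h2 := (PiLp.volume_preserving_ofLp (Fin 3)).quasiMeasurePreserving.preimage_ae_eq h1
  have e1 : brillouin = WithLp.ofLp ⁻¹' (Icc (fun _ : Fin 3 => (0 : ℝ)) fun _ => 2 * Real.pi) := by
    ext θ
    simp [brillouin, Pi.le_def, forall_and]
  have e2 : openCell = WithLp.ofLp ⁻¹' (univ.pi fun _ : Fin 3 => Ioo (0 : ℝ) (2 * Real.pi)) := by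
    ext θ
    simp [openCell]
  rw [muBrillouin, e1, ← Measure.restrict_congr_set h2, ← e2]
  exact ae_restrict_mem isOpen_openCell.measurableSet

/-- Coordinatewise, a multiple of `2π` leading from `[0, 2π]` into `(0, 2π)` has an integer factor
strictly between -1 and 1. -/
theorem eq_of_mem_openCell {θ : E3} (hθ : θ ∈ brillouin) {k l : Z3}
    (h : θ - (2 * Real.pi) • latticePt l + (2 * Real.pi) • latticePt k ∈ openCell) : l = k := by
  have hp : 0 < 2 * Real.pi := by positivity
  funext j
  have h1 := hθ j
  have h2 := h j
  have e : (θ - (2 * Real.pi) • latticePt l + (2 * Real.pi) • latticePt k) j =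
      θ j + (2 * Real.pi) * ((k j - l j : ℤ) : ℝ) := by
    simp [latticePt]; ring
  rw [e] at h2
  obtain ⟨h3, h4⟩ := h1
  obtain ⟨h5, h6⟩ := h2
  have h7 : (-1 : ℝ) < ((k j - l j : ℤ) : ℝ) := by
    by_contra hc
    push Not at hc
    nlinarith
  have h8 : ((k j - l j : ℤ) : ℝ) < 1 := by
    by_contra hc
    push Not at hc
    nlinarith
  have h9 : (-1 : ℤ) < k j - l j := by exact_mod_cast h7
  have h10 : k j - l j < 1 := by exact_mod_cast h8
  omega

section

variable {φ : E3 → ℝ} (h1 : ContDiff ℝ (⊤ : ℕ∞) φ) (h2 : HasCompactSupport φ)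
  (h3 : tsupport φ ⊆ openCell)

include h1 h2 h3

/-- Choose `f` with Fourier transform `φ(ξ + 2πk)`. The `l`-th coefficient at `θ` is `φ(θ - 2πl +
2πk)`, and the support of `φ` in the open cell leaves only `l = k`. -/
theorem exists_schwartz_bloch (k : Z3) : ∃ f : 𝓢(E3, ℂ),
    ∀ᵐ θ ∂muBrillouin, blochFn (f.toLp 2) θ = (φ θ : ℂ) • waveT k := by
  have hr : -(2 * Real.pi) ≠ 0 := by have := Real.pi_pos; exact neg_ne_zero.2 (by positivity)
  let h : E3 → ℂ := fun w => (φ (-(2 * Real.pi) • w + (2 * Real.pi) • latticePt k) : ℂ)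
  have hc : HasCompactSupport h := by
    have := h2.comp_homeomorph ((Homeomorph.smulOfNeZero (α := E3) _ hr).trans
      (Homeomorph.addRight ((2 * Real.pi) • latticePt k)))
    exact this.comp_left (g := Complex.ofReal) Complex.ofReal_zero
  have hs : ContDiff ℝ (⊤ : ℕ∞) h :=
    Complex.ofRealCLM.contDiff.comp (h1.comp (by fun_prop))
  refine ⟨𝓕⁻ (hc.toSchwartzMap hs), ?_⟩
  filter_upwards [coefT_blochFn_toLp (𝓕⁻ (hc.toSchwartzMap hs)),
    ae_restrict_mem Crystal.isClosed_brillouin.measurableSet] with θ h4 h5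
  refine ext_coefT fun l => ?_
  rw [h4, ft_eq_fourier, ← SchwartzMap.fourier_coe, FourierTransform.fourier_fourierInv_eq]
  change (φ (-(2 * Real.pi) • -(2 * Real.pi)⁻¹ • xi θ l + (2 * Real.pi) • latticePt k) : ℂ) = _
  have hp := Real.pi_ne_zero
  rw [smul_smul, show -(2 * Real.pi) * -(2 * Real.pi)⁻¹ = 1 by field_simp, one_smul,
    Crystal.coefT_smul, coefT_waveT]
  by_cases hlk : l = k
  · rw [if_pos hlk, hlk, xi, sub_add_cancel, mul_one]
  · rw [if_neg hlk, mul_zero]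
    have : φ (xi θ l + (2 * Real.pi) • latticePt k) = 0 := by
      refine image_eq_zero_of_notMem_tsupport fun h6 => hlk ?_
      exact eq_of_mem_openCell h5 (h3 h6)
    rw [this, Complex.ofReal_zero]

/-- The Fourier coefficients of `φ` are samples, at `n/2π`, of the Fourier transform of a smooth
compactly supported function. That transform is Schwartz, so they decrease rapidly. -/
theorem exists_seq_bloch (j : Fin 3) : ∃ q : SeqL2, Crystal.RapidlyDecreasing q ∧
    ∀ᵐ θ ∂muBrillouin, blochSeq q θ = (φ θ : ℂ) • EuclideanSpace.single j 1 := by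
  let h : E3 → ℂ := fun w => (φ w : ℂ)
  have hc : HasCompactSupport h := h2.comp_left (g := Complex.ofReal) Complex.ofReal_zero
  have hs : ContDiff ℝ (⊤ : ℕ∞) h := Complex.ofRealCLM.contDiff.comp h1
  have hm : MemLp (fun θ => h θ • (EuclideanSpace.single j 1 : C3)) 2 muBrillouin :=
    (ContinuousLinearMap.toSpanSingleton ℂ (EuclideanSpace.single j 1 : C3)).comp_memLp'
      ((hs.continuous.memLp_of_hasCompactSupport hc).restrict _)
  obtain ⟨q, hq⟩ := exists_blochSeq_eq hm.toLp
  have hq' := hm.coeFn_toLp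
  rw [← hq] at hq'
  refine ⟨q, ?_, hq'⟩
  let Φ : 𝓢(E3, ℂ) := 𝓕 (hc.toSchwartzMap hs)
  have hv := brillouinVol_pos
  have hv' : (brillouinVol : ℂ) ≠ 0 := by exact_mod_cast hv.ne'
  have hp := Real.pi_pos
  have key : ∀ n, q n = ((brillouinVol : ℂ)⁻¹ * Φ ((2 * Real.pi)⁻¹ • latticePt n)) •
      EuclideanSpace.single j (1 : ℂ) := fun n => by
    ext i
    have h4 := integral_phase_blochSeq q n i
    have h5 : ∫ θ, (starRingEnd ℂ) (phase θ n) * blochSeq q θ i ∂muBrillouin =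
        Φ ((2 * Real.pi)⁻¹ • latticePt n) * (EuclideanSpace.single j (1 : ℂ) : C3) i := by
      have h6 : Φ ((2 * Real.pi)⁻¹ • latticePt n) =
          ∫ θ, (starRingEnd ℂ) (phase θ n) * h θ ∂muBrillouin := by
        have h7 : ∀ θ, θ ∉ brillouin → (starRingEnd ℂ) (phase θ n) * h θ = 0 := fun θ hθ => by
          have : φ θ = 0 := image_eq_zero_of_notMem_tsupport fun h8 => hθ (openCell_subset (h3 h8))
          simp [h, this]
        rw [setIntegral_eq_integral_of_forall_compl_eq_zero h7]
        change 𝓕 h _ = _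
        rw [Real.fourier_eq']
        refine integral_congr_ae (Eventually.of_forall fun θ => ?_)
        simp only [smul_eq_mul]
        congr 1
        rw [phase_eq_wave, conj_wave, wave, real_inner_smul_right, inner_neg_left]
        congr 1
        push_cast
        field_simp
      rw [h6, ← integral_mul_const]
      refine integral_congr_ae ?_
      filter_upwards [hq'] with θ h7
      rw [h7]
      simp
    rw [h5] at h4
    change q n i = ((brillouinVol : ℂ)⁻¹ * Φ ((2 * Real.pi)⁻¹ • latticePt n)) *
      (EuclideanSpace.single j (1 : ℂ) : C3) i
    rw [mul_assoc, h4, ← mul_assoc, inv_mul_cancel₀ hv', one_mul]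
  intro m
  obtain ⟨c, hc0, hc⟩ := Φ.decay m 0
  refine ⟨brillouinVol⁻¹ * ((2 * Real.pi) ^ m * c), fun n => ?_⟩
  have h4 := hc ((2 * Real.pi)⁻¹ • latticePt n)
  rw [norm_iteratedFDeriv_zero, norm_smul, norm_inv, Real.norm_of_nonneg (by positivity)] at h4
  have h5 : ‖n‖ ≤ ‖latticePt n‖ := by
    refine (pi_norm_le_iff_of_nonneg (norm_nonneg _)).2 fun i => ?_
    have := PiLp.norm_apply_le (latticePt n) i
    rwa [show ‖latticePt n i‖ = ‖n i‖ by rw [← Int.norm_cast_real]; rfl] at this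
  rw [key, norm_smul, norm_mul, norm_inv, Complex.norm_real, Real.norm_of_nonneg hv.le,
    PiLp.norm_single, norm_one, mul_one]
  have h6 : ‖n‖ ^ m ≤ (2 * Real.pi) ^ m * ((2 * Real.pi)⁻¹ * ‖latticePt n‖) ^ m := by
    rw [← mul_pow, mul_inv_cancel_left₀ (by positivity)]
    gcongr
  calc ‖n‖ ^ m * (brillouinVol⁻¹ * ‖Φ ((2 * Real.pi)⁻¹ • latticePt n)‖)
      ≤ ((2 * Real.pi) ^ m * ((2 * Real.pi)⁻¹ * ‖latticePt n‖) ^ m) *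
        (brillouinVol⁻¹ * ‖Φ ((2 * Real.pi)⁻¹ • latticePt n)‖) := by gcongr
    _ = brillouinVol⁻¹ * ((2 * Real.pi) ^ m * (((2 * Real.pi)⁻¹ * ‖latticePt n‖) ^ m *
        ‖Φ ((2 * Real.pi)⁻¹ • latticePt n)‖)) := by ring
    _ ≤ _ := by gcongr

end

/-- The Sobolev condition supplies `u ∈ L²` which is `(1 + |w|²)^{1/2}` times the Fourier transform,
as a tempered distribution. Dividing by the weight within `L²` recovers the transform itself,
because `L²` embeds injectively into tempered distributions. -/
theorem memLp_norm_ftL_of_memSobolev {f : L2R}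
    (hf : TemperedDistribution.MemSobolev 1 2 (Lp.toTemperedDistribution f)) :
    MemLp (fun ξ => ((‖ξ‖ : ℝ) : ℂ) * ftL f ξ) 2 volume := by
  obtain ⟨u, hu⟩ := TemperedDistribution.memSobolev_iff_exists_smulLeftCLM_fourier.mp hf
  have hb : MemLp (fun x : E3 => Complex.ofReal ((1 + ‖x‖ ^ 2) ^ (-1 / 2 : ℝ) : ℝ)) ⊤ volume := by
    have hg : (fun x : E3 => (1 + ‖x‖ ^ 2) ^ (-1 / 2 : ℝ)).HasTemperateGrowth := by fun_prop
    refine memLp_top_of_bound (C := 1)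
      (Complex.continuous_ofReal.comp hg.1.continuous).aestronglyMeasurable
      (Eventually.of_forall fun x => ?_)
    rw [Complex.norm_real, Real.norm_eq_abs, abs_eq_self.mpr (by positivity)]
    exact Real.rpow_le_one_of_one_le_of_nonpos (by simp) (by norm_num)
  have h1 : (𝓕 f : L2R) = (hb.toLp • u : L2R) := by
    have hinj : Function.Injective (Lp.toTemperedDistributionCLM ℂ (volume : Measure E3) 2) :=
      LinearMap.ker_eq_bot.1 Lp.ker_toTemperedDistributionCLM_eq_bot
    apply hinj
    rw [Lp.toTemperedDistributionCLM_apply, Lp.toTemperedDistributionCLM_apply,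
      Lp.toTemperedDistribution_smul_eq (by fun_prop), ← hu,
      TemperedDistribution.smulLeftCLM_smulLeftCLM_apply (by fun_prop) (by fun_prop),
      Lp.fourier_toTemperedDistribution_eq]
    have hmul : ((fun x : E3 => (((1 + ‖x‖ ^ 2) ^ ((1 : ℝ) / 2) : ℝ) : ℂ)) *
        fun x : E3 => (((1 + ‖x‖ ^ 2) ^ (-1 / 2 : ℝ) : ℝ) : ℂ)) = fun _ => 1 := by
      funext x
      rw [Pi.mul_apply, ← Complex.ofReal_mul, ← Real.rpow_add (by positivity)]
      norm_num
    rw [hmul, TemperedDistribution.smulLeftCLM_const, one_smul]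
  rw [← memLp_comp_ft]
  have hp := Real.pi_pos
  -- The two frequency variables are related by `ξ = -2πw`, so `|ξ| ≤ 2π(1 + |w|²)^{1/2}`.
  refine ((Lp.memLp u).const_mul ((2 * Real.pi : ℝ) : ℂ)).of_le ?_ ?_
  · have := (memLp_comp_ft.2 (memLp_ftL f)).1
    exact AEStronglyMeasurable.mul (by fun_prop) this
  · filter_upwards [Lp.coeFn_lpSMul (r := 2) hb.toLp u, hb.coeFn_toLp] with w h2 h3
    simp only [ftL, smul_smul]
    rw [show -(2 * Real.pi)⁻¹ * -(2 * Real.pi) = 1 by field_simp, one_smul, h1, h2, Pi.smul_apply',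
      h3, smul_eq_mul, ← mul_assoc, norm_mul, norm_mul _ (u w)]
    refine mul_le_mul_of_nonneg_right ?_ (norm_nonneg _)
    rw [norm_mul, Complex.norm_real, Complex.norm_real, Complex.norm_real, norm_norm, norm_smul,
      norm_neg, Real.norm_of_nonneg (by positivity : 0 ≤ 2 * Real.pi), mul_assoc,
      Real.norm_of_nonneg (by positivity : (0 : ℝ) ≤ (1 + ‖w‖ ^ 2) ^ (-1 / 2 : ℝ))]
    refine mul_le_of_le_one_right (by positivity) ?_
    rw [show (-1 / 2 : ℝ) = -(1 / 2) by norm_num, Real.rpow_neg (by positivity), ← Real.sqrt_eq_rpow,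
      ← div_eq_mul_inv]
    refine div_le_one_of_le₀ (Real.le_sqrt_of_sq_le (by linarith)) (Real.sqrt_nonneg _)

namespace Crystal

variable {C : Crystal}

theorem Test_subset_CoreD0 {V : X0} (hV : V ∈ C.Test) : V ∈ CoreD0 := by
  obtain ⟨⟨f, h1⟩, ⟨g, h2⟩, h3, h4, K, hKs, hK, h5⟩ := hV
  refine ⟨?_, ?_, Kᶜ, hK.isClosed.isOpen_compl, fun γ hγ hγK => (hKs hγK).2.1 hγ, h5⟩
  · rw [← h1, Lp.toTemperedDistribution_toLp_eq]
    exact f.memSobolev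
  · rw [← h2, Lp.toTemperedDistribution_toLp_eq]
    exact g.memSobolev

theorem rapidlyDecreasing_zero : RapidlyDecreasing (0 : SeqL2) := fun k =>
  ⟨0, fun n => by simp⟩

theorem mem_Test_mk {f g : 𝓢(E3, ℂ)} {q p : SeqL2} (hq : RapidlyDecreasing q)
    (hp : RapidlyDecreasing p) (hK : ∃ K ⊆ C.PiPlus, IsCompact K ∧
      ∀ᵐ θ ∂muBrillouin, θ ∉ K → bloch (Quad.mk (f.toLp 2) (g.toLp 2) q p) θ = 0) :
    (Quad.mk (f.toLp 2) (g.toLp 2) q p : X0) ∈ C.Test :=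
  ⟨⟨f, rfl⟩, ⟨g, rfl⟩, hq, hp, hK⟩

theorem exists_test {φ : E3 → ℝ} (h1 : ContDiff ℝ (⊤ : ℕ∞) φ) (h2 : HasCompactSupport φ)
    (h3 : tsupport φ ⊆ openCell ∩ C.posSet) (m : Mode) :
    ∃ V ∈ C.Test, ∀ᵐ θ ∂muBrillouin, blochMk V θ = (φ θ : ℂ) • modeVec m := by
  have hcell := h3.trans inter_subset_left
  have z2 : ∀ᵐ θ ∂muBrillouin, blochFn ((0 : 𝓢(E3, ℂ)).toLp 2) θ = 0 := by
    have z1 : ((0 : 𝓢(E3, ℂ)).toLp 2 : L2R) = 0 := map_zero (SchwartzMap.toLpCLM ℝ ℂ 2 volume)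
    rw [z1, map_zero]; exact Lp.coeFn_zero _ _ _
  have z3 : ∀ᵐ θ ∂muBrillouin, blochSeq 0 θ = 0 := by
    rw [map_zero]; exact Lp.coeFn_zero _ _ _
  have hK : ∀ V : X0, (∀ᵐ θ ∂muBrillouin, blochMk V θ = (φ θ : ℂ) • modeVec m) →
      ∃ K ⊆ C.PiPlus, IsCompact K ∧ ∀ᵐ θ ∂muBrillouin, θ ∉ K → bloch V θ = 0 := fun V hV => by
    refine ⟨tsupport φ, fun θ hθ => ⟨openCell_subset (hcell hθ), (h3 hθ).2⟩, h2, ?_⟩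
    filter_upwards [hV, bloch_ae_eq V] with θ h4 h5 h6
    rw [h5, h4, image_eq_zero_of_notMem_tsupport h6, Complex.ofReal_zero, zero_smul]
  rcases m with (k | k) | (j | j)
  · obtain ⟨f, hf⟩ := exists_schwartz_bloch h1 h2 hcell k
    have hV : ∀ᵐ θ ∂muBrillouin,
        blochMk (Quad.mk (f.toLp 2) ((0 : 𝓢(E3, ℂ)).toLp 2) 0 0) θ =
        (φ θ : ℂ) • modeVec (.inl (.inl k)) := by
      filter_upwards [hf, z2, z3] with θ a b c
      exact Quad.ext' a (b.trans (smul_zero _).symm) (c.trans (smul_zero _).symm)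
        (c.trans (smul_zero _).symm)
    exact ⟨_, mem_Test_mk rapidlyDecreasing_zero rapidlyDecreasing_zero (hK _ hV), hV⟩
  · obtain ⟨f, hf⟩ := exists_schwartz_bloch h1 h2 hcell k
    have hV : ∀ᵐ θ ∂muBrillouin,
        blochMk (Quad.mk ((0 : 𝓢(E3, ℂ)).toLp 2) (f.toLp 2) 0 0) θ =
        (φ θ : ℂ) • modeVec (.inl (.inr k)) := by
      filter_upwards [hf, z2, z3] with θ a b c
      exact Quad.ext' (b.trans (smul_zero _).symm) a (c.trans (smul_zero _).symm)
        (c.trans (smul_zero _).symm)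
    exact ⟨_, mem_Test_mk rapidlyDecreasing_zero rapidlyDecreasing_zero (hK _ hV), hV⟩
  · obtain ⟨q, hq, hf⟩ := exists_seq_bloch h1 h2 hcell j
    have hV : ∀ᵐ θ ∂muBrillouin,
        blochMk (Quad.mk ((0 : 𝓢(E3, ℂ)).toLp 2) ((0 : 𝓢(E3, ℂ)).toLp 2) q 0) θ =
        (φ θ : ℂ) • modeVec (.inr (.inl j)) := by
      filter_upwards [hf, z2, z3] with θ a b c
      exact Quad.ext' (b.trans (smul_zero _).symm) (b.trans (smul_zero _).symm) a
        (c.trans (smul_zero _).symm)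
    exact ⟨_, mem_Test_mk hq rapidlyDecreasing_zero (hK _ hV), hV⟩
  · obtain ⟨q, hq, hf⟩ := exists_seq_bloch h1 h2 hcell j
    have hV : ∀ᵐ θ ∂muBrillouin,
        blochMk (Quad.mk ((0 : 𝓢(E3, ℂ)).toLp 2) ((0 : 𝓢(E3, ℂ)).toLp 2) 0 q) θ =
        (φ θ : ℂ) • modeVec (.inr (.inr j)) := by
      filter_upwards [hf, z2, z3] with θ a b c
      exact Quad.ext' (b.trans (smul_zero _).symm) (b.trans (smul_zero _).symm)
        (c.trans (smul_zero _).symm) a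
    exact ⟨_, mem_Test_mk rapidlyDecreasing_zero hq (hK _ hV), hV⟩

end Crystal

/-! ### The energy space as an isometric copy of `L²(Π*₊)` -/

namespace Crystal

variable {C : Crystal}

theorem muPlus_eq (hW : C.Wiener) : C.muPlus = muBrillouin := by
  refine Measure.restrict_congr_set ?_
  have h := ae_mem_posSet hW
  rw [ae_restrict_iff' isClosed_brillouin.measurableSet] at h
  filter_upwards [h] with θ h1
  exact propext ⟨fun h2 => h2.1, fun h2 => ⟨h2, h1 h2⟩⟩

theorem exists_norm_LamInv_le (hC : C.Regular) (hM : 0 < C.M) {K : Set E3} (hK : IsCompact K)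
    (hsub : K ⊆ C.PiPlus) : ∃ c, 0 ≤ c ∧ ∀ θ ∈ K, ‖C.LamInv θ‖ ≤ c := by
  obtain ⟨c, hc⟩ := hK.exists_bound_of_continuousOn
    ((continuousOn_LamInv hC hM).mono fun θ hθ => (hsub hθ).2)
  exact ⟨max c 0, le_max_right _ _, fun θ hθ => (hc θ hθ).trans (le_max_left _ _)⟩

theorem ae_mem_PiPlus (hC : C.Regular) : ∀ᵐ θ ∂C.muPlus, θ ∈ C.PiPlus :=
  ae_restrict_mem (measurableSet_PiPlus hC)

theorem lamField_ae_eq (w : C.W) : ∀ᵐ θ ∂C.muPlus, C.lamField w θ = (C.Lam θ).ap (C.field w θ) :=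
  MemLp.coeFn_toLp w.2.2.1

section

variable (hC : C.Regular) (hM : 0 < C.M)
include hC hM

theorem aestronglyMeasurable_LamInv {z : E3 → X0T} (hz : AEStronglyMeasurable z C.muPlus) :
    AEStronglyMeasurable (fun θ => C.LamInv θ (z θ)) C.muPlus :=
  ((continuousOn_LamInv hC hM).mono fun _ hθ => hθ.2).aestronglyMeasurable_clm_apply
    (measurableSet_PiPlus hC) hz

/-- `Λ̃⁻¹` is norm-continuous, hence bounded on compact subsets of `Π*₊`. This gives the local
square integrability required of elements of `𝒲`. -/
theorem memLp_LamInv_restrict {z : E3 → X0T} (hz : MemLp z 2 C.muPlus) {K : Set E3}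
    (hK : IsCompact K) (hsub : K ⊆ C.PiPlus) :
    MemLp (fun θ => C.LamInv θ (z θ)) 2 (volume.restrict K) := by
  obtain ⟨c, -, hc⟩ := exists_norm_LamInv_le hC hM hK hsub
  have hle : volume.restrict K ≤ C.muPlus := Measure.restrict_mono hsub le_rfl
  refine MemLp.of_le_mul (c := c) (hz.mono_measure hle)
    ((aestronglyMeasurable_LamInv hC hM hz.1).mono_measure hle) ?_
  filter_upwards [ae_restrict_mem hK.measurableSet] with θ hθ
  exact (C.LamInv θ).le_of_opNorm_le (hc θ hθ) _

/-- The element of `𝒲` with `Λ̃ w̃ = z`. -/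
theorem exists_lamField_eq (z : Lp X0T 2 C.muPlus) : ∃ w : C.W, C.lamField w = z := by
  let w : E3 →ₘ[C.muPlus] X0T := AEEqFun.mk (fun θ => C.LamInv θ (z θ))
    (aestronglyMeasurable_LamInv hC hM (Lp.aestronglyMeasurable z))
  have hw : w =ᵐ[C.muPlus] fun θ => C.LamInv θ (z θ) := AEEqFun.coeFn_mk _ _
  have h2 : ∀ᵐ θ ∂C.muPlus, (C.Lam θ).ap (w θ) = z θ := by
    filter_upwards [hw, ae_mem_PiPlus hC] with θ h1 h2
    rw [h1, (hasInverse_Lam hC hM h2.2).ap]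
  have hmem : w ∈ C.WSub := by
    refine ⟨?_, (memLp_congr_ae h2).2 (Lp.memLp z), fun K hK hc => ?_⟩
    · filter_upwards [hw, ae_mem_PiPlus hC] with θ h1 h2
      rw [h1]
      exact (hasInverse_Lam hC hM h2.2).mem_domain _
    · refine (memLp_congr_ae (ae_mono (Measure.restrict_mono hK le_rfl) hw)).2 ?_
      exact memLp_LamInv_restrict hC hM (Lp.memLp z) hc hK
  refine ⟨⟨w, hmem⟩, Lp.ext ?_⟩
  exact EventuallyEq.trans (lamField_ae_eq ⟨w, hmem⟩) h2

theorem field_ae_eq (w : C.W) : ∀ᵐ θ ∂C.muPlus, C.field w θ = C.LamInv θ (C.lamField w θ) := by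
  filter_upwards [lamField_ae_eq w, w.2.1, ae_mem_PiPlus hC] with θ h1 h2 h3
  rw [h1]
  exact ((hasInverse_Lam hC hM h3.2).ap_inverse h2).symm

theorem lamField_injective : Function.Injective C.lamField := by
  rw [injective_iff_map_eq_zero]
  intro w hw
  apply Subtype.ext
  apply AEEqFun.ext
  filter_upwards [field_ae_eq hC hM w, Lp.coeFn_zero X0T 2 C.muPlus,
    AEEqFun.coeFn_zero (α := E3) (β := X0T) (μ := C.muPlus)] with θ h1 h2 h3
  change C.field w θ = _
  rw [h1, hw, h2, Pi.zero_apply, map_zero]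
  exact h3.symm

omit hC hM in
theorem norm_W (w : C.W) : ‖w‖ = ‖C.lamField w‖ := rfl

omit hC hM in
theorem isometry_lamField : Isometry C.lamField :=
  AddMonoidHomClass.isometry_of_norm C.lamField fun _ => rfl

theorem eq_zero_of_norm_W {w : C.W} (h : ‖w‖ = 0) : w = 0 := by
  refine lamField_injective hC hM ?_
  rw [map_zero, ← norm_eq_zero]
  exact h

theorem completeSpace_W : CompleteSpace C.W :=
  (isometry_lamField.isUniformInducing.completeSpace_congr
    (fun z => exists_lamField_eq hC hM z)).2 inferInstance

end

theorem pairing_of_represents (hW : C.Wiener) {w : C.W} {Y : X0} (h : C.Represents w Y) (V : X0) :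
    C.pairing w V = inner ℂ V Y := by
  have hv : (brillouinVol : ℂ) ≠ 0 := by exact_mod_cast brillouinVol_pos.ne'
  have h1 : ∫ θ, inner ℂ (bloch V θ) (C.field w θ) ∂C.muPlus = brillouinVol * inner ℂ V Y := by
    rw [← integral_inner_blochMk, ← muPlus_eq hW]
    refine integral_congr_ae ?_
    have e1 := bloch_ae_eq V
    have e2 := bloch_ae_eq Y
    rw [← muPlus_eq hW] at e1 e2
    filter_upwards [h, e1, e2] with θ h2 h3 h4
    rw [h2, h3, h4]
  rw [pairing, h1]
  exact inv_mul_cancel_left₀ hv _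

/-- The functional `V ↦ ⟨·, V⟩` on `𝒲`, as a vector of `L²(Π*₊, X⁰(T³))`. -/
def testField (C : Crystal) (V : X0) (θ : E3) : X0T := C.LamInv θ (bloch V θ)

/-- The Bloch transform of `V` vanishes off a compact subset of `Π*₊`. -/
def CompactBloch (C : Crystal) (V : X0) : Prop :=
  ∃ K ⊆ C.PiPlus, IsCompact K ∧ ∀ᵐ θ ∂muBrillouin, θ ∉ K → bloch V θ = 0

theorem memLp_bloch (V : X0) : MemLp (bloch V) 2 C.muPlus :=
  ((memLp_congr_ae (bloch_ae_eq V)).2 (memLp_blochMk V)).mono_measure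
    (Measure.restrict_mono (fun _ h => h.1) le_rfl)

theorem memLp_testField (hC : C.Regular) (hM : 0 < C.M) {V : X0} (hV : C.CompactBloch V) :
    MemLp (C.testField V) 2 C.muPlus := by
  obtain ⟨K, hKs, hK, h⟩ := hV
  obtain ⟨c, hc0, hc⟩ := exists_norm_LamInv_le hC hM hK hKs
  refine MemLp.of_le_mul (c := c) (memLp_bloch V)
    (aestronglyMeasurable_LamInv hC hM (memLp_bloch V).1) ?_
  have h' : ∀ᵐ θ ∂C.muPlus, θ ∉ K → bloch V θ = 0 :=
    ae_mono (Measure.restrict_mono (fun _ h => h.1) le_rfl) h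
  filter_upwards [h'] with θ h1
  by_cases hθ : θ ∈ K
  · exact (C.LamInv θ).le_of_opNorm_le (hc θ hθ) _
  · rw [testField, h1 hθ, map_zero]; simp

theorem inner_LamInv (θ : E3) (x y : X0T) :
    inner ℂ (C.LamInv θ x) y = inner ℂ x (C.LamInv θ y) := by
  rw [← ContinuousLinearMap.adjoint_inner_right, isSelfAdjoint_LamInv.adjoint_eq]

/-- Write `w̃ = Λ̃⁻¹(Λ̃w̃)` and move the selfadjoint `Λ̃⁻¹` to the test vector. The pairing is
thereby a continuous functional of `Λ̃w̃`. -/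
theorem pairing_eq (hC : C.Regular) (hM : 0 < C.M) {V : X0} (hV : C.CompactBloch V) (w : C.W) :
    C.pairing w V = (brillouinVol : ℂ)⁻¹ *
      inner ℂ (memLp_testField hC hM hV).toLp (C.lamField w) := by
  rw [pairing, L2.inner_def]
  congr 1
  refine integral_congr_ae ?_
  filter_upwards [field_ae_eq hC hM w, (memLp_testField hC hM hV).coeFn_toLp] with θ h1 h2
  rw [h1, h2, testField, inner_LamInv]

/-- Sobolev regularity means that `Ỹ = AX̃` with `X` square integrable. The range of `A` lies in the
domain of `Λ̃`, with `‖Λ̃AX̃‖ ≤ ‖N‖^{1/2}‖X̃‖`, so `Λ̃Ỹ` is square integrable. -/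
theorem exists_represents (hC : C.Regular) (hM : 0 < C.M) {Y : X0} (hY : Y ∈ CoreD0) :
    ∃ w : C.W, C.Represents w Y := by
  obtain ⟨h1, h2, U, hU, hsub, hz⟩ := hY
  obtain ⟨χ₁, hχ₁⟩ := exists_ftL_eq (memLp_norm_ftL_of_memSobolev h1)
  obtain ⟨χ₂, hχ₂⟩ := exists_ftL_eq (memLp_norm_ftL_of_memSobolev h2)
  set X : X0 := Quad.mk χ₁ χ₂ Y.q Y.p
  have hle : C.muPlus ≤ muBrillouin := Measure.restrict_mono (fun _ h => h.1) le_rfl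
  have key : ∀ {f g : L2R}, (ftL g =ᵐ[volume] fun ξ => ((‖ξ‖ : ℝ) : ℂ) * ftL f ξ) →
      ∀ᵐ θ ∂muBrillouin, blochFn f θ = bddT symInv θ (blochFn g θ) := by
    intro f g h
    filter_upwards [ae_xi h, coefT_blochFn_eq_ftL f, coefT_blochFn_eq_ftL g,
      ae_notMem_dualLattice] with θ a b c d
    refine ext_coefT fun k => ?_
    have hn : ((‖xi θ k‖ : ℝ) : ℂ) ≠ 0 := by exact_mod_cast (norm_xi_pos d k).ne'
    rw [coefT_bddT_symInv d, b, c, a, Complex.ofReal_inv, inv_mul_cancel_left₀ hn]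
  have hscale : ∀ᵐ θ ∂C.muPlus, bloch Y θ = scaleT θ (blochMk X θ) := by
    refine ae_mono hle ?_
    filter_upwards [key hχ₁, key hχ₂, bloch_ae_eq Y] with θ a b c
    rw [c, scaleT_apply]
    exact Quad.ext' a b rfl rfl
  -- A bound on `N(θ)` is needed only off the neighbourhood `U` of `Γ*`, where `Ỹ` does not vanish;
  -- there compactness supplies it.
  obtain ⟨c, hc⟩ := (isCompact_brillouin.diff hU).exists_bound_of_continuousOn
    ((continuousOn_innerT hC).mono fun θ hθ h => hθ.2 (hsub h))
  have hform : ∀ᵐ θ ∂C.muPlus, bloch Y θ ∈ (C.Lam θ).domain ∧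
      ‖(C.Lam θ).ap (bloch Y θ)‖ ≤ Real.sqrt c * ‖blochMk X θ‖ := by
    filter_upwards [hscale, ae_mem_PiPlus hC, ae_mono hle hz] with θ a b d
    have h3 := mem_form_domain (isSelfAdjoint_scaleT b.2.1) (nonneg_innerT hM)
      (isUnit_innerT hC hM b.2) (hasInverse_Lam hC hM b.2) (blochMk X θ)
    rw [← a] at h3
    refine ⟨h3.1, ?_⟩
    by_cases hθ : θ ∈ U
    · rw [d hθ, LinearPMap.ap_of_mem _ (Submodule.zero_mem _)]
      have : C.Lam θ ⟨0, Submodule.zero_mem _⟩ = 0 := (C.Lam θ).map_zero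
      rw [this, norm_zero]
      positivity
    · refine h3.2.trans (mul_le_mul_of_nonneg_right (Real.sqrt_le_sqrt ?_) (norm_nonneg _))
      exact hc θ ⟨b.1, hθ⟩
  -- The unbounded `Λ̃(θ)` is replaced by regularised inverses of `Λ̃(θ)⁻¹`, which depend
  -- norm-continuously on `θ` and converge on the domain.
  have hm : AEStronglyMeasurable (fun θ => (C.Lam θ).ap (bloch Y θ)) C.muPlus := by
    refine aestronglyMeasurable_of_tendsto_ae atTop
      (f := fun n θ => invApprox (C.LamInv θ) n (bloch Y θ)) (fun n => ?_) ?_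
    · have h3 := continuousOn_invApprox (fun _ _ => isSelfAdjoint_LamInv)
        (continuousOn_LamInv hC hM) n
      exact (h3.mono fun _ hθ => hθ.2).aestronglyMeasurable_clm_apply (measurableSet_PiPlus hC)
        (memLp_bloch Y).1
    · filter_upwards [hform, ae_mem_PiPlus hC] with θ a b
      have h3 := hasInverse_Lam hC hM b.2
      have h4 := tendsto_invApprox isSelfAdjoint_LamInv (isCompactOperator_LamInv hC hM b.2)
        h3.injective ((C.Lam θ).ap (bloch Y θ))
      rwa [h3.ap_inverse a.1] at h4
  have hL : MemLp (fun θ => (C.Lam θ).ap (bloch Y θ)) 2 C.muPlus := by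
    refine MemLp.of_le_mul (c := Real.sqrt c) ((memLp_blochMk X).mono_measure hle) hm ?_
    filter_upwards [hform] with θ a
    exact a.2
  obtain ⟨w, hw⟩ := exists_lamField_eq hC hM hL.toLp
  refine ⟨w, ?_⟩
  have h3 := hL.coeFn_toLp
  rw [← hw] at h3
  filter_upwards [field_ae_eq hC hM w, h3, hform, ae_mem_PiPlus hC] with θ a b d e
  rw [a, b, (hasInverse_Lam hC hM e.2).ap_inverse d.1]

end Crystal

theorem Quad.continuousOn_mk {H Q X : Type} [NormedAddCommGroup H] [InnerProductSpace ℂ H]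
    [NormedAddCommGroup Q] [InnerProductSpace ℂ Q] [TopologicalSpace X] {s : Set X} {a b : X → H}
    {c d : X → Q} (ha : ContinuousOn a s) (hb : ContinuousOn b s) (hc : ContinuousOn c s)
    (hd : ContinuousOn d s) : ContinuousOn (fun x => Quad.mk (a x) (b x) (c x) (d x)) s := by
  simp only [Quad.mk_eq_sum]
  exact ((((in1 : H →L[ℂ] Quad H Q).continuous.comp_continuousOn ha).add
    ((in2 : H →L[ℂ] Quad H Q).continuous.comp_continuousOn hb)).add
    ((in3 : Q →L[ℂ] Quad H Q).continuous.comp_continuousOn hc)).add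
    ((in4 : Q →L[ℂ] Quad H Q).continuous.comp_continuousOn hd)

/-! ### Weak characterisation of `B̃(θ)` and density of `𝒟₀` -/

namespace Crystal

variable {C : Crystal}

theorem continuousOn_BtMode (hC : C.Regular) (m : Mode) :
    ContinuousOn (fun θ => C.BtMode θ m) dualLatticeᶜ := by
  have hx : ∀ k, Continuous fun θ => ‖xi θ k‖ := fun k =>
    continuous_norm.comp (continuous_id.sub continuous_const)
  have hi : ∀ k, ContinuousOn (fun θ => ‖xi θ k‖⁻¹) dualLatticeᶜ := fun k =>
    (hx k).continuousOn.inv₀ fun θ hθ => (norm_xi_pos hθ k).ne'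
  have ofr : ∀ {f : E3 → ℝ} {s : Set E3}, ContinuousOn f s → ContinuousOn (fun θ => (f θ : ℂ)) s :=
    fun h => Complex.continuous_ofReal.comp_continuousOn h
  have hD := continuousOn_dipole hC
  have hDa : ContinuousOn (fun θ => (C.dipole θ).adjoint) dualLatticeᶜ :=
    (ContinuousLinearMap.adjoint (𝕜 := ℂ) (E := C3) (F := L2T)).continuous.comp_continuousOn hD
  rcases m with (k | k) | (j | j)
  · refine Quad.continuousOn_mk ?_ continuousOn_const ?_ continuousOn_const
    · exact (ofr (((hx k).continuousOn.pow 2).add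
        (continuousOn_const.mul ((hi k).pow 2)))).smul continuousOn_const
    · exact (ofr (continuousOn_const.mul (hi k))).smul (hDa.clm_apply continuousOn_const)
  · exact Quad.continuousOn_mk continuousOn_const
      ((ofr ((hx k).continuousOn.pow 2)).smul continuousOn_const) continuousOn_const
      continuousOn_const
  · refine Quad.continuousOn_mk ?_ continuousOn_const ?_ continuousOn_const
    · exact (admissible_symInv.continuousOn.clm_apply
        (hD.clm_apply continuousOn_const)).const_smul (C.coupling : ℂ)
    · exact hDa.clm_apply (hD.clm_apply continuousOn_const)
  · exact continuousOn_const

/-- For each basis vector the fundamental lemma of the calculus of variations removes the cutoff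
`φ`. There are countably many basis vectors, so a common null set can be discarded, and they
determine the graph of `B̃(θ)`. The faces of the Brillouin zone are negligible. -/
theorem mem_Bt_graph_of_weak (hC : C.Regular) {a b : E3 → X0T}
    (ha : ∀ K ⊆ C.PiPlus, IsCompact K → IntegrableOn a K)
    (hb : ∀ K ⊆ C.PiPlus, IsCompact K → IntegrableOn b K)
    (h : ∀ m (φ : E3 → ℝ), ContDiff ℝ (⊤ : ℕ∞) φ → HasCompactSupport φ →
      tsupport φ ⊆ openCell ∩ C.posSet →
      ∫ θ, (φ θ : ℂ) * (inner ℂ (C.BtMode θ m) (b θ) - inner ℂ (modeVec m) (a θ)) ∂C.muPlus = 0) :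
    ∀ᵐ θ ∂C.muPlus, (b θ, a θ) ∈ (C.Bt θ).graph := by
  have hU : IsOpen (openCell ∩ C.posSet) := isOpen_openCell.inter (isOpen_posSet hC)
  have hsub : openCell ∩ C.posSet ⊆ C.PiPlus := fun θ h => ⟨openCell_subset h.1, h.2⟩
  have key : ∀ m, ∀ᵐ θ ∂(volume : Measure E3), θ ∈ openCell ∩ C.posSet →
      inner ℂ (C.BtMode θ m) (b θ) - inner ℂ (modeVec m) (a θ) = 0 := fun m => by
    refine hU.ae_eq_zero_of_integral_contDiff_smul_eq_zero ?_ fun φ h1 h2 h3 => ?_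
    · rw [locallyIntegrableOn_iff hU.isLocallyClosed]
      intro K hK hc
      have hcont := (continuousOn_BtMode hC m).mono fun θ hθ => (hK hθ).2.1
      obtain ⟨c, hc'⟩ := hc.exists_bound_of_continuousOn hcont
      have hbK := hb K (hK.trans hsub) hc
      have haK := ha K (hK.trans hsub) hc
      refine Integrable.sub ?_ ?_
      · refine (hbK.norm.const_mul c).mono'
          ((hcont.aestronglyMeasurable hc.measurableSet).inner hbK.1) ?_
        filter_upwards [ae_restrict_mem hc.measurableSet] with θ hθ
        exact (norm_inner_le_norm _ _).trans
          (mul_le_mul_of_nonneg_right (hc' θ hθ) (norm_nonneg _))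
      · refine (haK.norm.const_mul ‖(modeVec m)‖).mono'
          (aestronglyMeasurable_const.inner haK.1) (Eventually.of_forall fun θ => ?_)
        exact norm_inner_le_norm _ _
    · have h4 := h m φ h1 h2 h3
      rw [muPlus, setIntegral_eq_integral_of_forall_compl_eq_zero] at h4
      · simpa only [Complex.real_smul] using h4
      · intro θ hθ
        rw [image_eq_zero_of_notMem_tsupport fun h5 => hθ (hsub (h3 h5)), Complex.ofReal_zero,
          zero_mul]
  have h1 : ∀ᵐ θ ∂C.muPlus, ∀ m, θ ∈ openCell ∩ C.posSet →
      inner ℂ (C.BtMode θ m) (b θ) - inner ℂ (modeVec m) (a θ) = 0 :=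
    ae_all_iff.2 fun m => ae_restrict_of_ae (key m)
  have hle : C.muPlus ≤ muBrillouin := Measure.restrict_mono (fun _ h => h.1) le_rfl
  filter_upwards [h1, ae_mem_PiPlus hC, ae_mono hle ae_mem_openCell] with θ h2 h3 h4
  exact mem_Bt_graph_of_modes hC h3.2.1 fun m => sub_eq_zero.1 (h2 m ⟨h4, h3.2⟩)

theorem modeVec_eq (hC : C.Regular) (hM : 0 < C.M) {θ : E3} (hθ : θ ∈ C.posSet) (m : Mode) :
    modeVec m = C.LamInv θ (C.LamInv θ (C.BtMode θ m)) := by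
  rw [LamInv_LamInv hC hM hθ]
  exact (hasInverse_Bt hC hM hθ _ _).1 (BtMode_mem_graph hC hθ.1 m)

theorem bloch_add (X Y : X0) : ∀ᵐ θ ∂muBrillouin, bloch (X + Y) θ = bloch X θ + bloch Y θ := by
  have e1 := Lp.coeFn_add (blochFn X.psi1) (blochFn Y.psi1)
  have e2 := Lp.coeFn_add (blochFn X.psi2) (blochFn Y.psi2)
  have e3 := Lp.coeFn_add (blochSeq X.q) (blochSeq Y.q)
  have e4 := Lp.coeFn_add (blochSeq X.p) (blochSeq Y.p)
  rw [← map_add] at e1 e2 e3 e4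
  filter_upwards [bloch_ae_eq (X + Y), bloch_ae_eq X, bloch_ae_eq Y, e1, e2, e3, e4]
    with θ h1 h2 h3 h4 h5 h6 h7
  rw [h1, h2, h3]
  exact Quad.ext' h4 h5 h6 h7

theorem bloch_smul (c : ℂ) (X : X0) : ∀ᵐ θ ∂muBrillouin, bloch (c • X) θ = c • bloch X θ := by
  have e1 := Lp.coeFn_smul c (blochFn X.psi1)
  have e2 := Lp.coeFn_smul c (blochFn X.psi2)
  have e3 := Lp.coeFn_smul c (blochSeq X.q)
  have e4 := Lp.coeFn_smul c (blochSeq X.p)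
  rw [← map_smul] at e1 e2 e3 e4
  filter_upwards [bloch_ae_eq (c • X), bloch_ae_eq X, e1, e2, e3, e4] with θ h1 h2 h4 h5 h6 h7
  rw [h1, h2]
  exact Quad.ext' h4 h5 h6 h7

theorem CoreD0_add {X Y : X0} (hX : X ∈ CoreD0) (hY : Y ∈ CoreD0) : X + Y ∈ CoreD0 := by
  obtain ⟨a1, a2, U, hU, hU', a3⟩ := hX
  obtain ⟨b1, b2, V, hV, hV', b3⟩ := hY
  refine ⟨?_, ?_, U ∩ V, hU.inter hV, subset_inter hU' hV', ?_⟩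
  · have h := a1.add b1
    rw [← Lp.toTemperedDistributionCLM_apply, ← Lp.toTemperedDistributionCLM_apply,
      ← map_add] at h
    exact h
  · have h := a2.add b2
    rw [← Lp.toTemperedDistributionCLM_apply, ← Lp.toTemperedDistributionCLM_apply,
      ← map_add] at h
    exact h
  · filter_upwards [bloch_add X Y, a3, b3] with θ h1 h2 h3 h4
    rw [h1, h2 h4.1, h3 h4.2, add_zero]

theorem CoreD0_smul (c : ℂ) {X : X0} (hX : X ∈ CoreD0) : c • X ∈ CoreD0 := by
  obtain ⟨a1, a2, U, hU, hU', a3⟩ := hX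
  refine ⟨?_, ?_, U, hU, hU', ?_⟩
  · have h := a1.smul c
    rw [← Lp.toTemperedDistributionCLM_apply, ← map_smul] at h
    exact h
  · have h := a2.smul c
    rw [← Lp.toTemperedDistributionCLM_apply, ← map_smul] at h
    exact h
  · filter_upwards [bloch_smul c X, a3] with θ h1 h2 h4
    rw [h1, h2 h4, smul_zero]

theorem CoreD0_zero : (0 : X0) ∈ CoreD0 := by
  have h0 : TemperedDistribution.MemSobolev 1 2 (Lp.toTemperedDistribution (0 : L2R)) := by
    rw [← Lp.toTemperedDistributionCLM_apply, map_zero]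
    exact TemperedDistribution.memSobolev_fun_zero E3 ℂ 1 2
  refine ⟨h0, h0, univ, isOpen_univ, subset_univ _, ?_⟩
  have h := bloch_smul 0 0
  rw [zero_smul] at h
  filter_upwards [h] with θ h1 _
  rw [h1, zero_smul]

theorem muPlus_le : C.muPlus ≤ muBrillouin := Measure.restrict_mono (fun _ h => h.1) le_rfl

/-- The elements of `𝒲` that are given by states in `𝒟₀`. -/
def coreSub (C : Crystal) : Submodule ℂ C.W where
  carrier := {w | ∃ Y ∈ CoreD0, C.Represents w Y}
  zero_mem' := by
    refine ⟨0, CoreD0_zero, ?_⟩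
    have h := bloch_smul 0 0
    rw [zero_smul] at h
    filter_upwards [AEEqFun.coeFn_zero (α := E3) (β := X0T) (μ := C.muPlus), ae_mono muPlus_le h]
      with θ h1 h2
    rw [h2, zero_smul]
    exact h1
  add_mem' := by
    rintro v w ⟨X, hX, hv⟩ ⟨Y, hY, hw⟩
    refine ⟨X + Y, CoreD0_add hX hY, ?_⟩
    filter_upwards [AEEqFun.coeFn_add (C.field v) (C.field w), ae_mono muPlus_le (bloch_add X Y),
      hv, hw] with θ h1 h2 h3 h4
    rw [h2, ← h3, ← h4]
    exact h1
  smul_mem' := by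
    rintro c v ⟨X, hX, hv⟩
    refine ⟨c • X, CoreD0_smul c hX, ?_⟩
    filter_upwards [AEEqFun.coeFn_smul c (C.field v), ae_mono muPlus_le (bloch_smul c X), hv]
      with θ h1 h2 h3
    rw [h2, ← h3]
    exact h1

theorem integrableOn_LamInv (hC : C.Regular) (hM : 0 < C.M) (z : Lp X0T 2 C.muPlus) {K : Set E3}
    (hK : K ⊆ C.PiPlus) (hc : IsCompact K) : IntegrableOn (fun θ => C.LamInv θ (z θ)) K := by
  have : IsFiniteMeasure (volume.restrict K) := ⟨by
    rw [Measure.restrict_apply_univ]; exact hc.measure_lt_top⟩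
  exact (memLp_LamInv_restrict hC hM (Lp.memLp z) hc hK).integrable one_le_two

/-- For `Ṽ = φ·v` with a basis vector `v = Λ̃⁻¹Λ̃⁻¹B̃v` one has `Λ̃Ṽ = φΛ̃⁻¹B̃v`. Orthogonality thus
says weakly that `B̃Λ̃⁻¹z = 0`, whence `z = 0` by injectivity. -/
theorem eq_zero_of_orthogonal (hC : C.Regular) (hM : 0 < C.M) {z : Lp X0T 2 C.muPlus}
    (hz : ∀ w ∈ C.coreSub, inner ℂ (C.lamField w) z = 0) : z = 0 := by
  have key := mem_Bt_graph_of_weak hC (a := fun _ => 0) (b := fun θ => C.LamInv θ (z θ))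
    (fun K _ _ => integrableOn_zero) (fun K => integrableOn_LamInv hC hM z) fun m φ h1 h2 h3 => by
      obtain ⟨V, hV, hVe⟩ := exists_test (C := C) h1 h2 h3 m
      have hV0 := Test_subset_CoreD0 hV
      obtain ⟨w, hw⟩ := exists_represents hC hM hV0
      rw [← hz w ⟨V, hV0, hw⟩, L2.inner_def]
      refine integral_congr_ae ?_
      filter_upwards [lamField_ae_eq w, hw, ae_mono muPlus_le hVe,
        ae_mono muPlus_le (bloch_ae_eq V), ae_mem_PiPlus hC] with θ e1 e2 e3 e4 e5
      rw [e1, e2, e4, e3, modeVec_eq hC hM e5.2, ← map_smul,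
        (hasInverse_Lam hC hM e5.2).ap, inner_zero_right, sub_zero, inner_smul_left,
        Complex.conj_ofReal, inner_LamInv]
  refine Lp.ext ?_
  filter_upwards [key, ae_mem_PiPlus hC, Lp.coeFn_zero X0T 2 C.muPlus] with θ h1 h2 h3
  rw [h3, Pi.zero_apply]
  have h4 := (hasInverse_Bt hC hM h2.2 _ _).1 h1
  rw [map_zero] at h4
  exact (hasInverse_Lam hC hM h2.2).injective (h4.trans (map_zero _).symm)

/-- The image under the isometry `lamField` has trivial orthogonal complement, and the topology of
`𝒲` is induced by that map. -/
theorem dense_coreSub (hC : C.Regular) (hM : 0 < C.M) :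
    Dense {w : C.W | ∃ Y ∈ CoreD0, C.Represents w Y} := by
  have h1 : (C.coreSub.map C.lamField).topologicalClosure = ⊤ := by
    rw [Submodule.topologicalClosure_eq_top_iff, eq_bot_iff]
    intro z hz
    rw [Submodule.mem_bot]
    refine eq_zero_of_orthogonal hC hM fun w hw => ?_
    exact (Submodule.mem_orthogonal _ _).1 hz _ (Submodule.mem_map_of_mem hw)
  intro w
  rw [isometry_lamField.isUniformInducing.isInducing.closure_eq_preimage_closure_image]
  have h2 : C.lamField w ∈ (C.coreSub.map C.lamField).topologicalClosure := h1 ▸ Submodule.mem_top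
  exact h2

end Crystal

/-! ### The unitary evolution on `L²(Π*₊)` -/

theorem IsUnitaryGroup.inner_neg {H : Type} [NormedAddCommGroup H] [InnerProductSpace ℂ H]
    [CompleteSpace H] {K : H →ₗ.[ℂ] H} {U : ℝ → H →L[ℂ] H} (hU : IsUnitaryGroup K U) (t : ℝ)
    (x y : H) : inner ℂ (U (-t) x) y = inner ℂ x (U t y) := by
  let L : H →ₗᵢ[ℂ] H := ⟨(U t).toLinearMap, hU.isometry t⟩
  have h1 : L (U (-t) x) = x := by
    change (U t * U (-t)) x = x
    rw [← hU.map_add, add_neg_cancel, hU.map_zero]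
    rfl
  rw [← L.inner_map_map, h1]
  rfl

theorem bloch_J (V : X0) : ∀ᵐ θ ∂muBrillouin, bloch (Quad.J V) θ = Quad.J (bloch V θ) := by
  have e1 := Lp.coeFn_smul (1 / 2 : ℂ) (blochFn V.psi2)
  have e2 := Lp.coeFn_smul (-(1 / 2) : ℂ) (blochFn V.psi1)
  have e4 := Lp.coeFn_neg (blochSeq V.q)
  rw [← map_smul] at e1 e2
  rw [← map_neg] at e4
  rw [neg_smul] at e2
  filter_upwards [bloch_ae_eq (Quad.J V), bloch_ae_eq V, e1, e2, e4] with θ h1 h2 h4 h5 h7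
  rw [Pi.smul_apply, neg_smul] at h5
  rw [h1, h2]
  exact Quad.ext' h4 h5 rfl h7

namespace Crystal

variable {C : Crystal}

theorem J_bloch_mem_graph (hC : C.Regular) {V : X0} (hV : V ∈ C.Test) :
    ∀ᵐ θ ∂muBrillouin, (Quad.J (bloch V θ), -bloch (C.opAstar V) θ) ∈ (C.Bt θ).graph := by
  have e := bloch_smul (-1) (C.opB (Quad.J V))
  rw [neg_one_smul] at e
  filter_upwards [blochMk_opB_mem_graph hC (nice_of_mem_Test hV).J, bloch_J V, e,
    bloch_ae_eq (Quad.J V), bloch_ae_eq (C.opB (Quad.J V))] with θ h1 h2 h3 h4 h5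
  rw [opAstar, h3, neg_one_smul, neg_neg, h5, ← h2, h4]
  exact h1

theorem compactBloch_of_mem_Test {V : X0} (hV : V ∈ C.Test) : C.CompactBloch V := hV.2.2.2.2

/-- `B̃(θ)` acts fibrewise and `J` does not move fibres, so `A*` does not enlarge the support in
`θ`. -/
theorem compactBloch_opAstar (hC : C.Regular) {V : X0} (hV : V ∈ C.Test) :
    C.CompactBloch (C.opAstar V) := by
  obtain ⟨K, hK, hc, h⟩ := compactBloch_of_mem_Test hV
  refine ⟨K, hK, hc, ?_⟩
  filter_upwards [h, J_bloch_mem_graph hC hV] with θ h1 h2 h3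
  rw [h1 h3, map_zero] at h2
  exact neg_eq_zero.1 ((C.Bt θ).graph_fst_eq_zero_snd h2 rfl)

/-- From `A* = -BJ` one has `JṼ = -R(A*V)~`, with `R` the inverse of `B̃`. Inserting the inverse of
`iJ` and `R = Λ̃⁻¹Λ̃⁻¹` produces `K̃⁻¹`. In particular the left side lies fibrewise in the domain of
`K̃`. -/
theorem testField_eq (hC : C.Regular) (hM : 0 < C.M) {V : X0} (hV : V ∈ C.Test) :
    ∀ᵐ θ ∂C.muPlus,
      C.testField V θ = -(Complex.I • C.KtInv θ (C.testField (C.opAstar V) θ)) := by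
  filter_upwards [ae_mono muPlus_le (J_bloch_mem_graph hC hV), ae_mem_PiPlus hC] with θ h1 h2
  have h3 := (hasInverse_Bt hC hM h2.2 _ _).1 h1
  have h4 : bloch V θ = Quad.iJinv ((Complex.I • (Quad.J : X0T →ₗ[ℂ] X0T)) (bloch V θ)) :=
    (Quad.iJinv_iJ _).symm
  rw [LinearMap.smul_apply, h3, ← LamInv_LamInv hC hM h2.2] at h4
  rw [testField, h4, testField, KtInv]
  simp only [map_neg, map_smul, smul_neg]
  rfl

section Evolution

variable (hC : C.Regular) (hM : 0 < C.M)

include hC hM in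
-- Unitarity bounds the norm. Measurability comes from the approximants of the group, which are
-- norm-continuous in `θ` and converge strongly in each fibre.
theorem memLp_evolve (z : Lp X0T 2 C.muPlus) (t : ℝ) :
    MemLp (fun θ => expGroup (C.Kt θ) t (z θ)) 2 C.muPlus := by
  refine (Lp.memLp z).of_le ?_ ?_
  · refine aestronglyMeasurable_of_tendsto_ae atTop
      (f := fun n θ => unitApprox (C.KtInv θ) n t (z θ)) (fun n => ?_) ?_
    · have h := continuousOn_unitApprox (fun _ _ => isSelfAdjoint_KtInv)
        (continuousOn_KtInv hC hM) n t
      exact (h.mono fun _ hθ => hθ.2).aestronglyMeasurable_clm_apply (measurableSet_PiPlus hC)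
        (Lp.aestronglyMeasurable z)
    · filter_upwards [ae_mem_PiPlus hC] with θ h
      exact (isUnitaryGroup_expGroup hC hM h.2).tendsto_unitApprox isSelfAdjoint_KtInv
        (isCompactOperator_KtInv hC hM h.2) (hasInverse_Kt hC hM h.2) t _
  · filter_upwards [ae_mem_PiPlus hC] with θ h
    rw [(isUnitaryGroup_expGroup hC hM h.2).isometry]

/-- The unitary evolution `exp(-i K̃(θ) t)` on `L²(Π*₊, X⁰(T³))`. -/
def evolve (z : Lp X0T 2 C.muPlus) (t : ℝ) : Lp X0T 2 C.muPlus := (memLp_evolve hC hM z t).toLp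

theorem evolve_ae_eq (z : Lp X0T 2 C.muPlus) (t : ℝ) :
    ∀ᵐ θ ∂C.muPlus, evolve hC hM z t θ = expGroup (C.Kt θ) t (z θ) :=
  (memLp_evolve hC hM z t).coeFn_toLp

theorem norm_evolve (z : Lp X0T 2 C.muPlus) (t : ℝ) : ‖evolve hC hM z t‖ = ‖z‖ := by
  have h : ∀ᵐ θ ∂C.muPlus, ‖evolve hC hM z t θ‖ = ‖z θ‖ := by
    filter_upwards [evolve_ae_eq hC hM z t, ae_mem_PiPlus hC] with θ h1 h2
    rw [h1, (isUnitaryGroup_expGroup hC hM h2.2).isometry]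
  exact le_antisymm (Lp.norm_le_norm_of_ae_le (h.mono fun _ h => h.le))
    (Lp.norm_le_norm_of_ae_le (h.mono fun _ h => h.ge))

theorem evolve_zero (z : Lp X0T 2 C.muPlus) : evolve hC hM z 0 = z := by
  refine Lp.ext ?_
  filter_upwards [evolve_ae_eq hC hM z 0, ae_mem_PiPlus hC] with θ h1 h2
  rw [h1, (isUnitaryGroup_expGroup hC hM h2.2).map_zero]
  rfl

omit hC hM in
theorem integrable_norm_mul_norm (x z : Lp X0T 2 C.muPlus) :
    Integrable (fun θ => ‖x θ‖ * ‖z θ‖) C.muPlus :=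
  (Lp.memLp x).norm.integrable_mul (Lp.memLp z).norm

theorem inner_evolve (x z : Lp X0T 2 C.muPlus) (t : ℝ) : inner ℂ x (evolve hC hM z t) =
    ∫ θ, inner ℂ (x θ) (expGroup (C.Kt θ) t (z θ)) ∂C.muPlus := by
  rw [L2.inner_def]
  refine integral_congr_ae ?_
  filter_upwards [evolve_ae_eq hC hM z t] with θ h
  rw [h]

theorem continuous_inner_evolve (x z : Lp X0T 2 C.muPlus) :
    Continuous fun t => inner ℂ x (evolve hC hM z t) := by
  simp only [inner_evolve]
  refine continuous_of_dominated (bound := fun θ => ‖x θ‖ * ‖z θ‖) (fun t => ?_) (fun t => ?_)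
    (integrable_norm_mul_norm x z) ?_
  · exact (Lp.aestronglyMeasurable x).inner (memLp_evolve hC hM z t).1
  · filter_upwards [ae_mem_PiPlus hC] with θ h2
    refine (norm_inner_le_norm _ _).trans_eq ?_
    rw [(isUnitaryGroup_expGroup hC hM h2.2).isometry]
  · filter_upwards [ae_mem_PiPlus hC] with θ h2
    exact (continuous_const (y := x θ)).inner ((isUnitaryGroup_expGroup hC hM h2.2).continuous _)

/-- Weak continuity together with constancy of the norm gives strong continuity. -/
theorem continuous_evolve (z : Lp X0T 2 C.muPlus) : Continuous (evolve hC hM z) := by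
  rw [continuous_iff_continuousAt]
  intro s
  rw [ContinuousAt, tendsto_iff_norm_sub_tendsto_zero]
  have h1 : ∀ t, ‖evolve hC hM z t - evolve hC hM z s‖ =
      Real.sqrt (2 * ‖z‖ ^ 2 - 2 * (inner ℂ (evolve hC hM z s) (evolve hC hM z t)).re) := fun t => by
    rw [← Real.sqrt_sq (norm_nonneg (evolve hC hM z t - evolve hC hM z s)),
      norm_sub_rev, @norm_sub_sq ℂ, norm_evolve, norm_evolve, RCLike.re_to_complex]
    congr 1
    ring
  simp only [h1]
  have h2 : Continuous fun t =>
      Real.sqrt (2 * ‖z‖ ^ 2 - 2 * (inner ℂ (evolve hC hM z s) (evolve hC hM z t)).re) :=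
    Real.continuous_sqrt.comp (continuous_const.sub (continuous_const.mul
      (Complex.continuous_re.comp (continuous_inner_evolve hC hM _ z))))
  have h3 := h2.tendsto s
  rwa [← h1, sub_self, norm_zero] at h3

/-- Differentiation under the integral sign. The vector `z` need not lie in the domain of `K̃`, but
the test vector does, and the derivative is dominated by `‖y‖‖z‖`. -/
theorem hasDerivAt_inner_evolve (z : Lp X0T 2 C.muPlus) {V : X0} (hV : V ∈ C.Test) (t : ℝ) :
    HasDerivAt (fun t => inner ℂ
        (memLp_testField hC hM (compactBloch_of_mem_Test hV)).toLp (evolve hC hM z t))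
      (inner ℂ (memLp_testField hC hM (compactBloch_opAstar hC hV)).toLp (evolve hC hM z t)) t := by
  set x : Lp X0T 2 C.muPlus := (memLp_testField hC hM (compactBloch_of_mem_Test hV)).toLp with hx
  set y : Lp X0T 2 C.muPlus := (memLp_testField hC hM (compactBloch_opAstar hC hV)).toLp with hy
  have hxy : ∀ᵐ θ ∂C.muPlus, x θ = -(Complex.I • C.KtInv θ (y θ)) := by
    filter_upwards [testField_eq hC hM hV,
      (memLp_testField hC hM (compactBloch_of_mem_Test hV)).coeFn_toLp,
      (memLp_testField hC hM (compactBloch_opAstar hC hV)).coeFn_toLp] with θ h1 h2 h3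
    rw [hx, hy, h2, h3, h1]
  simp only [inner_evolve]
  refine (hasDerivAt_integral_of_dominated_loc_of_deriv_le (𝕜 := ℝ) (s := univ)
    (F := fun t θ => inner ℂ (x θ) (expGroup (C.Kt θ) t (z θ)))
    (F' := fun t θ => inner ℂ (y θ) (expGroup (C.Kt θ) t (z θ)))
    (bound := fun θ => ‖y θ‖ * ‖z θ‖) univ_mem (Eventually.of_forall fun s => ?_) ?_ ?_ ?_
    (integrable_norm_mul_norm y z) ?_).2
  · exact (Lp.aestronglyMeasurable x).inner (memLp_evolve hC hM z s).1
  · refine (integrable_norm_mul_norm x z).mono'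
      ((Lp.aestronglyMeasurable x).inner (memLp_evolve hC hM z t).1) ?_
    filter_upwards [ae_mem_PiPlus hC] with θ h2
    refine (norm_inner_le_norm _ _).trans_eq ?_
    rw [(isUnitaryGroup_expGroup hC hM h2.2).isometry]
  · exact (Lp.aestronglyMeasurable y).inner (memLp_evolve hC hM z t).1
  · filter_upwards [ae_mem_PiPlus hC] with θ h2 s _
    refine (norm_inner_le_norm _ _).trans_eq ?_
    rw [(isUnitaryGroup_expGroup hC hM h2.2).isometry]
  · filter_upwards [hxy, ae_mem_PiPlus hC] with θ h1 h2 s _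
    have hU := isUnitaryGroup_expGroup hC hM h2.2
    have hg : (C.KtInv θ (y θ), y θ) ∈ (C.Kt θ).graph := (hasInverse_Kt hC hM h2.2 _ _).2 rfl
    -- The group is moved to the left factor as `U(-s)`, which may be differentiated on the range of
    -- `K̃⁻¹`.
    have hd1 : HasDerivAt (fun s => (-Complex.I) • expGroup (C.Kt θ) (-s) (C.KtInv θ (y θ)))
        (expGroup (C.Kt θ) (-s) (y θ)) s := by
      refine (((hU.hasDerivAt hg (-s)).scomp s (hasDerivAt_neg s)).const_smul
        (-Complex.I)).congr_deriv ?_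
      rw [neg_one_smul, neg_neg, smul_smul, neg_mul, Complex.I_mul_I, neg_neg, one_smul]
    have hd := hd1.inner ℂ (hasDerivAt_const s (z θ))
    simp only [← hU.inner_neg]
    refine (hd.congr_deriv ?_).congr_of_eventuallyEq (Eventually.of_forall fun r => ?_)
    · rw [inner_zero_right, zero_add]
    · simp only [h1, map_neg, map_smul, neg_smul]

end Evolution

end Crystal

/-! ### Existence and uniqueness of weak solutions -/

namespace Crystal

variable {C : Crystal}

theorem inner_testField_eq (hC : C.Regular) (hM : 0 < C.M) {Y : ℝ → C.W}
    (h : C.IsWeakSolution Y) {V : X0} (hV : V ∈ C.Test) (t : ℝ) :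
    inner ℂ (memLp_testField hC hM (compactBloch_of_mem_Test hV)).toLp
        (C.lamField (Y t) - C.lamField (Y 0)) =
      ∫ s in (0 : ℝ)..t, inner ℂ (memLp_testField hC hM (compactBloch_opAstar hC hV)).toLp
        (C.lamField (Y s)) := by
  have hv : (brillouinVol : ℂ)⁻¹ ≠ 0 := inv_ne_zero (by exact_mod_cast brillouinVol_pos.ne')
  have h1 := h V hV t
  rw [pairing_eq hC hM (compactBloch_of_mem_Test hV), map_sub] at h1
  simp only [pairing_eq hC hM (compactBloch_opAstar hC hV)] at h1
  rw [intervalIntegral.integral_const_mul] at h1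
  exact mul_left_cancel₀ hv h1

theorem isWeakSolution_of_evolve (hC : C.Regular) (hM : 0 < C.M) {Y : ℝ → C.W}
    {z : Lp X0T 2 C.muPlus} (h : ∀ t, C.lamField (Y t) = evolve hC hM z t) :
    C.IsWeakSolution Y := by
  intro V hV t
  rw [pairing_eq hC hM (compactBloch_of_mem_Test hV), map_sub]
  simp only [pairing_eq hC hM (compactBloch_opAstar hC hV), h]
  rw [intervalIntegral.integral_const_mul, inner_sub_right,
    intervalIntegral.integral_eq_sub_of_hasDerivAt
      (fun s _ => hasDerivAt_inner_evolve hC hM z hV s)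
      ((continuous_inner_evolve hC hM _ z).intervalIntegrable _ _)]

/-- The weak form of `u = i K̃⁻¹ z`. -/
theorem eq_KtInv_of_weak (hC : C.Regular) (hM : 0 < C.M) {u z : Lp X0T 2 C.muPlus}
    (h : ∀ V (hV : V ∈ C.Test),
      inner ℂ (memLp_testField hC hM (compactBloch_of_mem_Test hV)).toLp z =
        inner ℂ (memLp_testField hC hM (compactBloch_opAstar hC hV)).toLp u) :
    ∀ᵐ θ ∂C.muPlus, u θ = Complex.I • C.KtInv θ (z θ) := by
  have key := mem_Bt_graph_of_weak hC (b := fun θ => C.LamInv θ (u θ))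
    (a := fun θ => (Complex.I • (Quad.iJinv : X0T →L[ℂ] X0T)) (C.LamInv θ (z θ)))
    (fun K hK hc => (Complex.I • (Quad.iJinv : X0T →L[ℂ] X0T)).integrable_comp
      (integrableOn_LamInv hC hM z hK hc))
    (fun K => integrableOn_LamInv hC hM u) fun m φ h1 h2 h3 => by
      -- The conjugate label is used so that `JṼ` is a multiple `φc` of the basis vector with label
      -- `m`, to which `B̃(θ)` is then applied.
      obtain ⟨V, hV, hVe⟩ := exists_test (C := C) h1 h2 h3 m.conj
      obtain ⟨c, hc, hJ⟩ := exists_J_modeVec m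
      have hV1 := memLp_testField hC hM (compactBloch_of_mem_Test hV)
      have hV2 := memLp_testField hC hM (compactBloch_opAstar hC hV)
      have hb : ∀ᵐ θ ∂C.muPlus, C.testField (C.opAstar V) θ =
          -((φ θ * c : ℂ) • C.LamInv θ (C.BtMode θ m)) := by
        filter_upwards [ae_mono muPlus_le (J_bloch_mem_graph hC hV), ae_mono muPlus_le hVe,
          ae_mono muPlus_le (bloch_ae_eq V), ae_mem_PiPlus hC] with θ e1 e2 e3 e4
        rw [e3, e2, map_smul, hJ, smul_smul] at e1
        have e5 := (C.Bt θ).graph.smul_mem (φ θ * c : ℂ) (BtMode_mem_graph hC e4.2.1 m)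
        have e6 := LinearPMap.mem_graph_snd_inj (C.Bt θ) e1 e5 rfl
        rw [testField, ← neg_neg (bloch _ _), map_neg, e6]
        change -C.LamInv θ ((φ θ * c : ℂ) • C.BtMode θ m) = _
        rw [map_smul]
      have h4 : ∫ θ, (inner ℂ (hV2.toLp (C.testField (C.opAstar V)) θ) (u θ) -
          inner ℂ (hV1.toLp (C.testField V) θ) (z θ)) ∂C.muPlus =
          (0 : ℂ) := by
        rw [integral_sub (L2.integrable_inner _ _) (L2.integrable_inner _ _), ← L2.inner_def,
          ← L2.inner_def, h V hV, sub_self]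
      -- The integrand of the tested equation carries the extra factor `-c̄` from `J`; it is nonzero
      -- and can be removed.
      refine (mul_eq_zero.1 (?_ : -(starRingEnd ℂ c) * _ = 0)).resolve_left
        (neg_ne_zero.2 ((map_ne_zero _).2 hc))
      rw [← h4, ← integral_const_mul]
      refine integral_congr_ae ?_
      filter_upwards [hb, testField_eq hC hM hV, ae_mem_PiPlus hC, hV1.coeFn_toLp,
        hV2.coeFn_toLp] with θ e1 e2 e3 e4 e5
      have e6 : C.KtInv θ (C.LamInv θ (C.BtMode θ m)) = C.LamInv θ (Quad.iJinv (modeVec m)) := by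
        rw [modeVec_eq hC hM e3.2]
        rfl
      have e7 : inner ℂ (Quad.iJinv (modeVec m)) (C.LamInv θ (z θ)) =
          inner ℂ (modeVec m) (Quad.iJinv (C.LamInv θ (z θ))) := by
        rw [← ContinuousLinearMap.adjoint_inner_right, Quad.isSelfAdjoint_iJinv.adjoint_eq]
      rw [e4, e5, e2, e1, map_neg, map_smul, e6]
      simp only [smul_neg, inner_neg_left, inner_smul_left, neg_neg, inner_LamInv, e7, map_mul,
        Complex.conj_ofReal, Complex.conj_I, smul_apply, inner_smul_right]
      ring
  filter_upwards [key, ae_mem_PiPlus hC] with θ h1 h2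
  have h4 := (hasInverse_Bt hC hM h2.2 _ _).1 h1
  rw [← LamInv_LamInv hC hM h2.2] at h4
  have h5 := (hasInverse_Lam hC hM h2.2).injective h4
  rw [h5, smul_apply, map_smul]
  rfl

/-- An energy argument for the primitive `u(t) = ∫₀ᵗ z`, which is regular enough where `z` is not:
the weak equation says `u = iK̃⁻¹z`. Since `u' = z` and `K̃⁻¹` is selfadjoint, `⟨u, u⟩` has zero
derivative; it vanishes at 0, so `u` and its derivative `z` vanish. -/
theorem eq_zero_of_weak (hC : C.Regular) (hM : 0 < C.M) {z : ℝ → Lp X0T 2 C.muPlus}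
    (hz : Continuous z) (h : ∀ t, ∀ V (hV : V ∈ C.Test),
      inner ℂ (memLp_testField hC hM (compactBloch_of_mem_Test hV)).toLp (z t) =
        ∫ s in (0 : ℝ)..t,
          inner ℂ (memLp_testField hC hM (compactBloch_opAstar hC hV)).toLp (z s)) (t : ℝ) :
    z t = 0 := by
  set u : ℝ → Lp X0T 2 C.muPlus := fun t => ∫ s in (0 : ℝ)..t, z s with hu
  have hd : ∀ t, HasDerivAt u (z t) t := fun t =>
    (hz.integral_hasStrictDerivAt 0 t).hasDerivAt
  have hre : ∀ t, inner ℂ (u t) (z t) + inner ℂ (z t) (u t) = 0 := fun t => by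
    have h1 : ∀ᵐ θ ∂C.muPlus, u t θ = Complex.I • C.KtInv θ (z t θ) := by
      refine eq_KtInv_of_weak hC hM fun V hV => ?_
      rw [h t V hV]
      exact (innerSL ℂ _).intervalIntegral_comp_comm (hz.intervalIntegrable _ _)
    rw [L2.inner_def, L2.inner_def, ← integral_add (L2.integrable_inner _ _)
      (L2.integrable_inner _ _)]
    refine integral_eq_zero_of_ae ?_
    filter_upwards [h1] with θ e1
    rw [e1, inner_smul_left, inner_smul_right, Complex.conj_I,
      ← ContinuousLinearMap.adjoint_inner_right, isSelfAdjoint_KtInv.adjoint_eq]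
    simp
  have hconst : ∀ t, inner ℂ (u t) (u t) = (0 : ℂ) := fun t => by
    have h0 : u 0 = 0 := intervalIntegral.integral_same
    have hd2 : ∀ t, HasDerivAt (fun t => inner ℂ (u t) (u t)) 0 t := fun t =>
      ((hd t).inner ℂ (hd t)).congr_deriv (hre t)
    have h1 := is_const_of_deriv_eq_zero (fun t => (hd2 t).differentiableAt)
      (fun t => (hd2 t).deriv) t 0
    rw [h1, h0, inner_zero_right]
  have hzero : u = fun _ => 0 := funext fun t => inner_self_eq_zero.1 (hconst t)
  have h2 := hd t
  rw [hzero] at h2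
  exact h2.unique (hasDerivAt_const t 0)

/-- The element of `𝒲` with `Λ̃ w̃ = z`. -/
def ofLamField (hC : C.Regular) (hM : 0 < C.M) (z : Lp X0T 2 C.muPlus) : C.W :=
  (exists_lamField_eq hC hM z).choose

theorem lamField_ofLamField (hC : C.Regular) (hM : 0 < C.M) (z : Lp X0T 2 C.muPlus) :
    C.lamField (ofLamField hC hM z) = z := (exists_lamField_eq hC hM z).choose_spec

/-- The solution with initial state `Y₀`. -/
def solution (hC : C.Regular) (hM : 0 < C.M) (Y₀ : C.W) : ℝ →ᵇ C.W :=
  BoundedContinuousFunction.ofNormedAddCommGroup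
    (fun t => ofLamField hC hM (evolve hC hM (C.lamField Y₀) t))
    (by
      rw [isometry_lamField.isUniformInducing.isInducing.continuous_iff]
      refine (continuous_evolve hC hM (C.lamField Y₀)).congr fun t => ?_
      exact (lamField_ofLamField hC hM _).symm)
    ‖Y₀‖ fun t => by rw [norm_W, lamField_ofLamField, norm_evolve, norm_W]

theorem lamField_solution (hC : C.Regular) (hM : 0 < C.M) (Y₀ : C.W) (t : ℝ) :
    C.lamField (solution hC hM Y₀ t) = evolve hC hM (C.lamField Y₀) t :=
  lamField_ofLamField hC hM _

theorem field_solution (hC : C.Regular) (hM : 0 < C.M) (Y₀ : C.W) (t : ℝ) :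
    ∀ᵐ θ ∂C.muPlus, C.field (solution hC hM Y₀ t) θ =
      (C.Lam θ).inverse.ap (expGroup (C.Kt θ) t ((C.Lam θ).ap (C.field Y₀ θ))) := by
  filter_upwards [field_ae_eq hC hM (solution hC hM Y₀ t), lamField_ae_eq Y₀,
    evolve_ae_eq hC hM (C.lamField Y₀) t, ae_mem_PiPlus hC] with θ h1 h2 h3 h4
  rw [h1, lamField_solution, h3, h2, (hasInverse_Lam hC hM h4.2).inverse_ap]

/-- The equation is linear, so the difference of the two fields solves it with zero initial value;
injectivity of `lamField` returns to `𝒲`. -/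
theorem eq_of_isWeakSolution (hC : C.Regular) (hM : 0 < C.M) {X Y : ℝ → C.W} (hX : Continuous X)
    (hY : Continuous Y) (hX' : C.IsWeakSolution X) (hY' : C.IsWeakSolution Y) (h : X 0 = Y 0)
    (t : ℝ) : X t = Y t := by
  have hl : Continuous C.lamField := isometry_lamField.continuous
  refine lamField_injective hC hM (sub_eq_zero.1 ?_)
  refine eq_zero_of_weak hC hM (z := fun t => C.lamField (X t) - C.lamField (Y t))
    ((hl.comp hX).sub (hl.comp hY)) (fun t V hV => ?_) t
  have h1 := inner_testField_eq hC hM hX' hV t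
  have h2 := inner_testField_eq hC hM hY' hV t
  have hi : ∀ {Z : ℝ → C.W} (y : Lp X0T 2 C.muPlus), Continuous Z →
      IntervalIntegrable (fun s => inner ℂ y (C.lamField (Z s))) volume 0 t := fun y hZ =>
    (continuous_const.inner (hl.comp hZ)).intervalIntegrable _ _
  simp only [inner_sub_right]
  rw [intervalIntegral.integral_sub (hi _ hX) (hi _ hY), ← h1, ← h2, h]
  simp only [inner_sub_right]
  ring

end Crystal

end

theorem mainTheorem9 (C : Crystal) (he : 0 < C.e) (hZ : 0 < C.Z) (hM : 0 < C.M)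
    (hreg : C.Regular) (hcharge : ∫ x, C.σ x = C.e * C.Z)
    (hjel : C.Jellium) (hwie : C.Wiener) :
    -- the operators in the formula for the solution
    (∀ θ ∈ C.PiPlus, IsPosSqrt (C.Bt θ) (C.Lam θ) ∧ Function.Bijective (C.Lam θ) ∧
      IsSelfAdjoint (C.Kt θ) ∧ HasCompactResolvent (C.Kt θ) ∧
      IsUnitaryGroup (C.Kt θ) (expGroup (C.Kt θ))) ∧
    -- `opAstar` is the formal adjoint of `A`
    (∀ Y ∈ Crystal.CoreD, ∀ V ∈ C.Test, inner ℂ V (C.opA Y) = inner ℂ (C.opAstar V) Y) ∧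
    -- `C.W` is the completion of `𝒟₀` in the energy norm, and the pairing extends that of `X⁰`
    ((∀ w : C.W, ‖w‖ = 0 → w = 0) ∧ CompleteSpace C.W ∧
      (∀ Y ∈ Crystal.CoreD0, ∃ w : C.W, C.Represents w Y ∧
        ∀ V : X0, C.pairing w V = inner ℂ V Y) ∧
      Dense {w : C.W | ∃ Y ∈ Crystal.CoreD0, C.Represents w Y}) ∧
    -- well-posedness, energy conservation and the formula for the solution
    ∀ Y₀ : C.W, ∃ Y : ℝ →ᵇ C.W,
      (Y 0 = Y₀ ∧ C.IsWeakSolution Y) ∧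
      (∀ X : ℝ →ᵇ C.W, X 0 = Y₀ → C.IsWeakSolution X → X = Y) ∧
      (∀ t, ‖Y t‖ = ‖Y₀‖) ∧
      ∀ t, ∀ᵐ θ ∂C.muPlus, C.field (Y t) θ =
        (C.Lam θ).inverse.ap (expGroup (C.Kt θ) t ((C.Lam θ).ap (C.field Y₀ θ))) := by
  refine ⟨fun θ hθ => ?_, fun Y hY V hV => ?_, ⟨?_, ?_, fun Y hY => ?_, ?_⟩, fun Y₀ => ?_⟩
  · have hθ' : θ ∈ C.posSet := hθ.2
    exact ⟨Crystal.isPosSqrt_Lam hreg hM hθ', (Crystal.hasInverse_Lam hreg hM hθ').bijective,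
      Crystal.isSelfAdjoint_Kt hreg hM hθ', Crystal.hasCompactResolvent_Kt hreg hM hθ',
      Crystal.isUnitaryGroup_expGroup hreg hM hθ'⟩
  · exact Crystal.inner_opA hreg hM hwie (Crystal.nice_of_mem_CoreD hY)
      (Crystal.nice_of_mem_Test hV)
  · exact fun w => Crystal.eq_zero_of_norm_W hreg hM
  · exact Crystal.completeSpace_W hreg hM
  · obtain ⟨w, hw⟩ := Crystal.exists_represents hreg hM hY
    exact ⟨w, hw, Crystal.pairing_of_represents hwie hw⟩
  · exact Crystal.dense_coreSub hreg hM
  · have h0 : Crystal.solution hreg hM Y₀ 0 = Y₀ := by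
      refine Crystal.lamField_injective hreg hM ?_
      rw [Crystal.lamField_solution, Crystal.evolve_zero]
    have hw : C.IsWeakSolution (Crystal.solution hreg hM Y₀) :=
      Crystal.isWeakSolution_of_evolve hreg hM (Crystal.lamField_solution hreg hM Y₀)
    refine ⟨Crystal.solution hreg hM Y₀, ⟨h0, hw⟩, fun X hX hX' => ?_, fun t => ?_,
      Crystal.field_solution hreg hM Y₀⟩
    · exact DFunLike.ext _ _ (Crystal.eq_of_isWeakSolution hreg hM X.continuous
        (Crystal.solution hreg hM Y₀).continuous hX' hw (hX.trans h0.symm))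
    · rw [Crystal.norm_W, Crystal.lamField_solution, Crystal.norm_evolve, Crystal.norm_W]
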